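/- Let $l>0$, $T>0$, let $\rho^1\neq\rho^2$ be real constants, and let $S=\mathbb R\times(-l,l)$. Put $H^3_l=\{g\in H^3(\mathbb R): |g(x)|<l \text{ for all } x\}$ (elements of $H^3(\mathbb R)$ being identified with their continuous representatives) and let $f\in C((0,T);H^3_l)$. Let $$S^1(t)=\{(x,y)\in S: y>f(x,t)\},\qquad S^2(t)=\{(x,y)\in S: y<f(x,t)\},\qquad \rho(t)=\rho^1\mathbf 1_{S^1(t)}+\rho^2\mathbf 1_{S^2(t)}.$$ A Darcy flow for $\rho$ is a pair $(v,p)$ on $(0,T)\times S$, with $v$ measurable, such that for every $t\in(0,T)$: $v(t)\in L^2(S;\mathbb R^2)$, $p(t)\in L^1_{loc}(S)$, $v(t)=-\nabla p(t)-(0,\rho(t))$ in the sense of distributions in $S$, and $\nabla\cdot v(t)=0$ in $S$ with $v(t)\cdot n=0$ on the walls $y=\pm l$ in the weak sense, i.e. $\int_S v(t)\cdot\nabla\varphi\,dx\,dy=0$ for all $\varphi\in C_c^\infty(\mathbb R^2)$. Then a Darcy flow for $\rho$ exists, and for every Darcy flow $(v,p)$ for $\rho$ the following two statements are equivalent. (i)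 $\rho$ is a weak solution of the conservation of mass equation $\partial_t\rho+v\cdot\nabla\rho=0$: for every $\phi\in C_c^\infty(\mathbb R\times(-l,l)\times(0,T))$ the function $\rho\,\partial_t\phi+\rho\, v\cdot\nabla_{x,y}\phi$ is integrable and $$\int_0^T\int_{\mathbb R}\int_{-l}^{l}\big(\rho\,\partial_t\phi+\rho\, v\cdot\nabla_{x,y}\phi\big)\,dy\,dx\,dt=0 .$$ (ii) $f$ solves the contour equation: for all $t\in(0,T)$ and $x\in\mathbb R$, the principal value below (at $\eta=0$ and at infinity) exists, $f(x,\cdot)$ is differentiable at $t$, and $$\partial_t f(x,t)=\frac{\rho^2-\rho^1}{8l}\,\mathrm{P.V.}\!\int_{\mathbb R}\Big[(\partial_xf(x,t)-\partial_xf(x-\eta,t))\,\Xi_1(x,\eta,t)+(\partial_xf(x,t)+\partial_xf(x-\eta,t))\,\Xi_2(x,\eta,t)\Big]d\eta,$$ where $$\Xi_1=\frac{\sinh\left(\frac{\pi}{2l}\eta\right)}{\cosh\left(\frac{\pi}{2l}\eta\right)-\cos\left(\frac{\pi}{2l}(f(x,t)-f(x-\eta,t))\right)},\qquad \Xi_2=\frac{\sinh\left(\frac{\pi}{2l}\eta\right)}{\cosh\left(\frac{\pi}{2l}\eta\right)+\cos\left(\frac{\pi}{2l}(f(x,t)+f(x-\eta,t))\right)}.$$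 -/

import Mathlib

open MeasureTheory Set Filter Topology
open scoped ContDiff

noncomputable section

namespace Muskat

/-- The open strip `S = ℝ × (-l, l)`; a point is a pair `(x, y)`. -/
def strip (l : ℝ) : Set (ℝ × ℝ) := {z | -l < z.2 ∧ z.2 < l}

/-- The part of the strip above the graph of `g`, filled by the fluid of density `ρ¹`. -/
def upperDomain (l : ℝ) (g : ℝ → ℝ) : Set (ℝ × ℝ) := {z | z ∈ strip l ∧ g z.1 < z.2}

/-- The part of the strip below the graph of `g`, filled by the fluid of density `ρ²`. -/
def lowerDomain (l : ℝ) (g : ℝ → ℝ) : Set (ℝ × ℝ) := {z | z ∈ strip l ∧ z.2 < g z.1}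

/-- The density `ρ(t) = ρ¹ 1_{S¹(t)} + ρ² 1_{S²(t)}` of the interface `y = f t x`. -/
def density (l ρ₁ ρ₂ : ℝ) (f : ℝ → ℝ → ℝ) (t : ℝ) (z : ℝ × ℝ) : ℝ :=
  (upperDomain l (f t)).indicator (fun _ => ρ₁) z +
    (lowerDomain l (f t)).indicator (fun _ => ρ₂) z

/-- `h` is the weak derivative of order `k` on `ℝ` of the function `g`. -/
def IsWeakDeriv (k : ℕ) (g h : ℝ → ℝ) : Prop :=
  ∀ φ : ℝ → ℝ, ContDiff ℝ ∞ φ → HasCompactSupport φ →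
    ∫ x, g x * iteratedDeriv k φ x = (-1) ^ k * ∫ x, h x * φ x

/-- `t ↦ f t` belongs to `C((0,T), H³_l)`, where `H³_l = H³(ℝ) ∩ {|g| < l}` and a class in `H³(ℝ)`
is given by its continuous representative. Continuity with values in `H³(ℝ)` says that each weak
derivative of order `k ≤ 3` is a continuous curve in `L²(ℝ)`. -/
structure IsInterfaceCurve (l T : ℝ) (f : ℝ → ℝ → ℝ) : Prop where
  continuous : ∀ t ∈ Ioo 0 T, Continuous (f t)
  abs_lt : ∀ t ∈ Ioo 0 T, ∀ x, |f t x| < l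
  sobolev : ∀ k ≤ 3, ∃ D : ℝ → Lp ℝ 2 (volume : Measure ℝ),
    ContinuousOn D (Ioo 0 T) ∧ ∀ t ∈ Ioo 0 T, IsWeakDeriv k (f t) (D t)

/-- `(v, p)` is a finite-energy solution, at each time `t ∈ (0,T)`, of Darcy's law
`v = -∇p - (0, ρ)` and `∇ · v = 0` in the strip with impermeable walls, `v · n = 0` at `y = ±l`;
all equations are meant in the weak sense. -/
structure IsDarcyFlow (l T : ℝ) (ρ : ℝ → ℝ × ℝ → ℝ) (v : ℝ → ℝ × ℝ → ℝ × ℝ)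
    (p : ℝ → ℝ × ℝ → ℝ) : Prop where
  measurable : AEStronglyMeasurable (fun q : ℝ × (ℝ × ℝ) => v q.1 q.2)
    (volume.restrict (Ioo 0 T ×ˢ strip l))
  square_integrable : ∀ t ∈ Ioo 0 T, MemLp (v t) 2 (volume.restrict (strip l))
  pressure_integrable : ∀ t ∈ Ioo 0 T, LocallyIntegrableOn (p t) (strip l)
  darcy_fst : ∀ t ∈ Ioo 0 T, ∀ φ : ℝ × ℝ → ℝ, ContDiff ℝ ∞ φ → HasCompactSupport φ →
    tsupport φ ⊆ strip l →
    ∫ z in strip l, (v t z).1 * φ z = ∫ z in strip l, p t z * fderiv ℝ φ z (1, 0)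
  darcy_snd : ∀ t ∈ Ioo 0 T, ∀ φ : ℝ × ℝ → ℝ, ContDiff ℝ ∞ φ → HasCompactSupport φ →
    tsupport φ ⊆ strip l →
    ∫ z in strip l, (v t z).2 * φ z =
      (∫ z in strip l, p t z * fderiv ℝ φ z (0, 1)) - ∫ z in strip l, ρ t z * φ z
  /-- Here `fderiv ℝ φ z (v t z)` is `v · ∇φ`. The test functions need not vanish at the walls, so
  that this contains both the incompressibility and the condition `v · n = 0`. -/
  incompressible_impermeable : ∀ t ∈ Ioo 0 T, ∀ φ : ℝ × ℝ → ℝ, ContDiff ℝ ∞ φ →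
    HasCompactSupport φ → ∫ z in strip l, fderiv ℝ φ z (v t z) = 0

/-- `ρ` is a weak solution of `∂ₜρ + v · ∇ρ = 0` in the strip for `0 < t < T`, the velocity `v` being
incompressible: `∫∫ ρ ∂ₜφ + ρ v · ∇φ = 0` for all `φ ∈ C_c^∞((0,T) × S)`. -/
def IsWeakMassSolution (l T : ℝ) (ρ : ℝ → ℝ × ℝ → ℝ) (v : ℝ → ℝ × ℝ → ℝ × ℝ) : Prop :=
  ∀ φ : ℝ × (ℝ × ℝ) → ℝ, ContDiff ℝ ∞ φ → HasCompactSupport φ →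
    tsupport φ ⊆ Ioo 0 T ×ˢ strip l →
    IntegrableOn (fun q => ρ q.1 q.2 * fderiv ℝ φ q (1, 0) +
      ρ q.1 q.2 * fderiv ℝ φ q (0, v q.1 q.2)) (Ioo 0 T ×ˢ strip l) ∧
    ∫ q in Ioo 0 T ×ˢ strip l, (ρ q.1 q.2 * fderiv ℝ φ q (1, 0) +
      ρ q.1 q.2 * fderiv ℝ φ q (0, v q.1 q.2)) = 0

/-- The principal value (at the origin and at infinity) of `∫ g` over `ℝ` exists and equals `a`. -/
def HasPrincipalValue (g : ℝ → ℝ) (a : ℝ) : Prop :=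
  (∀ ε R : ℝ, 0 < ε → IntegrableOn g {η | ε < |η| ∧ |η| < R}) ∧
  Tendsto (fun q : ℝ × ℝ => ∫ η in {η : ℝ | q.1 < |η| ∧ |η| < q.2}, g η)
    (𝓝[>] (0 : ℝ) ×ˢ atTop) (𝓝 a)

/-- The singular kernel `Ξ₁`. -/
def Xi₁ (l : ℝ) (g : ℝ → ℝ) (x η : ℝ) : ℝ :=
  Real.sinh (Real.pi / (2 * l) * η) /
    (Real.cosh (Real.pi / (2 * l) * η) - Real.cos (Real.pi / (2 * l) * (g x - g (x - η))))

/-- The kernel `Ξ₂` produced by the walls. -/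
def Xi₂ (l : ℝ) (g : ℝ → ℝ) (x η : ℝ) : ℝ :=
  Real.sinh (Real.pi / (2 * l) * η) /
    (Real.cosh (Real.pi / (2 * l) * η) + Real.cos (Real.pi / (2 * l) * (g x + g (x - η))))

/-- `f` solves the contour equation
`∂ₜf(x) = (ρ² - ρ¹)/(8l) P.V.∫ [(f'(x) - f'(x-η)) Ξ₁ + (f'(x) + f'(x-η)) Ξ₂] dη`
at every `x` and every `t ∈ (0,T)`. -/
def SolvesContourEquation (l T ρ₁ ρ₂ : ℝ) (f : ℝ → ℝ → ℝ) : Prop :=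
  ∀ t ∈ Ioo 0 T, ∀ x : ℝ, ∃ a : ℝ,
    HasPrincipalValue (fun η =>
      (deriv (f t) x - deriv (f t) (x - η)) * Xi₁ l (f t) x η +
      (deriv (f t) x + deriv (f t) (x - η)) * Xi₂ l (f t) x η) a ∧
    HasDerivAt (fun s => f s x) ((ρ₂ - ρ₁) / (8 * l) * a) t

end Muskat

end

/-! Taking the curl of Darcy's law shows that the vorticity sits on the interface, as a sheet of
strength proportional to `(ρ₁ - ρ₂) ∂ₓf`. The velocity is therefore explicit: the rotated gradient
of the Green function of the strip, integrated against the sheet. Reflection in the walls gives this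
Green function as `(1/4π) log (kerA / kerB)`, and with `m = π/(2l)` the factor `m/(4π) = 1/(8l)` is
the constant in `velocity`.

Existence (`IsInterfaceCurve.isDarcyFlow`). The kernels have a singularity of type 1/distance and
decay exponentially along the strip. A bound by a product of two integrable singularities puts the
velocity in `L²`. Adding `ε > 0` to both `kerA` and `kerB` makes the kernels smooth and keeps the
field exactly divergence free and tangent to the walls, so these properties pass to the limit `ε →
0`. The pressure is built from the harmonic conjugate `conjGreen` of the Green function; correction
terms cancel its cut and produce the density jump.

Uniqueness (`IsDarcyFlow.velocity_ae_eq`). The difference of two flows is square integrable, curl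
free, divergence free and tangent to the walls. Its cosine and sine modes across the strip combine
into functions of `x` with `R' = ∓λR`; such functions are exponentials, and square integrability
kills them. Completeness of the modes then gives zero. Hence any Darcy flow may be replaced by the
explicit one.

Flux (`setIntegral_upperDomain_velocity`). By the divergence theorem, the transport term in the weak
mass equation becomes an integral over the interface of the normal component of the velocity. This
component and the principal value of the contour equation differ by a total derivative along the
interface (`hasDerivAt_logPrim`), so they agree up to sign.

Equivalence. The weak mass equation now reads: `∂ₜφ` integrated above the graph, plus `(ρ₁ -
ρ₂)/(8l)` times the integral of `φ` on the graph against the principal value, is zero. If the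
contour equation holds, this is the divergence theorem in the `(t, y)` plane at each fixed `x`.
Conversely, test functions `θ(t) χ(x) ζ(y)` with `ζ = 1` around the interface recover the contour
equation weakly in `t`; continuity of the principal value in `(t, x)` makes it hold at every point.
-/

noncomputable section

namespace Muskat

/-! ### Weak derivatives on the line -/

/-- A smooth function with zero mean and compact support in an open interval has a primitive with
compact support in that interval. -/
lemma exists_primitive_compactSupport {U : Set ℝ} (hc : U.OrdConnected) {ψ : ℝ → ℝ}
    (hψ : ContDiff ℝ ∞ ψ) (hs : HasCompactSupport ψ) (hsU : tsupport ψ ⊆ U) (h0 : ∫ x, ψ x = 0) :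
    ∃ φ : ℝ → ℝ, ContDiff ℝ ∞ φ ∧ HasCompactSupport φ ∧ tsupport φ ⊆ U ∧ ∀ x, deriv φ x = ψ x := by
  rcases (tsupport ψ).eq_empty_or_nonempty with he | hne
  · have : ψ = 0 := tsupport_eq_empty_iff.1 he
    subst this
    exact ⟨fun _ => 0, contDiff_const, HasCompactSupport.zero, by simp [tsupport], by simp⟩
  have hK : IsCompact (tsupport ψ) := hs
  set a := sInf (tsupport ψ) with ha
  set b := sSup (tsupport ψ) with hb
  have haK : a ∈ tsupport ψ := hK.sInf_mem hne
  have hbK : b ∈ tsupport ψ := hK.sSup_mem hne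
  have hsub : tsupport ψ ⊆ Icc a b :=
    fun x hx => ⟨csInf_le hK.bddBelow hx, le_csSup hK.bddAbove hx⟩
  have hz : ∀ x, x ∉ Icc a b → ψ x = 0 := fun x hx =>
    image_eq_zero_of_notMem_tsupport fun h => hx (hsub h)
  have hd : ∀ x, HasDerivAt (fun x => ∫ t in a..x, ψ t) (ψ x) x := fun x =>
    intervalIntegral.integral_hasDerivAt_right (hψ.continuous.intervalIntegrable _ _)
      (hψ.continuous.stronglyMeasurableAtFilter _ _) hψ.continuous.continuousAt
  have hab : a ≤ b := (hsub haK).2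
  have hout : ∀ x, x ∉ Icc a b → (∫ t in a..x, ψ t) = 0 := by
    intro x hx
    by_cases hxa : x < a
    · rw [intervalIntegral.integral_symm, intervalIntegral.integral_of_le hxa.le,
        ← integral_Ico_eq_integral_Ioc, setIntegral_eq_zero_of_forall_eq_zero, neg_zero]
      exact fun t ht => hz t fun h => not_lt.2 h.1 ht.2
    · have hxb : b < x := by
        by_contra h
        exact hx ⟨not_lt.1 hxa, not_lt.1 h⟩
      rw [intervalIntegral.integral_of_le (hab.trans hxb.le), ← integral_Icc_eq_integral_Ioc,
        setIntegral_eq_integral_of_forall_compl_eq_zero, h0]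
      exact fun t ht => hz t fun h => ht ⟨h.1, h.2.trans hxb.le⟩
  have hts : tsupport (fun x => ∫ t in a..x, ψ t) ⊆ Icc a b :=
    closure_minimal (fun x hx => by_contra fun h => hx (hout x h)) isClosed_Icc
  refine ⟨fun x => ∫ t in a..x, ψ t, ?_, ?_, hts.trans (hc.out (hsU haK) (hsU hbK)),
    fun x => (hd x).deriv⟩
  · rw [contDiff_infty_iff_deriv]
    refine ⟨fun x => (hd x).differentiableAt, ?_⟩
    rwa [show deriv (fun x => ∫ t in a..x, ψ t) = ψ from funext fun x => (hd x).deriv]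
  · exact IsCompact.of_isClosed_subset isCompact_Icc (isClosed_tsupport _) hts

/-- The du Bois-Reymond lemma on an open interval. -/
lemma ae_eq_const_of_integral_deriv_eq_zero {U : Set ℝ} (hU : IsOpen U) (hc : U.OrdConnected)
    {u : ℝ → ℝ} (hu : LocallyIntegrableOn u U)
    (h : ∀ φ : ℝ → ℝ, ContDiff ℝ ∞ φ → HasCompactSupport φ → tsupport φ ⊆ U →
      ∫ x, u x * deriv φ x = 0) : ∃ c, ∀ᵐ x, x ∈ U → u x = c := by
  rcases U.eq_empty_or_nonempty with rfl | ⟨x₀, hx₀⟩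
  · exact ⟨0, by simp⟩
  obtain ⟨r, hr, hrU⟩ := Metric.isOpen_iff.1 hU x₀ hx₀
  let B : ContDiffBump x₀ := ⟨r / 4, r / 2, by positivity, by linarith⟩
  set η : ℝ → ℝ := B.normed volume with hη
  have hηc : ContDiff ℝ ∞ η := B.contDiff_normed
  have hηs : HasCompactSupport η := B.hasCompactSupport_normed
  have hηU : tsupport η ⊆ U := by
    rw [hη, B.tsupport_normed_eq]
    exact (Metric.closedBall_subset_ball (by change r / 2 < r; linarith)).trans hrU
  have hηi : ∫ x, η x = 1 := B.integral_normed
  have hint : ∀ ψ : ℝ → ℝ, Continuous ψ → HasCompactSupport ψ → tsupport ψ ⊆ U →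
      Integrable fun x => ψ x * u x := by
    intro ψ hψ hψs hψU
    have h1 : IntegrableOn u (tsupport ψ) := hu.integrableOn_compact_subset hψU hψs
    have h2 : IntegrableOn (fun x => ψ x * u x) (tsupport ψ) :=
      h1.continuousOn_mul hψ.continuousOn hψs
    refine (integrableOn_iff_integrable_of_support_subset ?_).1 h2
    intro x hx
    exact subset_tsupport _ fun h => hx (by simp [h])
  set c := ∫ x, η x * u x with hcdef
  refine ⟨c, ?_⟩
  have key := hU.ae_eq_zero_of_integral_contDiff_smul_eq_zero (μ := volume)
    (f := fun x => u x - c) (hu.sub ((locallyIntegrable_const c).locallyIntegrableOn U)) ?_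
  · filter_upwards [key] with x hx hxU using sub_eq_zero.1 (hx hxU)
  intro ψ hψ hψs hψU
  have hψi : Integrable ψ := hψ.continuous.integrable_of_hasCompactSupport hψs
  have hηint : Integrable η := hηc.continuous.integrable_of_hasCompactSupport hηs
  set I := ∫ x, ψ x with hI
  have hsupp : tsupport (fun x => ψ x - I * η x) ⊆ tsupport ψ ∪ tsupport η := by
    refine closure_minimal ?_ ((isClosed_tsupport _).union (isClosed_tsupport _))
    intro x hx
    by_contra hn
    rw [mem_union, not_or] at hn
    exact hx (by simp [image_eq_zero_of_notMem_tsupport hn.1, image_eq_zero_of_notMem_tsupport hn.2])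
  -- Subtracting from `ψ` its integral times the unit bump `η` gives mean zero, hence the derivative
  -- of an admissible test function. This forces the constant to be `c = ∫ η u`.
  obtain ⟨φ, h1, h2, h3, h4⟩ := exists_primitive_compactSupport hc
    (ψ := fun x => ψ x - I * η x) (hψ.sub (contDiff_const.mul hηc))
    (hψs.sub hηs.mul_left)
    (hsupp.trans (union_subset hψU hηU))
    (by rw [integral_sub hψi (hηint.const_mul I), integral_const_mul, hηi]; simp [hI])
  have h5 := h φ h1 h2 h3
  simp only [h4] at h5
  have h6 := hint ψ hψ.continuous hψs hψU
  have h7 := hint η hηc.continuous hηs hηU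
  have h8 : ∫ x, u x * (ψ x - I * η x) = (∫ x, ψ x * u x) - I * c := by
    rw [hcdef, ← integral_const_mul, ← integral_sub h6 (h7.const_mul I)]
    exact integral_congr_ae (ae_of_all _ fun x => by ring)
  simp only [smul_eq_mul, mul_sub]
  rw [integral_sub h6 (hψi.mul_const c), integral_mul_const]
  rw [h8] at h5
  linarith

/-- A primitive of a locally integrable function is absolutely continuous on an interval containing
the support of `φ`, where integration by parts applies; Lebesgue differentiation identifies its
derivative with `h` almost everywhere. -/
lemma integral_primitive_mul_deriv {h φ : ℝ → ℝ} (hh : LocallyIntegrable h)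
    (hφ : ContDiff ℝ ∞ φ) (hs : HasCompactSupport φ) :
    ∫ x, (∫ t in (0 : ℝ)..x, h t) * deriv φ x = -∫ x, h x * φ x := by
  obtain ⟨N, hN⟩ := hs.isBounded.subset_closedBall (0 : ℝ)
  set R := |N| + 1
  have hR : 0 < R := by positivity
  have hφR : ∀ x, R ≤ |x| → φ x = 0 := by
    intro x hx
    refine image_eq_zero_of_notMem_tsupport fun h => ?_
    have := hN h
    rw [mem_closedBall_zero_iff, Real.norm_eq_abs] at this
    have := le_abs_self N
    simp only [R] at hx
    linarith
  have hdR : ∀ x, R < |x| → deriv φ x = 0 := by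
    intro x hx
    have : φ =ᶠ[𝓝 x] fun _ => 0 := by
      filter_upwards [continuous_abs.continuousAt.eventually (lt_mem_nhds hx)] with y hy
        using hφR y hy.le
    rw [this.deriv_eq]; simp
  have hii : ∀ a b, IntervalIntegrable h volume a b := fun a b =>
    intervalIntegrable_iff.mpr
      ((hh.integrableOn_isCompact isCompact_uIcc).mono_set uIoc_subset_uIcc)
  have hac := (hii (-R) R).absolutelyContinuousOnInterval_intervalIntegral (c := 0)
    (by rw [uIcc_of_le (by linarith)]; constructor <;> linarith)
  have hac2 : AbsolutelyContinuousOnInterval φ (-R) R :=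
    ((hφ.of_le (by exact_mod_cast le_top)).contDiffOn).absolutelyContinuousOnInterval
  have hibp := hac.integral_mul_deriv_eq_deriv_mul hac2
  have e1 : ∀ F : ℝ → ℝ, (∀ x, R < |x| → F x = 0) → ∫ x in (-R)..R, F x = ∫ x, F x := by
    intro F hF
    rw [intervalIntegral.integral_of_le (by linarith), ← integral_Icc_eq_integral_Ioc]
    refine setIntegral_eq_integral_of_forall_compl_eq_zero fun x hx => hF x ?_
    by_contra hn
    exact hx (abs_le.1 (not_lt.1 hn))
  rw [hφR R (le_abs_self R), hφR (-R) (by rw [abs_neg]; exact le_abs_self R),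
    e1 _ (fun x hx => by simp [hdR x hx]), e1 _ (fun x hx => by simp [hφR x hx.le])] at hibp
  rw [hibp]
  simp only [mul_zero, sub_self, zero_sub, neg_inj]
  refine integral_congr_ae ?_
  filter_upwards [LocallyIntegrable.ae_hasDerivAt_integral hh] with x hx
  rw [(hx 0).deriv]

/-- A function with a locally integrable weak derivative is a.e. a primitive of it. -/
lemma IsWeakDeriv.ae_eq_primitive {g h : ℝ → ℝ} (hg : LocallyIntegrable g)
    (hh : LocallyIntegrable h) (hw : IsWeakDeriv 1 g h) :
    ∃ c, ∀ᵐ x, g x = c + ∫ t in (0 : ℝ)..x, h t := by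
  have hii : ∀ a b, IntervalIntegrable h volume a b := fun a b =>
    intervalIntegrable_iff.mpr
      ((hh.integrableOn_isCompact isCompact_uIcc).mono_set uIoc_subset_uIcc)
  have hH : Continuous fun x => ∫ t in (0 : ℝ)..x, h t :=
    intervalIntegral.continuous_primitive hii 0
  suffices h : ∀ φ : ℝ → ℝ, ContDiff ℝ ∞ φ → HasCompactSupport φ → tsupport φ ⊆ univ →
      ∫ x, (g x - ∫ t in (0 : ℝ)..x, h t) * deriv φ x = 0 by
    obtain ⟨c, hc⟩ := ae_eq_const_of_integral_deriv_eq_zero isOpen_univ ordConnected_univ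
      ((hg.sub hH.locallyIntegrable).locallyIntegrableOn _) h
    refine ⟨c, ?_⟩
    filter_upwards [hc] with x hx
    have := hx trivial
    simp only [Pi.sub_apply] at this
    linarith
  intro φ hφ hs _
  have h1 := hw φ hφ hs
  rw [iteratedDeriv_one] at h1
  have hdc : Continuous (deriv φ) := hφ.continuous_deriv (by exact_mod_cast le_top)
  have hds : HasCompactSupport (deriv φ) := hs.deriv
  simp only [sub_mul]
  rw [integral_sub, h1, integral_primitive_mul_deriv hh hφ hs]
  · ring
  · simpa only [smul_eq_mul, mul_comm] using
      hg.integrable_smul_right_of_hasCompactSupport hdc hds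
  · simpa only [smul_eq_mul, mul_comm] using
      hH.locallyIntegrable.integrable_smul_right_of_hasCompactSupport hdc hds

/-! ### The Sobolev inequality on the line and the classical regularity of the interface -/

lemma sq_le_of_primitive {u h : ℝ → ℝ} {c : ℝ} (hh : LocallyIntegrable h)
    (hu : ∀ x, u x = c + ∫ t in (0 : ℝ)..x, h t)
    (hu2 : Integrable fun x => u x ^ 2) (hh2 : Integrable fun x => h x ^ 2) (x : ℝ) :
    u x ^ 2 ≤ 2 * ((∫ x, u x ^ 2) + ∫ x, h x ^ 2) := by
  have hii : ∀ a b, IntervalIntegrable h volume a b := fun a b =>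
    intervalIntegrable_iff.mpr
      ((hh.integrableOn_isCompact isCompact_uIcc).mono_set uIoc_subset_uIcc)
  have huc : Continuous u := by
    rw [funext hu]
    exact continuous_const.add (intervalIntegral.continuous_primitive hii 0)
  have hd : ∀ᵐ x, deriv u x = h x := by
    filter_upwards [LocallyIntegrable.ae_hasDerivAt_integral hh] with x hx
    rw [funext hu]
    exact ((hx 0).const_add c).deriv
  -- Here `u(x)² - u(s)² = 2 ∫ u h` over `[s, x]`, which is at most the integral of `u² + h²`.
  -- Averaging over `s` in an interval of length one then replaces `u(s)²` by its integral.
  have key : ∀ s ∈ Icc (x - 1) x, u x ^ 2 ≤ u s ^ 2 + ((∫ x, u x ^ 2) + ∫ x, h x ^ 2) := by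
    intro s hs
    have hac : AbsolutelyContinuousOnInterval u s x := by
      have h1 := (hii s x).absolutelyContinuousOnInterval_intervalIntegral (c := s) left_mem_uIcc
      have h2 : AbsolutelyContinuousOnInterval (fun _ : ℝ => u s) s x :=
        (contDiff_const (n := 1)).contDiffOn.absolutelyContinuousOnInterval
      have h3 := h2.add h1
      refine (show u = _ from ?_) ▸ h3
      funext y
      simp only [Pi.add_apply]
      rw [hu y, hu s, ← intervalIntegral.integral_add_adjacent_intervals (hii 0 s) (hii s y)]
      ring
    have hibp := hac.integral_mul_deriv_eq_deriv_mul hac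
    have e : ∫ y in s..x, deriv u y * u y = ∫ y in s..x, u y * deriv u y := by
      simp only [mul_comm]
    have e2 : ∫ y in s..x, u y * deriv u y = ∫ y in s..x, u y * h y :=
      intervalIntegral.integral_congr_ae (by
        filter_upwards [hd] with y hy _ using by rw [hy])
    rw [e, e2] at hibp
    have hle : (∫ y in s..x, 2 * (u y * h y)) ≤ ∫ y in s..x, (u y ^ 2 + h y ^ 2) := by
      refine intervalIntegral.integral_mono_on hs.2 ?_ (hu2.add hh2).intervalIntegrable ?_
      · exact (((hii s x).continuousOn_mul huc.continuousOn)).const_mul 2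
      · intro y _
        nlinarith [sq_nonneg (u y - h y)]
    have hle2 : (∫ y in s..x, (u y ^ 2 + h y ^ 2)) ≤ (∫ x, u x ^ 2) + ∫ x, h x ^ 2 := by
      rw [intervalIntegral.integral_of_le hs.2, ← integral_add hu2 hh2]
      exact setIntegral_le_integral (hu2.add hh2) (ae_of_all _ fun y => by positivity)
    rw [intervalIntegral.integral_const_mul] at hle
    nlinarith
  have hI : (∫ s in (x - 1)..x, u x ^ 2) ≤
      ∫ s in (x - 1)..x, (u s ^ 2 + ((∫ x, u x ^ 2) + ∫ x, h x ^ 2)) :=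
    intervalIntegral.integral_mono_on (by linarith) (by simp)
      (((huc.pow 2).add continuous_const).intervalIntegrable _ _) key
  rw [intervalIntegral.integral_add (f := fun s => u s ^ 2) ((huc.pow 2).intervalIntegrable _ _)
    (by simp)] at hI
  simp only [intervalIntegral.integral_const, sub_sub_cancel, one_smul] at hI
  have h5 : (∫ s in (x - 1)..x, u s ^ 2) ≤ ∫ s, u s ^ 2 := by
    rw [intervalIntegral.integral_of_le (by linarith)]
    exact setIntegral_le_integral hu2 (ae_of_all _ fun y => by positivity)
  have h6 : 0 ≤ ∫ x, h x ^ 2 := integral_nonneg fun _ => by positivity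
  linarith

lemma integrable_sq_coe (F : Lp ℝ 2 (volume : Measure ℝ)) : Integrable fun x => F x ^ 2 :=
  (Lp.memLp F).integrable_sq

lemma integral_sq_coe (F : Lp ℝ 2 (volume : Measure ℝ)) : ∫ x, F x ^ 2 = ‖F‖ ^ 2 := by
  rw [← real_inner_self_eq_norm_sq, L2.inner_def]
  refine integral_congr_ae (ae_of_all _ fun x => ?_)
  simp [sq]

lemma locallyIntegrable_coe (F : Lp ℝ 2 (volume : Measure ℝ)) : LocallyIntegrable F :=
  (Lp.memLp F).locallyIntegrable (by norm_num)

/-- The regularity of an interface at a fixed time that the estimates depend on. -/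
structure ProfileBound (l δ M : ℝ) (g : ℝ → ℝ) : Prop where
  contDiff : ContDiff ℝ 1 g
  abs_le : ∀ x, |g x| ≤ l - δ
  deriv_le : ∀ x, |deriv g x| ≤ M
  deriv_lip : ∀ x y, |deriv g x - deriv g y| ≤ M * |x - y|
  sq_int : Integrable fun x => g x ^ 2
  deriv_sq_int : Integrable fun x => deriv g x ^ 2
  deriv_sq_le : ∫ x, deriv g x ^ 2 ≤ M

lemma IsWeakDeriv.sub {k : ℕ} {g g' : ℝ → ℝ} {D D' : Lp ℝ 2 (volume : Measure ℝ)}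
    (hgc : LocallyIntegrable g) (hgc' : LocallyIntegrable g')
    (h : IsWeakDeriv k g D) (h' : IsWeakDeriv k g' D') :
    IsWeakDeriv k (fun x => g x - g' x) (D - D' : Lp ℝ 2 (volume : Measure ℝ)) := by
  intro φ hφ hs
  have hic : Continuous (iteratedDeriv k φ) :=
    hφ.continuous_iteratedDeriv k (by exact_mod_cast le_top)
  have his : HasCompactSupport (iteratedDeriv k φ) := by
    clear h h'
    induction k with
    | zero => simpa using hs
    | succ k ih =>
      rw [iteratedDeriv_succ]
      exact (ih (hφ.continuous_iteratedDeriv k (by exact_mod_cast le_top))).deriv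
  have e : ∫ x, (D - D' : Lp ℝ 2 (volume : Measure ℝ)) x * φ x =
      ∫ x, (D x * φ x - D' x * φ x) := by
    refine integral_congr_ae ?_
    filter_upwards [Lp.coeFn_sub D D'] with x hx
    rw [hx, Pi.sub_apply, sub_mul]
  have hi : ∀ {u φ : ℝ → ℝ}, LocallyIntegrable u → Continuous φ → HasCompactSupport φ →
      Integrable fun x => u x * φ x := fun hu hφ hs => by
    simpa only [smul_eq_mul, mul_comm] using hu.integrable_smul_right_of_hasCompactSupport hφ hs
  rw [e, integral_sub (hi (locallyIntegrable_coe _) hφ.continuous hs)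
    (hi (locallyIntegrable_coe _) hφ.continuous hs)]
  simp only [sub_mul]
  rw [integral_sub (hi hgc hic his) (hi hgc' hic his), h φ hφ hs, h' φ hφ hs]
  ring

/-- Testing the `k`-th weak derivative with `φ'` compares the two definitions; the signs `(-1) ^ k`
cancel. This allows the one-step Sobolev inequality to be applied to each consecutive pair of
derivatives. -/
lemma IsWeakDeriv.of_succ {k : ℕ} {g h h' : ℝ → ℝ} (hk : IsWeakDeriv k g h)
    (hk' : IsWeakDeriv (k + 1) g h') : IsWeakDeriv 1 h h' := by
  intro φ hφ hs
  have h1 := hk' φ hφ hs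
  have hd : ContDiff ℝ ∞ (deriv φ) := by
    rw [contDiff_infty_iff_deriv] at hφ
    exact hφ.2
  have h2 := hk (deriv φ) hd hs.deriv
  rw [iteratedDeriv_succ'] at h1
  rw [h1, pow_succ] at h2
  rw [iteratedDeriv_one]
  have h3 : ((-1 : ℝ) ^ k) * (-1) ^ k = 1 := by rw [← mul_pow]; simp
  have h4 := congrArg (fun z => (-1 : ℝ) ^ k * z) h2
  simp only [← mul_assoc] at h4
  rw [h3] at h4
  linarith

lemma IsWeakDeriv.ae_eq {g h : ℝ → ℝ} (hg : LocallyIntegrable g) (hh : LocallyIntegrable h)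
    (hw : IsWeakDeriv 0 g h) : g =ᵐ[volume] h := by
  refine ae_eq_of_integral_contDiff_smul_eq hg hh fun φ hφ hs => ?_
  have := hw φ hφ hs
  simpa [mul_comm] using this

lemma IsWeakDeriv.congr {k : ℕ} {g g' h : ℝ → ℝ} (hw : IsWeakDeriv k g h)
    (e : g =ᵐ[volume] g') : IsWeakDeriv k g' h := by
  intro φ hφ hs
  rw [← hw φ hφ hs]
  exact integral_congr_ae (by filter_upwards [e] with x hx using by rw [hx])

/-- One-dimensional Sobolev inequality, a.e. form. -/
lemma IsWeakDeriv.ae_sq_le {D D' : Lp ℝ 2 (volume : Measure ℝ)} (hw : IsWeakDeriv 1 D D') :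
    ∀ᵐ x, D x ^ 2 ≤ 2 * (‖D‖ ^ 2 + ‖D'‖ ^ 2) := by
  obtain ⟨c, hc⟩ := hw.ae_eq_primitive (locallyIntegrable_coe D) (locallyIntegrable_coe D')
  have h1 := integrable_sq_coe D
  have e : (fun x => D x ^ 2) =ᵐ[volume] fun x => (c + ∫ t in (0 : ℝ)..x, D' t) ^ 2 := by
    filter_upwards [hc] with x hx
    rw [hx]
  have h2 := sq_le_of_primitive (locallyIntegrable_coe D') (fun x => rfl) (h1.congr e)
    (integrable_sq_coe D')
  rw [← integral_congr_ae e, integral_sq_coe, integral_sq_coe] at h2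
  filter_upwards [hc] with x hx
  rw [hx]
  exact h2 x

lemma Continuous.le_of_ae_le {G : ℝ → ℝ} (hG : Continuous G) {C : ℝ} (h : ∀ᵐ x, G x ≤ C) (x : ℝ) :
    G x ≤ C := by
  by_contra hn
  have ho : IsOpen {y | C < G y} := isOpen_lt continuous_const hG
  have := ho.measure_pos volume ⟨x, not_le.1 hn⟩
  rw [ae_iff] at h
  simp only [not_le] at h
  exact this.ne' h

/-- The four weak derivatives of the interface at a fixed time, and the classical ones. -/
lemma hasDerivAt_of_weakDerivs {g : ℝ → ℝ} (hg : Continuous g)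
    {D₀ D₁ D₂ D₃ : Lp ℝ 2 (volume : Measure ℝ)} (h0 : IsWeakDeriv 0 g D₀) (h1 : IsWeakDeriv 1 g D₁)
    (h2 : IsWeakDeriv 2 g D₂) (h3 : IsWeakDeriv 3 g D₃) :
    ContDiff ℝ 1 g ∧ g =ᵐ[volume] D₀ ∧ deriv g =ᵐ[volume] D₁ ∧
      ∀ x y, |deriv g x - deriv g y| ≤ √(2 * (‖D₂‖ ^ 2 + ‖D₃‖ ^ 2)) * |x - y| := by
  have hD1 := h1.of_succ h2
  have hD2 := h2.of_succ h3
  obtain ⟨c, hc⟩ := h1.ae_eq_primitive hg.locallyIntegrable (locallyIntegrable_coe D₁)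
  -- Two successive primitives: `D₁` agrees a.e. with the continuous function `r`, and `g` is a
  -- primitive of `D₁`, hence of `r`. So `g` is `C¹` with derivative `r`.
  obtain ⟨d, hd⟩ := hD1.ae_eq_primitive (locallyIntegrable_coe D₁) (locallyIntegrable_coe D₂)
  have hii : ∀ (F : Lp ℝ 2 (volume : Measure ℝ)) a b, IntervalIntegrable F volume a b :=
    fun F a b => intervalIntegrable_iff.mpr
      (((locallyIntegrable_coe F).integrableOn_isCompact isCompact_uIcc).mono_set uIoc_subset_uIcc)
  set r : ℝ → ℝ := fun x => d + ∫ t in (0 : ℝ)..x, D₂ t with hr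
  have hrc : Continuous r :=
    continuous_const.add (intervalIntegral.continuous_primitive (hii D₂) 0)
  have e1 : ∀ x, g x = c + ∫ t in (0 : ℝ)..x, r t := by
    have : g = fun x => c + ∫ t in (0 : ℝ)..x, D₁ t :=
      (Continuous.ae_eq_iff_eq volume hg
        (continuous_const.add (intervalIntegral.continuous_primitive (hii D₁) 0))).1 hc
    intro x
    rw [this]
    simp only [add_right_inj]
    exact intervalIntegral.integral_congr_ae (by filter_upwards [hd] with y hy _ using hy)
  have hder : ∀ x, HasDerivAt g (r x) x := by
    intro x
    rw [funext e1]
    exact (intervalIntegral.integral_hasDerivAt_right (hrc.intervalIntegrable _ _)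
      (hrc.stronglyMeasurableAtFilter _ _) hrc.continuousAt).const_add c
  have hdr : deriv g = r := funext fun x => (hder x).deriv
  refine ⟨?_, h0.ae_eq hg.locallyIntegrable (locallyIntegrable_coe _), ?_, ?_⟩
  · rw [contDiff_one_iff_deriv, hdr]
    exact ⟨fun x => (hder x).differentiableAt, hrc⟩
  · rw [hdr]
    filter_upwards [hd] with x hx using hx.symm
  · intro x y
    rw [hdr]
    -- The third derivative enters only here: it bounds `D₂` in the sup norm, which makes `g'`
    -- Lipschitz.
    have hb : ∀ᵐ s, ‖D₂ s‖ ≤ √(2 * (‖D₂‖ ^ 2 + ‖D₃‖ ^ 2)) := by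
      filter_upwards [hD2.ae_sq_le] with s hs
      exact Real.abs_le_sqrt hs
    have : r x - r y = ∫ t in y..x, D₂ t := by
      simp only [hr]
      rw [← intervalIntegral.integral_add_adjacent_intervals (hii D₂ 0 y) (hii D₂ y x)]
      ring
    rw [this]
    exact intervalIntegral.norm_integral_le_of_norm_le_const_ae
      (by filter_upwards [hb] with s hs _ using hs)

/-- The Sobolev inequality for a difference: continuity in time with values in `H¹` becomes
continuity in time uniform in `x`. -/
lemma sq_sub_le_of_weakDerivs {g g' : ℝ → ℝ} (hg : Continuous g) (hg' : Continuous g')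
    {D D' E E' : Lp ℝ 2 (volume : Measure ℝ)} (h0 : g =ᵐ[volume] D) (h0' : g' =ᵐ[volume] D')
    (h1 : IsWeakDeriv 1 D E) (h1' : IsWeakDeriv 1 D' E') (x : ℝ) :
    (g x - g' x) ^ 2 ≤ 2 * (‖D - D'‖ ^ 2 + ‖E - E'‖ ^ 2) := by
  have hw := IsWeakDeriv.sub (locallyIntegrable_coe D) (locallyIntegrable_coe D') h1 h1'
  have hw' : IsWeakDeriv 1 (D - D' : Lp ℝ 2 (volume : Measure ℝ))
      (E - E' : Lp ℝ 2 (volume : Measure ℝ)) := hw.congr (Lp.coeFn_sub D D').symm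
  refine Continuous.le_of_ae_le (G := fun x => (g x - g' x) ^ 2) (by fun_prop) ?_ x
  filter_upwards [hw'.ae_sq_le, Lp.coeFn_sub D D', h0, h0'] with y h2 h3 h4 h5
  rw [h3, Pi.sub_apply] at h2
  rwa [h4, h5]

/-- A square integrable `C¹` function with square integrable derivative vanishes at infinity;
hence it stays away from any strict upper bound. -/
lemma exists_abs_le_sub {l : ℝ} {g : ℝ → ℝ} (hl : 0 < l) (hg : ContDiff ℝ 1 g)
    (hg2 : Integrable fun x => g x ^ 2) (hd2 : Integrable fun x => deriv g x ^ 2)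
    (hlt : ∀ x, |g x| < l) : ∃ δ > 0, ∀ x, |g x| ≤ l - δ := by
  have hgc := hg.continuous
  have hdc : Continuous (deriv g) := hg.continuous_deriv le_rfl
  have hder : ∀ x, HasDerivAt (fun x => g x ^ 2) (2 * (g x * deriv g x)) x := fun x => by
    have := ((hg.differentiable (by norm_num) x).hasDerivAt.pow 2)
    convert! this using 1
    simp; ring
  have hint : Integrable fun x => 2 * (g x * deriv g x) := by
    refine (hg2.add hd2).mono' (by fun_prop) (ae_of_all _ fun x => ?_)
    rw [Real.norm_eq_abs, abs_le]
    simp only [Pi.add_apply]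
    constructor <;> nlinarith [sq_nonneg (g x - deriv g x), sq_nonneg (g x + deriv g x)]
  -- Both `g²` and its derivative `2 g g'` are integrable, so `g²` tends to zero at infinity. What
  -- remains is a maximum over a compact interval, where `|g| < l` is strict.
  have ht := tendsto_zero_of_hasDerivAt_of_integrableOn_Ioi (a := 0) (fun x _ => hder x)
    hint.integrableOn hg2.integrableOn
  have hb := tendsto_zero_of_hasDerivAt_of_integrableOn_Iic (a := 0) (fun x _ => hder x)
    hint.integrableOn hg2.integrableOn
  have hpos : (0 : ℝ) < (l / 2) ^ 2 := by positivity
  obtain ⟨a, ha⟩ := eventually_atTop.1 (ht.eventually (gt_mem_nhds hpos))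
  obtain ⟨b, hb⟩ := eventually_atBot.1 (hb.eventually (gt_mem_nhds hpos))
  obtain ⟨x₀, -, hx₀⟩ := (isCompact_uIcc (a := a) (b := b)).exists_isMaxOn nonempty_uIcc
    (hgc.abs.continuousOn)
  refine ⟨min (l / 2) (l - |g x₀|), lt_min (by positivity) (by linarith [hlt x₀]), fun x => ?_⟩
  have hsm : g x ^ 2 < (l / 2) ^ 2 → |g x| ≤ l - min (l / 2) (l - |g x₀|) := fun h => by
    have := abs_lt_of_sq_lt_sq h (by positivity)
    linarith [min_le_left (l / 2) (l - |g x₀|)]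
  by_cases hxa : a ≤ x
  · exact hsm (ha x hxa)
  by_cases hxb : x ≤ b
  · exact hsm (hb x hxb)
  have h3 : |g x| ≤ |g x₀| := hx₀ (by
    rw [mem_uIcc]; right; exact ⟨(not_le.1 hxb).le, (not_le.1 hxa).le⟩)
  linarith [min_le_right (l / 2) (l - |g x₀|)]

/-- All the constants are controlled by `L²` norms of weak derivatives, which are continuous in
time; so they can be chosen uniformly near each `t₀`. Joint continuity follows from continuity in
`x` and convergence in `t` uniform in `x`. -/
lemma IsInterfaceCurve.regularity {l T : ℝ} (hl : 0 < l) {f : ℝ → ℝ → ℝ}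
    (hf : IsInterfaceCurve l T f) :
    (∀ t₀ ∈ Ioo 0 T, ∃ δ > 0, ∃ M, ∀ᶠ t in 𝓝 t₀, ProfileBound l δ M (f t)) ∧
    ContinuousOn (fun q : ℝ × ℝ => f q.1 q.2) (Ioo 0 T ×ˢ univ) ∧
    ContinuousOn (fun q : ℝ × ℝ => deriv (f q.1) q.2) (Ioo 0 T ×ˢ univ) := by
  obtain ⟨D₀, c0, w0⟩ := hf.sobolev 0 (by norm_num)
  obtain ⟨D₁, c1, w1⟩ := hf.sobolev 1 (by norm_num)
  obtain ⟨D₂, c2, w2⟩ := hf.sobolev 2 (by norm_num)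
  obtain ⟨D₃, c3, w3⟩ := hf.sobolev 3 (by norm_num)
  have hreg := fun t ht => hasDerivAt_of_weakDerivs (hf.continuous t ht) (w0 t ht) (w1 t ht)
    (w2 t ht) (w3 t ht)
  have hdc : ∀ t ∈ Ioo 0 T, Continuous (deriv (f t)) := fun t ht =>
    (hreg t ht).1.continuous_deriv le_rfl
  have hdiff : ∀ t ∈ Ioo 0 T, ∀ s ∈ Ioo 0 T, ∀ x,
      (f t x - f s x) ^ 2 ≤ 2 * (‖D₀ t - D₀ s‖ ^ 2 + ‖D₁ t - D₁ s‖ ^ 2) := fun t ht s hs =>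
    sq_sub_le_of_weakDerivs (hf.continuous t ht) (hf.continuous s hs) (hreg t ht).2.1
      (hreg s hs).2.1 ((w0 t ht).of_succ (w1 t ht)) ((w0 s hs).of_succ (w1 s hs))
  have hdiff' : ∀ t ∈ Ioo 0 T, ∀ s ∈ Ioo 0 T, ∀ x,
      (deriv (f t) x - deriv (f s) x) ^ 2 ≤ 2 * (‖D₁ t - D₁ s‖ ^ 2 + ‖D₂ t - D₂ s‖ ^ 2) :=
    fun t ht s hs => sq_sub_le_of_weakDerivs (hdc t ht) (hdc s hs) (hreg t ht).2.2.1
      (hreg s hs).2.2.1 ((w1 t ht).of_succ (w2 t ht)) ((w1 s hs).of_succ (w2 s hs))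
  have hzero : ∀ D D' : ℝ → Lp ℝ 2 (volume : Measure ℝ), ContinuousOn D (Ioo 0 T) →
      ContinuousOn D' (Ioo 0 T) → ∀ t₀ ∈ Ioo 0 T,
      Tendsto (fun t => 2 * (‖D t - D t₀‖ ^ 2 + ‖D' t - D' t₀‖ ^ 2)) (𝓝 t₀) (𝓝 0) := by
    intro D D' hD hD' t₀ ht₀
    have h1 := hD.continuousAt (isOpen_Ioo.mem_nhds ht₀)
    have h2 := hD'.continuousAt (isOpen_Ioo.mem_nhds ht₀)
    have h3 : ContinuousAt (fun t => 2 * (‖D t - D t₀‖ ^ 2 + ‖D' t - D' t₀‖ ^ 2)) t₀ := by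
      fun_prop
    simpa using h3.tendsto
  have hunif : ∀ F : ℝ → ℝ → ℝ, (∀ t ∈ Ioo 0 T, Continuous (F t)) →
      ∀ D D' : ℝ → Lp ℝ 2 (volume : Measure ℝ), ContinuousOn D (Ioo 0 T) →
      ContinuousOn D' (Ioo 0 T) → (∀ t ∈ Ioo 0 T, ∀ s ∈ Ioo 0 T, ∀ x,
      (F t x - F s x) ^ 2 ≤ 2 * (‖D t - D s‖ ^ 2 + ‖D' t - D' s‖ ^ 2)) →
      ∀ t₀ ∈ Ioo 0 T, ∀ ε > 0, ∀ᶠ t in 𝓝 t₀, ∀ x, |F t x - F t₀ x| < ε := by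
    intro F _ D D' hD hD' hFD t₀ ht₀ ε hε
    filter_upwards [(hzero D D' hD hD' t₀ ht₀).eventually (gt_mem_nhds (pow_pos hε 2)),
      isOpen_Ioo.mem_nhds ht₀] with t h1 h2 x
    exact abs_lt_of_sq_lt_sq ((hFD t h2 t₀ ht₀ x).trans_lt h1) hε.le
  have hcont : ∀ F : ℝ → ℝ → ℝ, (∀ t ∈ Ioo 0 T, Continuous (F t)) →
      (∀ t₀ ∈ Ioo 0 T, ∀ ε > 0, ∀ᶠ t in 𝓝 t₀, ∀ x, |F t x - F t₀ x| < ε) →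
      ContinuousOn (fun q : ℝ × ℝ => F q.1 q.2) (Ioo 0 T ×ˢ univ) := by
    rintro F hF hu ⟨t₀, x₀⟩ ⟨ht₀, -⟩
    refine ContinuousAt.continuousWithinAt ?_
    rw [Metric.continuousAt_iff']
    intro ε hε
    have h1 := (hu t₀ ht₀ (ε / 2) (by positivity))
    have h2 := (Metric.continuousAt_iff'.1 ((hF t₀ ht₀).continuousAt (x := x₀))) (ε / 2) (by positivity)
    rw [nhds_prod_eq]
    filter_upwards [h1.prod_mk h2] with q hq
    have h3 := hq.1 q.2
    have h4 := hq.2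
    rw [Real.dist_eq] at h4 ⊢
    calc |F q.1 q.2 - F t₀ x₀| = |(F q.1 q.2 - F t₀ q.2) + (F t₀ q.2 - F t₀ x₀)| := by ring_nf
      _ ≤ _ := abs_add_le _ _
      _ < ε := by linarith
  have u0 := hunif f hf.continuous D₀ D₁ c0 c1 hdiff
  have u1 := hunif (fun t => deriv (f t)) hdc D₁ D₂ c1 c2 hdiff'
  refine ⟨fun t₀ ht₀ => ?_, hcont f hf.continuous u0, hcont _ hdc u1⟩
  have hsq : ∀ t ∈ Ioo 0 T, Integrable fun x => f t x ^ 2 := fun t ht =>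
    (integrable_sq_coe (D₀ t)).congr (by
      filter_upwards [(hreg t ht).2.1] with x hx using by rw [hx])
  have e1 : ∀ t ∈ Ioo 0 T, (fun x => D₁ t x ^ 2) =ᵐ[volume] fun x => deriv (f t) x ^ 2 :=
    fun t ht => by filter_upwards [(hreg t ht).2.2.1] with x hx using by rw [hx]
  have hsq' : ∀ t ∈ Ioo 0 T, Integrable fun x => deriv (f t) x ^ 2 := fun t ht =>
    (integrable_sq_coe (D₁ t)).congr (e1 t ht)
  obtain ⟨δ, hδ, hδb⟩ := exists_abs_le_sub hl (hreg t₀ ht₀).1 (hsq t₀ ht₀) (hsq' t₀ ht₀)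
    (hf.abs_lt t₀ ht₀)
  have n1 : ContinuousAt (fun t => ‖D₁ t‖ ^ 2) t₀ := by
    have := c1.continuousAt (isOpen_Ioo.mem_nhds ht₀); fun_prop
  have n2 : ContinuousAt (fun t => √(2 * (‖D₂ t‖ ^ 2 + ‖D₃ t‖ ^ 2))) t₀ := by
    have := c2.continuousAt (isOpen_Ioo.mem_nhds ht₀)
    have := c3.continuousAt (isOpen_Ioo.mem_nhds ht₀)
    fun_prop
  have n3 : ContinuousAt (fun t => √(2 * (‖D₁ t‖ ^ 2 + ‖D₂ t‖ ^ 2))) t₀ := by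
    have := c1.continuousAt (isOpen_Ioo.mem_nhds ht₀)
    have := c2.continuousAt (isOpen_Ioo.mem_nhds ht₀)
    fun_prop
  -- Each bound at `t₀` is relaxed by one, and the wall distance halved, so that it persists for `t`
  -- near `t₀`.
  refine ⟨δ / 2, by positivity, max (‖D₁ t₀‖ ^ 2 + 1)
    (max (√(2 * (‖D₂ t₀‖ ^ 2 + ‖D₃ t₀‖ ^ 2)) + 1) (√(2 * (‖D₁ t₀‖ ^ 2 + ‖D₂ t₀‖ ^ 2)) + 1)), ?_⟩
  filter_upwards [n1.eventually (gt_mem_nhds (lt_add_one _)),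
    n2.eventually (gt_mem_nhds (lt_add_one _)), n3.eventually (gt_mem_nhds (lt_add_one _)),
    isOpen_Ioo.mem_nhds ht₀, u0 t₀ ht₀ (δ / 2) (by positivity)] with t b1 b2 b3 ht b4
  refine ⟨(hreg t ht).1, fun x => ?_, fun x => ?_, fun x y => ?_, hsq t ht, hsq' t ht, ?_⟩
  · have h1 := hδb x
    have h2 := b4 x
    have h3 := abs_add_le (f t x - f t₀ x) (f t₀ x)
    rw [sub_add_cancel] at h3
    linarith
  · have hb : ∀ᵐ s, D₁ t s ^ 2 ≤ _ := ((w1 t ht).of_succ (w2 t ht)).ae_sq_le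
    have hb' : ∀ x, deriv (f t) x ^ 2 ≤ 2 * (‖D₁ t‖ ^ 2 + ‖D₂ t‖ ^ 2) :=
      Continuous.le_of_ae_le (by have := hdc t ht; fun_prop) (by
        filter_upwards [hb, e1 t ht] with s hs h's
        rwa [← h's])
    exact (Real.abs_le_sqrt (hb' x)).trans (b3.le.trans
      ((le_max_right _ _).trans (le_max_right _ _)))
  · exact ((hreg t ht).2.2.2 x y).trans (mul_le_mul_of_nonneg_right (b2.le.trans
      ((le_max_left _ _).trans (le_max_right _ _))) (abs_nonneg _))
  · rw [← integral_congr_ae (e1 t ht), integral_sq_coe]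
    exact b1.le.trans (le_max_left _ _)

/-! ### The kernels of the strip and their pointwise bounds -/

/-- `cosh mη - cos m(y - y') + ε` with `m = π / (2l)`. -/
def kerA (l ε η y y' : ℝ) : ℝ :=
  Real.cosh (Real.pi / (2 * l) * η) - Real.cos (Real.pi / (2 * l) * (y - y')) + ε

/-- `cosh mη + cos m(y + y') + ε` with `m = π / (2l)`. -/
def kerB (l ε η y y' : ℝ) : ℝ :=
  Real.cosh (Real.pi / (2 * l) * η) + Real.cos (Real.pi / (2 * l) * (y + y')) + ε

/-- The derivative in `y` of the regularized Green function `log kerA - log kerB`, over `m`. -/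
def kerY (l ε η y y' : ℝ) : ℝ :=
  Real.sin (Real.pi / (2 * l) * (y - y')) / kerA l ε η y y' +
    Real.sin (Real.pi / (2 * l) * (y + y')) / kerB l ε η y y'

/-- The derivative in `η` of the regularized Green function `log kerA - log kerB`, over `m`. -/
def kerX (l ε η y y' : ℝ) : ℝ :=
  Real.sinh (Real.pi / (2 * l) * η) / kerA l ε η y y' -
    Real.sinh (Real.pi / (2 * l) * η) / kerB l ε η y y'

/-- Half of `kerA`. -/
def kerP (l ε η y y' : ℝ) : ℝ :=
  Real.sinh (Real.pi / (2 * l) * η / 2) ^ 2 + Real.sin (Real.pi / (2 * l) * (y - y') / 2) ^ 2 + ε / 2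

/-- Half-angle formulas turn the denominators into sums of squares, from which positivity and lower
bounds can be read off. -/
lemma kerA_eq (l ε η y y' : ℝ) : kerA l ε η y y' = 2 * kerP l ε η y y' := by
  unfold kerA kerP
  set u := Real.pi / (2 * l) * η
  set w := Real.pi / (2 * l) * (y - y')
  have h1 : Real.cosh u = 1 + 2 * Real.sinh (u / 2) ^ 2 := by
    have := Real.cosh_two_mul (u / 2)
    rw [mul_div_cancel₀ _ two_ne_zero, Real.cosh_sq] at this
    linarith
  have h2 : Real.cos w = 1 - 2 * Real.sin (w / 2) ^ 2 := by
    have := Real.cos_two_mul (w / 2)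
    rw [mul_div_cancel₀ _ two_ne_zero, Real.cos_sq'] at this
    linarith
  rw [h1, h2]; ring

lemma kerB_eq (l ε η y y' : ℝ) : kerB l ε η y y' =
    2 * (Real.sinh (Real.pi / (2 * l) * η / 2) ^ 2 +
      Real.cos (Real.pi / (2 * l) * (y + y') / 2) ^ 2 + ε / 2) := by
  unfold kerB
  set u := Real.pi / (2 * l) * η
  set w := Real.pi / (2 * l) * (y + y')
  have h1 : Real.cosh u = 1 + 2 * Real.sinh (u / 2) ^ 2 := by
    have := Real.cosh_two_mul (u / 2)
    rw [mul_div_cancel₀ _ two_ne_zero, Real.cosh_sq] at this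
    linarith
  have h2 : Real.cos w = 2 * Real.cos (w / 2) ^ 2 - 1 := by
    have := Real.cos_two_mul (w / 2)
    rwa [mul_div_cancel₀ _ two_ne_zero] at this
  rw [h1, h2]; ring

lemma cos_wave_nonneg {l y : ℝ} (hl : 0 < l) (hy : |y| ≤ l) :
    0 ≤ Real.cos (Real.pi / (2 * l) * y) := by
  have hm : 0 < Real.pi / (2 * l) := by positivity
  have h1 : Real.pi / (2 * l) * l = Real.pi / 2 := by field_simp
  rw [abs_le] at hy
  apply Real.cos_nonneg_of_neg_pi_div_two_le_of_le
  · nlinarith [hy.1]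
  · nlinarith [hy.2]

/-- The right side minus the left is `cos my · cos my'`, nonnegative inside the strip: a point is
never closer to the reflected source than to the source. Hence `kerB` dominates `kerA`, and `kerP`
controls both fractions. -/
lemma sin_sq_le_cos_sq {l y y' : ℝ} (hl : 0 < l) (hy : |y| ≤ l) (hy' : |y'| ≤ l) :
    Real.sin (Real.pi / (2 * l) * (y - y') / 2) ^ 2 ≤
      Real.cos (Real.pi / (2 * l) * (y + y') / 2) ^ 2 := by
  have h := kerB_eq l 0 0 y y'
  have h' := kerA_eq l 0 0 y y'
  unfold kerB at h
  unfold kerA kerP at h'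
  simp only [mul_zero, zero_div, Real.sinh_zero, Real.cosh_zero] at h h'
  have h1 := cos_wave_nonneg hl hy
  have h2 := cos_wave_nonneg hl hy'
  have h3 : Real.cos (Real.pi / (2 * l) * (y - y')) + Real.cos (Real.pi / (2 * l) * (y + y')) =
      2 * (Real.cos (Real.pi / (2 * l) * y) * Real.cos (Real.pi / (2 * l) * y')) := by
    rw [mul_sub, mul_add, Real.cos_sub, Real.cos_add]; ring
  nlinarith [mul_nonneg h1 h2]

/-- In `sin w = 2 sin (w/2) cos (w/2)` one factor is at most `√Q` and the other at most one. -/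
lemma abs_sin_div_le {w R Q : ℝ} (hQ : 0 < Q) (hR : R = 2 * Q)
    (h : Real.sin (w / 2) ^ 2 ≤ Q ∨ Real.cos (w / 2) ^ 2 ≤ Q) :
    |Real.sin w / R| ≤ 1 / √Q := by
  have h1 : Real.sin w = 2 * Real.sin (w / 2) * Real.cos (w / 2) := by
    rw [← Real.sin_two_mul, mul_div_cancel₀ _ two_ne_zero]
  have h2 : |Real.sin (w / 2) * Real.cos (w / 2)| ≤ √Q := by
    apply Real.abs_le_sqrt
    have h3 := Real.sin_sq_add_cos_sq (w / 2)
    rcases h with h | h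
    · nlinarith [sq_nonneg (Real.sin (w / 2)), sq_nonneg (Real.cos (w / 2))]
    · nlinarith [sq_nonneg (Real.sin (w / 2)), sq_nonneg (Real.cos (w / 2))]
  have hs : 0 < √Q := Real.sqrt_pos.2 hQ
  have hq : √Q * √Q = Q := Real.mul_self_sqrt hQ.le
  rw [h1, hR, mul_assoc, mul_div_mul_left _ _ two_ne_zero, abs_div, abs_of_pos hQ,
    div_le_div_iff₀ hQ hs]
  nlinarith

lemma abs_kerY_le {l ε η y y' : ℝ} (hl : 0 < l) (hε : 0 ≤ ε) (hy : |y| ≤ l) (hy' : |y'| ≤ l)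
    (hP : 0 < kerP l ε η y y') : |kerY l ε η y y'| ≤ 2 / √(kerP l ε η y y') := by
  have hle := sin_sq_le_cos_sq hl hy hy'
  set Q := Real.sinh (Real.pi / (2 * l) * η / 2) ^ 2 +
      Real.cos (Real.pi / (2 * l) * (y + y') / 2) ^ 2 + ε / 2 with hQ
  have hPQ : kerP l ε η y y' ≤ Q := by unfold kerP; linarith
  have h1 := abs_sin_div_le (w := Real.pi / (2 * l) * (y - y')) hP (kerA_eq l ε η y y')
    (Or.inl (by unfold kerP; nlinarith [sq_nonneg (Real.sinh (Real.pi / (2 * l) * η / 2))]))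
  have h2 := abs_sin_div_le (w := Real.pi / (2 * l) * (y + y')) (hP.trans_le hPQ)
    (kerB_eq l ε η y y')
    (Or.inr (by nlinarith [sq_nonneg (Real.sinh (Real.pi / (2 * l) * η / 2))]))
  have h3 : 1 / √Q ≤ 1 / √(kerP l ε η y y') :=
    one_div_le_one_div_of_le (Real.sqrt_pos.2 hP) (Real.sqrt_le_sqrt hPQ)
  unfold kerY
  refine (abs_add_le _ _).trans ?_
  have h4 : 2 / √(kerP l ε η y y') = 1 / √(kerP l ε η y y') + 1 / √(kerP l ε η y y') := by ring
  linarith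

lemma abs_kerX_le {l ε η y y' : ℝ} (hl : 0 < l) (hε : 0 ≤ ε) (hy : |y| ≤ l) (hy' : |y'| ≤ l)
    (hP : 0 < kerP l ε η y y') : |kerX l ε η y y'| ≤ 1 / √(kerP l ε η y y') := by
  have hle := sin_sq_le_cos_sq hl hy hy'
  unfold kerX
  rw [kerA_eq, kerB_eq]
  have h0 : Real.sinh (Real.pi / (2 * l) * η) = 2 * Real.sinh (Real.pi / (2 * l) * η / 2) *
      Real.cosh (Real.pi / (2 * l) * η / 2) := by
    rw [← Real.sinh_two_mul, mul_div_cancel₀ _ two_ne_zero]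
  rw [h0]
  have hPd : kerP l ε η y y' = Real.sinh (Real.pi / (2 * l) * η / 2) ^ 2 +
    Real.sin (Real.pi / (2 * l) * (y - y') / 2) ^ 2 + ε / 2 := rfl
  set P := kerP l ε η y y'
  set s := Real.sinh (Real.pi / (2 * l) * η / 2)
  set ch := Real.cosh (Real.pi / (2 * l) * η / 2) with hch
  set σ := Real.sin (Real.pi / (2 * l) * (y - y') / 2)
  set τ := Real.cos (Real.pi / (2 * l) * (y + y') / 2) with hτ
  set Q := s ^ 2 + τ ^ 2 + ε / 2 with hQ
  have hch2 : ch ^ 2 = s ^ 2 + 1 := Real.cosh_sq _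
  have hchp : 0 < ch := Real.cosh_pos _
  have hτ1 : τ ^ 2 ≤ 1 := Real.cos_sq_le_one _
  have hPQ : P ≤ Q := by linarith
  have hQ0 : 0 < Q := hP.trans_le hPQ
  -- With `ε = 0` each fraction tends to `±1` at infinity; only the difference decays. It is `s/P`,
  -- of size `P ^ (-1/2)`, times `ch (Q - P)/Q`, which is at most one because `Q - P ≤ τ²` and `(ch
  -- τ²)² ≤ Q²`.
  have e : 2 * s * ch / (2 * P) - 2 * s * ch / (2 * Q) = s / P * (ch * (Q - P) / Q) := by
    field_simp
  have h1 : |ch * (Q - P) / Q| ≤ 1 := by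
    rw [abs_div, abs_of_pos hQ0, div_le_one hQ0, abs_of_nonneg (mul_nonneg hchp.le (by linarith))]
    have h2 : Q - P ≤ τ ^ 2 := by nlinarith [sq_nonneg σ]
    have h3 : (ch * τ ^ 2) ^ 2 ≤ Q ^ 2 := by
      have a1 : (ch * τ ^ 2) ^ 2 = (s ^ 2 * τ ^ 2 + τ ^ 2) * τ ^ 2 := by
        rw [mul_pow, hch2]; ring
      have a2 : s ^ 2 * τ ^ 2 + τ ^ 2 ≤ Q := by nlinarith [sq_nonneg s]
      have a3 : τ ^ 2 ≤ Q := by nlinarith [sq_nonneg s]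
      rw [a1, sq Q]
      exact mul_le_mul a2 a3 (sq_nonneg _) hQ0.le
    have h4 := abs_le_of_sq_le_sq h3 hQ0.le
    have h5 := le_abs_self (ch * τ ^ 2)
    nlinarith
  have h2 : |s / P| ≤ 1 / √P := by
    have hs : 0 < √P := Real.sqrt_pos.2 hP
    have hq : √P * √P = P := Real.mul_self_sqrt hP.le
    have h3 : |s| ≤ √P := Real.abs_le_sqrt (by nlinarith [sq_nonneg σ])
    rw [abs_div, abs_of_pos hP, div_le_div_iff₀ hP hs]
    nlinarith
  rw [e, abs_mul]
  calc |s / P| * |ch * (Q - P) / Q| ≤ 1 / √P * 1 :=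
        mul_le_mul h2 h1 (abs_nonneg _) (by positivity)
    _ = _ := mul_one _

/-- One lower bound that keeps both the linear behaviour at zero and exponential growth at infinity.
-/
lemma le_abs_sinh (u : ℝ) : |u| * Real.exp (|u| / 2) / 4 ≤ |Real.sinh u| := by
  have key : ∀ v : ℝ, 0 ≤ v → v * Real.exp (v / 2) / 4 ≤ Real.sinh v := by
    intro v hv
    rw [Real.sinh_eq]
    have h1 : Real.exp v * Real.exp (-v) = 1 := by rw [← Real.exp_add]; simp
    have h2 : Real.exp v = Real.exp (v / 2) * Real.exp (v / 2) := by
      rw [← Real.exp_add]; congr 1; ring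
    have h3 := Real.add_one_le_exp (v / 2)
    have h4 := Real.add_one_le_exp v
    have h5 : 0 < Real.exp (-v) := Real.exp_pos _
    have h6 : Real.exp (-v) ≤ 1 := Real.exp_le_one_iff.2 (by linarith)
    set a := Real.exp (v / 2)
    have ha : 1 ≤ a := by linarith
    rw [h2] at h1 h4 ⊢
    nlinarith
  rcases le_total 0 u with h | h
  · rw [abs_of_nonneg h, abs_of_nonneg (Real.sinh_nonneg_iff.2 h)]
    exact key u h
  · rw [abs_of_nonpos h, abs_of_nonpos (Real.sinh_nonpos_iff.2 h), ← Real.sinh_neg]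
    exact key (-u) (by linarith)

lemma le_abs_sin {l δ : ℝ} (hl : 0 < l) (hδ : |δ| ≤ 2 * l) :
    |δ| / (2 * l) ≤ |Real.sin (Real.pi / (2 * l) * δ / 2)| := by
  have hm : 0 < Real.pi / (2 * l) / 2 := by positivity
  have h1 : |Real.pi / (2 * l) * δ / 2| = Real.pi / (2 * l) / 2 * |δ| := by
    rw [show Real.pi / (2 * l) * δ / 2 = Real.pi / (2 * l) / 2 * δ by ring, abs_mul, abs_of_pos hm]
  have h2 : Real.pi / (2 * l) / 2 * (2 * l) = Real.pi / 2 := by field_simp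
  have h3 := Real.mul_abs_le_abs_sin (x := Real.pi / (2 * l) * δ / 2) (by
    rw [h1, ← h2]; exact mul_le_mul_of_nonneg_left hδ hm.le)
  rw [h1] at h3
  refine le_trans (le_of_eq ?_) h3
  have := Real.pi_pos
  field_simp

/-- The integrable singular profile that dominates the kernels in the horizontal variable. -/
def decay (l η : ℝ) : ℝ := |η| ^ (-(3 / 4) : ℝ) * Real.exp (-(3 * Real.pi / (32 * l)) * |η|)

lemma decay_nonneg (l η : ℝ) : 0 ≤ decay l η := by unfold decay; positivity

/-- The product bound of the kernels, uniform in the regularization. -/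
def kerC (l : ℝ) : ℝ := 2 * (16 * l / Real.pi) ^ (3 / 4 : ℝ) * (2 * l) ^ (1 / 4 : ℝ)

lemma kerC_nonneg {l : ℝ} (hl : 0 < l) : 0 ≤ kerC l := by
  unfold kerC; have := Real.pi_pos; positivity

/-- The weighted mean inequality `a ^ (3/4) b ^ (1/4) ≤ √(a² + b²)` splits the singularity into
separate factors in `η` and `y - y'`. The exponents suit the `L²` estimate: `|η| ^ (-3/4)` is
locally integrable, and so is the square of `|y - y'| ^ (-1/4)`. Nothing depends on `ε`. -/
lemma two_div_sqrt_kerP_le {l ε η y y' : ℝ} (hl : 0 < l) (hε : 0 ≤ ε) (hy : |y| ≤ l)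
    (hy' : |y'| ≤ l) (hη : η ≠ 0) (hyy : y ≠ y') : 0 < kerP l ε η y y' ∧
    2 / √(kerP l ε η y y') ≤ kerC l * (decay l η * |y - y'| ^ (-(1 / 4) : ℝ)) := by
  have hpi := Real.pi_pos
  have hη' : 0 < |η| := abs_pos.2 hη
  have hd : 0 < |y - y'| := abs_pos.2 (sub_ne_zero.2 hyy)
  set s := |Real.sinh (Real.pi / (2 * l) * η / 2)| with hs
  set σ := |Real.sin (Real.pi / (2 * l) * (y - y') / 2)| with hσ
  set a := |η| * Real.exp (Real.pi / (8 * l) * |η|) / (16 * l / Real.pi) with ha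
  have hsa : a ≤ s := by
    have h1 := le_abs_sinh (Real.pi / (2 * l) * η / 2)
    have h2 : |Real.pi / (2 * l) * η / 2| = Real.pi / (4 * l) * |η| := by
      rw [show Real.pi / (2 * l) * η / 2 = Real.pi / (4 * l) * η by ring, abs_mul,
        abs_of_pos (by positivity)]
    rw [h2, show Real.pi / (4 * l) * |η| / 2 = Real.pi / (8 * l) * |η| by ring] at h1
    refine le_trans (le_of_eq ?_) h1
    rw [ha]; field_simp; ring
  set b := |y - y'| / (2 * l) with hb
  have hσb : b ≤ σ := le_abs_sin hl (by
    have := abs_sub y y'; linarith)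
  have ha0 : 0 < a := by positivity
  have hb0 : 0 < b := by positivity
  have hPge : a ^ 2 + b ^ 2 ≤ kerP l ε η y y' := by
    have h1 : a ^ 2 ≤ Real.sinh (Real.pi / (2 * l) * η / 2) ^ 2 := by
      rw [← sq_abs (Real.sinh _)]; exact pow_le_pow_left₀ ha0.le hsa 2
    have h2 : b ^ 2 ≤ Real.sin (Real.pi / (2 * l) * (y - y') / 2) ^ 2 := by
      rw [← sq_abs (Real.sin _)]; exact pow_le_pow_left₀ hb0.le hσb 2
    unfold kerP; linarith
  have hP : 0 < kerP l ε η y y' := lt_of_lt_of_le (by positivity) hPge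
  refine ⟨hP, ?_⟩
  have hmul : a ^ (3 / 4 : ℝ) * b ^ (1 / 4 : ℝ) ≤ √(kerP l ε η y y') := by
    apply Real.le_sqrt_of_sq_le
    refine le_trans ?_ hPge
    have h3 := Real.geom_mean_le_arith_mean2_weighted (w₁ := 3 / 4) (w₂ := 1 / 4)
      (p₁ := a ^ 2) (p₂ := b ^ 2) (by norm_num) (by norm_num) (by positivity) (by positivity)
      (by norm_num)
    have e1 : (a ^ 2) ^ (3 / 4 : ℝ) = (a ^ (3 / 4 : ℝ)) ^ 2 := by
      rw [← Real.rpow_natCast, ← Real.rpow_natCast, ← Real.rpow_mul ha0.le, ← Real.rpow_mul ha0.le,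
        mul_comm]
    have e2 : (b ^ 2) ^ (1 / 4 : ℝ) = (b ^ (1 / 4 : ℝ)) ^ 2 := by
      rw [← Real.rpow_natCast, ← Real.rpow_natCast, ← Real.rpow_mul hb0.le, ← Real.rpow_mul hb0.le,
        mul_comm]
    rw [e1, e2, ← mul_pow] at h3
    nlinarith [sq_nonneg a, sq_nonneg b]
  have hpos : 0 < a ^ (3 / 4 : ℝ) * b ^ (1 / 4 : ℝ) := by positivity
  refine (div_le_div_of_nonneg_left zero_le_two hpos hmul).trans (le_of_eq ?_)
  rw [ha, hb, kerC, decay, Real.div_rpow (abs_nonneg (y - y')) (by positivity),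
    Real.div_rpow (x := |η| * _) (by positivity) (by positivity),
    Real.mul_rpow (abs_nonneg η) (Real.exp_pos _).le,
    Real.rpow_neg (abs_nonneg _), Real.rpow_neg (abs_nonneg _), ← Real.exp_mul,
    show -(3 * Real.pi / (32 * l)) * |η| = -(Real.pi / (8 * l) * |η| * (3 / 4)) by ring,
    Real.exp_neg]
  have p1 := Real.rpow_pos_of_pos hη' (3 / 4)
  have p2 := Real.rpow_pos_of_pos hd (1 / 4)
  have p3 := Real.exp_pos (Real.pi / (8 * l) * |η| * (3 / 4))
  have p4 : 0 < (16 * l / Real.pi) ^ (3 / 4 : ℝ) := by positivity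
  have p5 : 0 < (2 * l) ^ (1 / 4 : ℝ) := by positivity
  field_simp

lemma abs_ker_le {l ε η y y' : ℝ} (hl : 0 < l) (hε : 0 ≤ ε) (hy : |y| ≤ l)
    (hy' : |y'| ≤ l) (hη : η ≠ 0) (hyy : y ≠ y') :
    |kerY l ε η y y'| ≤ kerC l * (decay l η * |y - y'| ^ (-(1 / 4) : ℝ)) ∧
    |kerX l ε η y y'| ≤ kerC l * (decay l η * |y - y'| ^ (-(1 / 4) : ℝ)) := by
  obtain ⟨hP, h⟩ := two_div_sqrt_kerP_le hl hε hy hy' hη hyy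
  refine ⟨(abs_kerY_le hl hε hy hy' hP).trans h, (abs_kerX_le hl hε hy hy' hP).trans (le_trans ?_ h)⟩
  exact div_le_div_of_nonneg_right (by norm_num) (Real.sqrt_nonneg _)

/-- Bound of the regularized kernels without singularity. -/
lemma abs_ker_le_exp {l ε η y y' : ℝ} (hl : 0 < l) (hε : 0 < ε) (hy : |y| ≤ l)
    (hy' : |y'| ≤ l) :
    |kerY l ε η y y'| ≤ 4 * √(1 + 2 / ε) * Real.exp (-(Real.pi / (4 * l)) * |η|) ∧
    |kerX l ε η y y'| ≤ 4 * √(1 + 2 / ε) * Real.exp (-(Real.pi / (4 * l)) * |η|) := by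
  have hP : 0 < kerP l ε η y y' := by unfold kerP; positivity
  have hm : 0 < Real.pi / (4 * l) := by positivity
  have hk : 2 / √(kerP l ε η y y') ≤ 4 * √(1 + 2 / ε) * Real.exp (-(Real.pi / (4 * l)) * |η|) := by
    set ch := Real.cosh (Real.pi / (2 * l) * η / 2) with hch
    have hchp : 0 < ch := Real.cosh_pos _
    -- Since `ch² = s² + 1`, the summand `ε/2` in `kerP`, multiplied by `2/ε`, pays for the `1`.
    have h1 : ch ^ 2 ≤ (1 + 2 / ε) * kerP l ε η y y' := by
      rw [hch, Real.cosh_sq]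
      unfold kerP
      set s := Real.sinh (Real.pi / (2 * l) * η / 2)
      set σ := Real.sin (Real.pi / (2 * l) * (y - y') / 2)
      have : (2 / ε) * (s ^ 2 + σ ^ 2 + ε / 2) = 1 + (2 / ε) * (s ^ 2 + σ ^ 2) := by
        field_simp; ring
      rw [add_mul, this]
      have : 0 ≤ (2 / ε) * (s ^ 2 + σ ^ 2) := by positivity
      nlinarith [sq_nonneg σ]
    have h2 : ch ≤ √(1 + 2 / ε) * √(kerP l ε η y y') := by
      rw [← Real.sqrt_mul (by positivity)]
      exact Real.le_sqrt_of_sq_le h1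
    have h3 : Real.exp (Real.pi / (4 * l) * |η|) ≤ 2 * ch := by
      rw [hch, ← Real.cosh_abs, Real.cosh_eq, show Real.pi / (2 * l) * η / 2 =
        Real.pi / (4 * l) * η by ring, abs_mul, abs_of_pos hm]
      have := Real.exp_pos (-(Real.pi / (4 * l) * |η|))
      linarith
    have hsq : 0 < √(kerP l ε η y y') := Real.sqrt_pos.2 hP
    have he := Real.exp_pos (Real.pi / (4 * l) * |η|)
    rw [neg_mul, Real.exp_neg, ← div_eq_mul_inv, div_le_div_iff₀ hsq he]
    nlinarith
  refine ⟨(abs_kerY_le hl hε.le hy hy' hP).trans hk,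
    (abs_kerX_le hl hε.le hy hy' hP).trans (le_trans ?_ hk)⟩
  exact div_le_div_of_nonneg_right (by norm_num) (Real.sqrt_nonneg _)

lemma kerA_pos {l ε η y y' : ℝ} (hε : 0 < ε) : 0 < kerA l ε η y y' := by
  rw [kerA_eq]; unfold kerP; positivity

lemma kerB_pos {l ε η y y' : ℝ} (hε : 0 < ε) : 0 < kerB l ε η y y' := by
  rw [kerB_eq]; positivity

lemma kerA_pos_of_ne {l ε η y y' : ℝ} (hl : 0 < l) (hε : 0 ≤ ε) (hη : η ≠ 0) :
    0 < kerA l ε η y y' := by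
  have hm : 0 < Real.pi / (2 * l) := by positivity
  have : Real.sinh (Real.pi / (2 * l) * η / 2) ≠ 0 := by
    rw [Ne, Real.sinh_eq_zero]
    positivity
  rw [kerA_eq]; unfold kerP; positivity

lemma kerB_pos_of_ne {l ε η y y' : ℝ} (hl : 0 < l) (hε : 0 ≤ ε) (hη : η ≠ 0) :
    0 < kerB l ε η y y' := by
  have hm : 0 < Real.pi / (2 * l) := by positivity
  have : Real.sinh (Real.pi / (2 * l) * η / 2) ≠ 0 := by
    rw [Ne, Real.sinh_eq_zero]
    positivity
  rw [kerB_eq]; positivity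

/-! ### `L²` bounds for integrals against the singular kernels -/

open scoped ENNReal

lemma strip_eq (l : ℝ) : strip l = univ ×ˢ Ioo (-l) l := by
  ext z; simp [strip]

lemma measurableSet_strip (l : ℝ) : MeasurableSet (strip l) := by
  rw [strip_eq]; exact MeasurableSet.univ.prod measurableSet_Ioo

lemma isOpen_strip (l : ℝ) : IsOpen (strip l) := by
  rw [strip_eq]; exact isOpen_univ.prod isOpen_Ioo

lemma restrict_strip (l : ℝ) : (volume : Measure (ℝ × ℝ)).restrict (strip l) =
    (volume : Measure ℝ).prod ((volume : Measure ℝ).restrict (Ioo (-l) l)) := by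
  rw [strip_eq, Measure.volume_eq_prod, ← Measure.prod_restrict, Measure.restrict_univ]

lemma integrable_abs_rpow_mul_exp {p b : ℝ} (hp : -1 < p) (hb : 0 < b) :
    Integrable fun x : ℝ => |x| ^ p * Real.exp (-b * |x|) := by
  have h1 : IntegrableOn (fun x : ℝ => |x| ^ p * Real.exp (-b * |x|)) (Ioi 0) := by
    refine (integrableOn_rpow_mul_exp_neg_mul_rpow hp one_pos hb).congr_fun ?_ measurableSet_Ioi
    intro x hx
    simp only [Real.rpow_one, abs_of_pos (mem_Ioi.1 hx)]
  have h2 : IntegrableOn (fun x : ℝ => |x| ^ p * Real.exp (-b * |x|)) (Iic 0) := by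
    rw [integrableOn_Iic_iff_integrableOn_Iio]
    have := h1.comp_neg
    simpa using this
  have := h2.union h1
  rwa [Iic_union_Ioi, integrableOn_univ] at this

lemma integrable_decay {l : ℝ} (hl : 0 < l) : Integrable (decay l) :=
  integrable_abs_rpow_mul_exp (by norm_num) (by positivity)

/-- Cauchy–Schwarz for the weight `k`, after writing `k h = √k · (√k h)`. -/
lemma sq_lintegral_mul_le {α : Type*} [MeasurableSpace α] {μ : Measure α} {k h : α → ℝ≥0∞}
    (hk : AEMeasurable k μ) (hh : AEMeasurable h μ) :
    (∫⁻ a, k a * h a ∂μ) ^ 2 ≤ (∫⁻ a, k a ∂μ) * ∫⁻ a, k a * h a ^ 2 ∂μ := by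
  have h2 := ENNReal.lintegral_mul_le_Lp_mul_Lq μ Real.HolderConjugate.two_two
    (f := fun a => k a ^ (1 / 2 : ℝ)) (g := fun a => k a ^ (1 / 2 : ℝ) * h a)
    (hk.pow_const _) ((hk.pow_const _).mul hh)
  have e0 : ∀ c : ℝ≥0∞, c ^ (1 / 2 : ℝ) * c ^ (1 / 2 : ℝ) = c := fun c => by
    rw [← ENNReal.rpow_add_of_nonneg _ _ (by norm_num) (by norm_num)]; norm_num
  have e1 : ∀ c : ℝ≥0∞, (c ^ (1 / 2 : ℝ)) ^ (2 : ℝ) = c := fun c => by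
    rw [← ENNReal.rpow_mul]; norm_num
  simp only [Pi.mul_apply, ← mul_assoc, e0, e1] at h2
  have h3 := pow_le_pow_left' h2 2
  rw [mul_pow] at h3
  have e2 : ∀ c : ℝ≥0∞, (c ^ (1 / 2 : ℝ)) ^ 2 = c := fun c => by rw [sq, e0]
  rw [e2, e2] at h3
  refine h3.trans (le_of_eq ?_)
  congr 1
  refine lintegral_congr fun a => ?_
  rw [ENNReal.mul_rpow_of_nonneg _ _ (by norm_num), e1]
  norm_num

/-- The dominating function of `w(x') K(z; x', g(x'))` for the kernels `K`. -/
def singBound (l : ℝ) (w g : ℝ → ℝ) (z : ℝ × ℝ) (x' : ℝ) : ℝ :=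
  |w x'| * (decay l (z.1 - x') * |z.2 - g x'| ^ (-(1 / 4) : ℝ))

lemma singBound_nonneg (l : ℝ) (w g : ℝ → ℝ) (z : ℝ × ℝ) (x' : ℝ) : 0 ≤ singBound l w g z x' := by
  unfold singBound decay; positivity

lemma measurable_singBound (l : ℝ) {w g : ℝ → ℝ} (hw : Measurable w) (hg : Measurable g) :
    Measurable fun q : (ℝ × ℝ) × ℝ => singBound l w g q.1 q.2 := by
  unfold singBound decay
  simp only [← Real.norm_eq_abs]
  fun_prop

/-- The constant in the `L²` bound for `singBound`. -/
def singC (l : ℝ) : ℝ≥0∞ := (∫⁻ x, ENNReal.ofReal (decay l x)) *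
  ((∫⁻ x, ENNReal.ofReal (decay l x)) *
    ∫⁻ y : ℝ, ENNReal.ofReal (Real.exp (2 * l) * (|y| ^ (-(1 / 2) : ℝ) * Real.exp (-1 * |y|))))

lemma singC_lt_top {l : ℝ} (hl : 0 < l) : singC l < ⊤ := by
  have h1 : (∫⁻ x, ENNReal.ofReal (decay l x)) < ⊤ := (integrable_decay hl).lintegral_lt_top
  refine ENNReal.mul_lt_top h1 (ENNReal.mul_lt_top h1 ?_)
  exact ((integrable_abs_rpow_mul_exp (by norm_num) one_pos).const_mul _).lintegral_lt_top

/-- A Young inequality: Cauchy–Schwarz with weight `decay` in `x'`, then Fubini. The horizontal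
integrals give the `L¹` norm of `decay` twice, the vertical one the squared `L²` norm of `|y| ^
(-1/4)`, and `∫ w²` is left. -/
lemma lintegral_sq_singBound_le {l : ℝ} {w g : ℝ → ℝ} (hw : Measurable w)
    (hg : Measurable g) (hgl : ∀ x, |g x| ≤ l) :
    ∫⁻ z in strip l, (∫⁻ x', ENNReal.ofReal (singBound l w g z x')) ^ 2 ≤
      singC l * ∫⁻ x, ENNReal.ofReal (w x ^ 2) := by
  set k : ℝ → ℝ≥0∞ := fun x => ENNReal.ofReal (decay l x) with hk
  set j : ℝ → ℝ≥0∞ := fun y => ENNReal.ofReal (|y| ^ (-(1 / 4) : ℝ)) with hj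
  set G : ℝ → ℝ≥0∞ := fun x => ENNReal.ofReal |w x| with hG
  have hkm : Measurable k := by
    simp only [hk, decay, ← Real.norm_eq_abs]; fun_prop
  have hjm : Measurable j := by
    simp only [hj, ← Real.norm_eq_abs]; fun_prop
  have hGm : Measurable G := by
    simp only [hG, ← Real.norm_eq_abs]; fun_prop
  have e1 : ∀ z x', ENNReal.ofReal (singBound l w g z x') =
      k (z.1 - x') * (G x' * j (z.2 - g x')) := by
    intro z x'
    have : 0 ≤ decay l (z.1 - x') := decay_nonneg _ _
    simp only [hk, hj, hG, singBound]
    rw [ENNReal.ofReal_mul (abs_nonneg _), ENNReal.ofReal_mul this]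
    ring
  set κ := ∫⁻ x, k x with hκ
  have hpt : ∀ z : ℝ × ℝ, (∫⁻ x', ENNReal.ofReal (singBound l w g z x')) ^ 2 ≤
      κ * ∫⁻ x', k (z.1 - x') * (G x' * j (z.2 - g x')) ^ 2 := by
    intro z
    simp only [e1]
    refine (sq_lintegral_mul_le ?_ ?_).trans (le_of_eq ?_)
    · fun_prop
    · fun_prop
    · rw [lintegral_sub_left_eq_self k z.1]
  set J : ℝ≥0∞ := ∫⁻ y : ℝ,
    ENNReal.ofReal (Real.exp (2 * l) * (|y| ^ (-(1 / 2) : ℝ) * Real.exp (-1 * |y|))) with hJ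
  -- Since `|y - a| ≤ 2l`, the factor `e^(2l) e^(-|y - a|)` is at least one; inserting it gives an
  -- integral over the whole line that is translation invariant, hence a bound independent of `a`.
  have hjb : ∀ a, |a| ≤ l → ∫⁻ y in Ioo (-l) l, j (y - a) ^ 2 ≤ J := by
    intro a ha
    rw [hJ, ← lintegral_sub_right_eq_self (μ := volume) (fun y : ℝ =>
      ENNReal.ofReal (Real.exp (2 * l) * (|y| ^ (-(1 / 2) : ℝ) * Real.exp (-1 * |y|)))) a]
    refine (setLIntegral_mono' measurableSet_Ioo fun y hy => ?_).trans (setLIntegral_le_lintegral _ _)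
    simp only [hj]
    rw [← ENNReal.ofReal_pow (by positivity)]
    refine ENNReal.ofReal_le_ofReal ?_
    have h1 : (|y - a| ^ (-(1 / 4) : ℝ)) ^ 2 = |y - a| ^ (-(1 / 2) : ℝ) := by
      rw [← Real.rpow_natCast, ← Real.rpow_mul (abs_nonneg _)]; norm_num
    have h2 : |y - a| ≤ 2 * l := by
      rw [abs_le] at *; constructor <;> linarith [hy.1, hy.2, ha.1, ha.2]
    have h3 : 1 ≤ Real.exp (2 * l) * Real.exp (-1 * |y - a|) := by
      rw [← Real.exp_add]; exact Real.one_le_exp (by linarith)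
    rw [h1]
    have h4 : 0 ≤ |y - a| ^ (-(1 / 2) : ℝ) := by positivity
    nlinarith
  calc ∫⁻ z in strip l, (∫⁻ x', ENNReal.ofReal (singBound l w g z x')) ^ 2
      ≤ ∫⁻ z in strip l, κ * ∫⁻ x', k (z.1 - x') * (G x' * j (z.2 - g x')) ^ 2 :=
        lintegral_mono fun z => hpt z
    _ = κ * ∫⁻ z in strip l, ∫⁻ x', k (z.1 - x') * (G x' * j (z.2 - g x')) ^ 2 := by
        rw [lintegral_const_mul]
        exact Measurable.lintegral_prod_right' (f := fun q : (ℝ × ℝ) × ℝ =>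
          k (q.1.1 - q.2) * (G q.2 * j (q.1.2 - g q.2)) ^ 2) (by fun_prop)
    _ = κ * ∫⁻ x', ∫⁻ z in strip l, k (z.1 - x') * (G x' * j (z.2 - g x')) ^ 2 := by
        rw [lintegral_lintegral_swap]
        exact Measurable.aemeasurable (by simp only [Function.uncurry_def]; fun_prop)
    _ ≤ κ * ∫⁻ x', κ * J * G x' ^ 2 := by
        gcongr with x'
        rw [restrict_strip, lintegral_prod _ (by fun_prop)]
        have e2 : ∀ x, (∫⁻ y in Ioo (-l) l, k (x - x') * (G x' * j (y - g x')) ^ 2) =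
            k (x - x') * (G x' ^ 2 * ∫⁻ y in Ioo (-l) l, j (y - g x') ^ 2) := by
          intro x
          rw [lintegral_const_mul _ (by fun_prop)]
          simp only [mul_pow]
          rw [lintegral_const_mul _ (by fun_prop)]
        simp only [e2]
        rw [lintegral_mul_const _ (by fun_prop), lintegral_sub_right_eq_self k x']
        calc _ ≤ κ * (G x' ^ 2 * J) := by gcongr; exact hjb _ (hgl x')
          _ = _ := by ring
    _ = singC l * ∫⁻ x, ENNReal.ofReal (w x ^ 2) := by
        have e3 : ∫⁻ x, ENNReal.ofReal (w x ^ 2) = ∫⁻ x, G x ^ 2 := by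
          refine lintegral_congr fun x => ?_
          simp only [hG]
          rw [← ENNReal.ofReal_pow (abs_nonneg _), sq_abs]
        rw [lintegral_const_mul _ (by fun_prop), e3]
        change _ = κ * (κ * J) * _
        ring

/-- For fixed `x'` the excluded set is a vertical line together with a horizontal one. Off this null
set the kernel bounds and the limit `ε → 0` hold pointwise. -/
lemma ae_off_interface {l : ℝ} {g : ℝ → ℝ} (hg : Measurable g) :
    ∀ᵐ q ∂((volume.restrict (strip l)).prod (volume : Measure ℝ)),
      q.1.1 ≠ q.2 ∧ q.1.2 ≠ g q.2 := by
  have hm : MeasurableSet {q : (ℝ × ℝ) × ℝ | q.1.1 ≠ q.2 ∧ q.1.2 ≠ g q.2} := by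
    apply MeasurableSet.inter
    · exact (measurableSet_eq_fun (by fun_prop) (by fun_prop)).compl
    · exact (measurableSet_eq_fun (by fun_prop) (by fun_prop)).compl
  rw [Measure.ae_prod_iff_ae_ae hm]
  change ∀ᵐ z ∂(volume.restrict (strip l)), ∀ᵐ x' : ℝ, z.1 ≠ x' ∧ z.2 ≠ g x'
  refine (Measure.ae_ae_comm (p := fun (z : ℝ × ℝ) x' => z.1 ≠ x' ∧ z.2 ≠ g x') hm).2 ?_
  refine ae_of_all _ fun x' => ?_
  have hm' : MeasurableSet {z : ℝ × ℝ | z.1 ≠ x' ∧ z.2 ≠ g x'} := by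
    apply MeasurableSet.inter
    · exact (measurableSet_eq_fun (by fun_prop) (by fun_prop)).compl
    · exact (measurableSet_eq_fun (by fun_prop) (by fun_prop)).compl
  rw [restrict_strip, Measure.ae_prod_iff_ae_ae hm']
  have h1 : ∀ᵐ x : ℝ, x ≠ x' := by simp [ae_iff]
  have h2 : ∀ᵐ y ∂(volume.restrict (Ioo (-l) l)), y ≠ g x' :=
    ae_restrict_of_ae (by simp [ae_iff])
  filter_upwards [h1] with x hx
  filter_upwards [h2] with y hy
  exact ⟨hx, hy⟩

section Dominated

variable {l C : ℝ} {w g : ℝ → ℝ} {K : ℝ × ℝ → ℝ → ℝ}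

lemma enorm_integral_le_singBound (hC : 0 ≤ C) (hw : Measurable w) (hg : Measurable g)
    (hK : ∀ᵐ q ∂((volume.restrict (strip l)).prod (volume : Measure ℝ)),
      |K q.1 q.2| ≤ C * singBound l w g q.1 q.2) :
    ∀ᵐ z ∂(volume.restrict (strip l)), ‖∫ x', K z x'‖ₑ ≤
      ENNReal.ofReal C * ∫⁻ x', ENNReal.ofReal (singBound l w g z x') := by
  filter_upwards [Measure.ae_ae_of_ae_prod hK] with z hz
  refine (enorm_integral_le_lintegral_enorm _).trans ?_
  have hm : Measurable (singBound l w g z) :=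
    (measurable_singBound l hw hg).comp (measurable_const.prodMk measurable_id)
  rw [← lintegral_const_mul _ hm.ennreal_ofReal]
  refine lintegral_mono_ae ?_
  filter_upwards [hz] with x' hx'
  rw [← ENNReal.ofReal_mul hC, ← ofReal_norm, Real.norm_eq_abs]
  exact ENNReal.ofReal_le_ofReal hx'

lemma lintegral_sq_integral_le (hC : 0 ≤ C) (hw : Measurable w) (hg : Measurable g)
    (hgl : ∀ x, |g x| ≤ l)
    (hK : ∀ᵐ q ∂((volume.restrict (strip l)).prod (volume : Measure ℝ)),
      |K q.1 q.2| ≤ C * singBound l w g q.1 q.2) :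
    ∫⁻ z in strip l, ‖∫ x', K z x'‖ₑ ^ 2 ≤
      ENNReal.ofReal C ^ 2 * (singC l * ∫⁻ x, ENNReal.ofReal (w x ^ 2)) := by
  have hm : Measurable fun z : ℝ × ℝ => ∫⁻ x', ENNReal.ofReal (singBound l w g z x') :=
    Measurable.lintegral_prod_right' (f := fun q : (ℝ × ℝ) × ℝ =>
      ENNReal.ofReal (singBound l w g q.1 q.2)) (measurable_singBound l hw hg).ennreal_ofReal
  calc ∫⁻ z in strip l, ‖∫ x', K z x'‖ₑ ^ 2
      ≤ ∫⁻ z in strip l, ENNReal.ofReal C ^ 2 *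
        (∫⁻ x', ENNReal.ofReal (singBound l w g z x')) ^ 2 := by
        refine lintegral_mono_ae ?_
        filter_upwards [enorm_integral_le_singBound hC hw hg hK] with z hz
        rw [← mul_pow]
        exact pow_le_pow_left' hz 2
    _ = ENNReal.ofReal C ^ 2 * ∫⁻ z in strip l,
        (∫⁻ x', ENNReal.ofReal (singBound l w g z x')) ^ 2 :=
        lintegral_const_mul _ (hm.pow_const 2)
    _ ≤ _ := by gcongr; exact lintegral_sq_singBound_le hw hg hgl

lemma memLp_integral_kernel (hl : 0 < l) (hC : 0 ≤ C) (hw : Measurable w) (hg : Measurable g)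
    (hgl : ∀ x, |g x| ≤ l) (hw2 : Integrable fun x => w x ^ 2)
    (hKm : AEStronglyMeasurable (fun q : (ℝ × ℝ) × ℝ => K q.1 q.2)
      ((volume.restrict (strip l)).prod (volume : Measure ℝ)))
    (hK : ∀ᵐ q ∂((volume.restrict (strip l)).prod (volume : Measure ℝ)),
      |K q.1 q.2| ≤ C * singBound l w g q.1 q.2) :
    MemLp (fun z => ∫ x', K z x') 2 (volume.restrict (strip l)) := by
  have hm : AEStronglyMeasurable (fun z => ∫ x', K z x') (volume.restrict (strip l)) :=
    hKm.integral_prod_right'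
  refine ⟨hm, ?_⟩
  rw [eLpNorm_lt_top_iff_lintegral_rpow_enorm_lt_top (by norm_num) (by norm_num)]
  have := lintegral_sq_integral_le hC hw hg hgl hK
  simp only [ENNReal.toReal_ofNat, ENNReal.rpow_ofNat]
  refine this.trans_lt (ENNReal.mul_lt_top (by simp) (ENNReal.mul_lt_top (singC_lt_top hl) ?_))
  exact hw2.lintegral_lt_top

/-- By `ab ≤ a² + b²` it suffices that `F` and the integrated dominating kernel both be square
integrable over the strip. This justifies Fubini for all later pairings with the velocity. -/
lemma integrable_mul_kernel (hl : 0 < l) (hC : 0 ≤ C) (hw : Measurable w) (hg : Measurable g)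
    (hgl : ∀ x, |g x| ≤ l) (hw2 : Integrable fun x => w x ^ 2)
    (hKm : AEStronglyMeasurable (fun q : (ℝ × ℝ) × ℝ => K q.1 q.2)
      ((volume.restrict (strip l)).prod (volume : Measure ℝ)))
    (hK : ∀ᵐ q ∂((volume.restrict (strip l)).prod (volume : Measure ℝ)),
      |K q.1 q.2| ≤ C * singBound l w g q.1 q.2)
    {F : ℝ × ℝ → ℝ} (hF : MemLp F 2 (volume.restrict (strip l))) :
    Integrable (fun q : (ℝ × ℝ) × ℝ => F q.1 * K q.1 q.2)
      ((volume.restrict (strip l)).prod (volume : Measure ℝ)) := by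
  have hm := measurable_singBound l hw hg
  have hFm : AEMeasurable (fun z => ‖F z‖ₑ) (volume.restrict (strip l)) := hF.1.enorm
  refine ⟨hF.1.comp_fst.mul hKm, ?_⟩
  rw [hasFiniteIntegral_iff_enorm]
  set Nf : ℝ × ℝ → ℝ≥0∞ := fun z => ∫⁻ x', ENNReal.ofReal (singBound l w g z x') with hN
  have hNm : Measurable Nf := Measurable.lintegral_prod_right' (f := fun q : (ℝ × ℝ) × ℝ =>
      ENNReal.ofReal (singBound l w g q.1 q.2)) hm.ennreal_ofReal
  have h1 : ∫⁻ q, ‖F q.1 * K q.1 q.2‖ₑ ∂((volume.restrict (strip l)).prod (volume : Measure ℝ)) ≤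
      ∫⁻ q, ‖F q.1‖ₑ * ENNReal.ofReal (C * singBound l w g q.1 q.2)
        ∂((volume.restrict (strip l)).prod (volume : Measure ℝ)) := by
    refine lintegral_mono_ae ?_
    filter_upwards [hK] with q hq
    rw [enorm_mul]
    gcongr
    rw [← ofReal_norm, Real.norm_eq_abs]
    exact ENNReal.ofReal_le_ofReal hq
  refine h1.trans_lt ?_
  have hm2 : AEMeasurable (fun q : (ℝ × ℝ) × ℝ =>
      ‖F q.1‖ₑ * ENNReal.ofReal (C * singBound l w g q.1 q.2))
      ((volume.restrict (strip l)).prod (volume : Measure ℝ)) :=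
    hFm.comp_fst.mul (hm.const_mul C).ennreal_ofReal.aemeasurable
  rw [lintegral_prod _ hm2]
  have h2 : ∀ z : ℝ × ℝ, (∫⁻ x', ‖F z‖ₑ * ENNReal.ofReal (C * singBound l w g z x')) =
      ENNReal.ofReal C * (‖F z‖ₑ * Nf z) := by
    intro z
    have hmz : Measurable (singBound l w g z) := hm.comp (measurable_const.prodMk measurable_id)
    simp only [ENNReal.ofReal_mul hC]
    rw [lintegral_const_mul _ (by fun_prop), lintegral_const_mul _ (by fun_prop)]
    ring
  simp only [h2]
  have h3 : ∀ a b : ℝ≥0∞, a * b ≤ a ^ 2 + b ^ 2 := by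
    intro a b
    rcases le_total a b with h | h
    · calc a * b ≤ b * b := by gcongr
        _ = b ^ 2 := (sq b).symm
        _ ≤ _ := le_add_self
    · calc a * b ≤ a * a := by gcongr
        _ = a ^ 2 := (sq a).symm
        _ ≤ _ := le_self_add
  rw [lintegral_const_mul' _ _ ENNReal.ofReal_ne_top]
  refine ENNReal.mul_lt_top (by simp) ?_
  refine (lintegral_mono fun z => h3 _ _).trans_lt ?_
  rw [lintegral_add_left' (hFm.pow_const 2)]
  refine ENNReal.add_lt_top.2 ⟨?_, ?_⟩
  · have := hF.2
    rw [eLpNorm_lt_top_iff_lintegral_rpow_enorm_lt_top (by norm_num) (by norm_num)] at this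
    simpa using this
  · exact (lintegral_sq_singBound_le hw hg hgl).trans_lt
      (ENNReal.mul_lt_top (singC_lt_top hl) hw2.lintegral_lt_top)

end Dominated

/-! ### The divergence theorem above a graph -/

/-- The region above the graph of `g`. -/
def epi (g : ℝ → ℝ) : Set (ℝ × ℝ) := {z | g z.1 < z.2}

lemma isOpen_epi {g : ℝ → ℝ} (hg : Continuous g) : IsOpen (epi g) :=
  isOpen_lt (by fun_prop) (by fun_prop)

lemma setIntegral_epi {g : ℝ → ℝ} (hg : Continuous g) {F : ℝ × ℝ → ℝ} (hF : Integrable F) :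
    ∫ z in epi g, F z = ∫ x, ∫ y in Ioi (g x), F (x, y) := by
  rw [← integral_indicator (isOpen_epi hg).measurableSet, Measure.volume_eq_prod, integral_prod]
  · refine integral_congr_ae (ae_of_all _ fun x => ?_)
    simp only
    rw [← integral_indicator measurableSet_Ioi]
    rfl
  · exact hF.indicator (isOpen_epi hg).measurableSet

lemma hasDerivAt_fst {W : ℝ × ℝ → ℝ} (hW : ContDiff ℝ 1 W) (x y : ℝ) :
    HasDerivAt (fun x => W (x, y)) (fderiv ℝ W (x, y) (1, 0)) x := by
  have h := (hW.differentiable (by norm_num) (x, y)).hasFDerivAt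
  exact h.comp_hasDerivAt x ((hasDerivAt_id x).prodMk (hasDerivAt_const x y))

lemma hasDerivAt_snd {W : ℝ × ℝ → ℝ} (hW : ContDiff ℝ 1 W) (x y : ℝ) :
    HasDerivAt (fun y => W (x, y)) (fderiv ℝ W (x, y) (0, 1)) y := by
  have h := (hW.differentiable (by norm_num) (x, y)).hasFDerivAt
  exact h.comp_hasDerivAt y ((hasDerivAt_const y x).prodMk (hasDerivAt_id y))

lemma continuous_fderiv_apply' {W : ℝ × ℝ → ℝ} (hW : ContDiff ℝ 1 W) (v : ℝ × ℝ) :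
    Continuous fun z => fderiv ℝ W z v :=
  (hW.continuous_fderiv (by norm_num)).clm_apply continuous_const

lemma hasCompactSupport_fderiv_apply {W : ℝ × ℝ → ℝ} (hs : HasCompactSupport W) (v : ℝ × ℝ) :
    HasCompactSupport fun z => fderiv ℝ W z v :=
  (hs.fderiv (𝕜 := ℝ)).comp_left (g := fun L : ℝ × ℝ →L[ℝ] ℝ => L v) rfl

lemma integrable_fderiv_apply {W : ℝ × ℝ → ℝ} (hW : ContDiff ℝ 1 W) (hs : HasCompactSupport W)
    (v : ℝ × ℝ) : Integrable fun z => fderiv ℝ W z v :=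
  (continuous_fderiv_apply' hW v).integrable_of_hasCompactSupport
    (hasCompactSupport_fderiv_apply hs v)

lemma exists_zero_of_hasCompactSupport {W : ℝ × ℝ → ℝ} (hs : HasCompactSupport W) :
    ∃ R, 0 < R ∧ ∀ x y, (R < |x| ∨ R < |y|) → W (x, y) = 0 := by
  obtain ⟨R, hR⟩ := hs.isBounded.subset_closedBall (0 : ℝ × ℝ)
  refine ⟨|R| + 1, by positivity, fun x y h => image_eq_zero_of_notMem_tsupport fun hm => ?_⟩
  have h1 := hR hm
  rw [mem_closedBall_zero_iff, Prod.norm_mk, max_le_iff, Real.norm_eq_abs, Real.norm_eq_abs] at h1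
  have := le_abs_self R
  rcases h with h | h <;> linarith

lemma hasCompactSupport_slice {W : ℝ × ℝ → ℝ} (hs : HasCompactSupport W) (h : ℝ → ℝ) :
    HasCompactSupport fun x => W (x, h x) := by
  obtain ⟨R, -, hR⟩ := exists_zero_of_hasCompactSupport hs
  refine HasCompactSupport.of_support_subset_isCompact (isCompact_Icc (a := -R) (b := R)) ?_
  intro x hx
  by_contra hn
  refine hx (hR x _ (Or.inl ?_))
  by_contra h2
  exact hn (abs_le.1 (not_lt.1 h2))

lemma hasCompactSupport_slice_snd {W : ℝ × ℝ → ℝ} (hs : HasCompactSupport W) (x : ℝ) :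
    HasCompactSupport fun y => W (x, y) := by
  obtain ⟨R, -, hR⟩ := exists_zero_of_hasCompactSupport hs
  refine HasCompactSupport.of_support_subset_isCompact (isCompact_Icc (a := -R) (b := R)) ?_
  intro y hx
  by_contra hn
  refine hx (hR x _ (Or.inr ?_))
  by_contra h2
  exact hn (abs_le.1 (not_lt.1 h2))

lemma integral_Ioi_fderiv_snd {W : ℝ × ℝ → ℝ} (hW : ContDiff ℝ 1 W) (hs : HasCompactSupport W)
    (x a : ℝ) : ∫ y in Ioi a, fderiv ℝ W (x, y) (0, 1) = -W (x, a) := by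
  have h := HasCompactSupport.integral_Ioi_deriv_eq (f := fun y => W (x, y))
    (hW.comp (contDiff_const.prodMk contDiff_id)) (hasCompactSupport_slice_snd hs x) a
  rw [← h]
  refine setIntegral_congr_fun measurableSet_Ioi fun y _ => ?_
  exact (hasDerivAt_snd hW x y).deriv.symm

/-- The integral of a vertical derivative above a graph. -/
lemma setIntegral_epi_fderiv_snd {g : ℝ → ℝ} (hg : Continuous g) {W : ℝ × ℝ → ℝ}
    (hW : ContDiff ℝ 1 W) (hs : HasCompactSupport W) :
    ∫ z in epi g, fderiv ℝ W z (0, 1) = -∫ x, W (x, g x) := by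
  rw [setIntegral_epi hg (integrable_fderiv_apply hW hs _), ← integral_neg]
  exact integral_congr_ae (ae_of_all _ fun x => integral_Ioi_fderiv_snd hW hs x _)

lemma setIntegral_Ioi_add_left (F : ℝ → ℝ) (a : ℝ) :
    ∫ s in Ioi 0, F (a + s) = ∫ y in Ioi a, F y := by
  rw [← integral_indicator measurableSet_Ioi, ← integral_indicator measurableSet_Ioi,
    ← integral_add_left_eq_self (μ := volume) ((Ioi a).indicator F) a]
  refine integral_congr_ae (ae_of_all _ fun s => ?_)
  simp only [indicator, mem_Ioi, lt_add_iff_pos_right]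

/-- The integral of a horizontal derivative above a graph. -/
lemma setIntegral_epi_fderiv_fst {g : ℝ → ℝ} (hg : ContDiff ℝ 1 g) {W : ℝ × ℝ → ℝ}
    (hW : ContDiff ℝ 1 W) (hs : HasCompactSupport W) :
    ∫ z in epi g, fderiv ℝ W z (1, 0) = ∫ x, deriv g x * W (x, g x) := by
  have hgc := hg.continuous
  have hdc : Continuous (deriv g) := hg.continuous_deriv le_rfl
  -- Straightening the graph foliates the region above it by the shifted graphs `y = g(x) + s`, `s >
  -- 0`.
  let Ψ : ℝ × ℝ ≃ₜ ℝ × ℝ :=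
    { toFun := fun z => (z.1, g z.1 + z.2)
      invFun := fun z => (z.1, z.2 - g z.1)
      left_inv := fun z => by simp
      right_inv := fun z => by simp
      continuous_toFun := by fun_prop
      continuous_invFun := by fun_prop }
  set V : ℝ × ℝ → ℝ := fun z => fderiv ℝ W (z.1, g z.1 + z.2) (1, 0) +
    deriv g z.1 * fderiv ℝ W (z.1, g z.1 + z.2) (0, 1) with hV
  have c1 := continuous_fderiv_apply' hW (1, 0)
  have c2 := continuous_fderiv_apply' hW (0, 1)
  have s1 : HasCompactSupport fun z : ℝ × ℝ => fderiv ℝ W (z.1, g z.1 + z.2) (1, 0) :=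
    (hasCompactSupport_fderiv_apply hs (1, 0)).comp_homeomorph Ψ
  have s2 : HasCompactSupport fun z : ℝ × ℝ => fderiv ℝ W (z.1, g z.1 + z.2) (0, 1) :=
    (hasCompactSupport_fderiv_apply hs (0, 1)).comp_homeomorph Ψ
  have hVc : Continuous V := by
    have a1 : Continuous fun z : ℝ × ℝ => fderiv ℝ W (z.1, g z.1 + z.2) (1, 0) :=
      c1.comp Ψ.continuous
    have a2 : Continuous fun z : ℝ × ℝ => fderiv ℝ W (z.1, g z.1 + z.2) (0, 1) :=
      c2.comp Ψ.continuous
    fun_prop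
  have hVs : HasCompactSupport V := s1.add s2.mul_left
  have hVi : Integrable V := hVc.integrable_of_hasCompactSupport hVs
  -- `V (·, s)` is the derivative of the compactly supported function `W (x, g x + s)`. Swapping the
  -- integrals and computing the vertical derivative term exactly leaves the boundary integral.
  have hslice : ∀ s, ∫ x, V (x, s) = 0 := by
    intro s
    refine integral_eq_zero_of_hasDerivAt_of_integrable (f := fun x => W (x, g x + s)) ?_ ?_ ?_
    · intro x
      have h := (hW.differentiable (by norm_num) (x, g x + s)).hasFDerivAt
      have hx := (hg.differentiable (by norm_num) x).hasDerivAt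
      have h2 := h.comp_hasDerivAt x ((hasDerivAt_id x).prodMk (hx.add_const s))
      have h3 : HasDerivAt (fun x => W (x, g x + s)) (fderiv ℝ W (x, g x + s) (1, deriv g x)) x := h2
      refine h3.congr_deriv (Eq.symm ?_)
      change fderiv ℝ W (x, g x + s) (1, 0) + deriv g x * fderiv ℝ W (x, g x + s) (0, 1) =
        fderiv ℝ W (x, g x + s) (1, deriv g x)
      rw [show ((1 : ℝ), deriv g x) = (1, 0) + deriv g x • (0, 1) by simp, map_add, map_smul,
        smul_eq_mul]
    · exact (hVc.comp (by fun_prop : Continuous fun x : ℝ => (x, s))).integrable_of_hasCompactSupport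
        (hasCompactSupport_slice hVs fun _ => s)
    · exact (hW.continuous.comp (by fun_prop : Continuous fun x : ℝ =>
        (x, g x + s))).integrable_of_hasCompactSupport (hasCompactSupport_slice hs _)
  have hVi' : Integrable V ((volume : Measure ℝ).prod ((volume : Measure ℝ).restrict (Ioi 0))) := by
    have := hVi.integrableOn (s := univ ×ˢ Ioi (0 : ℝ))
    rwa [IntegrableOn, Measure.volume_eq_prod, ← Measure.prod_restrict, Measure.restrict_univ] at this
  have hswap := integral_integral_swap (f := fun x s => V (x, s)) (μ := volume)
    (ν := volume.restrict (Ioi (0 : ℝ))) hVi'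
  simp only [hslice, integral_zero] at hswap
  have hin : ∀ x, ∫ s in Ioi (0 : ℝ), V (x, s) =
      (∫ y in Ioi (g x), fderiv ℝ W (x, y) (1, 0)) - deriv g x * W (x, g x) := by
    intro x
    simp only [hV]
    rw [integral_add, integral_const_mul,
      setIntegral_Ioi_add_left (fun y => fderiv ℝ W (x, y) (1, 0)),
      setIntegral_Ioi_add_left (fun y => fderiv ℝ W (x, y) (0, 1)), integral_Ioi_fderiv_snd hW hs]
    · ring
    · exact ((c1.comp (by fun_prop : Continuous fun s : ℝ =>
        (x, g x + s))).integrable_of_hasCompactSupport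
        (hasCompactSupport_slice_snd s1 x)).integrableOn
    · exact (((c2.comp (by fun_prop : Continuous fun s : ℝ =>
        (x, g x + s))).integrable_of_hasCompactSupport
        (hasCompactSupport_slice_snd s2 x)).const_mul _).integrableOn
  simp only [hin] at hswap
  have i1 : Integrable fun x => ∫ y in Ioi (g x), fderiv ℝ W (x, y) (1, 0) := by
    have h1 := (integrable_fderiv_apply hW hs (1, 0)).indicator (isOpen_epi hgc).measurableSet
    rw [Measure.volume_eq_prod] at h1
    refine h1.integral_prod_left.congr (ae_of_all _ fun x => ?_)
    simp only
    rw [← integral_indicator measurableSet_Ioi]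
    rfl
  have i2 : Integrable fun x => deriv g x * W (x, g x) := by
    refine Continuous.integrable_of_hasCompactSupport ?_ ?_
    · have := hW.continuous; fun_prop
    · exact (hasCompactSupport_slice hs g).mul_left
  rw [integral_sub i1 i2] at hswap
  rw [setIntegral_epi hgc (integrable_fderiv_apply hW hs _)]
  linarith

/-! ### The regularized field: divergence free and tangent to the walls -/

section Regularized

variable {l ε : ℝ}

lemma kerA_contDiff (l ε x' y' : ℝ) :
    ContDiff ℝ 1 fun z : ℝ × ℝ => kerA l ε (z.1 - x') z.2 y' := by
  unfold kerA
  exact ((Real.contDiff_cosh.comp (contDiff_const.mul (contDiff_fst.sub contDiff_const))).sub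
    (Real.contDiff_cos.comp (contDiff_const.mul (contDiff_snd.sub contDiff_const)))).add
    contDiff_const

lemma kerB_contDiff (l ε x' y' : ℝ) :
    ContDiff ℝ 1 fun z : ℝ × ℝ => kerB l ε (z.1 - x') z.2 y' := by
  unfold kerB
  exact ((Real.contDiff_cosh.comp (contDiff_const.mul (contDiff_fst.sub contDiff_const))).add
    (Real.contDiff_cos.comp (contDiff_const.mul (contDiff_snd.add contDiff_const)))).add
    contDiff_const

lemma kerY_contDiff (hε : 0 < ε) (x' y' : ℝ) :
    ContDiff ℝ 1 fun z : ℝ × ℝ => kerY l ε (z.1 - x') z.2 y' := by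
  unfold kerY
  exact ((Real.contDiff_sin.comp (contDiff_const.mul (contDiff_snd.sub contDiff_const))).div
    (kerA_contDiff l ε x' y') fun z => (kerA_pos hε).ne').add
    ((Real.contDiff_sin.comp (contDiff_const.mul (contDiff_snd.add contDiff_const))).div
    (kerB_contDiff l ε x' y') fun z => (kerB_pos hε).ne')

lemma kerX_contDiff (hε : 0 < ε) (x' y' : ℝ) :
    ContDiff ℝ 1 fun z : ℝ × ℝ => kerX l ε (z.1 - x') z.2 y' := by
  unfold kerX
  exact ((Real.contDiff_sinh.comp (contDiff_const.mul (contDiff_fst.sub contDiff_const))).div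
    (kerA_contDiff l ε x' y') fun z => (kerA_pos hε).ne').sub
    ((Real.contDiff_sinh.comp (contDiff_const.mul (contDiff_fst.sub contDiff_const))).div
    (kerB_contDiff l ε x' y') fun z => (kerB_pos hε).ne')

lemma hasDerivAt_kerA_fst (l ε x' y' x y : ℝ) : HasDerivAt (fun x => kerA l ε (x - x') y y')
    (Real.pi / (2 * l) * Real.sinh (Real.pi / (2 * l) * (x - x'))) x := by
  unfold kerA
  have h := (((hasDerivAt_id x).sub_const x').const_mul (Real.pi / (2 * l))).cosh
  convert! (h.sub_const (Real.cos (Real.pi / (2 * l) * (y - y')))).add_const ε using 1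
  simp; ring

lemma hasDerivAt_kerB_fst (l ε x' y' x y : ℝ) : HasDerivAt (fun x => kerB l ε (x - x') y y')
    (Real.pi / (2 * l) * Real.sinh (Real.pi / (2 * l) * (x - x'))) x := by
  unfold kerB
  have h := (((hasDerivAt_id x).sub_const x').const_mul (Real.pi / (2 * l))).cosh
  convert! (h.add_const (Real.cos (Real.pi / (2 * l) * (y + y')))).add_const ε using 1
  simp; ring

lemma hasDerivAt_kerA_snd (l ε η y' y : ℝ) : HasDerivAt (fun y => kerA l ε η y y')
    (Real.pi / (2 * l) * Real.sin (Real.pi / (2 * l) * (y - y'))) y := by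
  unfold kerA
  have h := (((hasDerivAt_id y).sub_const y').const_mul (Real.pi / (2 * l))).cos
  convert! (h.const_sub (Real.cosh (Real.pi / (2 * l) * η))).add_const ε using 1
  simp; ring

lemma hasDerivAt_kerB_snd (l ε η y' y : ℝ) : HasDerivAt (fun y => kerB l ε η y y')
    (-(Real.pi / (2 * l) * Real.sin (Real.pi / (2 * l) * (y + y')))) y := by
  unfold kerB
  have h := (((hasDerivAt_id y).add_const y').const_mul (Real.pi / (2 * l))).cos
  convert! (h.const_add (Real.cosh (Real.pi / (2 * l) * η))).add_const ε using 1
  simp; ring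

/-- The common value of `∂ₓ kerY` and `∂_y kerX`. -/
def kerXY (l ε η y y' : ℝ) : ℝ :=
  -(Real.pi / (2 * l) * Real.sinh (Real.pi / (2 * l) * η) *
    (Real.sin (Real.pi / (2 * l) * (y - y')) / kerA l ε η y y' ^ 2 +
      Real.sin (Real.pi / (2 * l) * (y + y')) / kerB l ε η y y' ^ 2))

lemma hasDerivAt_kerY_fst {x' y' x y : ℝ} (hA : kerA l ε (x - x') y y' ≠ 0)
    (hB : kerB l ε (x - x') y y' ≠ 0) :
    HasDerivAt (fun x => kerY l ε (x - x') y y') (kerXY l ε (x - x') y y') x := by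
  unfold kerY
  have h1 := (hasDerivAt_const x (Real.sin (Real.pi / (2 * l) * (y - y')))).div
    (hasDerivAt_kerA_fst l ε x' y' x y) hA
  have h2 := (hasDerivAt_const x (Real.sin (Real.pi / (2 * l) * (y + y')))).div
    (hasDerivAt_kerB_fst l ε x' y' x y) hB
  convert! h1.add h2 using 1
  unfold kerXY
  field_simp
  ring

lemma hasDerivAt_kerX_snd {η y' y : ℝ} (hA : kerA l ε η y y' ≠ 0) (hB : kerB l ε η y y' ≠ 0) :
    HasDerivAt (fun y => kerX l ε η y y') (kerXY l ε η y y') y := by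
  unfold kerX
  have h1 := (hasDerivAt_const y (Real.sinh (Real.pi / (2 * l) * η))).div
    (hasDerivAt_kerA_snd l ε η y' y) hA
  have h2 := (hasDerivAt_const y (Real.sinh (Real.pi / (2 * l) * η))).div
    (hasDerivAt_kerB_snd l ε η y' y) hB
  convert! h1.sub h2 using 1
  unfold kerXY
  field_simp
  ring

lemma fderiv_apply_eq (φ : ℝ × ℝ → ℝ) (z : ℝ × ℝ) (a b : ℝ) :
    fderiv ℝ φ z (a, b) = a * fderiv ℝ φ z (1, 0) + b * fderiv ℝ φ z (0, 1) := by
  rw [show (a, b) = a • ((1 : ℝ), (0 : ℝ)) + b • ((0 : ℝ), (1 : ℝ)) by simp, map_add, map_smul,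
    map_smul, smul_eq_mul, smul_eq_mul]

lemma fderiv_kerX_snd (hε : 0 < ε) (x' y' x y : ℝ) :
    fderiv ℝ (fun z : ℝ × ℝ => kerX l ε (z.1 - x') z.2 y') (x, y) (0, 1) =
      kerXY l ε (x - x') y y' := by
  have h : HasDerivAt (fun y => kerX l ε (x - x') y y') (kerXY l ε (x - x') y y') y :=
    hasDerivAt_kerX_snd (kerA_pos hε).ne' (kerB_pos hε).ne'
  have h' := hasDerivAt_snd (kerX_contDiff (l := l) hε x' y') x y
  exact h'.unique h

lemma fderiv_kerY_fst (hε : 0 < ε) (x' y' x y : ℝ) :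
    fderiv ℝ (fun z : ℝ × ℝ => kerY l ε (z.1 - x') z.2 y') (x, y) (1, 0) =
      kerXY l ε (x - x') y y' :=
  (hasDerivAt_fst (kerY_contDiff (l := l) hε x' y') x y).unique
    (hasDerivAt_kerY_fst (kerA_pos hε).ne' (kerB_pos hε).ne')

lemma fderiv_mul_apply {φ K : ℝ × ℝ → ℝ} (hφ : ContDiff ℝ 1 φ) (hK : ContDiff ℝ 1 K)
    (z v : ℝ × ℝ) :
    fderiv ℝ (fun z => φ z * K z) z v = φ z * fderiv ℝ K z v + K z * fderiv ℝ φ z v := by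
  rw [fderiv_fun_mul (hφ.differentiable (by norm_num) z) (hK.differentiable (by norm_num) z)]
  rfl

/-- The field is the rotated gradient of the smooth stream function `(log kerA - log kerB)/m`. The
mixed derivatives `∂ₓ kerY = ∂_y kerX` cancel, and only boundary-type derivatives of products with
`φ` survive. -/
lemma fderiv_regularized_eq (hε : 0 < ε) (x' y' : ℝ) {φ : ℝ × ℝ → ℝ} (hφ : ContDiff ℝ 1 φ)
    (z : ℝ × ℝ) :
    fderiv ℝ φ z (-kerY l ε (z.1 - x') z.2 y', kerX l ε (z.1 - x') z.2 y') =
      fderiv ℝ (fun z => φ z * kerX l ε (z.1 - x') z.2 y') z (0, 1) -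
      fderiv ℝ (fun z => φ z * kerY l ε (z.1 - x') z.2 y') z (1, 0) := by
  rw [fderiv_mul_apply hφ (kerX_contDiff hε x' y'), fderiv_mul_apply hφ (kerY_contDiff hε x' y'),
    fderiv_kerX_snd hε, fderiv_kerY_fst hε, fderiv_apply_eq]
  ring

/-- The flux of the regularized field through a graph. -/
lemma setIntegral_epi_regularized (hε : 0 < ε) (x' y' : ℝ) {g : ℝ → ℝ} (hg : ContDiff ℝ 1 g)
    {φ : ℝ × ℝ → ℝ} (hφ : ContDiff ℝ 1 φ) (hs : HasCompactSupport φ) :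
    ∫ z in epi g, fderiv ℝ φ z (-kerY l ε (z.1 - x') z.2 y', kerX l ε (z.1 - x') z.2 y') =
      -∫ x, φ (x, g x) * (kerX l ε (x - x') (g x) y' + deriv g x * kerY l ε (x - x') (g x) y') := by
  have w1 := hφ.mul (kerX_contDiff (l := l) hε x' y')
  have w2 := hφ.mul (kerY_contDiff (l := l) hε x' y')
  have s1 : HasCompactSupport fun z : ℝ × ℝ => φ z * kerX l ε (z.1 - x') z.2 y' := hs.mul_right
  have s2 : HasCompactSupport fun z : ℝ × ℝ => φ z * kerY l ε (z.1 - x') z.2 y' := hs.mul_right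
  simp only [fderiv_regularized_eq hε x' y' hφ]
  rw [integral_sub (integrable_fderiv_apply w1 s1 _).integrableOn
    (integrable_fderiv_apply w2 s2 _).integrableOn, setIntegral_epi_fderiv_snd hg.continuous w1 s1,
    setIntegral_epi_fderiv_fst hg w2 s2, ← integral_neg, ← integral_sub, ← integral_neg]
  · refine integral_congr_ae (ae_of_all _ fun x => ?_)
    simp only
    ring
  · exact ((w1.continuous.comp (by have := hg.continuous; fun_prop : Continuous fun x : ℝ =>
      (x, g x))).integrable_of_hasCompactSupport (hasCompactSupport_slice s1 g)).neg
  · refine Continuous.integrable_of_hasCompactSupport ?_ (hasCompactSupport_slice s2 g).mul_left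
    have a1 := hg.continuous_deriv le_rfl
    exact a1.mul (w2.continuous.comp (by have := hg.continuous; fun_prop))

/-- A point of a wall is its own mirror image, so `kerA = kerB` there. Adding the same `ε` to both
kernels preserves this, and with it impermeability. -/
lemma kerX_wall (hl : 0 < l) (η y' : ℝ) : kerX l ε η l y' = 0 ∧ kerX l ε η (-l) y' = 0 := by
  have h1 : Real.pi / (2 * l) * l = Real.pi / 2 := by field_simp
  have e1 : kerA l ε η l y' = kerB l ε η l y' := by
    unfold kerA kerB
    rw [mul_sub, mul_add, h1, Real.cos_sub, Real.cos_add]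
    simp; ring
  have e2 : kerA l ε η (-l) y' = kerB l ε η (-l) y' := by
    unfold kerA kerB
    rw [mul_sub, mul_add, mul_neg, h1, Real.cos_sub, Real.cos_add, Real.cos_neg, Real.sin_neg]
    simp
  unfold kerX
  rw [e1, e2]
  simp

/-- The regularized field is divergence free and tangent to the walls. -/
lemma setIntegral_strip_regularized (hl : 0 < l) (hε : 0 < ε) (x' y' : ℝ)
    {φ : ℝ × ℝ → ℝ} (hφ : ContDiff ℝ 1 φ) (hs : HasCompactSupport φ) :
    ∫ z in strip l, fderiv ℝ φ z (-kerY l ε (z.1 - x') z.2 y', kerX l ε (z.1 - x') z.2 y') = 0 := by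
  have h1 := setIntegral_epi_regularized (l := l) hε x' y' (contDiff_const (c := l)) hφ hs
  have h2 := setIntegral_epi_regularized (l := l) hε x' y' (contDiff_const (c := -l)) hφ hs
  simp only [deriv_const, zero_mul, add_zero, (kerX_wall hl _ _).1, (kerX_wall hl _ _).2, mul_zero,
    integral_zero, neg_zero] at h1 h2
  -- Up to a null line the strip is the region above the lower wall minus the region above the upper
  -- one, and the flux through each wall is zero.
  have hr : (volume : Measure (ℝ × ℝ)).restrict (strip l) =
      volume.restrict (epi (fun _ => -l) \ epi fun _ => l) := by
    rw [restrict_strip, Measure.restrict_congr_set Ioo_ae_eq_Ioc]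
    have : epi (fun _ => -l) \ epi (fun _ => l) = univ ×ˢ Ioc (-l) l := by
      ext z; simp [epi]
    rw [this, Measure.volume_eq_prod, ← Measure.prod_restrict, Measure.restrict_univ]
  have hi : Integrable fun z : ℝ × ℝ =>
      fderiv ℝ φ z (-kerY l ε (z.1 - x') z.2 y', kerX l ε (z.1 - x') z.2 y') := by
    simp only [fderiv_regularized_eq hε x' y' hφ]
    exact (integrable_fderiv_apply (hφ.mul (kerX_contDiff (l := l) hε x' y')) hs.mul_right _).sub
      (integrable_fderiv_apply (hφ.mul (kerY_contDiff (l := l) hε x' y')) hs.mul_right _)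
  rw [hr, setIntegral_sdiff (isOpen_epi continuous_const).measurableSet hi.integrableOn, h1, h2,
    sub_zero]
  intro z hz
  simp only [epi, mem_ofPred_eq] at *
  linarith

end Regularized

/-! ### Bounds and continuity of the regularized principal value -/

/-- The regularized principal value integrand, with the odd function `2 g'(x) tanh mη` removed. -/
def pvReg (l ε : ℝ) (g : ℝ → ℝ) (x η : ℝ) : ℝ :=
  (deriv g x - deriv g (x - η)) * (Real.sinh (Real.pi / (2 * l) * η) /
      kerA l ε η (g x) (g (x - η)) - Real.tanh (Real.pi / (2 * l) * η)) +
  (deriv g x + deriv g (x - η)) * (Real.sinh (Real.pi / (2 * l) * η) /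
      kerB l ε η (g x) (g (x - η)) - Real.tanh (Real.pi / (2 * l) * η))

/-- The (regularized) principal value in the contour equation. -/
def pvInt (l ε : ℝ) (g : ℝ → ℝ) (x : ℝ) : ℝ := ∫ η, pvReg l ε g x η

/-- A lower bound for `kerB / cosh` for interfaces at distance `δ` from the walls. -/
def wallGap (l δ : ℝ) : ℝ := min 1 (1 - Real.cos (Real.pi / (2 * l) * (2 * δ)))

/-- The constant in the bound for `pvReg`. -/
def pvC (l δ M : ℝ) : ℝ := 16 * M / (Real.pi / (2 * l)) + 8 * M / wallGap l δ

section Bounds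

variable {l δ M ε : ℝ} {g : ℝ → ℝ}

lemma ProfileBound.nonneg (hg : ProfileBound l δ M g) : 0 ≤ M :=
  (abs_nonneg _).trans (hg.deriv_le 0)

lemma ProfileBound.abs_le' (hδ : 0 < δ) (hg : ProfileBound l δ M g) (x : ℝ) : |g x| ≤ l :=
  (hg.abs_le x).trans (by linarith)

lemma ProfileBound.abs_lt (hδ : 0 < δ) (hg : ProfileBound l δ M g) (x : ℝ) : |g x| < l :=
  (hg.abs_le x).trans_lt (by linarith)

lemma ProfileBound.continuous (hg : ProfileBound l δ M g) : Continuous g := hg.contDiff.continuous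

lemma ProfileBound.continuous_deriv (hg : ProfileBound l δ M g) : Continuous (deriv g) :=
  hg.contDiff.continuous_deriv le_rfl

lemma ProfileBound.delta_le (hg : ProfileBound l δ M g) : δ ≤ l := by
  linarith [(abs_nonneg _).trans (hg.abs_le 0)]

lemma wallGap_pos (hl : 0 < l) (hδ : 0 < δ) (hδl : δ ≤ l) : 0 < wallGap l δ := by
  refine lt_min one_pos ?_
  have hm : 0 < Real.pi / (2 * l) := by have := Real.pi_pos; positivity
  have h1 : Real.pi / (2 * l) * (2 * l) = Real.pi := by field_simp
  have h2 : Real.cos (Real.pi / (2 * l) * (2 * δ)) < Real.cos 0 :=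
    Real.cos_lt_cos_of_nonneg_of_le_pi le_rfl (by nlinarith) (by positivity)
  rw [Real.cos_zero] at h2
  linarith

/-- For profiles at distance `δ` from the walls, `m|y + y'| ≤ π - 2mδ`, so the cosine stays above
`-cos 2mδ`. The minimum in `wallGap` covers both signs of `cos 2mδ`, using `cosh ≥ 1`. -/
lemma kerB_ge (hl : 0 < l) (hδ : 0 < δ) (hε : 0 ≤ ε) {y y' : ℝ} (hy : |y| ≤ l - δ)
    (hy' : |y'| ≤ l - δ) (η : ℝ) :
    wallGap l δ * Real.cosh (Real.pi / (2 * l) * η) ≤ kerB l ε η y y' := by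
  have hm : 0 < Real.pi / (2 * l) := by have := Real.pi_pos; positivity
  have h1 : Real.pi / (2 * l) * (2 * l) = Real.pi := by field_simp
  have h2 : |Real.pi / (2 * l) * (y + y')| ≤ Real.pi - Real.pi / (2 * l) * (2 * δ) := by
    rw [abs_mul, abs_of_pos hm]
    have := abs_add_le y y'
    nlinarith
  have h0 := Real.pi_pos
  have h3 : Real.cos (Real.pi - Real.pi / (2 * l) * (2 * δ)) ≤
      Real.cos (Real.pi / (2 * l) * (y + y')) := by
    rw [← Real.cos_abs (Real.pi / (2 * l) * (y + y'))]
    exact Real.cos_le_cos_of_nonneg_of_le_pi (abs_nonneg _) (by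
      have : 0 < Real.pi / (2 * l) * (2 * δ) := by positivity
      linarith) h2
  rw [Real.cos_pi_sub] at h3
  unfold kerB
  have hc := Real.one_le_cosh (Real.pi / (2 * l) * η)
  set c := Real.cosh (Real.pi / (2 * l) * η)
  rcases le_total 0 (Real.cos (Real.pi / (2 * l) * (2 * δ))) with h | h
  · have : wallGap l δ ≤ 1 - Real.cos (Real.pi / (2 * l) * (2 * δ)) := min_le_right _ _
    nlinarith
  · have : wallGap l δ ≤ 1 := min_le_left _ _
    nlinarith

lemma abs_tanh_le_one (u : ℝ) : |Real.tanh u| ≤ 1 := by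
  rw [abs_le]
  exact ⟨(Real.neg_one_lt_tanh u).le, (Real.tanh_lt_one u).le⟩

/-- With `s = sinh` and `c = cosh` the difference is `s (c - A)/(A c)`. Here `|c - A| ≤ 2`, `A ≥ c -
1` and `s² = (c - 1)(c + 1)` bound it by `4/|s|`: a simple pole at zero, which the factor `|η|`
absorbs, and exponential decay. -/
lemma abs_sinh_div_kerA_sub_tanh_le (hl : 0 < l) (hε : 0 ≤ ε) (hε1 : ε ≤ 1) {η : ℝ} (hη : η ≠ 0)
    (y y' : ℝ) : |η| * |Real.sinh (Real.pi / (2 * l) * η) / kerA l ε η y y' -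
      Real.tanh (Real.pi / (2 * l) * η)| ≤
      16 / (Real.pi / (2 * l)) * Real.exp (-(Real.pi / (4 * l)) * |η|) := by
  have hm : 0 < Real.pi / (2 * l) := by have := Real.pi_pos; positivity
  have hA := kerA_pos_of_ne (y := y) (y' := y') hl hε hη
  have hs := le_abs_sinh (Real.pi / (2 * l) * η)
  rw [abs_mul, abs_of_pos hm, show Real.pi / (2 * l) * |η| / 2 = Real.pi / (4 * l) * |η| by ring]
    at hs
  have hAd : kerA l ε η y y' = Real.cosh (Real.pi / (2 * l) * η) -
    Real.cos (Real.pi / (2 * l) * (y - y')) + ε := rfl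
  have hc1 := Real.cos_le_one (Real.pi / (2 * l) * (y - y'))
  have hc2 := Real.neg_one_le_cos (Real.pi / (2 * l) * (y - y'))
  have hη' : 0 < |η| := abs_pos.2 hη
  have he := Real.exp_pos (Real.pi / (4 * l) * |η|)
  rw [Real.tanh_eq_sinh_div_cosh]
  set A := kerA l ε η y y'
  set c := Real.cosh (Real.pi / (2 * l) * η) with hc
  have hsq : Real.sinh (Real.pi / (2 * l) * η) ^ 2 = c ^ 2 - 1 := by rw [hc, Real.cosh_sq]; ring
  have h1c : 1 ≤ c := Real.one_le_cosh _
  set s := Real.sinh (Real.pi / (2 * l) * η)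
  have hc0 : 0 < c := by linarith
  have hs0 : 0 < |s| := lt_of_lt_of_le (by positivity) hs
  have e : s / A - s / c = s * (c - A) / (A * c) := by field_simp
  have hw : |c - A| ≤ 2 := by rw [abs_le]; constructor <;> linarith
  have h1 : |s * (c - A) / (A * c)| ≤ 4 / |s| := by
    rw [abs_div, abs_mul, abs_of_pos (mul_pos hA hc0), div_le_div_iff₀ (by positivity) hs0]
    have h3 : |s| * |s| = c ^ 2 - 1 := by rw [← sq, sq_abs, hsq]
    have h4 : c - 1 ≤ A := by linarith
    calc |s| * |c - A| * |s| = (|s| * |s|) * |c - A| := by ring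
      _ ≤ (c ^ 2 - 1) * 2 := by rw [h3]; exact mul_le_mul_of_nonneg_left hw (by nlinarith)
      _ ≤ 4 * (A * c) := by nlinarith
  rw [e]
  calc |η| * |s * (c - A) / (A * c)| ≤ |η| * (4 / |s|) := by gcongr
    _ ≤ |η| * (4 / (Real.pi / (2 * l) * |η| * Real.exp (Real.pi / (4 * l) * |η|) / 4)) := by
        gcongr
    _ = _ := by
        rw [neg_mul, Real.exp_neg]
        field_simp
        ring

/-- The same comparison with `tanh`, but without a pole: away from the walls `kerB` is bounded below
by a multiple of `cosh`. -/
lemma abs_sinh_div_kerB_sub_tanh_le (hl : 0 < l) (hδ : 0 < δ) (hδl : δ ≤ l) (hε : 0 ≤ ε)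
    (hε1 : ε ≤ 1) {y y' : ℝ} (hy : |y| ≤ l - δ) (hy' : |y'| ≤ l - δ) (η : ℝ) :
    |Real.sinh (Real.pi / (2 * l) * η) / kerB l ε η y y' - Real.tanh (Real.pi / (2 * l) * η)| ≤
      4 / wallGap l δ * Real.exp (-(Real.pi / (4 * l)) * |η|) := by
  have hm : 0 < Real.pi / (4 * l) := by have := Real.pi_pos; positivity
  have hgap := wallGap_pos hl hδ hδl
  have hB := kerB_ge hl hδ hε hy hy' η
  have ht := abs_tanh_le_one (Real.pi / (2 * l) * η)
  have hBd : kerB l ε η y y' = Real.cosh (Real.pi / (2 * l) * η) +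
    Real.cos (Real.pi / (2 * l) * (y + y')) + ε := rfl
  have hc1 := Real.cos_le_one (Real.pi / (2 * l) * (y + y'))
  have hc2 := Real.neg_one_le_cos (Real.pi / (2 * l) * (y + y'))
  have hexp : Real.exp (Real.pi / (4 * l) * |η|) ≤ 2 * Real.cosh (Real.pi / (2 * l) * η) := by
    rw [← Real.cosh_abs, Real.cosh_eq, abs_mul, abs_of_pos (show 0 < Real.pi / (2 * l) by
      have := Real.pi_pos; positivity)]
    have h1 : Real.exp (Real.pi / (4 * l) * |η|) ≤ Real.exp (Real.pi / (2 * l) * |η|) := by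
      apply Real.exp_le_exp.2
      rw [show Real.pi / (2 * l) * |η| = 2 * (Real.pi / (4 * l) * |η|) by ring]
      have : 0 ≤ Real.pi / (4 * l) * |η| := by positivity
      linarith
    have := Real.exp_pos (-(Real.pi / (2 * l) * |η|))
    linarith
  have he := Real.exp_pos (Real.pi / (4 * l) * |η|)
  rw [Real.tanh_eq_sinh_div_cosh] at *
  set B := kerB l ε η y y'
  have hc0 := Real.cosh_pos (Real.pi / (2 * l) * η)
  set c := Real.cosh (Real.pi / (2 * l) * η)
  set s := Real.sinh (Real.pi / (2 * l) * η)
  have hB0 : 0 < B := lt_of_lt_of_le (by positivity) hB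
  have e : s / B - s / c = s / c * ((c - B) / B) := by field_simp
  have hw : |c - B| ≤ 2 := by rw [abs_le]; constructor <;> linarith
  rw [e, abs_mul, abs_div (c - B), abs_of_pos hB0]
  calc |s / c| * (|c - B| / B) ≤ 1 * (2 / (wallGap l δ * c)) := by gcongr
    _ ≤ 1 * (2 / (wallGap l δ * (Real.exp (Real.pi / (4 * l) * |η|) / 2))) := by
        gcongr; linarith
    _ = _ := by
        rw [neg_mul, Real.exp_neg]
        field_simp
        ring

/-- The Lipschitz bound on `g'` supplies the factor `|η|` that compensates the pole of the first
kernel. The second kernel is bounded, so boundedness of `g'` suffices for it. -/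
lemma abs_pvReg_le (hl : 0 < l) (hδ : 0 < δ) (hg : ProfileBound l δ M g) (hε : 0 ≤ ε)
    (hε1 : ε ≤ 1) (x : ℝ) {η : ℝ} (hη : η ≠ 0) :
    |pvReg l ε g x η| ≤ pvC l δ M * Real.exp (-(Real.pi / (4 * l)) * |η|) := by
  have hm : 0 < Real.pi / (2 * l) := by have := Real.pi_pos; positivity
  have hgap := wallGap_pos hl hδ hg.delta_le
  have h1 := abs_sinh_div_kerA_sub_tanh_le hl hε hε1 hη (g x) (g (x - η))
  have h2 := abs_sinh_div_kerB_sub_tanh_le hl hδ hg.delta_le hε hε1 (hg.abs_le x)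
    (hg.abs_le (x - η)) η
  have h3 := hg.deriv_lip x (x - η)
  rw [sub_sub_cancel] at h3
  have h4 : |deriv g x + deriv g (x - η)| ≤ 2 * M :=
    (abs_add_le _ _).trans (by linarith [hg.deriv_le x, hg.deriv_le (x - η)])
  have hM := hg.nonneg
  unfold pvReg pvC
  set E := Real.exp (-(Real.pi / (4 * l)) * |η|)
  set a := Real.sinh (Real.pi / (2 * l) * η) / kerA l ε η (g x) (g (x - η)) -
    Real.tanh (Real.pi / (2 * l) * η)
  set b := Real.sinh (Real.pi / (2 * l) * η) / kerB l ε η (g x) (g (x - η)) -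
    Real.tanh (Real.pi / (2 * l) * η)
  refine (abs_add_le _ _).trans ?_
  rw [abs_mul, abs_mul, add_mul]
  refine add_le_add ?_ ?_
  · calc |deriv g x - deriv g (x - η)| * |a| ≤ M * |η| * |a| := by gcongr
      _ = M * (|η| * |a|) := by ring
      _ ≤ M * (16 / (Real.pi / (2 * l)) * E) := by gcongr
      _ = _ := by ring
  · calc |deriv g x + deriv g (x - η)| * |b| ≤ 2 * M * (4 / wallGap l δ * E) := by gcongr
      _ = _ := by ring

lemma measurable_pvReg (hg : ProfileBound l δ M g) (x : ℝ) : Measurable (pvReg l ε g x) := by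
  have h1 := hg.continuous
  have h2 := hg.continuous_deriv
  unfold pvReg kerA kerB
  simp only [Real.tanh_eq_sinh_div_cosh]
  have : ∀ y : ℝ, 0 < Real.cosh y := Real.cosh_pos
  fun_prop

lemma integrable_exp_abs {b : ℝ} (hb : 0 < b) : Integrable fun x : ℝ => Real.exp (-b * |x|) := by
  have := integrable_abs_rpow_mul_exp (p := 0) (by norm_num) hb
  simpa using this

lemma ae_abs_pvReg_le (hl : 0 < l) (hδ : 0 < δ) (hg : ProfileBound l δ M g) (hε : 0 ≤ ε)
    (hε1 : ε ≤ 1) (x : ℝ) :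
    ∀ᵐ η, ‖pvReg l ε g x η‖ ≤ pvC l δ M * Real.exp (-(Real.pi / (4 * l)) * |η|) := by
  have h1 : ∀ᵐ η : ℝ, η ≠ 0 := by simp [ae_iff]
  filter_upwards [h1] with η hη using abs_pvReg_le hl hδ hg hε hε1 x hη

lemma integrable_pvReg (hl : 0 < l) (hδ : 0 < δ) (hg : ProfileBound l δ M g) (hε : 0 ≤ ε)
    (hε1 : ε ≤ 1) (x : ℝ) : Integrable (pvReg l ε g x) :=
  ((integrable_exp_abs (by have := Real.pi_pos; positivity)).const_mul _).mono'
    (measurable_pvReg hg x).aestronglyMeasurable (ae_abs_pvReg_le hl hδ hg hε hε1 x)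

lemma abs_pvInt_le (hl : 0 < l) (hδ : 0 < δ) (hg : ProfileBound l δ M g) (hε : 0 ≤ ε)
    (hε1 : ε ≤ 1) (x : ℝ) :
    |pvInt l ε g x| ≤ ∫ η, pvC l δ M * Real.exp (-(Real.pi / (4 * l)) * |η|) :=
  norm_integral_le_of_norm_le
    ((integrable_exp_abs (by have := Real.pi_pos; positivity)).const_mul _)
    (ae_abs_pvReg_le hl hδ hg hε hε1 x)

/-- Joint continuity of the integrand in the regularization and the interface. -/
lemma tendsto_pvReg {ι : Type*} {F : Filter ι} (hl : 0 < l) {e : ι → ℝ} {G : ι → ℝ → ℝ}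
    {X : ι → ℝ} {x η : ℝ} (hη : η ≠ 0) (hε : 0 ≤ ε) (he : Tendsto e F (𝓝 ε))
    (h1 : Tendsto (fun i => G i (X i)) F (𝓝 (g x)))
    (h2 : Tendsto (fun i => G i (X i - η)) F (𝓝 (g (x - η))))
    (h3 : Tendsto (fun i => deriv (G i) (X i)) F (𝓝 (deriv g x)))
    (h4 : Tendsto (fun i => deriv (G i) (X i - η)) F (𝓝 (deriv g (x - η)))) :
    Tendsto (fun i => pvReg l (e i) (G i) (X i) η) F (𝓝 (pvReg l ε g x η)) := by
  have hA : Tendsto (fun i => kerA l (e i) η (G i (X i)) (G i (X i - η))) F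
      (𝓝 (kerA l ε η (g x) (g (x - η)))) :=
    (tendsto_const_nhds.sub ((Real.continuous_cos.tendsto _).comp
      ((h1.sub h2).const_mul _))).add he
  have hB : Tendsto (fun i => kerB l (e i) η (G i (X i)) (G i (X i - η))) F
      (𝓝 (kerB l ε η (g x) (g (x - η)))) :=
    (tendsto_const_nhds.add ((Real.continuous_cos.tendsto _).comp
      ((h1.add h2).const_mul _))).add he
  unfold pvReg
  exact ((h3.sub h4).mul ((tendsto_const_nhds.div hA (kerA_pos_of_ne hl hε hη).ne').sub
    tendsto_const_nhds)).add ((h3.add h4).mul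
    ((tendsto_const_nhds.div hB (kerB_pos_of_ne hl hε hη).ne').sub tendsto_const_nhds))

/-- Dominated convergence with a majorant that depends only on `δ` and `M`. Letting regularization,
profile and base point vary together covers the limit `ε → 0`, continuity in `x`, and joint
continuity in `(t, x)`. -/
lemma tendsto_pvInt {ι : Type*} {F : Filter ι} [F.IsCountablyGenerated] (hl : 0 < l) (hδ : 0 < δ)
    {e : ι → ℝ} {G : ι → ℝ → ℝ} {X : ι → ℝ} {x : ℝ} (hε : 0 ≤ ε) (he : Tendsto e F (𝓝 ε))
    (he' : ∀ᶠ i in F, e i ∈ Icc 0 1) (hG : ∀ᶠ i in F, ProfileBound l δ M (G i))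
    (h1 : ∀ η, Tendsto (fun i => G i (X i - η)) F (𝓝 (g (x - η))))
    (h3 : ∀ η, Tendsto (fun i => deriv (G i) (X i - η)) F (𝓝 (deriv g (x - η)))) :
    Tendsto (fun i => pvInt l (e i) (G i) (X i)) F (𝓝 (pvInt l ε g x)) := by
  refine tendsto_integral_filter_of_dominated_convergence
    (fun η => pvC l δ M * Real.exp (-(Real.pi / (4 * l)) * |η|)) ?_ ?_
    ((integrable_exp_abs (by have := Real.pi_pos; positivity)).const_mul _) ?_
  · filter_upwards [hG] with i hi using (measurable_pvReg hi _).aestronglyMeasurable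
  · filter_upwards [hG, he'] with i hi hi' using ae_abs_pvReg_le hl hδ hi hi'.1 hi'.2 _
  · have h0 : ∀ᵐ η : ℝ, η ≠ 0 := by simp [ae_iff]
    have e0 := h1 0
    have e1 := h3 0
    simp only [sub_zero] at e0 e1
    filter_upwards [h0] with η hη using tendsto_pvReg hl hη hε he e0 (h1 η) e1 (h3 η)

end Bounds

/-! ### Existence of the principal value; its identity with the normal velocity -/

section PrincipalValue

variable {l δ M ε : ℝ} {g : ℝ → ℝ}

lemma continuous_tanh : Continuous Real.tanh := by
  rw [show Real.tanh = fun x => Real.sinh x / Real.cosh x from funext Real.tanh_eq_sinh_div_cosh]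
  exact Real.continuous_sinh.div Real.continuous_cosh fun x => (Real.cosh_pos x).ne'

lemma measurableSet_annulus (a R : ℝ) : MeasurableSet {η : ℝ | a < |η| ∧ |η| < R} :=
  ((isOpen_lt continuous_const continuous_abs).inter
    (isOpen_lt continuous_abs continuous_const)).measurableSet

lemma setIntegral_annulus_tanh (m a R : ℝ) :
    ∫ η in {η : ℝ | a < |η| ∧ |η| < R}, Real.tanh (m * η) = 0 := by
  rw [← integral_indicator (measurableSet_annulus a R)]
  have h := integral_neg_eq_self ({η : ℝ | a < |η| ∧ |η| < R}.indicator
    fun η => Real.tanh (m * η)) volume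
  have e : ∀ η, ({η : ℝ | a < |η| ∧ |η| < R}.indicator fun η => Real.tanh (m * η)) (-η) =
      -({η : ℝ | a < |η| ∧ |η| < R}.indicator fun η => Real.tanh (m * η)) η := by
    intro η
    simp only [indicator, mem_ofPred_eq, abs_neg, mul_neg, Real.tanh_neg]
    split_ifs <;> simp
  simp only [e, integral_neg] at h
  linarith

lemma integrableOn_annulus_tanh (m a R : ℝ) :
    IntegrableOn (fun η => Real.tanh (m * η)) {η : ℝ | a < |η| ∧ |η| < R} := by
  have hc : Continuous fun η => Real.tanh (m * η) := continuous_tanh.comp (by fun_prop)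
  refine (hc.integrableOn_Icc (a := -R) (b := R)).mono_set fun η hη => ?_
  exact abs_le.1 hη.2.le

lemma Xi_eq_pvReg (l : ℝ) (g : ℝ → ℝ) (x η : ℝ) :
    (deriv g x - deriv g (x - η)) * Xi₁ l g x η + (deriv g x + deriv g (x - η)) * Xi₂ l g x η =
      pvReg l 0 g x η + 2 * deriv g x * Real.tanh (Real.pi / (2 * l) * η) := by
  unfold pvReg kerA kerB Xi₁ Xi₂
  simp only [add_zero]
  ring

/-- The principal value in the contour equation exists. -/
lemma hasPrincipalValue_pvInt (hl : 0 < l) (hδ : 0 < δ) (hg : ProfileBound l δ M g) (x : ℝ) :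
    HasPrincipalValue (fun η => (deriv g x - deriv g (x - η)) * Xi₁ l g x η +
      (deriv g x + deriv g (x - η)) * Xi₂ l g x η) (pvInt l 0 g x) := by
  have hi := integrable_pvReg hl hδ hg le_rfl zero_le_one x
  simp only [Xi_eq_pvReg]
  refine ⟨fun a R _ => hi.integrableOn.add ((integrableOn_annulus_tanh _ a R).const_mul _), ?_⟩
  -- On a symmetric annulus the odd `tanh` term integrates to zero, although it is not integrable at
  -- infinity; the rest is absolutely integrable.
  have e : ∀ q : ℝ × ℝ, ∫ η in {η : ℝ | q.1 < |η| ∧ |η| < q.2}, (pvReg l 0 g x η +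
      2 * deriv g x * Real.tanh (Real.pi / (2 * l) * η)) =
      ∫ η, {η : ℝ | q.1 < |η| ∧ |η| < q.2}.indicator (pvReg l 0 g x) η := by
    intro q
    rw [integral_add hi.integrableOn ((integrableOn_annulus_tanh _ _ _).const_mul _),
      integral_const_mul, setIntegral_annulus_tanh, mul_zero, add_zero,
      integral_indicator (measurableSet_annulus _ _)]
  simp only [e]
  refine tendsto_integral_filter_of_dominated_convergence (fun η => ‖pvReg l 0 g x η‖) ?_ ?_
    hi.norm ?_
  · exact Eventually.of_forall fun q => hi.1.indicator (measurableSet_annulus _ _)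
  · exact Eventually.of_forall fun q => ae_of_all _ fun η => norm_indicator_le_norm_self _ _
  · have h0 : ∀ᵐ η : ℝ, η ≠ 0 := by simp [ae_iff]
    filter_upwards [h0] with η hη
    refine tendsto_const_nhds.congr' ?_
    have h1 : ∀ᶠ a in 𝓝[>] (0 : ℝ), a < |η| :=
      mem_nhdsWithin_of_mem_nhds (gt_mem_nhds (abs_pos.2 hη))
    filter_upwards [h1.prod_mk (eventually_gt_atTop |η|)] with q hq
    rw [indicator_of_mem]
    exact hq

lemma hasPrincipalValue_unique {G : ℝ → ℝ} {a b : ℝ} (ha : HasPrincipalValue G a)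
    (hb : HasPrincipalValue G b) : a = b :=
  tendsto_nhds_unique ha.2 hb.2

/-- The normal component of the regularized velocity on the interface. -/
def normalKer (l ε : ℝ) (g : ℝ → ℝ) (x x' : ℝ) : ℝ :=
  deriv g x' * (kerX l ε (x - x') (g x) (g x') + deriv g x * kerY l ε (x - x') (g x) (g x'))

lemma abs_normalKer_le (hl : 0 < l) (hδ : 0 < δ) (hg : ProfileBound l δ M g) (hε : 0 < ε)
    (x x' : ℝ) : |normalKer l ε g x x'| ≤
      M * (1 + M) * (4 * √(1 + 2 / ε)) * Real.exp (-(Real.pi / (4 * l)) * |x - x'|) := by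
  obtain ⟨h1, h2⟩ := abs_ker_le_exp (η := x - x') hl hε (hg.abs_le' hδ x) (hg.abs_le' hδ x')
  have hM := hg.nonneg
  unfold normalKer
  rw [abs_mul]
  set E := 4 * √(1 + 2 / ε) * Real.exp (-(Real.pi / (4 * l)) * |x - x'|) with hE
  have hE0 : 0 ≤ E := by positivity
  have h3 : |kerX l ε (x - x') (g x) (g x') + deriv g x * kerY l ε (x - x') (g x) (g x')| ≤
      E + M * E := by
    refine (abs_add_le _ _).trans (add_le_add h2 ?_)
    rw [abs_mul]
    exact mul_le_mul (hg.deriv_le x) h1 (abs_nonneg _) hM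
  calc _ ≤ M * (E + M * E) := mul_le_mul (hg.deriv_le x') h3 (abs_nonneg _) hM
    _ = _ := by rw [hE]; ring

lemma continuous_normalKer (hg : ProfileBound l δ M g) (hε : 0 < ε) :
    Continuous fun q : ℝ × ℝ => normalKer l ε g q.1 q.2 := by
  have h1 := hg.continuous
  have h2 := hg.continuous_deriv
  have hA : ∀ q : ℝ × ℝ, kerA l ε (q.1 - q.2) (g q.1) (g q.2) ≠ 0 := fun q => (kerA_pos hε).ne'
  have hB : ∀ q : ℝ × ℝ, kerB l ε (q.1 - q.2) (g q.1) (g q.2) ≠ 0 := fun q => (kerB_pos hε).ne'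
  have cA : Continuous fun q : ℝ × ℝ => kerA l ε (q.1 - q.2) (g q.1) (g q.2) := by
    unfold kerA; fun_prop
  have cB : Continuous fun q : ℝ × ℝ => kerB l ε (q.1 - q.2) (g q.1) (g q.2) := by
    unfold kerB; fun_prop
  unfold normalKer kerX kerY
  fun_prop (disch := assumption)

lemma integrable_normalKer (hl : 0 < l) (hδ : 0 < δ) (hg : ProfileBound l δ M g) (hε : 0 < ε)
    (x : ℝ) : Integrable (normalKer l ε g x) := by
  have h := (integrable_exp_abs (b := Real.pi / (4 * l)) (by have := Real.pi_pos; positivity))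
  have h2 : Integrable fun x' => M * (1 + M) * (4 * √(1 + 2 / ε)) *
      Real.exp (-(Real.pi / (4 * l)) * |x - x'|) := (h.comp_sub_left x).const_mul _
  exact h2.mono' ((continuous_normalKer hg hε).comp
    (by fun_prop : Continuous fun x' : ℝ => (x, x'))).aestronglyMeasurable
    (ae_of_all _ fun x' => abs_normalKer_le hl hδ hg hε x x')

/-- The primitive relating the two forms of the normal velocity. -/
def logPrim (l ε : ℝ) (g : ℝ → ℝ) (x x' : ℝ) : ℝ :=
  Real.log (kerA l ε (x - x') (g x) (g x') / Real.cosh (Real.pi / (2 * l) * (x - x'))) +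
  Real.log (kerB l ε (x - x') (g x) (g x') / Real.cosh (Real.pi / (2 * l) * (x - x')))

/-- Differentiating `log kerA + log kerB` in `x'` along the graph yields `sinh` terms and `g'(x')`
times `sin` terms. After multiplication by `g'(x)`, the latter are the `kerY` part of the normal
velocity; the former add up the `kerX` part and the principal value integrand. Dividing by `cosh`
produces the `tanh` terms, and `ε > 0` keeps the logarithms smooth across `x' = x`. -/
lemma hasDerivAt_logPrim (hl : 0 < l) (hg : ContDiff ℝ 1 g) (hε : 0 < ε) (x x' : ℝ) :
    HasDerivAt (fun x' => -(deriv g x / (Real.pi / (2 * l))) * logPrim l ε g x x')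
      (normalKer l ε g x x' + pvReg l ε g x (x - x')) x' := by
  have hm : 0 < Real.pi / (2 * l) := by have := Real.pi_pos; positivity
  have hgd := (hg.differentiable (by norm_num) x').hasDerivAt
  set m := Real.pi / (2 * l) with hmdef
  have hA0 : kerA l ε (x - x') (g x) (g x') ≠ 0 := (kerA_pos hε).ne'
  have hB0 : kerB l ε (x - x') (g x) (g x') ≠ 0 := (kerB_pos hε).ne'
  have hc0 : Real.cosh (m * (x - x')) ≠ 0 := (Real.cosh_pos _).ne'
  have hu : HasDerivAt (fun x' => m * (x - x')) (-m) x' := by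
    simpa using ((hasDerivAt_id x').const_sub x).const_mul m
  have hc := hu.cosh
  have hw1 : HasDerivAt (fun x' => m * (g x - g x')) (m * -deriv g x') x' :=
    (hgd.const_sub (g x)).const_mul m
  have hw2 : HasDerivAt (fun x' => m * (g x + g x')) (m * deriv g x') x' :=
    (hgd.const_add (g x)).const_mul m
  have hA : HasDerivAt (fun x' => kerA l ε (x - x') (g x) (g x')) _ x' :=
    (hc.sub hw1.cos).add_const ε
  have hB : HasDerivAt (fun x' => kerB l ε (x - x') (g x) (g x')) _ x' :=
    (hc.add hw2.cos).add_const ε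
  have h1 := (hA.div hc hc0).log (div_ne_zero hA0 hc0)
  have h2 := (hB.div hc hc0).log (div_ne_zero hB0 hc0)
  have h3 := (h1.add h2).const_mul (-(deriv g x / m))
  refine h3.congr_deriv ?_
  unfold normalKer pvReg kerX kerY
  simp only [sub_sub_cancel, ← hmdef, Real.tanh_eq_sinh_div_cosh, Pi.div_apply]
  field_simp
  ring

lemma tendsto_logPrim (hl : 0 < l) (hε : 0 < ε) (x : ℝ) {F : Filter ℝ}
    (hF : Tendsto (fun x' => |x - x'|) F atTop) : Tendsto (logPrim l ε g x) F (𝓝 0) := by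
  have hm : 0 < Real.pi / (2 * l) := by have := Real.pi_pos; positivity
  set m := Real.pi / (2 * l) with hmdef
  have hcosh : Tendsto (fun x' => Real.cosh (m * (x - x'))) F atTop := by
    have h1 : Tendsto (fun x' => m * |x - x'|) F atTop := hF.const_mul_atTop hm
    refine tendsto_atTop_mono (fun x' => ?_) h1
    rw [← Real.cosh_abs, abs_mul, abs_of_pos hm, Real.cosh_eq]
    have h2 := Real.add_one_le_exp (m * |x - x'|)
    have h3 := Real.quadratic_le_exp_of_nonneg (x := m * |x - x'|) (by positivity)
    have h4 := Real.exp_pos (-(m * |x - x'|))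
    nlinarith [sq_nonneg (m * |x - x'| - 1)]
  have key : ∀ w : ℝ → ℝ, (∀ x', |w x'| ≤ 1 + ε) →
      Tendsto (fun x' => Real.log ((Real.cosh (m * (x - x')) + w x') / Real.cosh (m * (x - x'))))
        F (𝓝 0) := by
    intro w hw
    have h1 : Tendsto (fun x' => w x' / Real.cosh (m * (x - x'))) F (𝓝 0) := by
      refine squeeze_zero_norm (fun x' => ?_) (tendsto_const_nhds.div_atTop hcosh (a := 1 + ε))
      rw [norm_div, Real.norm_eq_abs, Real.norm_eq_abs, abs_of_pos (Real.cosh_pos _)]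
      exact div_le_div_of_nonneg_right (hw x') (Real.cosh_pos _).le
    have h2 : Tendsto (fun x' => Real.log (1 + w x' / Real.cosh (m * (x - x')))) F
        (𝓝 (Real.log (1 + 0))) :=
      ((Real.continuousAt_log (by norm_num)).tendsto).comp (h1.const_add 1)
    rw [add_zero, Real.log_one] at h2
    refine h2.congr fun x' => ?_
    congr 1
    have := (Real.cosh_pos (m * (x - x'))).ne'
    field_simp
  have hA := key (fun x' => -Real.cos (m * (g x - g x')) + ε) (fun x' => by
    rw [abs_le]
    constructor <;> linarith [Real.cos_le_one (m * (g x - g x')),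
      Real.neg_one_le_cos (m * (g x - g x'))])
  have hB := key (fun x' => Real.cos (m * (g x + g x')) + ε) (fun x' => by
    rw [abs_le]
    constructor <;> linarith [Real.cos_le_one (m * (g x + g x')),
      Real.neg_one_le_cos (m * (g x + g x'))])
  have h := hA.add hB
  rw [add_zero] at h
  refine h.congr fun x' => ?_
  unfold logPrim kerA kerB
  rw [← hmdef]
  congr 3 <;> ring

/-- The two forms of the normal velocity on the interface agree. -/
lemma integral_normalKer (hl : 0 < l) (hδ : 0 < δ) (hg : ProfileBound l δ M g) (hε : 0 < ε)
    (hε1 : ε ≤ 1) (x : ℝ) : ∫ x', normalKer l ε g x x' = -pvInt l ε g x := by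
  have i1 := integrable_normalKer hl hδ hg hε x
  have i2 : Integrable fun x' => pvReg l ε g x (x - x') :=
    (integrable_pvReg hl hδ hg hε.le hε1 x).comp_sub_left x
  have hb : Tendsto (fun x' : ℝ => |x - x'|) atBot atTop :=
    tendsto_abs_atTop_atTop.comp (tendsto_atTop_add_const_left _ x tendsto_neg_atBot_atTop)
  have ht : Tendsto (fun x' : ℝ => |x - x'|) atTop atTop :=
    tendsto_abs_atBot_atTop.comp (tendsto_atBot_add_const_left _ x tendsto_neg_atTop_atBot)
  -- The primitive vanishes at both ends because `kerA/cosh` and `kerB/cosh` tend to one, so the two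
  -- integrals add up to zero.
  have h := integral_of_hasDerivAt_of_tendsto (hasDerivAt_logPrim hl hg.contDiff hε x) (i1.add i2)
    ((tendsto_logPrim hl hε x hb).const_mul _) ((tendsto_logPrim hl hε x ht).const_mul _)
  rw [integral_add i1 i2, integral_sub_left_eq_self (fun η => pvReg l ε g x η)] at h
  unfold pvInt
  linarith

end PrincipalValue

/-! ### The explicit velocity: square integrability, incompressibility, flux through the interface
-/

/-- The kernel of the horizontal velocity, up to sign and constants. -/
def intY (l ε : ℝ) (g : ℝ → ℝ) (z : ℝ × ℝ) (x' : ℝ) : ℝ :=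
  deriv g x' * kerY l ε (z.1 - x') z.2 (g x')

/-- The kernel of the vertical velocity, up to constants. -/
def intX (l ε : ℝ) (g : ℝ → ℝ) (z : ℝ × ℝ) (x' : ℝ) : ℝ :=
  deriv g x' * kerX l ε (z.1 - x') z.2 (g x')

/-- The velocity of the Darcy flow with interface `g`. -/
def velocity (l ρ₁ ρ₂ : ℝ) (g : ℝ → ℝ) (z : ℝ × ℝ) : ℝ × ℝ :=
  (-((ρ₁ - ρ₂) / (8 * l) * ∫ x', intY l 0 g z x'), (ρ₁ - ρ₂) / (8 * l) * ∫ x', intX l 0 g z x')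

section Velocity

variable {l δ M ε : ℝ} {g : ℝ → ℝ}

lemma measurable_intY (hg : Measurable g) (ε : ℝ) :
    Measurable fun q : (ℝ × ℝ) × ℝ => intY l ε g q.1 q.2 := by
  have := measurable_deriv g
  unfold intY kerY kerA kerB
  fun_prop

lemma measurable_intX (hg : Measurable g) (ε : ℝ) :
    Measurable fun q : (ℝ × ℝ) × ℝ => intX l ε g q.1 q.2 := by
  have := measurable_deriv g
  unfold intX kerX kerA kerB
  fun_prop

lemma ae_mem_strip_fst (l : ℝ) : ∀ᵐ q ∂((volume.restrict (strip l)).prod (volume : Measure ℝ)),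
    q.1 ∈ strip l :=
  Measure.quasiMeasurePreserving_fst.ae (ae_restrict_mem (measurableSet_strip l))

lemma ae_abs_int_le (hl : 0 < l) (hδ : 0 < δ) (hg : ProfileBound l δ M g) (hε : 0 ≤ ε) :
    ∀ᵐ q ∂((volume.restrict (strip l)).prod (volume : Measure ℝ)),
      |intY l ε g q.1 q.2| ≤ kerC l * singBound l (deriv g) g q.1 q.2 ∧
      |intX l ε g q.1 q.2| ≤ kerC l * singBound l (deriv g) g q.1 q.2 := by
  filter_upwards [ae_mem_strip_fst l, ae_off_interface (l := l) hg.continuous.measurable]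
    with q hq hq'
  obtain ⟨h1, h2⟩ := abs_ker_le hl hε (abs_le.2 ⟨hq.1.le, hq.2.le⟩) (hg.abs_le' hδ q.2)
    (sub_ne_zero.2 hq'.1) hq'.2
  unfold intY intX singBound
  simp only [abs_mul]
  constructor
  · calc _ ≤ |deriv g q.2| * _ := mul_le_mul_of_nonneg_left h1 (abs_nonneg _)
      _ = _ := by ring
  · calc _ ≤ |deriv g q.2| * _ := mul_le_mul_of_nonneg_left h2 (abs_nonneg _)
      _ = _ := by ring

lemma integrable_mul_intY (hl : 0 < l) (hδ : 0 < δ) (hg : ProfileBound l δ M g) (hε : 0 ≤ ε)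
    {F : ℝ × ℝ → ℝ} (hF : MemLp F 2 (volume.restrict (strip l))) :
    Integrable (fun q : (ℝ × ℝ) × ℝ => F q.1 * intY l ε g q.1 q.2)
      ((volume.restrict (strip l)).prod (volume : Measure ℝ)) :=
  integrable_mul_kernel hl (kerC_nonneg hl) (measurable_deriv g) hg.continuous.measurable
    (hg.abs_le' hδ) hg.deriv_sq_int (measurable_intY hg.continuous.measurable ε).aestronglyMeasurable
    ((ae_abs_int_le hl hδ hg hε).mono fun _ h => h.1) hF

lemma integrable_mul_intX (hl : 0 < l) (hδ : 0 < δ) (hg : ProfileBound l δ M g) (hε : 0 ≤ ε)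
    {F : ℝ × ℝ → ℝ} (hF : MemLp F 2 (volume.restrict (strip l))) :
    Integrable (fun q : (ℝ × ℝ) × ℝ => F q.1 * intX l ε g q.1 q.2)
      ((volume.restrict (strip l)).prod (volume : Measure ℝ)) :=
  integrable_mul_kernel hl (kerC_nonneg hl) (measurable_deriv g) hg.continuous.measurable
    (hg.abs_le' hδ) hg.deriv_sq_int (measurable_intX hg.continuous.measurable ε).aestronglyMeasurable
    ((ae_abs_int_le hl hδ hg hε).mono fun _ h => h.2) hF

lemma memLp_velocity (hl : 0 < l) (hδ : 0 < δ) (hg : ProfileBound l δ M g) (ρ₁ ρ₂ : ℝ) :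
    MemLp (velocity l ρ₁ ρ₂ g) 2 (volume.restrict (strip l)) := by
  have h1 := memLp_integral_kernel hl (kerC_nonneg hl) (measurable_deriv g)
    hg.continuous.measurable (hg.abs_le' hδ) hg.deriv_sq_int
    (measurable_intY (l := l) hg.continuous.measurable 0).aestronglyMeasurable
    ((ae_abs_int_le hl hδ hg le_rfl).mono fun _ h => h.1)
  have h2 := memLp_integral_kernel hl (kerC_nonneg hl) (measurable_deriv g)
    hg.continuous.measurable (hg.abs_le' hδ) hg.deriv_sq_int
    (measurable_intX (l := l) hg.continuous.measurable 0).aestronglyMeasurable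
    ((ae_abs_int_le hl hδ hg le_rfl).mono fun _ h => h.2)
  exact MemLp.of_fst_snd ⟨(h1.const_mul _).neg, h2.const_mul _⟩

/-- The pairing of the velocity kernel with a pair of square integrable functions. -/
def pairing (l ε : ℝ) (g : ℝ → ℝ) (F₁ F₂ : ℝ × ℝ → ℝ) : ℝ :=
  ∫ q, (F₂ q.1 * intX l ε g q.1 q.2 - F₁ q.1 * intY l ε g q.1 q.2)
    ∂((volume.restrict (strip l)).prod (volume : Measure ℝ))

variable {F₁ F₂ : ℝ × ℝ → ℝ}

lemma integrable_pairing (hl : 0 < l) (hδ : 0 < δ) (hg : ProfileBound l δ M g) (hε : 0 ≤ ε)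
    (h₁ : MemLp F₁ 2 (volume.restrict (strip l))) (h₂ : MemLp F₂ 2 (volume.restrict (strip l))) :
    Integrable (fun q : (ℝ × ℝ) × ℝ =>
      F₂ q.1 * intX l ε g q.1 q.2 - F₁ q.1 * intY l ε g q.1 q.2)
      ((volume.restrict (strip l)).prod (volume : Measure ℝ)) :=
  (integrable_mul_intX hl hδ hg hε h₂).sub (integrable_mul_intY hl hδ hg hε h₁)

lemma setIntegral_velocity (hl : 0 < l) (hδ : 0 < δ) (hg : ProfileBound l δ M g) (ρ₁ ρ₂ : ℝ)
    (h₁ : MemLp F₁ 2 (volume.restrict (strip l))) (h₂ : MemLp F₂ 2 (volume.restrict (strip l))) :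
    ∫ z in strip l, ((velocity l ρ₁ ρ₂ g z).1 * F₁ z + (velocity l ρ₁ ρ₂ g z).2 * F₂ z) =
      (ρ₁ - ρ₂) / (8 * l) * pairing l 0 g F₁ F₂ := by
  have i1 := integrable_mul_intY hl hδ hg le_rfl h₁
  have i2 := integrable_mul_intX hl hδ hg le_rfl h₂
  unfold pairing
  rw [integral_sub i2 i1, integral_prod _ i1, integral_prod _ i2,
    ← integral_sub i2.integral_prod_left i1.integral_prod_left, ← integral_const_mul]
  refine integral_congr_ae (ae_of_all _ fun z => ?_)
  simp only [integral_const_mul, velocity]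
  ring

lemma pairing_eq (hl : 0 < l) (hδ : 0 < δ) (hg : ProfileBound l δ M g) (hε : 0 ≤ ε)
    (h₁ : MemLp F₁ 2 (volume.restrict (strip l))) (h₂ : MemLp F₂ 2 (volume.restrict (strip l))) :
    pairing l ε g F₁ F₂ = ∫ x', deriv g x' * ∫ z in strip l,
      (F₂ z * kerX l ε (z.1 - x') z.2 (g x') - F₁ z * kerY l ε (z.1 - x') z.2 (g x')) := by
  unfold pairing
  rw [integral_prod_symm _ (integrable_pairing hl hδ hg hε h₁ h₂)]
  refine integral_congr_ae (ae_of_all _ fun x' => ?_)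
  simp only
  rw [← integral_const_mul]
  refine integral_congr_ae (ae_of_all _ fun z => ?_)
  simp only [intX, intY]
  ring

/-- The product bound of the kernels is uniform in `ε` and integrable against square integrable
functions, so it serves as majorant. This transfers identities of the smooth kernels to the singular
velocity. -/
lemma tendsto_pairing (hl : 0 < l) (hδ : 0 < δ) (hg : ProfileBound l δ M g)
    (h₁ : MemLp F₁ 2 (volume.restrict (strip l))) (h₂ : MemLp F₂ 2 (volume.restrict (strip l))) :
    Tendsto (fun ε => pairing l ε g F₁ F₂) (𝓝[>] 0) (𝓝 (pairing l 0 g F₁ F₂)) := by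
  have hgm := hg.continuous.measurable
  have hsm := measurable_singBound l (measurable_deriv g) hgm
  have hsb : ∀ᵐ q ∂((volume.restrict (strip l)).prod (volume : Measure ℝ)),
      |kerC l * singBound l (deriv g) g q.1 q.2| ≤ kerC l * singBound l (deriv g) g q.1 q.2 :=
    ae_of_all _ fun q => (abs_of_nonneg (mul_nonneg (kerC_nonneg hl)
      (singBound_nonneg _ _ _ _ _))).le
  have b1 := (integrable_mul_kernel (K := fun z x' => kerC l * singBound l (deriv g) g z x') hl
    (kerC_nonneg hl) (measurable_deriv g) hgm (hg.abs_le' hδ) hg.deriv_sq_int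
    (hsm.const_mul _).aestronglyMeasurable hsb h₁).norm
  have b2 := (integrable_mul_kernel (K := fun z x' => kerC l * singBound l (deriv g) g z x') hl
    (kerC_nonneg hl) (measurable_deriv g) hgm (hg.abs_le' hδ) hg.deriv_sq_int
    (hsm.const_mul _).aestronglyMeasurable hsb h₂).norm
  refine tendsto_integral_filter_of_dominated_convergence _ ?_ ?_ (b2.add b1) ?_
  · filter_upwards [self_mem_nhdsWithin] with ε hε
      using (integrable_pairing hl hδ hg (mem_Ioi.1 hε).le h₁ h₂).1
  · filter_upwards [self_mem_nhdsWithin] with ε hε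
    filter_upwards [ae_abs_int_le hl hδ hg (mem_Ioi.1 hε).le] with q hq
    have h0 : 0 ≤ kerC l * singBound l (deriv g) g q.1 q.2 := mul_nonneg (kerC_nonneg hl)
      (singBound_nonneg _ _ _ _ _)
    simp only [Pi.add_apply]
    refine (norm_sub_le _ _).trans (add_le_add ?_ ?_)
    · rw [norm_mul, norm_mul, Real.norm_of_nonneg h0]
      exact mul_le_mul_of_nonneg_left hq.2 (norm_nonneg _)
    · rw [norm_mul, norm_mul, Real.norm_of_nonneg h0]
      exact mul_le_mul_of_nonneg_left hq.1 (norm_nonneg _)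
  · filter_upwards [ae_off_interface (l := l) hgm] with q hq
    have hη : q.1.1 - q.2 ≠ 0 := sub_ne_zero.2 hq.1
    have hA : Tendsto (fun ε => kerA l ε (q.1.1 - q.2) q.1.2 (g q.2)) (𝓝[>] 0)
        (𝓝 (kerA l 0 (q.1.1 - q.2) q.1.2 (g q.2))) :=
      (tendsto_id.mono_left nhdsWithin_le_nhds).const_add _
    have hB : Tendsto (fun ε => kerB l ε (q.1.1 - q.2) q.1.2 (g q.2)) (𝓝[>] 0)
        (𝓝 (kerB l 0 (q.1.1 - q.2) q.1.2 (g q.2))) :=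
      (tendsto_id.mono_left nhdsWithin_le_nhds).const_add _
    have nA := (kerA_pos_of_ne (y := q.1.2) (y' := g q.2) hl le_rfl hη).ne'
    have nB := (kerB_pos_of_ne (y := q.1.2) (y' := g q.2) hl le_rfl hη).ne'
    unfold intX intY kerX kerY
    exact (((((tendsto_const_nhds.div hA nA).sub (tendsto_const_nhds.div hB nB)).const_mul
      _).const_mul _)).sub ((((tendsto_const_nhds.div hA nA).add
      (tendsto_const_nhds.div hB nB)).const_mul _).const_mul _)

lemma memLp_fderiv_apply {φ : ℝ × ℝ → ℝ} (hφ : ContDiff ℝ 1 φ) (hs : HasCompactSupport φ)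
    (v : ℝ × ℝ) : MemLp (fun z => fderiv ℝ φ z v) 2 (volume.restrict (strip l)) :=
  ((continuous_fderiv_apply' hφ v).memLp_of_hasCompactSupport
    (hasCompactSupport_fderiv_apply hs v)).restrict _

/-- The velocity is divergence free and tangent to the walls. -/
lemma setIntegral_fderiv_velocity (hl : 0 < l) (hδ : 0 < δ) (hg : ProfileBound l δ M g)
    (ρ₁ ρ₂ : ℝ) {φ : ℝ × ℝ → ℝ} (hφ : ContDiff ℝ 1 φ) (hs : HasCompactSupport φ) :
    ∫ z in strip l, fderiv ℝ φ z (velocity l ρ₁ ρ₂ g z) = 0 := by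
  have h₁ := memLp_fderiv_apply (l := l) hφ hs (1, 0)
  have h₂ := memLp_fderiv_apply (l := l) hφ hs (0, 1)
  have e : ∀ z, fderiv ℝ φ z (velocity l ρ₁ ρ₂ g z) = (velocity l ρ₁ ρ₂ g z).1 *
      fderiv ℝ φ z (1, 0) + (velocity l ρ₁ ρ₂ g z).2 * fderiv ℝ φ z (0, 1) :=
    fun z => fderiv_apply_eq φ z _ _
  simp only [e]
  rw [setIntegral_velocity hl hδ hg ρ₁ ρ₂ h₁ h₂]
  have ht := tendsto_pairing hl hδ hg h₁ h₂
  have h0 : Tendsto (fun ε => pairing l ε g (fun z => fderiv ℝ φ z (1, 0))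
      fun z => fderiv ℝ φ z (0, 1)) (𝓝[>] 0) (𝓝 0) := by
    refine tendsto_const_nhds.congr' ?_
    filter_upwards [self_mem_nhdsWithin] with ε hε
    rw [pairing_eq hl hδ hg (mem_Ioi.1 hε).le h₁ h₂]
    have : ∀ x', ∫ z in strip l, (fderiv ℝ φ z (0, 1) * kerX l ε (z.1 - x') z.2 (g x') -
        fderiv ℝ φ z (1, 0) * kerY l ε (z.1 - x') z.2 (g x')) = 0 := by
      intro x'
      refine (integral_congr_ae (ae_of_all _ fun z => ?_)).trans
        (setIntegral_strip_regularized hl (mem_Ioi.1 hε) x' (g x') hφ hs)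
      rw [fderiv_apply_eq φ z (-kerY l ε (z.1 - x') z.2 (g x'))]
      ring
    simp [this]
  rw [tendsto_nhds_unique ht h0, mul_zero]

lemma upperDomain_eq (l : ℝ) (g : ℝ → ℝ) : upperDomain l g = strip l ∩ epi g := rfl

/-- The flux of the velocity through the interface. -/
lemma setIntegral_upperDomain_velocity (hl : 0 < l) (hδ : 0 < δ) (hg : ProfileBound l δ M g)
    (ρ₁ ρ₂ : ℝ) {φ : ℝ × ℝ → ℝ} (hφ : ContDiff ℝ 1 φ) (hs : HasCompactSupport φ)
    (hsupp : tsupport φ ⊆ strip l) :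
    ∫ z in upperDomain l g, fderiv ℝ φ z (velocity l ρ₁ ρ₂ g z) =
      (ρ₁ - ρ₂) / (8 * l) * ∫ x, φ (x, g x) * pvInt l 0 g x := by
  have hem := (isOpen_epi hg.continuous).measurableSet
  have h₁ := (memLp_fderiv_apply (l := l) hφ hs (1, 0)).indicator hem
  have h₂ := (memLp_fderiv_apply (l := l) hφ hs (0, 1)).indicator hem
  set F₁ := (epi g).indicator fun z => fderiv ℝ φ z (1, 0) with hF₁
  set F₂ := (epi g).indicator fun z => fderiv ℝ φ z (0, 1) with hF₂
  have hzero : ∀ z, z ∉ strip l → ∀ v, fderiv ℝ φ z v = 0 := by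
    intro z hz v
    have : fderiv ℝ φ z = 0 :=
      image_eq_zero_of_notMem_tsupport fun h => hz (hsupp (tsupport_fderiv_subset ℝ h))
    simp [this]
  have e : ∫ z in upperDomain l g, fderiv ℝ φ z (velocity l ρ₁ ρ₂ g z) =
      ∫ z in strip l, ((velocity l ρ₁ ρ₂ g z).1 * F₁ z + (velocity l ρ₁ ρ₂ g z).2 * F₂ z) := by
    rw [upperDomain_eq, ← setIntegral_indicator hem]
    refine integral_congr_ae (ae_of_all _ fun z => ?_)
    simp only [hF₁, hF₂, indicator]
    split_ifs
    · exact fderiv_apply_eq φ z _ _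
    · simp
  rw [e, setIntegral_velocity hl hδ hg ρ₁ ρ₂ h₁ h₂]
  congr 1
  -- Both sides are identified as the limit of the same regularized pairing as `ε → 0`.
  refine tendsto_nhds_unique (tendsto_pairing hl hδ hg h₁ h₂) ?_
  have hφg : Continuous fun x => φ (x, g x) := by
    have := hφ.continuous; have := hg.continuous; fun_prop
  have hφs : HasCompactSupport fun x => φ (x, g x) := hasCompactSupport_slice hs g
  have hφi : Integrable (fun x => φ (x, g x)) (volume : Measure ℝ) := hφg.integrable_of_hasCompactSupport hφs
  have hpv : Tendsto (fun ε => ∫ x, φ (x, g x) * pvInt l ε g x) (𝓝[>] 0)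
      (𝓝 (∫ x, φ (x, g x) * pvInt l 0 g x)) := by
    have hev : ∀ᶠ ε in 𝓝[>] (0 : ℝ), ε ∈ Icc (0 : ℝ) 1 := by
      filter_upwards [Ioo_mem_nhdsGT (zero_lt_one' ℝ)] with ε hε using ⟨hε.1.le, hε.2.le⟩
    refine tendsto_integral_filter_of_dominated_convergence (fun x => ‖φ (x, g x)‖ *
      ∫ η, pvC l δ M * Real.exp (-(Real.pi / (4 * l)) * |η|)) ?_ ?_ (hφi.norm.mul_const _) ?_
    · filter_upwards [hev] with ε hε
      have hc : Continuous (pvInt l ε g) := continuous_iff_continuousAt.2 fun x =>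
        tendsto_pvInt (e := fun _ => ε) (G := fun _ => g) (X := fun x => x) hl hδ hε.1
          tendsto_const_nhds (Eventually.of_forall fun _ => hε) (Eventually.of_forall fun _ => hg)
          (fun η => (hg.continuous.tendsto _).comp (tendsto_id.sub_const η))
          (fun η => (hg.continuous_deriv.tendsto _).comp (tendsto_id.sub_const η))
      exact (hφg.mul hc).aestronglyMeasurable
    · filter_upwards [hev] with ε hε
      refine ae_of_all _ fun x => ?_
      rw [norm_mul]
      exact mul_le_mul_of_nonneg_left (abs_pvInt_le hl hδ hg hε.1 hε.2 x) (norm_nonneg _)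
    · refine ae_of_all _ fun x => Tendsto.const_mul _ ?_
      exact tendsto_pvInt (e := fun ε => ε) (G := fun _ => g) (X := fun _ => x) hl hδ le_rfl
        (tendsto_id.mono_left nhdsWithin_le_nhds) hev (Eventually.of_forall fun _ => hg)
        (fun η => tendsto_const_nhds) fun η => tendsto_const_nhds
  refine hpv.congr' ?_
  filter_upwards [Ioo_mem_nhdsGT (zero_lt_one' ℝ)] with ε hε
  rw [pairing_eq hl hδ hg hε.1.le h₁ h₂]
  -- For each source point of the sheet, the divergence theorem above the graph reduces the area
  -- integral to the flux through the graph; nothing comes from the walls since `φ` vanishes near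
  -- them.
  have hin : ∀ x', ∫ z in strip l, (F₂ z * kerX l ε (z.1 - x') z.2 (g x') -
      F₁ z * kerY l ε (z.1 - x') z.2 (g x')) = -∫ x, φ (x, g x) *
      (kerX l ε (x - x') (g x) (g x') + deriv g x * kerY l ε (x - x') (g x) (g x')) := by
    intro x'
    rw [← setIntegral_epi_regularized hε.1 x' (g x') hg.contDiff hφ hs,
      ← integral_indicator hem, ← integral_indicator (measurableSet_strip l)]
    refine integral_congr_ae (ae_of_all _ fun z => ?_)
    simp only [indicator, hF₁, hF₂]
    by_cases hz : z ∈ strip l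
    · rw [if_pos hz]
      split_ifs
      · rw [fderiv_apply_eq φ z (-kerY l ε (z.1 - x') z.2 (g x'))]; ring
      · ring
    · rw [if_neg hz]
      simp [hzero z hz]
  simp only [hin]
  have hI : Integrable (fun q : ℝ × ℝ => φ (q.1, g q.1) * normalKer l ε g q.1 q.2)
      ((volume : Measure ℝ).prod volume) := by
    have hcn : Continuous fun q : ℝ × ℝ => φ (q.1, g q.1) * normalKer l ε g q.1 q.2 :=
      (hφg.comp continuous_fst).mul (continuous_normalKer hg hε.1)
    have hexp := (integrable_exp_abs (b := Real.pi / (4 * l))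
      (by have := Real.pi_pos; positivity)).const_mul (M * (1 + M) * (4 * √(1 + 2 / ε)))
    refine (integrable_prod_iff hcn.aestronglyMeasurable).2 ⟨ae_of_all _ fun x =>
      (integrable_normalKer hl hδ hg hε.1 x).const_mul (φ (x, g x)), ?_⟩
    refine (hφi.norm.mul_const (∫ η, M * (1 + M) * (4 * √(1 + 2 / ε)) *
      Real.exp (-(Real.pi / (4 * l)) * |η|))).mono'
      hcn.norm.aestronglyMeasurable.integral_prod_right' (ae_of_all _ fun x => ?_)
    rw [Real.norm_of_nonneg (integral_nonneg fun _ => norm_nonneg _)]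
    simp only [norm_mul (φ _)]
    rw [integral_const_mul]
    refine mul_le_mul_of_nonneg_left ?_ (norm_nonneg _)
    rw [← integral_sub_left_eq_self (fun η => M * (1 + M) * (4 * √(1 + 2 / ε)) *
      Real.exp (-(Real.pi / (4 * l)) * |η|)) volume x]
    exact integral_mono (integrable_normalKer hl hδ hg hε.1 x).norm (hexp.comp_sub_left x)
      fun x' => abs_normalKer_le hl hδ hg hε.1 x x'
  have e2 : ∀ x', deriv g x' * -∫ x, φ (x, g x) *
      (kerX l ε (x - x') (g x) (g x') + deriv g x * kerY l ε (x - x') (g x) (g x')) =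
      -∫ x, φ (x, g x) * normalKer l ε g x x' := by
    intro x'
    rw [mul_neg, ← integral_const_mul]
    congr 1
    refine integral_congr_ae (ae_of_all _ fun x => ?_)
    simp only [normalKer]
    ring
  simp only [e2]
  -- After the swap the inner integral runs over source points at a fixed point of the interface:
  -- the normal velocity there, which is minus the principal value.
  rw [integral_neg, ← integral_integral_swap hI, ← integral_neg]
  refine integral_congr_ae (ae_of_all _ fun x => ?_)
  simp only
  rw [integral_const_mul, integral_normalKer hl hδ hg hε.1 hε.2.le]
  ring

end Velocity

/-! ### The conjugate Green function: gradient, decay and jump -/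

/-- The harmonic conjugate of the Green function of the strip, cut along `η = 0`. -/
def conjGreen (l η y y' : ℝ) : ℝ :=
  2 * Real.arctan (Real.tan (Real.pi / (2 * l) * (y - y') / 2) /
    Real.tanh (Real.pi / (2 * l) * η / 2)) -
  2 * Real.arctan (Real.tanh (Real.pi / (2 * l) * η / 2) *
    Real.tan (Real.pi / (2 * l) * (y + y') / 2))

lemma abs_half_angle_lt {l y : ℝ} (hl : 0 < l) (hy : |y| < 2 * l) :
    |Real.pi / (2 * l) * y / 2| < Real.pi / 2 := by
  have hm : 0 < Real.pi / (2 * l) := by have := Real.pi_pos; positivity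
  rw [abs_div, abs_mul, abs_of_pos hm, abs_two]
  have : Real.pi / (2 * l) * |y| < Real.pi / (2 * l) * (2 * l) := by gcongr
  rw [div_mul_cancel₀ _ (by positivity)] at this
  linarith

lemma cos_half_angle_pos {l y : ℝ} (hl : 0 < l) (hy : |y| < 2 * l) :
    0 < Real.cos (Real.pi / (2 * l) * y / 2) :=
  Real.cos_pos_of_mem_Ioo (abs_lt.1 (abs_half_angle_lt hl hy))

lemma kerY_eq_half {l η y y' : ℝ} : kerY l 0 η y y' =
    Real.sin (Real.pi / (2 * l) * (y - y') / 2) * Real.cos (Real.pi / (2 * l) * (y - y') / 2) /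
      (Real.sinh (Real.pi / (2 * l) * η / 2) ^ 2 + Real.sin (Real.pi / (2 * l) * (y - y') / 2) ^ 2) +
    Real.sin (Real.pi / (2 * l) * (y + y') / 2) * Real.cos (Real.pi / (2 * l) * (y + y') / 2) /
      (Real.sinh (Real.pi / (2 * l) * η / 2) ^ 2 +
        Real.cos (Real.pi / (2 * l) * (y + y') / 2) ^ 2) := by
  unfold kerY
  rw [kerA_eq, kerB_eq, kerP]
  have h (w : ℝ) : Real.sin w = 2 * (Real.sin (w / 2) * Real.cos (w / 2)) := by
    rw [← mul_assoc, ← Real.sin_two_mul, mul_div_cancel₀ _ two_ne_zero]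
  rw [h (Real.pi / (2 * l) * (y - y')), h (Real.pi / (2 * l) * (y + y')),
    mul_div_mul_left _ _ two_ne_zero, mul_div_mul_left _ _ two_ne_zero, zero_div, add_zero, add_zero]

lemma kerX_eq_half {l η y y' : ℝ} : kerX l 0 η y y' =
    Real.sinh (Real.pi / (2 * l) * η / 2) * Real.cosh (Real.pi / (2 * l) * η / 2) /
      (Real.sinh (Real.pi / (2 * l) * η / 2) ^ 2 + Real.sin (Real.pi / (2 * l) * (y - y') / 2) ^ 2) -
    Real.sinh (Real.pi / (2 * l) * η / 2) * Real.cosh (Real.pi / (2 * l) * η / 2) /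
      (Real.sinh (Real.pi / (2 * l) * η / 2) ^ 2 +
        Real.cos (Real.pi / (2 * l) * (y + y') / 2) ^ 2) := by
  unfold kerX
  rw [kerA_eq, kerB_eq, kerP]
  have h (w : ℝ) : Real.sinh w = 2 * (Real.sinh (w / 2) * Real.cosh (w / 2)) := by
    rw [← mul_assoc, ← Real.sinh_two_mul, mul_div_cancel₀ _ two_ne_zero]
  rw [h (Real.pi / (2 * l) * η),
    mul_div_mul_left _ _ two_ne_zero, mul_div_mul_left _ _ two_ne_zero, zero_div, add_zero, add_zero]

lemma hasDerivAt_tanh' (x : ℝ) : HasDerivAt Real.tanh (1 / Real.cosh x ^ 2) x := by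
  have h := (Real.hasDerivAt_sinh x).div (Real.hasDerivAt_cosh x) (Real.cosh_pos x).ne'
  have e : Real.tanh = fun x => Real.sinh x / Real.cosh x := funext Real.tanh_eq_sinh_div_cosh
  rw [e]
  refine h.congr_deriv ?_
  congr 1
  have := Real.cosh_sq x
  nlinarith

lemma hasDerivAt_arctan_div_tanh {t a : ℝ} {s c : ℝ} (ht : t = s / c) (hc : c ≠ 0)
    (hsc : s ^ 2 + c ^ 2 = 1) (ha : a ≠ 0) :
    HasDerivAt (fun a => Real.arctan (t / Real.tanh a)) (-(s * c / (Real.sinh a ^ 2 + s ^ 2))) a := by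
  have hS : Real.sinh a ≠ 0 := Real.sinh_ne_zero.2 ha
  have hC := (Real.cosh_pos a).ne'
  have hT : Real.tanh a ≠ 0 := by
    rw [Real.tanh_eq_sinh_div_cosh]; exact div_ne_zero hS hC
  have h := (((hasDerivAt_const a t).div (hasDerivAt_tanh' a) hT)).arctan
  refine h.congr_deriv ?_
  have hCS := Real.cosh_sq a
  have hp : Real.sinh a ^ 2 + s ^ 2 ≠ 0 := by positivity
  simp only [Pi.div_apply]
  rw [Real.tanh_eq_sinh_div_cosh, ht]
  -- This identity, from `cosh² = sinh² + 1` and `s² + c² = 1`, turns the denominator of the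
  -- `arctan` derivative into the half-angle denominator of the kernels.
  have hq : c ^ 2 * Real.sinh a ^ 2 + s ^ 2 * Real.cosh a ^ 2 = Real.sinh a ^ 2 + s ^ 2 := by
    rw [hCS]; linear_combination Real.sinh a ^ 2 * hsc
  have hq' : 1 + (s / c / (Real.sinh a / Real.cosh a)) ^ 2 =
      (Real.sinh a ^ 2 + s ^ 2) / (c * Real.sinh a) ^ 2 := by
    rw [← hq]; field_simp
  rw [hq']
  field_simp
  ring

lemma hasDerivAt_arctan_tanh_mul {t a : ℝ} {s c : ℝ} (ht : t = s / c) (hc : c ≠ 0)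
    (hsc : s ^ 2 + c ^ 2 = 1) :
    HasDerivAt (fun a => Real.arctan (Real.tanh a * t)) (s * c / (Real.sinh a ^ 2 + c ^ 2)) a := by
  have hC := (Real.cosh_pos a).ne'
  have h := ((hasDerivAt_tanh' a).mul_const t).arctan
  refine h.congr_deriv ?_
  have hCS := Real.cosh_sq a
  have hp : Real.sinh a ^ 2 + c ^ 2 ≠ 0 := by positivity
  rw [Real.tanh_eq_sinh_div_cosh, ht]
  have hq : c ^ 2 * Real.cosh a ^ 2 + s ^ 2 * Real.sinh a ^ 2 = Real.sinh a ^ 2 + c ^ 2 := by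
    rw [hCS]; linear_combination Real.sinh a ^ 2 * hsc
  have hq' : 1 + (Real.sinh a / Real.cosh a * (s / c)) ^ 2 =
      (Real.sinh a ^ 2 + c ^ 2) / (c * Real.cosh a) ^ 2 := by
    rw [← hq]; field_simp
  rw [hq']
  field_simp

lemma hasDerivAt_arctan_tan_div {a b : ℝ} (hc : Real.cos b ≠ 0) (ha : a ≠ 0) :
    HasDerivAt (fun b => Real.arctan (Real.tan b / Real.tanh a))
      (Real.sinh a * Real.cosh a / (Real.sinh a ^ 2 + Real.sin b ^ 2)) b := by
  have hS : Real.sinh a ≠ 0 := Real.sinh_ne_zero.2 ha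
  have hC := (Real.cosh_pos a).ne'
  have h := ((Real.hasDerivAt_tan hc).div_const (Real.tanh a)).arctan
  refine h.congr_deriv ?_
  have hCS := Real.cosh_sq a
  have hsc := Real.sin_sq_add_cos_sq b
  have hp : Real.sinh a ^ 2 + Real.sin b ^ 2 ≠ 0 := by positivity
  rw [Real.tanh_eq_sinh_div_cosh, Real.tan_eq_sin_div_cos]
  have hq : Real.cos b ^ 2 * Real.sinh a ^ 2 + Real.sin b ^ 2 * Real.cosh a ^ 2 =
      Real.sinh a ^ 2 + Real.sin b ^ 2 := by
    rw [hCS]; linear_combination Real.sinh a ^ 2 * hsc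
  have hq' : 1 + (Real.sin b / Real.cos b / (Real.sinh a / Real.cosh a)) ^ 2 =
      (Real.sinh a ^ 2 + Real.sin b ^ 2) / (Real.cos b * Real.sinh a) ^ 2 := by
    rw [← hq]; field_simp
  rw [hq']
  field_simp

lemma hasDerivAt_arctan_mul_tan {a b : ℝ} (hc : Real.cos b ≠ 0) :
    HasDerivAt (fun b => Real.arctan (Real.tanh a * Real.tan b))
      (Real.sinh a * Real.cosh a / (Real.sinh a ^ 2 + Real.cos b ^ 2)) b := by
  have hC := (Real.cosh_pos a).ne'
  have h := ((Real.hasDerivAt_tan hc).const_mul (Real.tanh a)).arctan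
  refine h.congr_deriv ?_
  have hCS := Real.cosh_sq a
  have hsc := Real.sin_sq_add_cos_sq b
  have hp : Real.sinh a ^ 2 + Real.cos b ^ 2 ≠ 0 := by positivity
  rw [Real.tanh_eq_sinh_div_cosh, Real.tan_eq_sin_div_cos]
  have hq : Real.cos b ^ 2 * Real.cosh a ^ 2 + Real.sin b ^ 2 * Real.sinh a ^ 2 =
      Real.sinh a ^ 2 + Real.cos b ^ 2 := by
    rw [hCS]; linear_combination Real.sinh a ^ 2 * hsc
  have hq' : 1 + (Real.sinh a / Real.cosh a * (Real.sin b / Real.cos b)) ^ 2 =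
      (Real.sinh a ^ 2 + Real.cos b ^ 2) / (Real.cos b * Real.cosh a) ^ 2 := by
    rw [← hq]; field_simp
  rw [hq']
  field_simp

variable {l : ℝ}

/-- Cauchy–Riemann: off the cut, the gradient of `conjGreen` is `m (-kerY, kerX)`, a multiple of the
velocity kernel. Thus each vortex of the sheet has a potential, from which the pressure is
assembled. -/
lemma hasDerivAt_conjGreen_fst (hl : 0 < l) {x x' y y' : ℝ} (hy : |y| < l) (hy' : |y'| < l)
    (hx : x ≠ x') : HasDerivAt (fun x => conjGreen l (x - x') y y')
      (-(Real.pi / (2 * l) * kerY l 0 (x - x') y y')) x := by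
  have h1 : |y - y'| < 2 * l := by have := abs_sub y y'; linarith
  have h2 : |y + y'| < 2 * l := by have := abs_add_le y y'; linarith
  have c1 := (cos_half_angle_pos hl h1).ne'
  have c2 := (cos_half_angle_pos hl h2).ne'
  have hm : Real.pi / (2 * l) ≠ 0 := by have := Real.pi_pos; positivity
  have ha : Real.pi / (2 * l) * (x - x') / 2 ≠ 0 :=
    div_ne_zero (mul_ne_zero hm (sub_ne_zero.2 hx)) two_ne_zero
  have hi : HasDerivAt (fun x => Real.pi / (2 * l) * (x - x') / 2) (Real.pi / (2 * l) / 2) x := by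
    have := (((hasDerivAt_id x).sub_const x').const_mul (Real.pi / (2 * l))).div_const 2
    simpa using this
  have d1 := ((hasDerivAt_arctan_div_tanh (Real.tan_eq_sin_div_cos _) c1
    (Real.sin_sq_add_cos_sq _) ha).comp x hi).const_mul 2
  have d2 := ((hasDerivAt_arctan_tanh_mul (a := Real.pi / (2 * l) * (x - x') / 2)
    (Real.tan_eq_sin_div_cos _) c2 (Real.sin_sq_add_cos_sq _)).comp x hi).const_mul 2
  refine (d1.sub d2).congr_deriv ?_
  rw [kerY_eq_half]
  ring

lemma hasDerivAt_conjGreen_snd (hl : 0 < l) {η y y' : ℝ} (hy : |y| < l) (hy' : |y'| < l)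
    (hη : η ≠ 0) : HasDerivAt (fun y => conjGreen l η y y')
      (Real.pi / (2 * l) * kerX l 0 η y y') y := by
  have h1 : |y - y'| < 2 * l := by have := abs_sub y y'; linarith
  have h2 : |y + y'| < 2 * l := by have := abs_add_le y y'; linarith
  have c1 := (cos_half_angle_pos hl h1).ne'
  have c2 := (cos_half_angle_pos hl h2).ne'
  have hm : Real.pi / (2 * l) ≠ 0 := by have := Real.pi_pos; positivity
  have ha : Real.pi / (2 * l) * η / 2 ≠ 0 := div_ne_zero (mul_ne_zero hm hη) two_ne_zero
  have i1 : HasDerivAt (fun y => Real.pi / (2 * l) * (y - y') / 2) (Real.pi / (2 * l) / 2) y := by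
    have := (((hasDerivAt_id y).sub_const y').const_mul (Real.pi / (2 * l))).div_const 2
    simpa using this
  have i2 : HasDerivAt (fun y => Real.pi / (2 * l) * (y + y') / 2) (Real.pi / (2 * l) / 2) y := by
    have := (((hasDerivAt_id y).add_const y').const_mul (Real.pi / (2 * l))).div_const 2
    simpa using this
  have d1 := ((hasDerivAt_arctan_tan_div c1 ha).comp y i1).const_mul 2
  have d2 := ((hasDerivAt_arctan_mul_tan (a := Real.pi / (2 * l) * η / 2) c2).comp y i2).const_mul 2
  refine (d1.sub d2).congr_deriv ?_
  rw [kerX_eq_half]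
  ring

lemma abs_conjGreen_le (l η y y' : ℝ) : |conjGreen l η y y'| ≤ 2 * Real.pi := by
  unfold conjGreen
  set p := Real.arctan (Real.tan (Real.pi / (2 * l) * (y - y') / 2) /
    Real.tanh (Real.pi / (2 * l) * η / 2)) with hp
  set q := Real.arctan (Real.tanh (Real.pi / (2 * l) * η / 2) *
    Real.tan (Real.pi / (2 * l) * (y + y') / 2)) with hq
  have h1 : |p| < Real.pi / 2 := abs_lt.2 ⟨Real.neg_pi_div_two_lt_arctan _, Real.arctan_lt_pi_div_two _⟩
  have h2 : |q| < Real.pi / 2 := abs_lt.2 ⟨Real.neg_pi_div_two_lt_arctan _, Real.arctan_lt_pi_div_two _⟩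
  rw [abs_lt] at h1 h2
  rw [abs_le]
  constructor <;> linarith

lemma conjGreen_neg (l η y y' : ℝ) : conjGreen l (-η) y y' = -conjGreen l η y y' := by
  unfold conjGreen
  rw [show Real.pi / (2 * l) * -η / 2 = -(Real.pi / (2 * l) * η / 2) by ring, Real.tanh_neg, div_neg,
    neg_mul, Real.arctan_neg, Real.arctan_neg]
  ring

/-- The derivative in `r` of `arctan (r t)` is `t/(1 + r²t²)`, at most `1/(2r)` in absolute value
whatever `t` is. Uniformity in `t` is needed because the tangents inserted later are unbounded. -/
lemma abs_arctan_mul_sub_le {s t u : ℝ} (hu : 0 < u) (hs : u ≤ s) (hu1 : u ≤ 1) :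
    |Real.arctan (s * t) - Real.arctan t| ≤ |s - 1| / (2 * u) := by
  have hd : ∀ r ∈ Ici u, HasDerivWithinAt (fun r => Real.arctan (r * t))
      (1 / (1 + (r * t) ^ 2) * t) (Ici u) r := by
    intro r _
    have := ((hasDerivAt_id r).mul_const t).arctan.hasDerivWithinAt (s := Ici u)
    simpa using this
  have := (convex_Ici u).norm_image_sub_le_of_norm_hasDerivWithin_le (C := 1 / (2 * u)) hd ?_
    (mem_Ici.2 hu1) (mem_Ici.2 hs)
  · simp only [one_mul, Real.norm_eq_abs] at this
    calc _ ≤ 1 / (2 * u) * |s - 1| := this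
      _ = _ := by ring
  · intro r hr
    have hr0 : u ≤ r := hr
    rw [norm_mul, Real.norm_eq_abs, Real.norm_eq_abs, abs_of_pos (by positivity), div_mul_eq_mul_div,
      one_mul, div_le_div_iff₀ (by positivity) (by positivity), one_mul]
    have h1 : 2 * (r * |t|) ≤ 1 + (r * t) ^ 2 := by
      have := sq_nonneg (r * |t| - 1)
      have e : (r * t) ^ 2 = (r * |t|) ^ 2 := by rw [mul_pow, mul_pow, sq_abs]
      rw [e]; nlinarith
    have : |t| * (2 * u) ≤ |t| * (2 * r) := by gcongr
    linarith

/-- As `η → ∞` the `tanh` tends to one and `arctan ∘ tan` leaves `m(y - y') - m(y + y') = -(π/l)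
y'`. So `conjGreen` does not decay, but its limit is linear in `y'` and is reached exponentially
fast. -/
lemma abs_conjGreen_le_half (hl : 0 < l) {η y y' : ℝ} (hy : |y| < l) (hy' : |y'| < l) :
    |conjGreen l η y y'| ≤ Real.pi / l * |y'| +
      8 * Real.pi * Real.exp (-(Real.pi / (2 * l)) * η) := by
  have hπ := Real.pi_gt_three
  have h1 : |y - y'| < 2 * l := by have := abs_sub y y'; linarith
  have h2 : |y + y'| < 2 * l := by have := abs_add_le y y'; linarith
  have hm : 0 < Real.pi / (2 * l) := by positivity
  set E := Real.exp (-(Real.pi / (2 * l)) * η) with hE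
  have hE0 : 0 < E := Real.exp_pos _
  have hl' : 0 ≤ Real.pi / l * |y'| := by positivity
  rcases le_or_gt (1 / 2) E with h | h
  · have := abs_conjGreen_le l η y y'
    nlinarith
  set T := Real.tanh (Real.pi / (2 * l) * η / 2) with hT
  have hTE : T = (1 - E) / (1 + E) := by
    rw [hT, Real.tanh_eq_sinh_div_cosh, Real.sinh_eq, Real.cosh_eq]
    have e : E = Real.exp (-(Real.pi / (2 * l) * η / 2)) * Real.exp (-(Real.pi / (2 * l) * η / 2)) := by
      rw [hE, ← Real.exp_add]; congr 1; ring
    have e2 : Real.exp (Real.pi / (2 * l) * η / 2) * Real.exp (-(Real.pi / (2 * l) * η / 2)) = 1 := by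
      rw [← Real.exp_add]; simp
    set P := Real.exp (Real.pi / (2 * l) * η / 2)
    set N := Real.exp (-(Real.pi / (2 * l) * η / 2))
    have hP : 0 < P := Real.exp_pos _
    have hN : 0 < N := Real.exp_pos _
    rw [e]
    have : P + N ≠ 0 := by positivity
    field_simp
    linear_combination (2 * N) * e2
  have hT0 : 1 / 3 ≤ T := by
    rw [hTE, div_le_div_iff₀ (by norm_num) (by positivity)]; linarith
  have hT1 : T ≤ 1 := by rw [hTE, div_le_one (by positivity)]; linarith
  have h1T : 1 - T ≤ 2 * E := by
    rw [hTE, sub_le_iff_le_add, ← sub_le_iff_le_add', le_div_iff₀ (by positivity)]; nlinarith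
  have a1 := abs_arctan_mul_sub_le (s := T⁻¹) (t := Real.tan (Real.pi / (2 * l) * (y - y') / 2))
    one_pos ((one_le_inv₀ (by linarith)).2 hT1) le_rfl
  have a2 := abs_arctan_mul_sub_le (s := T) (t := Real.tan (Real.pi / (2 * l) * (y + y') / 2))
    (by norm_num : (0 : ℝ) < 1 / 3) hT0 (by norm_num)
  have b1 := abs_lt.1 (abs_half_angle_lt hl h1)
  have b2 := abs_lt.1 (abs_half_angle_lt hl h2)
  rw [Real.arctan_tan b1.1 b1.2] at a1
  rw [Real.arctan_tan b2.1 b2.2] at a2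
  have e1 : |T⁻¹ - 1| ≤ 6 * E := by
    rw [abs_of_nonneg (by have := (one_le_inv₀ (show 0 < T by linarith)).2 hT1; linarith)]
    rw [sub_le_iff_le_add, inv_le_iff_one_le_mul₀ (by linarith)]
    nlinarith
  have e2 : |T - 1| ≤ 2 * E := by rw [abs_sub_comm, abs_of_nonneg (by linarith)]; exact h1T
  have a1' := a1.trans (div_le_div_of_nonneg_right e1 (by norm_num))
  have a2' := a2.trans (div_le_div_of_nonneg_right e2 (by norm_num))
  unfold conjGreen
  rw [← hT, div_eq_inv_mul]
  rw [abs_le] at a1' a2'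
  have hyy : |Real.pi / l * y'| = Real.pi / l * |y'| := by
    rw [abs_mul, abs_of_pos (by positivity)]
  rw [← hyy]
  have habs := abs_le.1 (le_refl |Real.pi / l * y'|)
  have e3 : Real.pi / (2 * l) * (y - y') / 2 - Real.pi / (2 * l) * (y + y') / 2 =
      -(Real.pi / l * y') / 2 := by field_simp; ring
  have hEπ : 3 * E ≤ Real.pi * E := by gcongr
  generalize Real.pi / l * y' = w at *
  generalize Real.arctan (T⁻¹ * Real.tan (Real.pi / (2 * l) * (y - y') / 2)) = p at *
  generalize Real.arctan (T * Real.tan (Real.pi / (2 * l) * (y + y') / 2)) = q at *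
  generalize Real.pi / (2 * l) * (y - y') / 2 = b at *
  generalize Real.pi / (2 * l) * (y + y') / 2 = b' at *
  obtain ⟨a3, a4⟩ := a1'
  obtain ⟨a5, a6⟩ := a2'
  obtain ⟨a7, a8⟩ := habs
  rw [show 6 * E / (2 * 1) = 3 * E by ring] at a3 a4
  rw [show 2 * E / (2 * (1 / 3)) = 3 * E by ring] at a5 a6
  rw [abs_le, mul_assoc 8]
  generalize Real.pi * E = F at *
  constructor <;> linarith only [a3, a4, a5, a6, a7, a8, e3, hEπ, hE0]

lemma abs_conjGreen_le_exp (hl : 0 < l) {y y' : ℝ} (hy : |y| < l) (hy' : |y'| < l) (η : ℝ) :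
    |conjGreen l η y y'| ≤ Real.pi / l * |y'| +
      8 * Real.pi * Real.exp (-(Real.pi / (2 * l)) * |η|) := by
  have hπ := Real.pi_pos
  rcases lt_trichotomy η 0 with h | h | h
  · rw [← neg_neg η, conjGreen_neg, abs_neg, abs_neg, abs_of_pos (neg_pos.2 h)]
    exact abs_conjGreen_le_half hl hy hy'
  · subst h
    have := abs_conjGreen_le l 0 y y'
    have : 0 ≤ Real.pi / l * |y'| := by positivity
    simp only [abs_zero, mul_zero, Real.exp_zero]
    linarith
  · rw [abs_of_pos h]; exact abs_conjGreen_le_half hl hy hy'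

/-- As `tanh → 0⁺` the first `arctan` goes to `±π/2` according to the sign of `y - y'`, and the
second to zero. By oddness in `η` the jump across the cut is `2π` times that sign. -/
lemma tendsto_conjGreen_right (hl : 0 < l) {y y' : ℝ} (hy : |y| < l) (hy' : |y'| < l)
    (hne : y ≠ y') : Tendsto (fun η => conjGreen l η y y') (𝓝[>] 0)
      (𝓝 (Real.pi * SignType.sign (y - y'))) := by
  have hm : 0 < Real.pi / (2 * l) := by have := Real.pi_pos; positivity
  have h1 : |y - y'| < 2 * l := by have := abs_sub y y'; linarith
  have hT : Tendsto (fun η => Real.tanh (Real.pi / (2 * l) * η / 2)) (𝓝[>] 0) (𝓝[>] 0) := by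
    refine tendsto_nhdsWithin_iff.2 ⟨?_, ?_⟩
    · have : Tendsto (fun η => Real.tanh (Real.pi / (2 * l) * η / 2)) (𝓝 0)
          (𝓝 (Real.tanh (Real.pi / (2 * l) * 0 / 2))) :=
        (continuous_tanh.comp (by fun_prop)).tendsto 0
      simp only [mul_zero, zero_div, Real.tanh_zero] at this
      exact this.mono_left nhdsWithin_le_nhds
    · filter_upwards [self_mem_nhdsWithin] with η hη
      have hη : 0 < η := hη
      rw [mem_Ioi, Real.tanh_eq_sinh_div_cosh]
      exact div_pos (Real.sinh_pos_iff.2 (by positivity)) (Real.cosh_pos _)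
  have b1 := abs_lt.1 (abs_half_angle_lt hl h1)
  have l2 : Tendsto (fun η => 2 * Real.arctan (Real.tanh (Real.pi / (2 * l) * η / 2) *
      Real.tan (Real.pi / (2 * l) * (y + y') / 2))) (𝓝[>] 0) (𝓝 0) := by
    have := ((Real.continuous_arctan.tendsto _).comp ((tendsto_nhdsWithin_iff.1 hT).1.mul_const
      (Real.tan (Real.pi / (2 * l) * (y + y') / 2)))).const_mul 2
    simpa using this
  have hinv := tendsto_inv_nhdsGT_zero.comp hT
  have l1 : Tendsto (fun η => 2 * Real.arctan (Real.tan (Real.pi / (2 * l) * (y - y') / 2) /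
      Real.tanh (Real.pi / (2 * l) * η / 2))) (𝓝[>] 0)
      (𝓝 (Real.pi * SignType.sign (y - y'))) := by
    simp only [div_eq_mul_inv (Real.tan _)]
    rcases lt_or_gt_of_ne hne with h | h
    · have ht : Real.tan (Real.pi / (2 * l) * (y - y') / 2) < 0 := by
        apply Real.tan_neg_of_neg_of_pi_div_two_lt _ b1.1
        have : Real.pi / (2 * l) * (y - y') < 0 := mul_neg_of_pos_of_neg hm (by linarith)
        linarith
      have := ((Real.tendsto_arctan_atBot.mono_right nhdsWithin_le_nhds).comp
        (hinv.const_mul_atTop_of_neg ht)).const_mul 2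
      rw [sign_neg (sub_neg.2 h)]
      convert! this using 2
      simp; ring
    · have ht : 0 < Real.tan (Real.pi / (2 * l) * (y - y') / 2) := by
        apply Real.tan_pos_of_pos_of_lt_pi_div_two _ b1.2
        have : 0 < Real.pi / (2 * l) * (y - y') := mul_pos hm (by linarith)
        linarith
      have := ((Real.tendsto_arctan_atTop.mono_right nhdsWithin_le_nhds).comp
        (hinv.const_mul_atTop ht)).const_mul 2
      rw [sign_pos (sub_pos.2 h)]
      convert! this using 2
      simp; ring
  have := l1.sub l2
  rw [sub_zero] at this
  exact this

/-! ### Distributional gradient of the conjugate Green function -/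

section Jump

variable {H H' u u' : ℝ → ℝ} {a L R : ℝ}

/-- Integration by parts for a function with a jump. -/
lemma integral_mul_deriv_of_jump (hH : ∀ x, x ≠ a → HasDerivAt H (H' x) x)
    (hR : Tendsto H (𝓝[>] a) (𝓝 R)) (hL : Tendsto H (𝓝[<] a) (𝓝 L))
    (hu : ∀ x, HasDerivAt u (u' x) x) (hs : HasCompactSupport u)
    (hi : Integrable fun x => H x * u' x) (hi' : Integrable fun x => H' x * u x) :
    ∫ x, H x * u' x = (L - R) * u a - ∫ x, H' x * u x := by
  have hz : (fun x => H x * u x) =ᶠ[cocompact ℝ] fun _ => 0 := by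
    have := hs
    rw [hasCompactSupport_iff_eventuallyEq, coclosedCompact_eq_cocompact] at this
    filter_upwards [this] with x hx
    rw [hx, Pi.zero_apply, mul_zero]
  have ht : Tendsto (H * u) atTop (𝓝 0) :=
    (tendsto_const_nhds.congr' (hz.filter_mono _root_.atTop_le_cocompact).symm)
  have hb : Tendsto (H * u) atBot (𝓝 0) :=
    (tendsto_const_nhds.congr' (hz.filter_mono _root_.atBot_le_cocompact).symm)
  have h1 := integral_Ioi_mul_deriv_eq_deriv_mul (u := H) (v := u)
    (fun x hx => hH x (ne_of_gt hx)) (fun x _ => hu x) hi.integrableOn hi'.integrableOn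
    (hR.mul ((hu a).continuousAt.tendsto.mono_left nhdsWithin_le_nhds)) ht
  have h2 := integral_Iic_mul_deriv_eq_deriv_mul (u := H) (v := u)
    (fun x hx => hH x (ne_of_lt hx)) (fun x _ => hu x) hi.integrableOn hi'.integrableOn
    (hL.mul ((hu a).continuousAt.tendsto.mono_left nhdsWithin_le_nhds)) hb
  rw [← integral_add_compl measurableSet_Iic hi, ← integral_add_compl measurableSet_Iic hi',
    compl_Iic, h1, h2]
  ring

end Jump

section Slices

variable {l : ℝ}

lemma integrableOn_abs_sub_rpow (l y' : ℝ) :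
    IntegrableOn (fun y => |y - y'| ^ (-(1 / 4) : ℝ)) (Ioo (-l) l) := by
  have h := (integrable_abs_rpow_mul_exp (p := -(1 / 4)) (by norm_num) one_pos).comp_sub_right y'
  refine ((h.const_mul (Real.exp (l + |y'|))).integrableOn (s := Ioo (-l) l)).mono'
    (Measurable.aestronglyMeasurable (by fun_prop)) ?_
  filter_upwards [ae_restrict_mem measurableSet_Ioo] with y hy
  have h1 : |y - y'| ≤ l + |y'| :=
    (abs_sub y y').trans (by gcongr; exact (abs_lt.2 ⟨hy.1, hy.2⟩).le)
  have h2 : 1 ≤ Real.exp (l + |y'|) * Real.exp (-1 * |y - y'|) := by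
    rw [← Real.exp_add]; exact Real.one_le_exp (by linarith)
  have h3 : 0 ≤ |y - y'| ^ (-(1 / 4) : ℝ) := by positivity
  rw [Real.norm_of_nonneg h3]
  nlinarith

lemma integrable_ker_strip (hl : 0 < l) (x' : ℝ) {y' : ℝ} (hy' : |y'| < l) :
    Integrable (fun z : ℝ × ℝ => kerY l 0 (z.1 - x') z.2 y') (volume.restrict (strip l)) ∧
    Integrable (fun z : ℝ × ℝ => kerX l 0 (z.1 - x') z.2 y') (volume.restrict (strip l)) := by
  have hb : Integrable (fun z : ℝ × ℝ => kerC l * (decay l (z.1 - x') * |z.2 - y'| ^ (-(1 / 4) : ℝ)))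
      (volume.restrict (strip l)) := by
    rw [restrict_strip]
    exact (((integrable_decay hl).comp_sub_right x').mul_prod
      (integrableOn_abs_sub_rpow l y')).const_mul _
  have hne : ∀ᵐ z ∂(volume.restrict (strip l)), z.1 - x' ≠ 0 ∧ z.2 ≠ y' := by
    rw [restrict_strip]
    have h1 : ∀ᵐ x : ℝ, x - x' ≠ 0 := by
      simp only [sub_ne_zero]; simp [ae_iff]
    have h2 : ∀ᵐ y ∂((volume : Measure ℝ).restrict (Ioo (-l) l)), y ≠ y' :=
      ae_restrict_of_ae (by simp [ae_iff])
    exact (Measure.quasiMeasurePreserving_fst.ae h1).and (Measure.quasiMeasurePreserving_snd.ae h2)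
  have hmem := ae_restrict_mem (μ := (volume : Measure (ℝ × ℝ))) (measurableSet_strip l)
  constructor
  · refine hb.mono' (by unfold kerY kerA kerB; fun_prop) ?_
    filter_upwards [hne, hmem] with z hz hz'
      using (abs_ker_le hl le_rfl (abs_le.2 ⟨hz'.1.le, hz'.2.le⟩) hy'.le hz.1 hz.2).1
  · refine hb.mono' (by unfold kerX kerA kerB; fun_prop) ?_
    filter_upwards [hne, hmem] with z hz hz'
      using (abs_ker_le hl le_rfl (abs_le.2 ⟨hz'.1.le, hz'.2.le⟩) hy'.le hz.1 hz.2).2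

lemma measurable_conjGreen (l : ℝ) :
    Measurable fun q : (ℝ × ℝ) × ℝ => conjGreen l q.1.1 q.1.2 q.2 := by
  have := continuous_tanh.measurable
  unfold conjGreen
  simp only [Real.tan_eq_sin_div_cos]
  fun_prop

variable {φ : ℝ × ℝ → ℝ}

lemma integrable_conjGreen_mul (x' y' : ℝ) {F : ℝ × ℝ → ℝ} (hF : Integrable F) :
    Integrable (fun z : ℝ × ℝ => conjGreen l (z.1 - x') z.2 y' * F z) := by
  refine hF.bdd_mul (c := 2 * Real.pi) ?_ (ae_of_all _ fun z => abs_conjGreen_le _ _ _ _)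
  exact ((measurable_conjGreen l).comp (by fun_prop :
    Measurable fun z : ℝ × ℝ => ((z.1 - x', z.2), y'))).aestronglyMeasurable

lemma integrable_mul_of_hasCompactSupport {K : ℝ × ℝ → ℝ} {μ : Measure (ℝ × ℝ)}
    (hK : Integrable K μ) (hφ : Continuous φ) (hs : HasCompactSupport φ) :
    Integrable (fun z => K z * φ z) μ := by
  obtain ⟨C, hC⟩ := hφ.bounded_above_of_compact_support hs
  exact hK.mul_bdd hφ.aestronglyMeasurable (ae_of_all _ hC)

lemma tendsto_conjGreen_left (hl : 0 < l) {y y' : ℝ} (hy : |y| < l) (hy' : |y'| < l)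
    (hne : y ≠ y') : Tendsto (fun η => conjGreen l η y y') (𝓝[<] 0)
      (𝓝 (-(Real.pi * SignType.sign (y - y')))) := by
  have h : Tendsto (fun η : ℝ => -η) (𝓝[<] 0) (𝓝[>] 0) := by
    have := tendsto_neg_nhdsLT (a := (0 : ℝ)); rwa [neg_zero] at this
  refine ((tendsto_conjGreen_right hl hy hy' hne).comp h).neg.congr fun η => ?_
  simp only [Function.comp, conjGreen_neg, neg_neg]

/-- Almost every horizontal line crosses the cut once, at `x = x'`; integration by parts there
leaves the jump, which is the sign term. -/
lemma setIntegral_conjGreen_fderiv_fst (hl : 0 < l) (x' : ℝ) {y' : ℝ} (hy' : |y'| < l)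
    (hφ : ContDiff ℝ 1 φ) (hs : HasCompactSupport φ) :
    ∫ z in strip l, conjGreen l (z.1 - x') z.2 y' * fderiv ℝ φ z (1, 0) =
      Real.pi / (2 * l) * (∫ z in strip l, kerY l 0 (z.1 - x') z.2 y' * φ z) -
      2 * Real.pi * ∫ y in Ioo (-l) l, SignType.sign (y - y') * φ (x', y) := by
  have i1 : Integrable (fun z : ℝ × ℝ => conjGreen l (z.1 - x') z.2 y' * fderiv ℝ φ z (1, 0))
      (volume.restrict (strip l)) :=
    (integrable_conjGreen_mul x' y' (integrable_fderiv_apply hφ hs _)).restrict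
  have i2 : Integrable (fun z : ℝ × ℝ => kerY l 0 (z.1 - x') z.2 y' * φ z)
      (volume.restrict (strip l)) :=
    integrable_mul_of_hasCompactSupport (integrable_ker_strip hl x' hy').1 hφ.continuous hs
  have hφx : Continuous fun y => φ (x', y) := hφ.continuous.comp (by fun_prop)
  have i3 : Integrable (fun y => (SignType.sign (y - y') : ℝ) * φ (x', y))
      (volume.restrict (Ioo (-l) l)) := by
    have h : Integrable fun y => φ (x', y) :=
      hφx.integrable_of_hasCompactSupport (hasCompactSupport_slice_snd hs x')
    refine h.restrict.bdd_mul (c := 1) ?_ (ae_of_all _ fun y => ?_)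
    · have : Measurable fun y : ℝ => (SignType.sign (y - y') : ℝ) := by
        have e : (fun y : ℝ => (SignType.sign (y - y') : ℝ)) =
            fun y => if 0 < y - y' then 1 else if y - y' < 0 then -1 else 0 := by
          funext y
          rw [sign_apply]
          split_ifs <;> simp
        rw [e]
        exact Measurable.ite (measurableSet_lt measurable_const (by fun_prop)) measurable_const
          (Measurable.ite (measurableSet_lt (by fun_prop) measurable_const) measurable_const
            measurable_const)
      exact this.aestronglyMeasurable
    · rcases SignType.sign (y - y') <;> simp
  rw [restrict_strip] at i1 i2 ⊢
  rw [integral_prod_symm _ i1, integral_prod_symm _ i2, ← integral_const_mul, ← integral_const_mul,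
    ← integral_sub (i2.integral_prod_right.const_mul _) (i3.const_mul _)]
  have hne : ∀ᵐ y ∂((volume : Measure ℝ).restrict (Ioo (-l) l)), y ≠ y' :=
    ae_restrict_of_ae (by simp [ae_iff])
  refine integral_congr_ae ?_
  filter_upwards [i1.prod_left_ae, i2.prod_left_ae, hne, ae_restrict_mem measurableSet_Ioo]
    with y j1 j2 hy hyI
  have hyl : |y| < l := abs_lt.2 hyI
  have hsub : Tendsto (fun x : ℝ => x - x') (𝓝[>] x') (𝓝[>] 0) := by
    refine tendsto_nhdsWithin_iff.2 ⟨?_, ?_⟩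
    · have := (continuous_sub_right x').tendsto x'
      rw [sub_self] at this
      exact this.mono_left nhdsWithin_le_nhds
    · filter_upwards [self_mem_nhdsWithin] with x hx using sub_pos.2 (mem_Ioi.1 hx)
  have hsub' : Tendsto (fun x : ℝ => x - x') (𝓝[<] x') (𝓝[<] 0) := by
    refine tendsto_nhdsWithin_iff.2 ⟨?_, ?_⟩
    · have := (continuous_sub_right x').tendsto x'
      rw [sub_self] at this
      exact this.mono_left nhdsWithin_le_nhds
    · filter_upwards [self_mem_nhdsWithin] with x hx using sub_neg.2 (mem_Iio.1 hx)
  have h := integral_mul_deriv_of_jump (u := fun x => φ (x, y))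
    (fun x hx => hasDerivAt_conjGreen_fst hl hyl hy' hx)
    ((tendsto_conjGreen_right hl hyl hy' hy).comp hsub)
    ((tendsto_conjGreen_left hl hyl hy' hy).comp hsub')
    (fun x => hasDerivAt_fst hφ x y) (hasCompactSupport_slice hs fun _ => y) j1
    ((j2.const_mul (-(Real.pi / (2 * l)))).congr (ae_of_all _ fun x => by simp only; ring))
  refine h.trans ?_
  simp only [neg_mul, integral_neg, mul_assoc (Real.pi / (2 * l)), integral_const_mul]
  ring

/-- Vertical lines with `x ≠ x'` never meet the cut, and `φ` vanishes near the walls, so integration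
by parts leaves no boundary term. -/
lemma setIntegral_conjGreen_fderiv_snd (hl : 0 < l) (x' : ℝ) {y' : ℝ} (hy' : |y'| < l)
    (hφ : ContDiff ℝ 1 φ) (hs : HasCompactSupport φ) (hsupp : tsupport φ ⊆ strip l) :
    ∫ z in strip l, conjGreen l (z.1 - x') z.2 y' * fderiv ℝ φ z (0, 1) =
      -(Real.pi / (2 * l) * ∫ z in strip l, kerX l 0 (z.1 - x') z.2 y' * φ z) := by
  have i1 : Integrable (fun z : ℝ × ℝ => conjGreen l (z.1 - x') z.2 y' * fderiv ℝ φ z (0, 1))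
      (volume.restrict (strip l)) :=
    (integrable_conjGreen_mul x' y' (integrable_fderiv_apply hφ hs _)).restrict
  have i2 : Integrable (fun z : ℝ × ℝ => kerX l 0 (z.1 - x') z.2 y' * φ z)
      (volume.restrict (strip l)) :=
    integrable_mul_of_hasCompactSupport (integrable_ker_strip hl x' hy').2 hφ.continuous hs
  have hzero : ∀ z, z ∉ strip l → φ z = 0 ∧ fderiv ℝ φ z = 0 := fun z hz =>
    ⟨image_eq_zero_of_notMem_tsupport fun h => hz (hsupp h),
      image_eq_zero_of_notMem_tsupport fun h => hz (hsupp (tsupport_fderiv_subset ℝ h))⟩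
  rw [restrict_strip] at i1 i2 ⊢
  rw [integral_prod _ i1, integral_prod _ i2, ← integral_const_mul, ← integral_neg]
  refine integral_congr_ae ?_
  have hne : ∀ᵐ x : ℝ, x ≠ x' := by simp [ae_iff]
  filter_upwards [i1.prod_right_ae, i2.prod_right_ae, hne] with x j1 j2 hx
  have hx' : x - x' ≠ 0 := sub_ne_zero.2 hx
  have hz1 : ∀ y, y ∉ Ioo (-l) l → conjGreen l (x - x') y y' * fderiv ℝ φ (x, y) (0, 1) = 0 :=
    fun y hy => by rw [(hzero (x, y) hy).2]; simp
  have hz2 : ∀ y, y ∉ Ioo (-l) l → kerX l 0 (x - x') y y' * φ (x, y) = 0 :=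
    fun y hy => by rw [(hzero (x, y) hy).1, mul_zero]
  have k1 : Integrable fun y => conjGreen l (x - x') y y' * fderiv ℝ φ (x, y) (0, 1) :=
    (integrableOn_iff_integrable_of_support_subset fun y hy => by
      by_contra hn; exact hy (hz1 y hn)).1 j1
  have k2 : Integrable fun y => kerX l 0 (x - x') y y' * φ (x, y) :=
    (integrableOn_iff_integrable_of_support_subset fun y hy => by
      by_contra hn; exact hy (hz2 y hn)).1 j2
  rw [setIntegral_eq_integral_of_forall_compl_eq_zero hz1,
    setIntegral_eq_integral_of_forall_compl_eq_zero hz2]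
  have hφi : Integrable fun y => φ (x, y) :=
    (hφ.continuous.comp (by fun_prop)).integrable_of_hasCompactSupport
      (hasCompactSupport_slice_snd hs x)
  have h0 := integral_eq_zero_of_hasDerivAt_of_integrable
    (f := fun y => conjGreen l (x - x') y y' * φ (x, y))
    (f' := fun y => conjGreen l (x - x') y y' * fderiv ℝ φ (x, y) (0, 1) +
      Real.pi / (2 * l) * (kerX l 0 (x - x') y y' * φ (x, y))) ?_ (k1.add (k2.const_mul _)) ?_
  · rw [integral_add k1 (k2.const_mul _), integral_const_mul] at h0
    linarith
  · intro y
    by_cases hy : y ∈ Ioo (-l) l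
    · refine ((hasDerivAt_conjGreen_snd hl (abs_lt.2 hy) hy' hx').mul
        (hasDerivAt_snd hφ x y)).congr_deriv ?_
      ring
    · have e : (fun y => conjGreen l (x - x') y y' * φ (x, y)) =ᶠ[𝓝 y] fun _ => 0 := by
        have h1 : ∀ᶠ z in 𝓝 (x, y), z ∉ tsupport φ :=
          (isClosed_tsupport φ).isOpen_compl.mem_nhds fun h => hy (hsupp h)
        have h2 : Tendsto (fun y : ℝ => (x, y)) (𝓝 y) (𝓝 (x, y)) :=
          Continuous.tendsto (by fun_prop) y
        filter_upwards [h2.eventually h1] with y' hy'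
        rw [image_eq_zero_of_notMem_tsupport hy', mul_zero]
      refine ((hasDerivAt_const y (0 : ℝ)).congr_of_eventuallyEq e).congr_deriv ?_
      rw [hz1 y hy, hz2 y hy]; ring
  · refine hφi.bdd_mul (c := 2 * Real.pi) ?_ (ae_of_all _ fun z => abs_conjGreen_le _ _ _ _)
    exact ((measurable_conjGreen l).comp (by fun_prop :
      Measurable fun y : ℝ => ((x - x', y), y'))).aestronglyMeasurable

end Slices

/-! ### The pressure and Darcy's law -/

/-- The part of the pressure generated by the vorticity sheet. -/
def sheetPotential (l : ℝ) (g : ℝ → ℝ) (z : ℝ × ℝ) : ℝ :=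
  ∫ x', deriv g x' * conjGreen l (z.1 - x') z.2 (g x')

/-- The pressure of the Darcy flow with interface `g`. -/
def pressure (l ρ₁ ρ₂ : ℝ) (g : ℝ → ℝ) (z : ℝ × ℝ) : ℝ :=
  -((ρ₁ - ρ₂) / (4 * Real.pi) * sheetPotential l g z) - (ρ₁ - ρ₂) * max (z.2 - g z.1) 0 -
    ρ₂ * z.2 - (ρ₁ - ρ₂) / 2 * g z.1

lemma ae_ne_graph {g : ℝ → ℝ} (hg : Measurable g) : ∀ᵐ z : ℝ × ℝ, z.2 ≠ g z.1 := by
  have hm : MeasurableSet {z : ℝ × ℝ | z.2 ≠ g z.1} :=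
    (measurableSet_eq_fun (by fun_prop) (by fun_prop)).compl
  rw [Measure.volume_eq_prod, Measure.ae_prod_iff_ae_ae hm]
  exact ae_of_all _ fun x => by simp [ae_iff]

lemma density_ae_eq (l ρ₁ ρ₂ : ℝ) (f : ℝ → ℝ → ℝ) (t : ℝ) (hf : Measurable (f t)) :
    ∀ᵐ z ∂(volume.restrict (strip l)), density l ρ₁ ρ₂ f t z =
      ρ₂ + (ρ₁ - ρ₂) * (epi (f t)).indicator (fun _ => 1) z := by
  filter_upwards [ae_restrict_of_ae (ae_ne_graph hf),
    ae_restrict_mem (measurableSet_strip l)] with z hz hzs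
  unfold density
  rcases lt_or_gt_of_ne hz with h | h
  · have h1 : z ∉ upperDomain l (f t) := fun h' => lt_asymm h h'.2
    have h2 : z ∈ lowerDomain l (f t) := ⟨hzs, h⟩
    have h3 : z ∉ epi (f t) := fun h' => lt_asymm h h'
    simp [h1, h2, h3]
  · have h1 : z ∈ upperDomain l (f t) := ⟨hzs, h⟩
    have h2 : z ∉ lowerDomain l (f t) := fun h' => lt_asymm h h'.2
    have h3 : z ∈ epi (f t) := h
    simp [h1, h2, h3]

lemma setIntegral_density_mul (l ρ₁ ρ₂ : ℝ) (f : ℝ → ℝ → ℝ) (t : ℝ) (hf : Continuous (f t))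
    {F : ℝ × ℝ → ℝ} (hF : IntegrableOn F (strip l)) :
    ∫ z in strip l, density l ρ₁ ρ₂ f t z * F z =
      ρ₂ * (∫ z in strip l, F z) + (ρ₁ - ρ₂) * ∫ z in upperDomain l (f t), F z := by
  have hem := (isOpen_epi hf).measurableSet
  rw [upperDomain_eq, ← setIntegral_indicator hem, ← integral_const_mul, ← integral_const_mul,
    ← integral_add (hF.const_mul _) ((hF.indicator hem).const_mul _)]
  refine integral_congr_ae ?_
  filter_upwards [density_ae_eq l ρ₁ ρ₂ f t hf.measurable] with z hz
  rw [hz]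
  by_cases h : z ∈ epi (f t)
  · simp only [h, indicator_of_mem]; ring
  · simp [h]

section Potential

variable {l δ M : ℝ} {g : ℝ → ℝ} {F φ : ℝ × ℝ → ℝ}

lemma measurable_sheet_integrand (hg : Measurable g) : Measurable fun q : (ℝ × ℝ) × ℝ =>
    deriv g q.2 * conjGreen l (q.1.1 - q.2) q.1.2 (g q.2) := by
  have h1 : Measurable fun q : (ℝ × ℝ) × ℝ => deriv g q.2 :=
    (measurable_deriv g).comp measurable_snd
  have h2 : Measurable fun q : (ℝ × ℝ) × ℝ => ((q.1.1 - q.2, q.1.2), g q.2) := by fun_prop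
  have h3 := (measurable_conjGreen l).comp h2
  simp only [Function.comp_def] at h3
  exact h1.mul h3

/-- A bound of the integrand of the potential, for `|z.1| ≤ R`. -/
def sheetBound (l M : ℝ) (g : ℝ → ℝ) (R x' : ℝ) : ℝ :=
  Real.pi / l * (g x' ^ 2 + deriv g x' ^ 2) +
    M * (8 * Real.pi * Real.exp (Real.pi / (2 * l) * R) * Real.exp (-(Real.pi / (2 * l)) * |x'|))

lemma integrable_sheetBound (hl : 0 < l) (hg : ProfileBound l δ M g) (R : ℝ) :
    Integrable (sheetBound l M g R) :=
  ((hg.sq_int.add hg.deriv_sq_int).const_mul _).add (((integrable_exp_abs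
    (by have := Real.pi_pos; positivity)).const_mul _).const_mul _)

/-- The nondecaying part of `conjGreen`, linear in `g(x')`, meets the factor `g'(x')`. Their product
is integrable because `g` and `g'` are square integrable; the remainder decays exponentially. -/
lemma abs_sheet_integrand_le (hl : 0 < l) (hδ : 0 < δ) (hg : ProfileBound l δ M g) {R : ℝ}
    {z : ℝ × ℝ} (hz : z ∈ strip l) (hR : |z.1| ≤ R) (x' : ℝ) :
    |deriv g x' * conjGreen l (z.1 - x') z.2 (g x')| ≤ sheetBound l M g R x' := by
  have hπ := Real.pi_pos
  have h := abs_conjGreen_le_exp hl (abs_lt.2 hz) (hg.abs_lt hδ x') (z.1 - x')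
  have hM := hg.nonneg
  rw [abs_mul]
  unfold sheetBound
  have he : Real.exp (-(Real.pi / (2 * l)) * |z.1 - x'|) ≤
      Real.exp (Real.pi / (2 * l) * R) * Real.exp (-(Real.pi / (2 * l)) * |x'|) := by
    rw [← Real.exp_add]
    apply Real.exp_le_exp.2
    have h1 : |x'| ≤ R + |z.1 - x'| := by
      have := abs_sub_abs_le_abs_sub x' z.1
      rw [abs_sub_comm] at this; linarith
    have : Real.pi / (2 * l) * |x'| ≤ Real.pi / (2 * l) * (R + |z.1 - x'|) := by gcongr
    linarith
  have hsq : |deriv g x'| * |g x'| ≤ g x' ^ 2 + deriv g x' ^ 2 := by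
    rw [← sq_abs (g x'), ← sq_abs (deriv g x')]
    nlinarith [sq_nonneg (|g x'| - |deriv g x'|), sq_nonneg (|g x'| + |deriv g x'|)]
  calc |deriv g x'| * |conjGreen l (z.1 - x') z.2 (g x')|
      ≤ |deriv g x'| * (Real.pi / l * |g x'| +
        8 * Real.pi * (Real.exp (Real.pi / (2 * l) * R) * Real.exp (-(Real.pi / (2 * l)) * |x'|))) := by
        refine mul_le_mul_of_nonneg_left (h.trans ?_) (abs_nonneg _)
        gcongr
    _ = Real.pi / l * (|deriv g x'| * |g x'|) + |deriv g x'| *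
        (8 * Real.pi * Real.exp (Real.pi / (2 * l) * R) * Real.exp (-(Real.pi / (2 * l)) * |x'|)) := by
        ring
    _ ≤ _ := by
        gcongr
        exact hg.deriv_le x'

lemma integrable_mul_sheet (hl : 0 < l) (hδ : 0 < δ) (hg : ProfileBound l δ M g)
    (hF : Continuous F) (hs : HasCompactSupport F) :
    Integrable (fun q : (ℝ × ℝ) × ℝ => F q.1 *
      (deriv g q.2 * conjGreen l (q.1.1 - q.2) q.1.2 (g q.2)))
      ((volume.restrict (strip l)).prod (volume : Measure ℝ)) := by
  obtain ⟨R, -, hR⟩ := exists_zero_of_hasCompactSupport hs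
  have hFi : Integrable F (volume.restrict (strip l)) :=
    (hF.integrable_of_hasCompactSupport hs).restrict
  refine (hFi.norm.mul_prod (integrable_sheetBound hl hg R)).mono'
    ((hF.measurable.comp measurable_fst).mul
      (measurable_sheet_integrand hg.continuous.measurable)).aestronglyMeasurable ?_
  filter_upwards [ae_mem_strip_fst l] with q hq
  rw [norm_mul]
  by_cases h : |q.1.1| ≤ R
  · exact mul_le_mul_of_nonneg_left (abs_sheet_integrand_le hl hδ hg hq h q.2) (norm_nonneg _)
  · have : F q.1 = 0 := hR q.1.1 q.1.2 (Or.inl (not_le.1 h))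
    simp [this]

lemma integrable_mul_sheetPotential (hl : 0 < l) (hδ : 0 < δ) (hg : ProfileBound l δ M g)
    (hF : Continuous F) (hs : HasCompactSupport F) :
    Integrable (fun z => F z * sheetPotential l g z) (volume.restrict (strip l)) ∧
    ∫ z in strip l, F z * sheetPotential l g z =
      ∫ x', deriv g x' * ∫ z in strip l, conjGreen l (z.1 - x') z.2 (g x') * F z := by
  have h := integrable_mul_sheet hl hδ hg hF hs
  have e : ∀ z, F z * sheetPotential l g z = ∫ x', F z *
      (deriv g x' * conjGreen l (z.1 - x') z.2 (g x')) := fun z => by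
    rw [integral_const_mul]; rfl
  simp only [e]
  refine ⟨h.integral_prod_left, (integral_integral_swap h).trans ?_⟩
  refine integral_congr_ae (ae_of_all _ fun x' => ?_)
  simp only
  rw [← integral_const_mul]
  refine integral_congr_ae (ae_of_all _ fun z => ?_)
  simp only
  ring

lemma locallyIntegrableOn_pressure (hl : 0 < l) (hδ : 0 < δ) (hg : ProfileBound l δ M g)
    (ρ₁ ρ₂ : ℝ) : LocallyIntegrableOn (pressure l ρ₁ ρ₂ g) (strip l) := by
  have hgc := hg.continuous
  have hc : LocallyIntegrableOn (fun z : ℝ × ℝ => (ρ₁ - ρ₂) * max (z.2 - g z.1) 0 + ρ₂ * z.2 +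
      (ρ₁ - ρ₂) / 2 * g z.1) (strip l) :=
    ((by fun_prop : Continuous fun z : ℝ × ℝ => (ρ₁ - ρ₂) * max (z.2 - g z.1) 0 + ρ₂ * z.2 +
      (ρ₁ - ρ₂) / 2 * g z.1).locallyIntegrable).locallyIntegrableOn _
  have hp : LocallyIntegrableOn (sheetPotential l g) (strip l) := by
    refine (locallyIntegrableOn_iff (isOpen_strip l).isLocallyClosed).2 fun K hK hKc => ?_
    obtain ⟨R, hR⟩ := hKc.isBounded.subset_closedBall (0 : ℝ × ℝ)
    refine Measure.integrableOn_of_bounded (M := ∫ x', sheetBound l M g R x') hKc.measure_lt_top.ne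
      (StronglyMeasurable.integral_prod_right' (measurable_sheet_integrand
        hg.continuous.measurable).stronglyMeasurable).aestronglyMeasurable ?_
    filter_upwards [ae_restrict_mem hKc.measurableSet] with z hz
    have h1 := hR hz
    rw [mem_closedBall_zero_iff, Prod.norm_def, max_le_iff] at h1
    exact norm_integral_le_of_norm_le (integrable_sheetBound hl hg R)
      (ae_of_all _ fun x' => abs_sheet_integrand_le hl hδ hg (hK hz) h1.1 x')
  have := (hp.smul (-((ρ₁ - ρ₂) / (4 * Real.pi)))).sub hc
  convert! this using 2 with z
  funext z
  simp only [pressure, Pi.sub_apply, Pi.smul_apply, smul_eq_mul]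
  ring

lemma setIntegral_pressure_mul (hl : 0 < l) (hδ : 0 < δ) (hg : ProfileBound l δ M g) (ρ₁ ρ₂ : ℝ)
    (hF : Continuous F) (hs : HasCompactSupport F) (h0 : ∀ z, z ∉ strip l → F z = 0) :
    ∫ z in strip l, pressure l ρ₁ ρ₂ g z * F z = -((ρ₁ - ρ₂) / (4 * Real.pi) *
      ∫ x', deriv g x' * ∫ z in strip l, conjGreen l (z.1 - x') z.2 (g x') * F z) -
      (ρ₁ - ρ₂) * (∫ z in epi g, (z.2 - g z.1) * F z) - ρ₂ * (∫ z, z.2 * F z) -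
      (ρ₁ - ρ₂) / 2 * ∫ z, g z.1 * F z := by
  have hgc := hg.continuous
  obtain ⟨i1, e1⟩ := integrable_mul_sheetPotential hl hδ hg hF hs
  have i2 : Integrable fun z : ℝ × ℝ => max (z.2 - g z.1) 0 * F z :=
    Continuous.integrable_of_hasCompactSupport (by fun_prop) hs.mul_left
  have i3 : Integrable fun z : ℝ × ℝ => z.2 * F z :=
    Continuous.integrable_of_hasCompactSupport (by fun_prop) hs.mul_left
  have i4 : Integrable fun z : ℝ × ℝ => g z.1 * F z :=
    Continuous.integrable_of_hasCompactSupport (by fun_prop) hs.mul_left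
  have z2 : ∫ z in strip l, max (z.2 - g z.1) 0 * F z = ∫ z in epi g, (z.2 - g z.1) * F z := by
    rw [setIntegral_eq_integral_of_forall_compl_eq_zero fun z hz => by rw [h0 z hz, mul_zero],
      ← integral_indicator (isOpen_epi hgc).measurableSet]
    refine integral_congr_ae (ae_of_all _ fun z => ?_)
    by_cases h : z ∈ epi g
    · have h' : g z.1 < z.2 := h
      rw [indicator_of_mem h]
      simp only [max_eq_left (sub_nonneg.2 h'.le)]
    · have h' : ¬g z.1 < z.2 := h
      rw [indicator_of_notMem h]
      simp only [max_eq_right (sub_nonpos.2 (not_lt.1 h')), zero_mul]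
  have z3 : ∫ z in strip l, z.2 * F z = ∫ z, z.2 * F z :=
    setIntegral_eq_integral_of_forall_compl_eq_zero fun z hz => by rw [h0 z hz, mul_zero]
  have z4 : ∫ z in strip l, g z.1 * F z = ∫ z, g z.1 * F z :=
    setIntegral_eq_integral_of_forall_compl_eq_zero fun z hz => by rw [h0 z hz, mul_zero]
  have j1 := i1.const_mul (-((ρ₁ - ρ₂) / (4 * Real.pi)))
  have j2 := (i2.const_mul (ρ₁ - ρ₂)).restrict (s := strip l)
  have j3 := (i3.const_mul ρ₂).restrict (s := strip l)
  have j4 := (i4.const_mul ((ρ₁ - ρ₂) / 2)).restrict (s := strip l)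
  have e : ∀ z, pressure l ρ₁ ρ₂ g z * F z = -((ρ₁ - ρ₂) / (4 * Real.pi)) *
      (F z * sheetPotential l g z) - (ρ₁ - ρ₂) * (max (z.2 - g z.1) 0 * F z) -
      ρ₂ * (z.2 * F z) - (ρ₁ - ρ₂) / 2 * (g z.1 * F z) := fun z => by
    unfold pressure; ring
  simp only [e]
  rw [integral_sub (by exact (j1.sub j2).sub j3) j4, integral_sub (by exact j1.sub j2) j3,
    integral_sub j1 j2, integral_const_mul, integral_const_mul, integral_const_mul, integral_const_mul, e1, z2, z3, z4,
    neg_mul]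

lemma integral_mul_fderiv_apply {K : ℝ × ℝ → ℝ} (hK : ContDiff ℝ 1 K) (hφ : ContDiff ℝ 1 φ)
    (hs : HasCompactSupport φ) (v : ℝ × ℝ) :
    ∫ z, K z * fderiv ℝ φ z v = -∫ z, fderiv ℝ K z v * φ z := by
  have c1 := continuous_fderiv_apply' hK v
  have c2 := continuous_fderiv_apply' hφ v
  have hKc := hK.continuous
  have hφc := hφ.continuous
  exact integral_mul_fderiv_eq_neg_fderiv_mul_of_integrable
    ((c1.mul hφc).integrable_of_hasCompactSupport hs.mul_left)
    ((hKc.mul c2).integrable_of_hasCompactSupport (hasCompactSupport_fderiv_apply hs v).mul_left)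
    ((hKc.mul hφc).integrable_of_hasCompactSupport hs.mul_left)
    (fun z _ => hK.differentiable (by norm_num) z) fun z _ => hφ.differentiable (by norm_num) z

/-- The sign of `y - g(x)` equals twice the indicator of the region above the graph, minus one,
almost everywhere. -/
lemma setIntegral_sign_mul (hgc : Continuous g) (h0 : ∀ z, z ∉ strip l → φ z = 0)
    (hi : Integrable fun z : ℝ × ℝ => deriv g z.1 * φ z) :
    ∫ x, deriv g x * ∫ y in Ioo (-l) l, SignType.sign (y - g x) * φ (x, y) =
      2 * (∫ z in epi g, deriv g z.1 * φ z) - ∫ z, deriv g z.1 * φ z := by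
  have hem := (isOpen_epi hgc).measurableSet
  have hi2 := hi.indicator hem
  rw [← integral_indicator hem, ← integral_const_mul, ← integral_sub (hi2.const_mul 2) hi,
    Measure.volume_eq_prod, integral_prod]
  · refine integral_congr_ae (ae_of_all _ fun x => ?_)
    simp only
    rw [setIntegral_eq_integral_of_forall_compl_eq_zero fun y hy => by
      rw [h0 (x, y) hy, mul_zero], ← integral_const_mul]
    have hne : ∀ᵐ y : ℝ, y ≠ g x := by simp [ae_iff]
    refine integral_congr_ae ?_
    filter_upwards [hne] with y hy
    rcases lt_or_gt_of_ne hy with h | h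
    · rw [sign_neg (sub_neg.2 h), indicator_of_notMem fun h' : (x, y) ∈ epi g => lt_asymm h h']
      simp
    · rw [sign_pos (sub_pos.2 h), indicator_of_mem (show (x, y) ∈ epi g from h)]
      simp only [SignType.coe_one]
      ring
  · exact (hi2.const_mul 2).sub hi

/-- The pressure satisfies the first component of Darcy's law. -/
lemma setIntegral_velocity_fst (hl : 0 < l) (hδ : 0 < δ) (hg : ProfileBound l δ M g) (ρ₁ ρ₂ : ℝ)
    (hφ : ContDiff ℝ 1 φ) (hs : HasCompactSupport φ) (hsupp : tsupport φ ⊆ strip l) :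
    ∫ z in strip l, (velocity l ρ₁ ρ₂ g z).1 * φ z =
      ∫ z in strip l, pressure l ρ₁ ρ₂ g z * fderiv ℝ φ z (1, 0) := by
  have hπ := Real.pi_pos
  have hgc := hg.continuous
  have hdc := hg.continuous_deriv
  have hφc := hφ.continuous
  have hzero : ∀ z, z ∉ strip l → φ z = 0 := fun z hz =>
    image_eq_zero_of_notMem_tsupport fun h => hz (hsupp h)
  have hzero' : ∀ z, z ∉ strip l → fderiv ℝ φ z (1, 0) = 0 := fun z hz => by
    rw [image_eq_zero_of_notMem_tsupport fun h => hz (hsupp (tsupport_fderiv_subset ℝ h))]; rfl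
  have hφ2 : MemLp φ 2 (volume.restrict (strip l)) :=
    (hφc.memLp_of_hasCompactSupport hs).restrict _
  have h02 : MemLp (fun _ : ℝ × ℝ => (0 : ℝ)) 2 (volume.restrict (strip l)) := MemLp.zero
  have hv := setIntegral_velocity hl hδ hg ρ₁ ρ₂ hφ2 h02
  simp only [mul_zero, add_zero] at hv
  rw [pairing_eq hl hδ hg le_rfl hφ2 h02] at hv
  have ik : Integrable fun x' => deriv g x' * ∫ z in strip l, kerY l 0 (z.1 - x') z.2 (g x') * φ z := by
    refine (integrable_mul_intY hl hδ hg le_rfl hφ2).integral_prod_right.congr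
      (ae_of_all _ fun x' => ?_)
    simp only [intY]
    rw [← integral_const_mul]
    refine integral_congr_ae (ae_of_all _ fun z => ?_)
    simp only
    ring
  rw [hv, setIntegral_pressure_mul hl hδ hg ρ₁ ρ₂ (continuous_fderiv_apply' hφ (1, 0))
    (hasCompactSupport_fderiv_apply hs _) hzero']
  have d1 : ∫ z : ℝ × ℝ, z.2 * fderiv ℝ φ z (1, 0) = 0 := by
    rw [integral_mul_fderiv_apply contDiff_snd hφ hs]
    simp [fderiv_snd]
  have d2 : ∫ z : ℝ × ℝ, g z.1 * fderiv ℝ φ z (1, 0) = -∫ z, deriv g z.1 * φ z := by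
    have hK : ContDiff ℝ 1 fun z : ℝ × ℝ => g z.1 := hg.contDiff.comp contDiff_fst
    rw [integral_mul_fderiv_apply hK hφ hs]
    congr 1
    refine integral_congr_ae (ae_of_all _ fun z => ?_)
    have h1 := hasDerivAt_fst hK z.1 z.2
    have h2 : HasDerivAt (fun x => g x) (deriv g z.1) z.1 :=
      (hg.contDiff.differentiable (by norm_num) z.1).hasDerivAt
    simp only
    rw [h1.unique h2]
  have d3 : ∫ z in epi g, (z.2 - g z.1) * fderiv ℝ φ z (1, 0) =
      ∫ z in epi g, deriv g z.1 * φ z := by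
    have hK : ContDiff ℝ 1 fun z : ℝ × ℝ => z.2 - g z.1 :=
      contDiff_snd.sub (hg.contDiff.comp contDiff_fst)
    have h := setIntegral_epi_fderiv_fst hg.contDiff (hφ.mul hK) hs.mul_right
    simp only [sub_self, mul_zero, integral_zero] at h
    have e : ∀ z : ℝ × ℝ, fderiv ℝ (fun z => φ z * (z.2 - g z.1)) z (1, 0) =
        (z.2 - g z.1) * fderiv ℝ φ z (1, 0) - deriv g z.1 * φ z := by
      intro z
      have h1 := hasDerivAt_fst hK z.1 z.2
      have h2 : HasDerivAt (fun x => z.2 - g x) (-deriv g z.1) z.1 :=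
        ((hg.contDiff.differentiable (by norm_num) z.1).hasDerivAt).const_sub z.2
      rw [fderiv_mul_apply hφ hK, h1.unique h2]
      ring
    simp only [e] at h
    rw [integral_sub] at h
    · linarith
    · refine (Continuous.integrable_of_hasCompactSupport ?_
        (hasCompactSupport_fderiv_apply hs (1, 0)).mul_left).integrableOn
      have := continuous_fderiv_apply' hφ (1, 0)
      fun_prop
    · exact (Continuous.integrable_of_hasCompactSupport (by fun_prop) hs.mul_left).integrableOn
  have hi : Integrable fun z : ℝ × ℝ => deriv g z.1 * φ z :=
    Continuous.integrable_of_hasCompactSupport (by fun_prop) hs.mul_left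
  -- Integrated over `x'`, the cuts spread into a bulk term with density `g'(x)` times the sign of
  -- `y - g(x)`. The summand `(ρ₁ - ρ₂)(max (y - g) 0 + g/2)` of minus the pressure cancels it, its
  -- `x`-derivative being `-(ρ₁ - ρ₂) g' sign (y - g)/2`.
  have hin : ∀ x', deriv g x' * ∫ z in strip l, conjGreen l (z.1 - x') z.2 (g x') *
      fderiv ℝ φ z (1, 0) = Real.pi / (2 * l) * (deriv g x' * ∫ z in strip l,
      kerY l 0 (z.1 - x') z.2 (g x') * φ z) - 2 * Real.pi *
      (deriv g x' * ∫ y in Ioo (-l) l, SignType.sign (y - g x') * φ (x', y)) := by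
    intro x'
    rw [setIntegral_conjGreen_fderiv_fst hl x' (hg.abs_lt hδ x') hφ hs]
    ring
  have itot := (integrable_mul_sheet hl hδ hg (continuous_fderiv_apply' hφ (1, 0))
    (hasCompactSupport_fderiv_apply hs (1, 0))).integral_prod_right
  have itot' : Integrable fun x' => deriv g x' * ∫ z in strip l, conjGreen l (z.1 - x') z.2 (g x') *
      fderiv ℝ φ z (1, 0) := by
    refine itot.congr (ae_of_all _ fun x' => ?_)
    simp only
    rw [← integral_const_mul]
    refine integral_congr_ae (ae_of_all _ fun z => ?_)
    simp only
    ring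
  -- Integrability of the sign term follows from that of the other two terms of the identity.
  have is : Integrable fun x' => deriv g x' * ∫ y in Ioo (-l) l,
      SignType.sign (y - g x') * φ (x', y) := by
    refine (((ik.const_mul (Real.pi / (2 * l))).sub itot').const_mul (1 / (2 * Real.pi))).congr
      (ae_of_all _ fun x' => ?_)
    simp only [Pi.sub_apply]
    rw [hin x']
    field_simp
    ring
  simp only [hin]
  rw [integral_sub (ik.const_mul _) (is.const_mul _), integral_const_mul, integral_const_mul,
    setIntegral_sign_mul hgc hzero hi, d1, d2, d3]
  have e : ∀ x', ∫ z in strip l, (0 * kerX l 0 (z.1 - x') z.2 (g x') -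
      φ z * kerY l 0 (z.1 - x') z.2 (g x')) =
      -∫ z in strip l, kerY l 0 (z.1 - x') z.2 (g x') * φ z := by
    intro x'
    rw [← integral_neg]
    refine integral_congr_ae (ae_of_all _ fun z => ?_)
    simp only
    ring
  simp only [e, mul_neg, integral_neg]
  field_simp
  ring

/-- The pressure satisfies the second component of Darcy's law. -/
lemma setIntegral_velocity_snd (hl : 0 < l) (hδ : 0 < δ) (hg : ProfileBound l δ M g) (ρ₁ ρ₂ : ℝ)
    (hφ : ContDiff ℝ 1 φ) (hs : HasCompactSupport φ) (hsupp : tsupport φ ⊆ strip l) :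
    ∫ z in strip l, (velocity l ρ₁ ρ₂ g z).2 * φ z =
      (∫ z in strip l, pressure l ρ₁ ρ₂ g z * fderiv ℝ φ z (0, 1)) -
        (ρ₂ * (∫ z in strip l, φ z) + (ρ₁ - ρ₂) * ∫ z in upperDomain l g, φ z) := by
  have hπ := Real.pi_pos
  have hgc := hg.continuous
  have hφc := hφ.continuous
  have hem := (isOpen_epi hgc).measurableSet
  have hzero : ∀ z, z ∉ strip l → φ z = 0 := fun z hz =>
    image_eq_zero_of_notMem_tsupport fun h => hz (hsupp h)
  have hzero' : ∀ z, z ∉ strip l → fderiv ℝ φ z (0, 1) = 0 := fun z hz => by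
    rw [image_eq_zero_of_notMem_tsupport fun h => hz (hsupp (tsupport_fderiv_subset ℝ h))]; rfl
  have hφ2 : MemLp φ 2 (volume.restrict (strip l)) :=
    (hφc.memLp_of_hasCompactSupport hs).restrict _
  have h02 : MemLp (fun _ : ℝ × ℝ => (0 : ℝ)) 2 (volume.restrict (strip l)) := MemLp.zero
  have hv := setIntegral_velocity hl hδ hg ρ₁ ρ₂ h02 hφ2
  simp only [mul_zero, zero_add] at hv
  rw [pairing_eq hl hδ hg le_rfl h02 hφ2] at hv
  rw [hv, setIntegral_pressure_mul hl hδ hg ρ₁ ρ₂ (continuous_fderiv_apply' hφ (0, 1))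
    (hasCompactSupport_fderiv_apply hs _) hzero']
  have d0 : ∫ z in strip l, φ z = ∫ z, φ z :=
    setIntegral_eq_integral_of_forall_compl_eq_zero hzero
  have du : ∫ z in upperDomain l g, φ z = ∫ z in epi g, φ z := by
    rw [upperDomain_eq, ← setIntegral_indicator hem, ← integral_indicator hem]
    exact setIntegral_eq_integral_of_forall_compl_eq_zero fun z hz => by
      simp [indicator, hzero z hz]
  have d1 : ∫ z : ℝ × ℝ, z.2 * fderiv ℝ φ z (0, 1) = -∫ z, φ z := by
    rw [integral_mul_fderiv_apply contDiff_snd hφ hs]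
    simp [fderiv_snd]
  have d2 : ∫ z : ℝ × ℝ, g z.1 * fderiv ℝ φ z (0, 1) = 0 := by
    have hK : ContDiff ℝ 1 fun z : ℝ × ℝ => g z.1 := hg.contDiff.comp contDiff_fst
    rw [integral_mul_fderiv_apply hK hφ hs]
    have : ∀ z : ℝ × ℝ, fderiv ℝ (fun z : ℝ × ℝ => g z.1) z (0, 1) = 0 := fun z =>
      (hasDerivAt_snd hK z.1 z.2).unique (hasDerivAt_const z.2 (g z.1))
    simp [this]
  have d3 : ∫ z in epi g, (z.2 - g z.1) * fderiv ℝ φ z (0, 1) = -∫ z in epi g, φ z := by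
    have hK : ContDiff ℝ 1 fun z : ℝ × ℝ => z.2 - g z.1 :=
      contDiff_snd.sub (hg.contDiff.comp contDiff_fst)
    have h := setIntegral_epi_fderiv_snd hgc (hφ.mul hK) hs.mul_right
    simp only [sub_self, mul_zero, integral_zero, neg_zero] at h
    have e : ∀ z : ℝ × ℝ, fderiv ℝ (fun z => φ z * (z.2 - g z.1)) z (0, 1) =
        (z.2 - g z.1) * fderiv ℝ φ z (0, 1) + φ z := by
      intro z
      have h1 := hasDerivAt_snd hK z.1 z.2
      have h2 : HasDerivAt (fun y => y - g z.1) 1 z.2 := (hasDerivAt_id z.2).sub_const _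
      rw [fderiv_mul_apply hφ hK, h1.unique h2]
      ring
    simp only [e] at h
    rw [integral_add] at h
    · linarith
    · refine (Continuous.integrable_of_hasCompactSupport ?_
        (hasCompactSupport_fderiv_apply hs (0, 1)).mul_left).integrableOn
      have := continuous_fderiv_apply' hφ (0, 1)
      fun_prop
    · exact (hφc.integrable_of_hasCompactSupport hs).integrableOn
  -- Vertically the cuts contribute nothing; the density comes from the `y`-derivatives of `ρ₂ y`
  -- and `(ρ₁ - ρ₂) max (y - g) 0`.
  have hin : ∀ x', deriv g x' * ∫ z in strip l, conjGreen l (z.1 - x') z.2 (g x') *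
      fderiv ℝ φ z (0, 1) = -(Real.pi / (2 * l)) * (deriv g x' * ∫ z in strip l,
      (φ z * kerX l 0 (z.1 - x') z.2 (g x') - 0 * kerY l 0 (z.1 - x') z.2 (g x'))) := by
    intro x'
    rw [setIntegral_conjGreen_fderiv_snd hl x' (hg.abs_lt hδ x') hφ hs hsupp]
    simp only [zero_mul, sub_zero, mul_comm (φ _)]
    ring
  simp only [hin]
  rw [integral_const_mul, d0, du, d1, d2, d3]
  field_simp
  ring

end Potential

/-! ### Existence of the Darcy flow -/

lemma measurable_indicator_of_continuousOn {T : ℝ} {h : ℝ × ℝ → ℝ}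
    (hh : ContinuousOn h (Ioo 0 T ×ˢ univ)) :
    Measurable ((Ioo 0 T ×ˢ (univ : Set ℝ)).indicator h) := by
  classical
  rw [← piecewise_eq_indicator]
  exact hh.measurable_piecewise continuousOn_const (measurableSet_Ioo.prod MeasurableSet.univ)

variable {l T : ℝ} {f : ℝ → ℝ → ℝ}

lemma IsInterfaceCurve.profileBound (hl : 0 < l) (hf : IsInterfaceCurve l T f) {t : ℝ}
    (ht : t ∈ Ioo 0 T) : ∃ δ > 0, ∃ M, ProfileBound l δ M (f t) := by
  obtain ⟨δ, hδ, M, h⟩ := (hf.regularity hl).1 t ht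
  exact ⟨δ, hδ, M, h.self_of_nhds⟩

lemma IsInterfaceCurve.aestronglyMeasurable_velocity (hl : 0 < l) (hf : IsInterfaceCurve l T f)
    (ρ₁ ρ₂ : ℝ) : AEStronglyMeasurable (fun q : ℝ × (ℝ × ℝ) => velocity l ρ₁ ρ₂ (f q.1) q.2)
      (volume.restrict (Ioo 0 T ×ˢ strip l)) := by
  obtain ⟨-, h1, h2⟩ := hf.regularity hl
  -- Outside `(0, T)` nothing is known about `f`; extending the profile and its slope by zero gives
  -- globally measurable functions and does not change the velocity on `(0, T)`.
  set F := (Ioo 0 T ×ˢ (univ : Set ℝ)).indicator fun q : ℝ × ℝ => f q.1 q.2 with hF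
  set D := (Ioo 0 T ×ˢ (univ : Set ℝ)).indicator fun q : ℝ × ℝ => deriv (f q.1) q.2 with hD
  have mF : Measurable F := measurable_indicator_of_continuousOn h1
  have mD : Measurable D := measurable_indicator_of_continuousOn h2
  have m1 : Measurable fun q : (ℝ × (ℝ × ℝ)) × ℝ => (q.1.1, q.2) := by fun_prop
  have mF' : Measurable fun q : (ℝ × (ℝ × ℝ)) × ℝ => F (q.1.1, q.2) := mF.comp m1
  have mD' : Measurable fun q : (ℝ × (ℝ × ℝ)) × ℝ => D (q.1.1, q.2) := mD.comp m1
  have mY : Measurable fun q : (ℝ × (ℝ × ℝ)) × ℝ =>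
      D (q.1.1, q.2) * kerY l 0 (q.1.2.1 - q.2) q.1.2.2 (F (q.1.1, q.2)) := by
    unfold kerY kerA kerB; fun_prop
  have mX : Measurable fun q : (ℝ × (ℝ × ℝ)) × ℝ =>
      D (q.1.1, q.2) * kerX l 0 (q.1.2.1 - q.2) q.1.2.2 (F (q.1.1, q.2)) := by
    unfold kerX kerA kerB; fun_prop
  have sY := (StronglyMeasurable.integral_prod_right' (ν := (volume : Measure ℝ))
    mY.stronglyMeasurable).measurable
  have sX := (StronglyMeasurable.integral_prod_right' (ν := (volume : Measure ℝ))
    mX.stronglyMeasurable).measurable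
  refine AEStronglyMeasurable.congr ((sY.const_mul ((ρ₁ - ρ₂) / (8 * l))).neg.prodMk
    (sX.const_mul ((ρ₁ - ρ₂) / (8 * l)))).aestronglyMeasurable ?_
  filter_upwards [ae_restrict_mem (measurableSet_Ioo.prod (measurableSet_strip l))] with q hq
  have hm : ∀ x : ℝ, (q.1, x) ∈ Ioo 0 T ×ˢ (univ : Set ℝ) := fun x => ⟨hq.1, trivial⟩
  have e1 : ∀ x, F (q.1, x) = f q.1 x := fun x => indicator_of_mem (hm x) _
  have e2 : ∀ x, D (q.1, x) = deriv (f q.1) x := fun x => indicator_of_mem (hm x) _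
  simp only [velocity, intY, intX, e1, e2, Pi.neg_apply]

lemma IsInterfaceCurve.isDarcyFlow (hl : 0 < l) (hf : IsInterfaceCurve l T f) (ρ₁ ρ₂ : ℝ) :
    IsDarcyFlow l T (density l ρ₁ ρ₂ f) (fun t => velocity l ρ₁ ρ₂ (f t))
      fun t => pressure l ρ₁ ρ₂ (f t) where
  measurable := hf.aestronglyMeasurable_velocity hl ρ₁ ρ₂
  square_integrable t ht := by
    obtain ⟨δ, hδ, M, hg⟩ := hf.profileBound hl ht
    exact memLp_velocity hl hδ hg ρ₁ ρ₂
  pressure_integrable t ht := by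
    obtain ⟨δ, hδ, M, hg⟩ := hf.profileBound hl ht
    exact locallyIntegrableOn_pressure hl hδ hg ρ₁ ρ₂
  darcy_fst t ht φ hφ hs hsupp := by
    obtain ⟨δ, hδ, M, hg⟩ := hf.profileBound hl ht
    exact setIntegral_velocity_fst hl hδ hg ρ₁ ρ₂ (hφ.of_le (by norm_num)) hs hsupp
  darcy_snd t ht φ hφ hs hsupp := by
    obtain ⟨δ, hδ, M, hg⟩ := hf.profileBound hl ht
    rw [setIntegral_density_mul l ρ₁ ρ₂ f t hg.continuous
      (hφ.continuous.integrable_of_hasCompactSupport hs).integrableOn]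
    exact setIntegral_velocity_snd hl hδ hg ρ₁ ρ₂ (hφ.of_le (by norm_num)) hs hsupp
  incompressible_impermeable t ht φ hφ hs := by
    obtain ⟨δ, hδ, M, hg⟩ := hf.profileBound hl ht
    exact setIntegral_fderiv_velocity hl hδ hg ρ₁ ρ₂ (hφ.of_le (by norm_num)) hs

/-! ### Completeness of the cosine and sine modes across the strip -/

section Completeness

variable {l : ℝ} {h : ℝ → ℝ}

/-- The angle that maps `(-l, l)` to `(0, π)`. -/
def wallAngle (l y : ℝ) : ℝ := Real.pi / (2 * l) * (y + l)

lemma continuous_wallAngle (l : ℝ) : Continuous (wallAngle l) := by unfold wallAngle; fun_prop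

lemma wallAngle_mem (hl : 0 < l) {y : ℝ} (hy : y ∈ Ioo (-l) l) : wallAngle l y ∈ Ioo 0 Real.pi := by
  have hm : 0 < Real.pi / (2 * l) := by have := Real.pi_pos; positivity
  have h1 : 0 < y + l := by linarith [hy.1]
  refine ⟨mul_pos hm h1, ?_⟩
  have : wallAngle l y < Real.pi / (2 * l) * (2 * l) := by
    unfold wallAngle; gcongr; linarith [hy.2]
  rwa [div_mul_cancel₀ _ (by positivity)] at this

lemma integrable_mul_bdd_continuous {h b : ℝ → ℝ} {μ : Measure ℝ} (hh : Integrable h μ)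
    (hb : Continuous b) {C : ℝ} (hC : ∀ y, |b y| ≤ C) : Integrable (fun y => h y * b y) μ :=
  hh.mul_bdd hb.aestronglyMeasurable (ae_of_all _ hC)

lemma abs_cos_pow_mul_le (θ : ℝ) (j n : ℕ) : |Real.cos θ ^ j * Real.cos (n * θ)| ≤ 1 := by
  rw [abs_mul, abs_pow]
  exact mul_le_one₀ (pow_le_one₀ (abs_nonneg _) (Real.abs_cos_le_one _)) (abs_nonneg _)
    (Real.abs_cos_le_one _)

/-- Induction on the power via `2 cos θ cos kθ = cos (k+1)θ + cos (k-1)θ`. Keeping the extra factor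
`cos nθ` makes the induction close, and `n = 0` gives all powers of `cos θ`. -/
lemma integral_mul_cos_pow (hh : IntegrableOn h (Ioo (-l) l))
    (h0 : ∀ n : ℕ, ∫ y in Ioo (-l) l, h y * Real.cos (n * wallAngle l y) = 0) (j : ℕ) :
    ∀ n : ℕ, ∫ y in Ioo (-l) l, h y *
      (Real.cos (wallAngle l y) ^ j * Real.cos (n * wallAngle l y)) = 0 := by
  have hc := continuous_wallAngle l
  induction j with
  | zero => simpa using h0
  | succ j ih =>
    rintro (_ | n)
    · simpa [pow_succ] using ih 1
    · have e : ∀ y, h y * (Real.cos (wallAngle l y) ^ (j + 1) *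
          Real.cos ((n + 1 : ℕ) * wallAngle l y)) =
          1 / 2 * (h y * (Real.cos (wallAngle l y) ^ j * Real.cos ((n + 2 : ℕ) * wallAngle l y))) +
          1 / 2 * (h y * (Real.cos (wallAngle l y) ^ j * Real.cos (n * wallAngle l y))) := by
        intro y
        set θ := wallAngle l y
        have h1 : Real.cos ((n + 2 : ℕ) * θ) = Real.cos ((n + 1 : ℕ) * θ + θ) := by
          congr 1; push_cast; ring
        have h2 : Real.cos (n * θ) = Real.cos ((n + 1 : ℕ) * θ - θ) := by
          congr 1; push_cast; ring
        rw [h1, h2, Real.cos_add, Real.cos_sub]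
        ring
      have i1 : ∀ k : ℕ, IntegrableOn (fun y => 1 / 2 * (h y * (Real.cos (wallAngle l y) ^ j *
          Real.cos (k * wallAngle l y)))) (Ioo (-l) l) := fun k =>
        (integrable_mul_bdd_continuous hh (by fun_prop)
          fun y => abs_cos_pow_mul_le (wallAngle l y) j k).const_mul _
      simp only [e]
      rw [integral_add (i1 _) (i1 _), integral_const_mul, integral_const_mul, ih, ih]
      simp

lemma integral_mul_eval_cos (hh : IntegrableOn h (Ioo (-l) l))
    (h0 : ∀ n : ℕ, ∫ y in Ioo (-l) l, h y * Real.cos (n * wallAngle l y) = 0)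
    (p : Polynomial ℝ) : ∫ y in Ioo (-l) l, h y * p.eval (Real.cos (wallAngle l y)) = 0 := by
  have hc := continuous_wallAngle l
  simp only [Polynomial.eval_eq_sum_range, Finset.mul_sum]
  have e : ∀ j y, h y * (p.coeff j * Real.cos (wallAngle l y) ^ j) = p.coeff j *
      (h y * (Real.cos (wallAngle l y) ^ j * Real.cos ((0 : ℕ) * wallAngle l y))) := by
    intro j y; simp; ring
  simp only [e]
  rw [integral_finsetSum]
  · refine Finset.sum_eq_zero fun j _ => ?_
    rw [integral_const_mul, integral_mul_cos_pow hh h0, mul_zero]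
  · intro j _
    exact (integrable_mul_bdd_continuous hh (by fun_prop)
      fun y => abs_cos_pow_mul_le (wallAngle l y) j 0).const_mul _

/-- Completeness of the cosines on `(-l, l)`. -/
lemma ae_eq_zero_of_integral_cos (hl : 0 < l) (hh : IntegrableOn h (Ioo (-l) l))
    (h0 : ∀ n : ℕ, ∫ y in Ioo (-l) l, h y * Real.cos (n * wallAngle l y) = 0) :
    ∀ᵐ y ∂(volume.restrict (Ioo (-l) l)), h y = 0 := by
  have hc := continuous_wallAngle l
  rw [ae_restrict_iff' measurableSet_Ioo]
  refine isOpen_Ioo.ae_eq_zero_of_integral_contDiff_smul_eq_zero hh.locallyIntegrableOn ?_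
  intro F hF hs hsupp
  have hFc := hF.continuous
  simp only [smul_eq_mul]
  have hz : ∀ y, y ∉ Ioo (-l) l → F y * h y = 0 := fun y hy => by
    rw [image_eq_zero_of_notMem_tsupport fun h' => hy (hsupp h'), zero_mul]
  rw [← setIntegral_eq_integral_of_forall_compl_eq_zero hz]
  -- The angle takes values in `(0, π)`, where the cosine is injective; so `F` is a continuous
  -- function of `cos θ`, which Weierstrass approximates uniformly by polynomials.
  set G : ℝ → ℝ := fun u => F (2 * l / Real.pi * Real.arccos u - l) with hG
  have hGc : Continuous G := by have := Real.continuous_arccos; fun_prop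
  have hGF : ∀ y ∈ Ioo (-l) l, G (Real.cos (wallAngle l y)) = F y := by
    intro y hy
    have h1 := wallAngle_mem hl hy
    simp only [hG]
    rw [Real.arccos_cos h1.1.le h1.2.le]
    congr 1
    unfold wallAngle
    have := Real.pi_pos
    field_simp
    ring
  obtain ⟨C, hC⟩ := hFc.bounded_above_of_compact_support hs
  have iF : IntegrableOn (fun y => h y * F y) (Ioo (-l) l) :=
    integrable_mul_bdd_continuous hh hFc hC
  have key : ∀ ε > 0, |∫ y in Ioo (-l) l, F y * h y| ≤ ε * ∫ y in Ioo (-l) l, |h y| := by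
    intro ε hε
    obtain ⟨p, hp⟩ := exists_polynomial_near_of_continuousOn (-1) 1 G hGc.continuousOn ε hε
    have hpc : Continuous fun y => p.eval (Real.cos (wallAngle l y)) := by
      have := p.continuous; fun_prop
    obtain ⟨K, hK⟩ := (isCompact_Icc (a := (-1 : ℝ)) (b := 1)).exists_bound_of_continuousOn
      p.continuous.continuousOn
    have ip : IntegrableOn (fun y => h y * p.eval (Real.cos (wallAngle l y))) (Ioo (-l) l) :=
      integrable_mul_bdd_continuous hh hpc fun y => hK _ (Real.cos_mem_Icc _)
    have e : ∫ y in Ioo (-l) l, F y * h y =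
        ∫ y in Ioo (-l) l, (h y * F y - h y * p.eval (Real.cos (wallAngle l y))) := by
      rw [integral_sub iF ip, integral_mul_eval_cos hh h0, sub_zero]
      simp only [mul_comm]
    rw [e, ← integral_const_mul]
    rw [← Real.norm_eq_abs]
    refine norm_integral_le_of_norm_le (hh.norm.const_mul ε) ?_
    filter_upwards [ae_restrict_mem measurableSet_Ioo] with y hy
    rw [← mul_sub, norm_mul, mul_comm, ← hGF y hy, norm_sub_rev]
    exact mul_le_mul_of_nonneg_right (hp _ (Real.cos_mem_Icc _)).le (norm_nonneg _)
  have hI : 0 ≤ ∫ y in Ioo (-l) l, |h y| := integral_nonneg fun _ => abs_nonneg _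
  refine abs_nonpos_iff.1 (le_of_forall_pos_le_add fun ε hε => ?_)
  have := key (ε / ((∫ y in Ioo (-l) l, |h y|) + 1)) (by positivity)
  refine this.trans ?_
  rw [zero_add, div_mul_eq_mul_div, div_le_iff₀ (by positivity)]
  nlinarith

/-- Completeness of the sines on `(-l, l)`. -/
lemma ae_eq_zero_of_integral_sin (hl : 0 < l) (hh : IntegrableOn h (Ioo (-l) l))
    (h0 : ∀ n : ℕ, ∫ y in Ioo (-l) l, h y * Real.sin (n * wallAngle l y) = 0) :
    ∀ᵐ y ∂(volume.restrict (Ioo (-l) l)), h y = 0 := by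
  have hc := continuous_wallAngle l
  have i1 : ∀ k : ℕ, IntegrableOn (fun y => h y * Real.sin (k * wallAngle l y)) (Ioo (-l) l) :=
    fun k => integrable_mul_bdd_continuous hh (by fun_prop) fun y => Real.abs_sin_le_one _
  have hs : IntegrableOn (fun y => h y * Real.sin (wallAngle l y)) (Ioo (-l) l) :=
    integrable_mul_bdd_continuous hh (by fun_prop) fun y => Real.abs_sin_le_one _
  -- Since `sin θ cos kθ` is half a difference of sines, `h sin θ` is orthogonal to all cosines; and
  -- `sin θ > 0` inside the strip.
  have hz := ae_eq_zero_of_integral_cos (h := fun y => h y * Real.sin (wallAngle l y)) hl hs ?_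
  · filter_upwards [hz, ae_restrict_mem measurableSet_Ioo] with y hy hy'
    have h1 := wallAngle_mem hl hy'
    exact (mul_eq_zero.1 hy).resolve_right (Real.sin_pos_of_pos_of_lt_pi h1.1 h1.2).ne'
  · rintro (_ | n)
    · simpa using h0 1
    · have e : ∀ y, h y * Real.sin (wallAngle l y) * Real.cos ((n + 1 : ℕ) * wallAngle l y) =
          1 / 2 * (h y * Real.sin ((n + 2 : ℕ) * wallAngle l y)) -
          1 / 2 * (h y * Real.sin (n * wallAngle l y)) := by
        intro y
        set θ := wallAngle l y
        have h1 : Real.sin ((n + 2 : ℕ) * θ) = Real.sin ((n + 1 : ℕ) * θ + θ) := by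
          congr 1; push_cast; ring
        have h2 : Real.sin (n * θ) = Real.sin ((n + 1 : ℕ) * θ - θ) := by
          congr 1; push_cast; ring
        rw [h1, h2, Real.sin_add, Real.sin_sub]
        ring
      simp only [e]
      rw [integral_sub ((i1 _).const_mul _) ((i1 _).const_mul _), integral_const_mul,
        integral_const_mul, h0, h0]
      simp

end Completeness

/-! ### Square integrable solutions of a first-order equation -/

section Growth

/-- A square integrable solution of `R' = -μ R` vanishes. -/
lemma ae_eq_zero_of_weak_ode {R : ℝ → ℝ} {μ : ℝ} (hR : LocallyIntegrable R)
    (hR2 : Integrable fun x => R x ^ 2)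
    (h : ∀ χ : ℝ → ℝ, ContDiff ℝ ∞ χ → HasCompactSupport χ →
      ∫ x, R x * (deriv χ x - μ * χ x) = 0) : ∀ᵐ x, R x = 0 := by
  have hexp : ContDiff ℝ ∞ fun x : ℝ => Real.exp (μ * x) := by fun_prop
  have hloc : LocallyIntegrable fun x => R x * Real.exp (μ * x) :=
    hR.mul_continuous hexp.continuous
  -- The integrating factor: `R e^(μx)` has zero weak derivative, hence is a constant `c`.
  have hder : ∀ ψ : ℝ → ℝ, ContDiff ℝ ∞ ψ → HasCompactSupport ψ → tsupport ψ ⊆ univ →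
      ∫ x, R x * Real.exp (μ * x) * deriv ψ x = 0 := by
    intro ψ hψ hs _
    have hd : ∀ x, deriv (fun x => Real.exp (μ * x) * ψ x) x =
        Real.exp (μ * x) * deriv ψ x + μ * (Real.exp (μ * x) * ψ x) := by
      intro x
      have h1 : HasDerivAt (fun x => Real.exp (μ * x)) (Real.exp (μ * x) * μ) x := by
        have := ((hasDerivAt_id x).const_mul μ).exp
        simpa using this
      have h2 := (hψ.differentiable (by norm_num) x).hasDerivAt
      rw [(h1.fun_mul h2).deriv]
      ring
    rw [← h (fun x => Real.exp (μ * x) * ψ x) (hexp.mul hψ) hs.mul_left]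
    refine integral_congr_ae (ae_of_all _ fun x => ?_)
    simp only
    rw [hd]
    ring
  obtain ⟨c, hc⟩ := ae_eq_const_of_integral_deriv_eq_zero isOpen_univ ordConnected_univ
    (hloc.locallyIntegrableOn univ) hder
  have hRc : ∀ᵐ x, R x ^ 2 = c ^ 2 * Real.exp (-(2 * μ) * x) := by
    filter_upwards [hc] with x hx
    have hx := hx trivial
    have : R x = c * Real.exp (-(μ * x)) := by
      rw [← hx, mul_assoc, ← Real.exp_add]; simp
    rw [this, mul_pow, ← Real.exp_nat_mul]
    congr 2
    push_cast; ring
  have hc0 : c = 0 := by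
    by_contra hne
    have hi : Integrable fun x => c ^ 2 * Real.exp (-(2 * μ) * x) := hR2.congr hRc
    -- Of the values at `x` and `-x` of `e^(-2μx)` one is at least one, whatever the sign of `μ`; so
    -- their sum dominates a constant, which would be integrable. This includes `μ = 0`.
    have hi2 : Integrable fun _ : ℝ => (c ^ 2 : ℝ) := by
      have hi3 := hi.add hi.comp_neg
      refine hi3.mono' (by fun_prop) (ae_of_all _ fun x => ?_)
      simp only [Pi.add_apply]
      rw [Real.norm_of_nonneg (sq_nonneg c), ← mul_add]
      refine le_mul_of_one_le_right (sq_nonneg c) ?_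
      rcases le_total 0 (-(2 * μ) * x) with h1 | h1
      · have := Real.one_le_exp h1
        have := Real.exp_pos (-(2 * μ) * -x)
        linarith
      · have := Real.one_le_exp (show 0 ≤ -(2 * μ) * -x by linarith)
        have := Real.exp_pos (-(2 * μ) * x)
        linarith
    rw [integrable_const_iff] at hi2
    rcases hi2 with h1 | h1
    · exact hne (by simpa using h1)
    · have := h1.measure_univ_lt_top
      simp at this
  filter_upwards [hRc] with x hx
  rw [hc0] at hx
  simpa using hx

end Growth

/-! ### Test functions in product form and cutoffs near the walls -/

section Cutoff

/-- A smooth function of `u` that vanishes for `u ≤ 1/N` and equals `1` for `u ≥ 2/N`. -/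
def wallCut (N : ℕ) (u : ℝ) : ℝ := Real.smoothTransition (N * u - 1)

lemma contDiff_wallCut (N : ℕ) : ContDiff ℝ ∞ (wallCut N) :=
  Real.smoothTransition.contDiff.comp (by fun_prop : ContDiff ℝ ∞ fun u : ℝ => N * u - 1)

lemma abs_wallCut_le_one (N : ℕ) (u : ℝ) : |wallCut N u| ≤ 1 := by
  unfold wallCut
  rw [abs_of_nonneg (Real.smoothTransition.nonneg _)]
  exact Real.smoothTransition.le_one _

lemma deriv_smoothTransition_eq_zero {u : ℝ} (hu : 1 < u) : deriv Real.smoothTransition u = 0 := by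
  have : Real.smoothTransition =ᶠ[𝓝 u] fun _ => 1 := by
    filter_upwards [Ioi_mem_nhds hu] with v hv using Real.smoothTransition.one_of_one_le hv.le
  rw [this.deriv_eq, deriv_const]

lemma deriv_smoothTransition_eq_zero' {u : ℝ} (hu : u < 0) : deriv Real.smoothTransition u = 0 := by
  have : Real.smoothTransition =ᶠ[𝓝 u] fun _ => 0 := by
    filter_upwards [Iio_mem_nhds hu] with v hv using Real.smoothTransition.zero_of_nonpos hv.le
  rw [this.deriv_eq, deriv_const]

lemma exists_deriv_smoothTransition_le :
    ∃ C, 0 ≤ C ∧ ∀ u, |deriv Real.smoothTransition u| ≤ C := by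
  have hc : Continuous (deriv Real.smoothTransition) :=
    (Real.smoothTransition.contDiff (n := 1)).continuous_deriv le_rfl
  obtain ⟨C, hC⟩ := (isCompact_Icc (a := (0 : ℝ)) (b := 1)).exists_bound_of_continuousOn
    hc.continuousOn
  have hC0 : 0 ≤ C := (norm_nonneg _).trans (hC 0 ⟨le_rfl, zero_le_one⟩)
  refine ⟨C, hC0, fun u => ?_⟩
  rcases lt_or_ge u 0 with h | h
  · rw [deriv_smoothTransition_eq_zero' h, abs_zero]; exact hC0
  rcases lt_or_ge 1 u with h' | h'
  · rw [deriv_smoothTransition_eq_zero h', abs_zero]; exact hC0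
  · exact hC u ⟨h, h'⟩

lemma hasDerivAt_wallCut (N : ℕ) (u : ℝ) :
    HasDerivAt (wallCut N) (N * deriv Real.smoothTransition (N * u - 1)) u := by
  have h1 : HasDerivAt (fun u : ℝ => (N : ℝ) * u - 1) N u := by
    simpa using ((hasDerivAt_id u).const_mul (N : ℝ)).sub_const 1
  have h2 := ((Real.smoothTransition.contDiff (n := 1)).differentiable (by norm_num)
    (N * u - 1)).hasDerivAt
  exact (h2.comp u h1).congr_deriv (mul_comm _ _)

/-- The derivative has size `N` but vanishes for `N u > 2`, so multiplication by the wall distance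
`u` makes it bounded uniformly in `N`. -/
lemma mul_abs_deriv_wallCut_le {C : ℝ} (hC0 : 0 ≤ C)
    (hC : ∀ u, |deriv Real.smoothTransition u| ≤ C) (N : ℕ) (u : ℝ) :
    u * |N * deriv Real.smoothTransition (N * u - 1)| ≤ 2 * C := by
  rcases lt_or_ge 2 ((N : ℝ) * u) with h | h
  · rw [deriv_smoothTransition_eq_zero (by linarith)]; simpa using hC0
  · rw [abs_mul, Nat.abs_cast]
    calc u * (N * |deriv Real.smoothTransition (N * u - 1)|)
        = (N * u) * |deriv Real.smoothTransition (N * u - 1)| := by ring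
      _ ≤ 2 * C := mul_le_mul h (hC _) (abs_nonneg _) (by norm_num)

end Cutoff

section TestFunctions

variable {l : ℝ} {w : ℝ × ℝ → ℝ × ℝ} {a b : ℝ → ℝ}

lemma memLp_mul_prod (ha : Continuous a) (hs : HasCompactSupport a) (hb : Continuous b) :
    MemLp (fun z : ℝ × ℝ => a z.1 * b z.2) 2 (volume.restrict (strip l)) := by
  refine (memLp_two_iff_integrable_sq (by fun_prop : Continuous fun z : ℝ × ℝ =>
    a z.1 * b z.2).aestronglyMeasurable).2 ?_
  have h1 : Integrable fun x => a x ^ 2 :=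
    Continuous.integrable_of_hasCompactSupport (by fun_prop) (by
      simp only [pow_two]; exact hs.mul_left)
  have h2 : IntegrableOn (fun y => b y ^ 2) (Ioo (-l) l) :=
    ((by fun_prop : Continuous fun y => b y ^ 2).integrableOn_Icc).mono_set Ioo_subset_Icc_self
  rw [restrict_strip]
  refine (h1.mul_prod h2).congr (ae_of_all _ fun z => ?_)
  simp only
  ring

lemma fderiv_mul_prod (ha : ContDiff ℝ ∞ a) (hb : ContDiff ℝ ∞ b) (z : ℝ × ℝ) :
    fderiv ℝ (fun z : ℝ × ℝ => a z.1 * b z.2) z (1, 0) = deriv a z.1 * b z.2 ∧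
    fderiv ℝ (fun z : ℝ × ℝ => a z.1 * b z.2) z (0, 1) = a z.1 * deriv b z.2 := by
  have hc : ContDiff ℝ 1 fun z : ℝ × ℝ => a z.1 * b z.2 :=
    ((ha.of_le (by norm_num)).comp contDiff_fst).mul ((hb.of_le (by norm_num)).comp contDiff_snd)
  exact ⟨(hasDerivAt_fst hc z.1 z.2).unique
      (((ha.differentiable (by norm_num) z.1).hasDerivAt).mul_const (b z.2)),
    (hasDerivAt_snd hc z.1 z.2).unique
      (((hb.differentiable (by norm_num) z.2).hasDerivAt).const_mul (a z.1))⟩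

lemma hasCompactSupport_mul_prod (ha : HasCompactSupport a) (hb : HasCompactSupport b) :
    HasCompactSupport fun z : ℝ × ℝ => a z.1 * b z.2 := by
  refine HasCompactSupport.of_support_subset_isCompact (ha.isCompact.prod hb.isCompact) ?_
  intro z hz
  exact ⟨subset_tsupport _ (left_ne_zero_of_mul hz), subset_tsupport _ (right_ne_zero_of_mul hz)⟩

lemma exists_smooth_cutoff (K : ℝ) : ∃ τ : ℝ → ℝ, ContDiff ℝ ∞ τ ∧ HasCompactSupport τ ∧
    ∀ y, |y| < K → τ =ᶠ[𝓝 y] fun _ => 1 := by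
  let B : ContDiffBump (0 : ℝ) := ⟨|K| + 1, |K| + 2, by positivity, by linarith⟩
  refine ⟨B, B.contDiff, B.hasCompactSupport, fun y hy => ?_⟩
  have h : Metric.ball (0 : ℝ) (|K| + 1) ∈ 𝓝 y := Metric.isOpen_ball.mem_nhds (by
    rw [mem_ball_zero_iff, Real.norm_eq_abs]
    have := le_abs_self K; linarith)
  filter_upwards [h] with y' hy'
  exact B.one_of_mem_closedBall (Metric.ball_subset_closedBall hy')

/-- Incompressibility tested with a product. -/
lemma setIntegral_div_prod (hD : ∀ φ : ℝ × ℝ → ℝ, ContDiff ℝ ∞ φ → HasCompactSupport φ →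
      ∫ z in strip l, fderiv ℝ φ z (w z) = 0)
    (ha : ContDiff ℝ ∞ a) (hs : HasCompactSupport a) (hb : ContDiff ℝ ∞ b) :
    ∫ z in strip l, ((w z).1 * (deriv a z.1 * b z.2) + (w z).2 * (a z.1 * deriv b z.2)) = 0 := by
  -- The cutoff only gives `b` compact support and equals one on the strip. That `b` need not vanish
  -- at the walls is where impermeability enters.
  obtain ⟨τ, hτ, hτs, hτ1⟩ := exists_smooth_cutoff l
  have hbτ : ContDiff ℝ ∞ fun y => b y * τ y := hb.mul hτ
  rw [← hD (fun z => a z.1 * (b z.2 * τ z.2)) ((ha.comp contDiff_fst).mul (hbτ.comp contDiff_snd))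
    (hasCompactSupport_mul_prod hs hτs.mul_left)]
  refine setIntegral_congr_fun (measurableSet_strip l) fun z hz => ?_
  have h1 := hτ1 z.2 (abs_lt.2 hz)
  have h2 : (fun y => b y * τ y) =ᶠ[𝓝 z.2] b := by
    filter_upwards [h1] with y hy; rw [hy, mul_one]
  obtain ⟨e1, e2⟩ := fderiv_mul_prod ha hbτ z
  rw [show w z = ((w z).1, (w z).2) from rfl, fderiv_apply_eq, e1, e2, h2.deriv_eq, h1.self_of_nhds, mul_one]

/-- Irrotationality tested with a product. -/
lemma setIntegral_curl_prod (hC : ∀ φ : ℝ × ℝ → ℝ, ContDiff ℝ ∞ φ → HasCompactSupport φ →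
      tsupport φ ⊆ strip l →
      ∫ z in strip l, ((w z).1 * fderiv ℝ φ z (0, 1) - (w z).2 * fderiv ℝ φ z (1, 0)) = 0)
    (ha : ContDiff ℝ ∞ a) (hs : HasCompactSupport a) (hb : ContDiff ℝ ∞ b)
    {r : ℝ} (hr : 0 < r) (hb0 : ∀ y, l - r < |y| → b y = 0) :
    ∫ z in strip l, ((w z).1 * (a z.1 * deriv b z.2) - (w z).2 * (deriv a z.1 * b z.2)) = 0 := by
  have hbs : HasCompactSupport b :=
    HasCompactSupport.of_support_subset_isCompact (isCompact_Icc (a := -(l - r)) (b := l - r))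
      fun y hy => abs_le.1 (not_lt.1 fun h => hy (hb0 y h))
  have hsub : tsupport (fun z : ℝ × ℝ => a z.1 * b z.2) ⊆ strip l := by
    have h1 : tsupport (fun z : ℝ × ℝ => a z.1 * b z.2) ⊆ {z : ℝ × ℝ | |z.2| ≤ l - r} := by
      refine closure_minimal (fun z hz => ?_) (isClosed_le (by fun_prop) continuous_const)
      exact not_lt.1 fun h => (right_ne_zero_of_mul hz) (hb0 z.2 h)
    intro z hz
    have h2 : |z.2| ≤ l - r := h1 hz
    exact abs_lt.1 (by linarith)
  rw [← hC _ ((ha.comp contDiff_fst).mul (hb.comp contDiff_snd))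
    (hasCompactSupport_mul_prod hs hbs) hsub]
  refine integral_congr_ae (ae_of_all _ fun z => ?_)
  obtain ⟨e1, e2⟩ := fderiv_mul_prod ha hb z
  simp only [Function.comp_def]
  rw [e1, e2]

/-- The angle is `0` at the lower wall and `π` at the upper, so the sine vanishes at both at least
linearly. -/
lemma abs_sin_mul_wallAngle_le (hl : 0 < l) (n : ℕ) (y : ℝ) :
    |Real.sin (n * wallAngle l y)| ≤ n * (Real.pi / (2 * l)) * |l + y| ∧
    |Real.sin (n * wallAngle l y)| ≤ n * (Real.pi / (2 * l)) * |l - y| := by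
  have hm : 0 < Real.pi / (2 * l) := by have := Real.pi_pos; positivity
  have hn : 0 ≤ (n : ℝ) * (Real.pi / (2 * l)) := by positivity
  constructor
  · refine Real.abs_sin_le_abs.trans (le_of_eq ?_)
    rw [show n * wallAngle l y = n * (Real.pi / (2 * l)) * (l + y) by unfold wallAngle; ring,
      abs_mul, abs_of_nonneg hn]
  · have e : n * wallAngle l y = n * Real.pi - n * (Real.pi / (2 * l)) * (l - y) := by
      unfold wallAngle; field_simp; ring
    have h : |Real.sin (n * wallAngle l y)| = |Real.sin (n * (Real.pi / (2 * l)) * (l - y))| := by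
      rw [e, Real.sin_nat_mul_pi_sub, abs_neg, abs_mul, abs_pow, abs_neg, abs_one, one_pow, one_mul]
    rw [h]
    refine Real.abs_sin_le_abs.trans (le_of_eq ?_)
    rw [abs_mul, abs_of_nonneg hn]

lemma hasDerivAt_sin_wallAngle (l : ℝ) (n : ℕ) (y : ℝ) :
    HasDerivAt (fun y => Real.sin (n * wallAngle l y))
      (n * (Real.pi / (2 * l)) * Real.cos (n * wallAngle l y)) y := by
  have h : HasDerivAt (fun y => n * wallAngle l y) (n * (Real.pi / (2 * l))) y := by
    have := (((hasDerivAt_id y).add_const l).const_mul (Real.pi / (2 * l))).const_mul (n : ℝ)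
    simpa [wallAngle] using this
  exact h.sin.congr_deriv (mul_comm _ _)

lemma hasDerivAt_cos_wallAngle (l : ℝ) (n : ℕ) (y : ℝ) :
    HasDerivAt (fun y => Real.cos (n * wallAngle l y))
      (-(n * (Real.pi / (2 * l)) * Real.sin (n * wallAngle l y))) y := by
  have h : HasDerivAt (fun y => n * wallAngle l y) (n * (Real.pi / (2 * l))) y := by
    have := (((hasDerivAt_id y).add_const l).const_mul (Real.pi / (2 * l))).const_mul (n : ℝ)
    simpa [wallAngle] using this
  exact h.cos.congr_deriv (by ring)

/-- Irrotationality tested with a sine that vanishes on the walls. -/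
lemma setIntegral_curl_sin (hl : 0 < l) (hw : MemLp w 2 (volume.restrict (strip l)))
    (hC : ∀ φ : ℝ × ℝ → ℝ, ContDiff ℝ ∞ φ → HasCompactSupport φ → tsupport φ ⊆ strip l →
      ∫ z in strip l, ((w z).1 * fderiv ℝ φ z (0, 1) - (w z).2 * fderiv ℝ φ z (1, 0)) = 0)
    (ha : ContDiff ℝ ∞ a) (hs : HasCompactSupport a) (n : ℕ) :
    ∫ z in strip l, ((w z).1 * (a z.1 * (n * (Real.pi / (2 * l)) * Real.cos (n * wallAngle l z.2))) -
      (w z).2 * (deriv a z.1 * Real.sin (n * wallAngle l z.2))) = 0 := by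
  have hm : 0 < Real.pi / (2 * l) := by have := Real.pi_pos; positivity
  obtain ⟨C, hC0, hC1⟩ := exists_deriv_smoothTransition_le
  set lam : ℝ := n * (Real.pi / (2 * l)) with hlam
  have hlam0 : 0 ≤ lam := by positivity
  set s : ℝ → ℝ := fun y => Real.sin (n * wallAngle l y) with hsdef
  set c : ℝ → ℝ := fun y => Real.cos (n * wallAngle l y) with hcdef
  set d := deriv Real.smoothTransition with hd
  set κ' : ℕ → ℝ → ℝ := fun N y => -(N * d (N * (l - y) - 1)) * wallCut N (l + y) +
    wallCut N (l - y) * (N * d (N * (l + y) - 1)) with hκ'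
  have hsm : ContDiff ℝ ∞ s := by
    simp only [hsdef, wallAngle]; fun_prop
  have hbN : ∀ N, ContDiff ℝ ∞ fun y => s y * (wallCut N (l - y) * wallCut N (l + y)) := fun N =>
    hsm.mul (((contDiff_wallCut N).comp (by fun_prop)).mul
      ((contDiff_wallCut N).comp (by fun_prop)))
  have hbd : ∀ N y, deriv (fun y => s y * (wallCut N (l - y) * wallCut N (l + y))) y =
      lam * c y * (wallCut N (l - y) * wallCut N (l + y)) + s y * κ' N y := by
    intro N y
    have h1 : HasDerivAt (fun y => wallCut N (l - y)) (-(N * d (N * (l - y) - 1))) y := by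
      have := (hasDerivAt_wallCut N (l - y)).comp y ((hasDerivAt_id y).const_sub l)
      exact this.congr_deriv (by ring)
    have h2 : HasDerivAt (fun y => wallCut N (l + y)) (N * d (N * (l + y) - 1)) y := by
      have := (hasDerivAt_wallCut N (l + y)).comp y ((hasDerivAt_id y).const_add l)
      exact this.congr_deriv (by ring)
    exact ((hasDerivAt_sin_wallAngle l n y).fun_mul (h1.fun_mul h2)).deriv
  -- Tests of irrotationality must be supported inside the strip, so the sine is first multiplied by
  -- cutoffs at both walls.
  have hzero : ∀ N : ℕ, 0 < N → ∫ z in strip l, ((w z).1 * (a z.1 * (lam * c z.2 *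
      (wallCut N (l - z.2) * wallCut N (l + z.2)) + s z.2 * κ' N z.2)) -
      (w z).2 * (deriv a z.1 * (s z.2 * (wallCut N (l - z.2) * wallCut N (l + z.2))))) = 0 := by
    intro N hN
    have hN' : (0 : ℝ) < N := by exact_mod_cast hN
    have h := setIntegral_curl_prod hC ha hs (hbN N) (r := 1 / N) (by positivity) ?_
    · simpa only [hbd] using h
    · intro y hy
      have hz : ∀ u : ℝ, u < 1 / N → wallCut N u = 0 := by
        intro u hu
        refine Real.smoothTransition.zero_of_nonpos ?_
        rw [lt_div_iff₀ hN'] at hu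
        linarith
      rcases le_total 0 y with h0 | h0
      · rw [abs_of_nonneg h0] at hy
        rw [hz (l - y) (by linarith)]; ring
      · rw [abs_of_nonpos h0] at hy
        rw [hz (l + y) (by linarith)]; ring
  have hda : Continuous (deriv a) := (ha.of_le (m := 1) (by norm_num)).continuous_deriv
    le_rfl
  have i1 : Integrable (fun z => (w z).1 * (a z.1 * 1)) (volume.restrict (strip l)) :=
    hw.fst.integrable_mul (memLp_mul_prod ha.continuous hs continuous_const)
  have i2 : Integrable (fun z => (w z).2 * (deriv a z.1 * 1)) (volume.restrict (strip l)) :=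
    hw.snd.integrable_mul (memLp_mul_prod hda hs.deriv continuous_const)
  have hdc : Continuous d := (Real.smoothTransition.contDiff (n := 1)).continuous_deriv le_rfl
  have hcut : ∀ N, Continuous (wallCut N) := fun N => (contDiff_wallCut N).continuous
  have hcc : Continuous c := by have := continuous_wallAngle l; fun_prop
  have hsc : Continuous s := hsm.continuous
  have hac := ha.continuous
  have hκc : ∀ N, Continuous (κ' N) := fun N => by have := hcut N; fun_prop
  -- At each interior point the cutoffs are eventually one, with zero derivative; it remains to
  -- dominate uniformly in `N`.
  refine tendsto_nhds_unique (tendsto_integral_filter_of_dominated_convergence (μ := volume.restrict (strip l)) (l := atTop)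
    (F := fun (N : ℕ) z => ((w z).1 * (a z.1 * (lam * c z.2 *
      (wallCut N (l - z.2) * wallCut N (l + z.2)) + s z.2 * κ' N z.2)) -
      (w z).2 * (deriv a z.1 * (s z.2 * (wallCut N (l - z.2) * wallCut N (l + z.2))))))
    (fun z => ‖(w z).1 * (a z.1 * 1)‖ * (lam + 4 * lam * C) + ‖(w z).2 * (deriv a z.1 * 1)‖)
    (Eventually.of_forall fun N => ?_) (Eventually.of_forall fun N => ?_)
    ((i1.norm.mul_const _).add i2.norm) ?_)
    (tendsto_const_nhds.congr' ((eventually_gt_atTop 0).mono fun N hN => (hzero N hN).symm))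
  · have h1 := hcut N
    have h2 := hκc N
    have c1 : Continuous fun z : ℝ × ℝ => a z.1 * (lam * c z.2 *
      (wallCut N (l - z.2) * wallCut N (l + z.2)) + s z.2 * κ' N z.2) := by fun_prop
    have c2 : Continuous fun z : ℝ × ℝ => deriv a z.1 * (s z.2 *
      (wallCut N (l - z.2) * wallCut N (l + z.2))) := by fun_prop
    exact (hw.fst.1.mul c1.aestronglyMeasurable).sub (hw.snd.1.mul c2.aestronglyMeasurable)
  · filter_upwards [ae_restrict_mem (measurableSet_strip l)] with z hz
    obtain ⟨s1, s2⟩ := abs_sin_mul_wallAngle_le hl n z.2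
    have p1 : 0 ≤ l + z.2 := by linarith [hz.1]
    have p2 : 0 ≤ l - z.2 := by linarith [hz.2]
    rw [abs_of_nonneg p1] at s1
    rw [abs_of_nonneg p2] at s2
    have k1 := mul_abs_deriv_wallCut_le hC0 hC1 N (l + z.2)
    have k2 := mul_abs_deriv_wallCut_le hC0 hC1 N (l - z.2)
    have q1 := abs_wallCut_le_one N (l - z.2)
    have q2 := abs_wallCut_le_one N (l + z.2)
    have hκκ : |wallCut N (l - z.2) * wallCut N (l + z.2)| ≤ 1 := by
      rw [abs_mul]; exact mul_le_one₀ q1 (abs_nonneg _) q2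
    -- The derivative of the cutoff is of order `N` only within `2/N` of a wall, where the sine is
    -- of order `1/N`.
    have hsκ : |s z.2 * κ' N z.2| ≤ 4 * lam * C := by
      have e : s z.2 * κ' N z.2 = -(s z.2 * (N * d (N * (l - z.2) - 1))) * wallCut N (l + z.2) +
        (s z.2 * (N * d (N * (l + z.2) - 1))) * wallCut N (l - z.2) := by
        simp only [hκ']; ring
      rw [e]
      refine (abs_add_le _ _).trans ?_
      rw [abs_mul, abs_mul, abs_neg, abs_mul, abs_mul (s z.2)]
      have b1 : |s z.2| * |N * d (N * (l - z.2) - 1)| ≤ lam * (2 * C) := by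
        calc _ ≤ lam * (l - z.2) * |N * d (N * (l - z.2) - 1)| := by gcongr
          _ = lam * ((l - z.2) * |N * d (N * (l - z.2) - 1)|) := by ring
          _ ≤ _ := by gcongr
      have b2 : |s z.2| * |N * d (N * (l + z.2) - 1)| ≤ lam * (2 * C) := by
        calc _ ≤ lam * (l + z.2) * |N * d (N * (l + z.2) - 1)| := by gcongr
          _ = lam * ((l + z.2) * |N * d (N * (l + z.2) - 1)|) := by ring
          _ ≤ _ := by gcongr
      calc _ ≤ lam * (2 * C) * 1 + lam * (2 * C) * 1 := by gcongr
        _ = _ := by ring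
    have hc1 : |lam * c z.2 * (wallCut N (l - z.2) * wallCut N (l + z.2))| ≤ lam := by
      rw [abs_mul, abs_mul, abs_of_nonneg hlam0]
      calc _ ≤ lam * 1 * 1 := by gcongr; exact Real.abs_cos_le_one _
        _ = lam := by ring
    have hs1 : |s z.2 * (wallCut N (l - z.2) * wallCut N (l + z.2))| ≤ 1 := by
      rw [abs_mul]
      exact mul_le_one₀ (Real.abs_sin_le_one _) (abs_nonneg _) hκκ
    refine (norm_sub_le _ _).trans (add_le_add ?_ ?_)
    · rw [mul_one, ← mul_assoc, norm_mul]
      exact mul_le_mul_of_nonneg_left ((abs_add_le _ _).trans (add_le_add hc1 hsκ)) (norm_nonneg _)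
    · rw [mul_one, ← mul_assoc, norm_mul]
      exact mul_le_of_le_one_right (norm_nonneg _) hs1
  · filter_upwards [ae_restrict_mem (measurableSet_strip l)] with z hz
    have p1 : 0 < l + z.2 := by linarith [hz.1]
    have p2 : 0 < l - z.2 := by linarith [hz.2]
    refine tendsto_const_nhds.congr' ?_
    have ev : ∀ u : ℝ, 0 < u → ∀ᶠ N : ℕ in atTop, 1 < N * u - 1 := by
      intro u hu
      filter_upwards [(tendsto_natCast_atTop_atTop (R := ℝ)).eventually_gt_atTop (2 / u)] with N hN
      rw [div_lt_iff₀ hu] at hN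
      linarith
    filter_upwards [ev _ p1, ev _ p2] with N h1 h2
    have e1 : wallCut N (l + z.2) = 1 := Real.smoothTransition.one_of_one_le h1.le
    have e2 : wallCut N (l - z.2) = 1 := Real.smoothTransition.one_of_one_le h2.le
    have e3 : d (N * (l + z.2) - 1) = 0 := deriv_smoothTransition_eq_zero h1
    have e4 : d (N * (l - z.2) - 1) = 0 := deriv_smoothTransition_eq_zero h2
    simp only [hκ', e1, e2, e3, e4]
    ring

end TestFunctions

/-! ### Uniqueness of the velocity -/

section Uniqueness

variable {l : ℝ} {w : ℝ × ℝ → ℝ × ℝ}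

lemma sq_setIntegral_le (hl : 0 < l) {h : ℝ → ℝ} (h1 : IntegrableOn h (Ioo (-l) l))
    (h2 : IntegrableOn (fun y => h y ^ 2) (Ioo (-l) l)) :
    (∫ y in Ioo (-l) l, h y) ^ 2 ≤ 2 * l * ∫ y in Ioo (-l) l, h y ^ 2 := by
  set I := ∫ y in Ioo (-l) l, h y with hI
  set m := I / (2 * l) with hm
  have h0 : 0 ≤ ∫ y in Ioo (-l) l, (h y - m) ^ 2 := integral_nonneg fun _ => sq_nonneg _
  have hc : IntegrableOn (fun _ : ℝ => m ^ 2) (Ioo (-l) l) := integrableOn_const (by simp)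
  have e : ∀ y, (h y - m) ^ 2 = h y ^ 2 - 2 * m * h y + m ^ 2 := fun y => by ring
  simp only [e] at h0
  rw [integral_add (by exact h2.sub (h1.const_mul _)) hc, integral_sub h2 (h1.const_mul _),
    integral_const_mul, ← hI, setIntegral_const, smul_eq_mul] at h0
  have hv : (volume : Measure ℝ).real (Ioo (-l) l) = 2 * l := by
    rw [Measure.real, Real.volume_Ioo, ENNReal.toReal_ofReal (by linarith)]; ring
  rw [hv] at h0
  have hIm : I = 2 * l * m := by rw [hm]; field_simp
  rw [hIm] at h0 ⊢
  nlinarith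

lemma slice_sq_integrable (hl : 0 < l) {H : ℝ × ℝ → ℝ} (hH : MemLp H 2 (volume.restrict (strip l))) :
    Integrable (fun x => (∫ y in Ioo (-l) l, H (x, y)) ^ 2) ∧
    LocallyIntegrable (fun x => ∫ y in Ioo (-l) l, H (x, y)) ∧
    ∀ᵐ x, IntegrableOn (fun y => H (x, y)) (Ioo (-l) l) := by
  have h2 := hH.integrable_sq
  have hm := hH.1
  rw [restrict_strip] at h2 hm
  have hmx : AEStronglyMeasurable (fun x => ∫ y in Ioo (-l) l, H (x, y)) := hm.integral_prod_right'
  have hae : ∀ᵐ x, IntegrableOn (fun y => H (x, y)) (Ioo (-l) l) := by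
    filter_upwards [h2.prod_right_ae, hm.prodMk_left] with x hx hx'
    exact ((memLp_two_iff_integrable_sq hx').2 hx).integrable (by norm_num)
  have hsq : Integrable (fun x => (∫ y in Ioo (-l) l, H (x, y)) ^ 2) := by
    refine (h2.integral_prod_left.const_mul (2 * l)).mono' (hmx.pow 2) ?_
    filter_upwards [h2.prod_right_ae, hae] with x hx hx'
    rw [Real.norm_of_nonneg (sq_nonneg _)]
    exact sq_setIntegral_le hl hx' hx
  exact ⟨hsq, ((memLp_two_iff_integrable_sq hmx).2 hsq).locallyIntegrable (by norm_num), hae⟩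

/-- The modes of an irrotational and incompressible field vanish. -/
lemma mode_ae_eq_zero (hl : 0 < l) (hw : MemLp w 2 (volume.restrict (strip l)))
    (hD : ∀ φ : ℝ × ℝ → ℝ, ContDiff ℝ ∞ φ → HasCompactSupport φ →
      ∫ z in strip l, fderiv ℝ φ z (w z) = 0)
    (hC : ∀ φ : ℝ × ℝ → ℝ, ContDiff ℝ ∞ φ → HasCompactSupport φ → tsupport φ ⊆ strip l →
      ∫ z in strip l, ((w z).1 * fderiv ℝ φ z (0, 1) - (w z).2 * fderiv ℝ φ z (1, 0)) = 0)
    (n : ℕ) {σ : ℝ} (hσ : σ ^ 2 = 1) : ∀ᵐ x, ∫ y in Ioo (-l) l,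
      ((w (x, y)).1 * Real.cos (n * wallAngle l y) +
        σ * ((w (x, y)).2 * Real.sin (n * wallAngle l y))) = 0 := by
  have hθ := continuous_wallAngle l
  set lam : ℝ := n * (Real.pi / (2 * l)) with hlam
  have cc : Continuous fun z : ℝ × ℝ => Real.cos (n * wallAngle l z.2) := by fun_prop
  have cs : Continuous fun z : ℝ × ℝ => Real.sin (n * wallAngle l z.2) := by fun_prop
  have m1 : MemLp (fun z : ℝ × ℝ => (w z).1 * Real.cos (n * wallAngle l z.2)) 2
      (volume.restrict (strip l)) :=
    hw.fst.of_le (hw.fst.1.mul cc.aestronglyMeasurable) (ae_of_all _ fun z => by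
      rw [norm_mul]
      exact mul_le_of_le_one_right (norm_nonneg _) (Real.abs_cos_le_one _))
  have m2 : MemLp (fun z : ℝ × ℝ => (w z).2 * Real.sin (n * wallAngle l z.2)) 2
      (volume.restrict (strip l)) :=
    hw.snd.of_le (hw.snd.1.mul cs.aestronglyMeasurable) (ae_of_all _ fun z => by
      rw [norm_mul]
      exact mul_le_of_le_one_right (norm_nonneg _) (Real.abs_sin_le_one _))
  have mH : MemLp (fun z : ℝ × ℝ => (w z).1 * Real.cos (n * wallAngle l z.2) +
      σ * ((w z).2 * Real.sin (n * wallAngle l z.2))) 2 (volume.restrict (strip l)) :=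
    m1.add (m2.const_mul σ)
  obtain ⟨r1, r2, -⟩ := slice_sq_integrable hl mH
  -- With `C` the cosine mode of the first component and `S` the sine mode of the second,
  -- incompressibility gives `C' = -λS` (`k1` below) and irrotationality `S' = -λC` (`k2`). Hence `R
  -- = C + σS` with `σ² = 1` solves `R' = -σλR`.
  refine ae_eq_zero_of_weak_ode (μ := σ * lam) r2 r1 fun χ hχ hs => ?_
  have hχc := hχ.continuous
  have hdχ : Continuous (deriv χ) :=
    (hχ.of_le (m := 1) (by norm_num)).continuous_deriv le_rfl
  have p1 : MemLp (fun z : ℝ × ℝ => χ z.1 * 1) 2 (volume.restrict (strip l)) :=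
    memLp_mul_prod hχc hs continuous_const
  have p2 : MemLp (fun z : ℝ × ℝ => deriv χ z.1 * 1) 2 (volume.restrict (strip l)) :=
    memLp_mul_prod hdχ hs.deriv continuous_const
  have a1 : Integrable (fun z : ℝ × ℝ => (w z).1 * Real.cos (n * wallAngle l z.2) * (χ z.1 * 1))
      (volume.restrict (strip l)) := m1.integrable_mul p1
  have a2 : Integrable (fun z : ℝ × ℝ => (w z).1 * Real.cos (n * wallAngle l z.2) *
      (deriv χ z.1 * 1)) (volume.restrict (strip l)) := m1.integrable_mul p2
  have a3 : Integrable (fun z : ℝ × ℝ => (w z).2 * Real.sin (n * wallAngle l z.2) * (χ z.1 * 1))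
      (volume.restrict (strip l)) := m2.integrable_mul p1
  have a4 : Integrable (fun z : ℝ × ℝ => (w z).2 * Real.sin (n * wallAngle l z.2) *
      (deriv χ z.1 * 1)) (volume.restrict (strip l)) := m2.integrable_mul p2
  have hcosm : ContDiff ℝ ∞ fun y => Real.cos (n * wallAngle l y) := by
    simp only [wallAngle]; fun_prop
  have e1 := setIntegral_div_prod hD hχ hs hcosm
  have e2 := setIntegral_curl_sin hl hw hC hχ hs n
  have k1 : ∫ z in strip l, (w z).1 * Real.cos (n * wallAngle l z.2) * (deriv χ z.1 * 1) =
      lam * ∫ z in strip l, (w z).2 * Real.sin (n * wallAngle l z.2) * (χ z.1 * 1) := by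
    rw [← sub_eq_zero, ← integral_const_mul, ← integral_sub a2 (a3.const_mul _), ← e1]
    refine integral_congr_ae (ae_of_all _ fun z => ?_)
    simp only
    rw [(hasDerivAt_cos_wallAngle l n z.2).deriv]
    ring
  have k2 : lam * ∫ z in strip l, (w z).1 * Real.cos (n * wallAngle l z.2) * (χ z.1 * 1) =
      ∫ z in strip l, (w z).2 * Real.sin (n * wallAngle l z.2) * (deriv χ z.1 * 1) := by
    rw [← sub_eq_zero, ← integral_const_mul, ← integral_sub (a1.const_mul _) a4, ← e2]
    refine integral_congr_ae (ae_of_all _ fun z => ?_)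
    simp only
    ring
  have htot : ∫ x, (∫ y in Ioo (-l) l, ((w (x, y)).1 * Real.cos (n * wallAngle l y) +
      σ * ((w (x, y)).2 * Real.sin (n * wallAngle l y)))) * (deriv χ x - σ * lam * χ x) =
      ∫ z in strip l, (((w z).1 * Real.cos (n * wallAngle l z.2) * (deriv χ z.1 * 1) +
        σ * ((w z).2 * Real.sin (n * wallAngle l z.2) * (deriv χ z.1 * 1))) -
        (σ * lam * ((w z).1 * Real.cos (n * wallAngle l z.2) * (χ z.1 * 1)) +
        σ ^ 2 * lam * ((w z).2 * Real.sin (n * wallAngle l z.2) * (χ z.1 * 1)))) := by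
    have hi := (a2.add (a4.const_mul σ)).sub ((a1.const_mul (σ * lam)).add
      (a3.const_mul (σ ^ 2 * lam)))
    rw [restrict_strip] at hi ⊢
    rw [integral_prod _ (by exact hi)]
    refine integral_congr_ae (ae_of_all _ fun x => ?_)
    simp only
    rw [← integral_mul_const]
    refine integral_congr_ae (ae_of_all _ fun y => ?_)
    simp only
    ring
  have b1 := a2.add (a4.const_mul σ)
  have b2 := (a1.const_mul (σ * lam)).add (a3.const_mul (σ ^ 2 * lam))
  rw [htot, integral_sub (by exact b1) (by exact b2), integral_add a2 (a4.const_mul _), integral_add (a1.const_mul _)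
    (a3.const_mul _), integral_const_mul, integral_const_mul, integral_const_mul, hσ, k1, ← k2]
  ring

/-- A square integrable field that is irrotational, incompressible and tangent to the walls
vanishes. -/
lemma ae_eq_zero_of_div_curl (hl : 0 < l) (hw : MemLp w 2 (volume.restrict (strip l)))
    (hD : ∀ φ : ℝ × ℝ → ℝ, ContDiff ℝ ∞ φ → HasCompactSupport φ →
      ∫ z in strip l, fderiv ℝ φ z (w z) = 0)
    (hC : ∀ φ : ℝ × ℝ → ℝ, ContDiff ℝ ∞ φ → HasCompactSupport φ → tsupport φ ⊆ strip l →
      ∫ z in strip l, ((w z).1 * fderiv ℝ φ z (0, 1) - (w z).2 * fderiv ℝ φ z (1, 0)) = 0) :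
    ∀ᵐ z ∂(volume.restrict (strip l)), w z = 0 := by
  have hθ := continuous_wallAngle l
  have hp := ae_all_iff.2 fun n : ℕ => mode_ae_eq_zero hl hw hD hC n (σ := 1) (by norm_num)
  have hm := ae_all_iff.2 fun n : ℕ => mode_ae_eq_zero hl hw hD hC n (σ := -1) (by norm_num)
  obtain ⟨-, -, s1⟩ := slice_sq_integrable hl hw.fst
  obtain ⟨-, -, s2⟩ := slice_sq_integrable hl hw.snd
  have hslice : ∀ᵐ x, ∀ᵐ y ∂(volume.restrict (Ioo (-l) l)), w (x, y) = 0 := by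
    filter_upwards [hp, hm, s1, s2] with x hx hx' i1 i2
    have j1 : ∀ n : ℕ, IntegrableOn (fun y => (w (x, y)).1 * Real.cos (n * wallAngle l y))
        (Ioo (-l) l) := fun n =>
      integrable_mul_bdd_continuous i1 (by fun_prop) fun y => Real.abs_cos_le_one _
    have j2 : ∀ n : ℕ, IntegrableOn (fun y => (w (x, y)).2 * Real.sin (n * wallAngle l y))
        (Ioo (-l) l) := fun n =>
      integrable_mul_bdd_continuous i2 (by fun_prop) fun y => Real.abs_sin_le_one _
    have hcs : ∀ n : ℕ, ∫ y in Ioo (-l) l, (w (x, y)).1 * Real.cos (n * wallAngle l y) = 0 ∧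
        ∫ y in Ioo (-l) l, (w (x, y)).2 * Real.sin (n * wallAngle l y) = 0 := by
      intro n
      have h1 := hx n
      have h2 := hx' n
      -- The two choices `σ = ±1` give `C + S = 0` and `C - S = 0`, so both modes vanish.
      rw [integral_add (j1 n) ((j2 n).const_mul _), integral_const_mul] at h1 h2
      constructor <;> linarith
    filter_upwards [ae_eq_zero_of_integral_cos hl i1 fun n => (hcs n).1,
      ae_eq_zero_of_integral_sin hl i2 fun n => (hcs n).2] with y h1 h2
    exact Prod.ext h1 h2
  have hm := hw.1.enorm
  have hint : ∫⁻ z in strip l, ‖w z‖ₑ = 0 := by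
    rw [restrict_strip] at hm ⊢
    rw [lintegral_prod _ hm]
    refine (lintegral_congr_ae ?_).trans lintegral_zero
    filter_upwards [hslice] with x hx
    refine (lintegral_congr_ae ?_).trans lintegral_zero
    filter_upwards [hx] with y hy
    rw [hy, enorm_zero]
  rw [lintegral_eq_zero_iff' hm] at hint
  filter_upwards [hint] with z hz
  simpa using hz

/-- The velocity of a Darcy flow is unique. -/
lemma IsDarcyFlow.velocity_ae_eq (hl : 0 < l) {T : ℝ} {ρ : ℝ → ℝ × ℝ → ℝ}
    {v v' : ℝ → ℝ × ℝ → ℝ × ℝ} {p p' : ℝ → ℝ × ℝ → ℝ} (h : IsDarcyFlow l T ρ v p)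
    (h' : IsDarcyFlow l T ρ v' p') {t : ℝ} (ht : t ∈ Ioo 0 T) :
    v t =ᵐ[volume.restrict (strip l)] v' t := by
  have hw := h.square_integrable t ht
  have hw' := h'.square_integrable t ht
  have hmem : ∀ {φ : ℝ × ℝ → ℝ} (_ : ContDiff ℝ ∞ φ) (_ : HasCompactSupport φ) (e : ℝ × ℝ),
      MemLp (fun z => fderiv ℝ φ z e) 2 (volume.restrict (strip l)) := fun hφ hs e =>
    memLp_fderiv_apply (hφ.of_le (by norm_num)) hs e
  have key := ae_eq_zero_of_div_curl hl (w := fun z => v t z - v' t z) (hw.sub hw') ?_ ?_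
  · filter_upwards [key] with z hz using sub_eq_zero.1 hz
  · intro φ hφ hs
    have hi : ∀ {u : ℝ × ℝ → ℝ × ℝ}, MemLp u 2 (volume.restrict (strip l)) →
        Integrable (fun z => fderiv ℝ φ z (u z)) (volume.restrict (strip l)) := by
      intro u hu
      have e : (fun z => fderiv ℝ φ z (u z)) = fun z => (u z).1 * fderiv ℝ φ z (1, 0) +
          (u z).2 * fderiv ℝ φ z (0, 1) := funext fun z => fderiv_apply_eq φ z _ _
      rw [e]
      exact (hu.fst.integrable_mul (hmem hφ hs _)).add (hu.snd.integrable_mul (hmem hφ hs _))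
    simp only [map_sub]
    rw [integral_sub (hi hw) (hi hw'), h.incompressible_impermeable t ht φ hφ hs,
      h'.incompressible_impermeable t ht φ hφ hs, sub_zero]
  · intro φ hφ hs hsupp
    have hφ' : ∀ e : ℝ × ℝ, ContDiff ℝ ∞ (fun z => fderiv ℝ φ z e) := fun e =>
      (hφ.fderiv_right (m := ∞) (by norm_num)).clm_apply contDiff_const
    have hs' : ∀ e : ℝ × ℝ, HasCompactSupport (fun z => fderiv ℝ φ z e) :=
      hasCompactSupport_fderiv_apply hs
    have hsupp' : ∀ e : ℝ × ℝ, tsupport (fun z => fderiv ℝ φ z e) ⊆ strip l := fun e =>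
      (closure_mono fun z hz => by
        intro h0
        refine hz ?_
        simp only [h0, zero_apply]).trans
        ((tsupport_fderiv_subset ℝ).trans hsupp)
    have hsymm : ∀ z, fderiv ℝ (fun z => fderiv ℝ φ z (0, 1)) z (1, 0) =
        fderiv ℝ (fun z => fderiv ℝ φ z (1, 0)) z (0, 1) := by
      intro z
      have hd : DifferentiableAt ℝ (fderiv ℝ φ) z :=
        (hφ.fderiv_right (m := ∞) (by norm_num)).differentiable (by norm_num) z
      have hs2 : IsSymmSndFDerivAt ℝ φ z :=
        hφ.contDiffAt.isSymmSndFDerivAt (by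
          rw [minSmoothness_of_isRCLikeNormedField]; exact WithTop.coe_le_coe.2 le_top)
      rw [fderiv_clm_apply hd (differentiableAt_const _),
        fderiv_clm_apply hd (differentiableAt_const _)]
      simpa using hs2 (1, 0) (0, 1)
    -- Testing Darcy's law with `∂_yφ` and `∂ₓφ` and subtracting eliminates the pressure, by
    -- symmetry of second derivatives. The curl that remains depends on the density alone and is
    -- common to both flows.
    have f1 : ∀ {u : ℝ → ℝ × ℝ → ℝ × ℝ} {q : ℝ → ℝ × ℝ → ℝ}, IsDarcyFlow l T ρ u q →
        ∫ z in strip l, (u t z).1 * fderiv ℝ φ z (0, 1) =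
        (∫ z in strip l, (u t z).2 * fderiv ℝ φ z (1, 0)) +
          ∫ z in strip l, ρ t z * fderiv ℝ φ z (1, 0) := by
      intro u q hu
      rw [hu.darcy_fst t ht _ (hφ' (0, 1)) (hs' _) (hsupp' _),
        hu.darcy_snd t ht _ (hφ' (1, 0)) (hs' _) (hsupp' _)]
      simp only [hsymm]
      ring
    have i1 := hw.fst.integrable_mul (hmem hφ hs (0, 1))
    have i2 := hw.snd.integrable_mul (hmem hφ hs (1, 0))
    have i3 := hw'.fst.integrable_mul (hmem hφ hs (0, 1))
    have i4 := hw'.snd.integrable_mul (hmem hφ hs (1, 0))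
    have e : ∀ z, (v t z - v' t z).1 * fderiv ℝ φ z (0, 1) -
        (v t z - v' t z).2 * fderiv ℝ φ z (1, 0) =
        ((v t z).1 * fderiv ℝ φ z (0, 1) - (v t z).2 * fderiv ℝ φ z (1, 0)) -
        ((v' t z).1 * fderiv ℝ φ z (0, 1) - (v' t z).2 * fderiv ℝ φ z (1, 0)) := by
      intro z; simp only [Prod.fst_sub, Prod.snd_sub]; ring
    simp only [e]
    rw [integral_sub (by exact i1.sub i2) (by exact i3.sub i4), integral_sub (by exact i1)
      (by exact i2), integral_sub (by exact i3) (by exact i4), f1 h, f1 h']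
    ring

end Uniqueness

/-! ### Bounds uniform on compact time intervals -/

section TimeUniform

variable {l T δ δ' M M' : ℝ} {f : ℝ → ℝ → ℝ} {g : ℝ → ℝ}

lemma ProfileBound.mono (hg : ProfileBound l δ M g) (hδ : δ' ≤ δ) (hM : M ≤ M') :
    ProfileBound l δ' M' g where
  contDiff := hg.contDiff
  abs_le x := (hg.abs_le x).trans (by linarith)
  deriv_le x := (hg.deriv_le x).trans hM
  deriv_lip x y := (hg.deriv_lip x y).trans (by gcongr)
  sq_int := hg.sq_int
  deriv_sq_int := hg.deriv_sq_int
  deriv_sq_le := hg.deriv_sq_le.trans hM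

/-- Local uniformity in time passes to compact sets by finite covers: a bound survives decreasing
`δ` and increasing `M`. -/
lemma IsInterfaceCurve.exists_uniform_bound (hl : 0 < l) (hf : IsInterfaceCurve l T f) {K : Set ℝ}
    (hK : IsCompact K) (hKT : K ⊆ Ioo 0 T) :
    ∃ δ > 0, ∃ M, ∀ t ∈ K, ProfileBound l δ M (f t) := by
  refine hK.induction_on (p := fun s => ∃ δ > 0, ∃ M, ∀ t ∈ s, ProfileBound l δ M (f t))
    ⟨1, one_pos, 0, by simp⟩ ?_ ?_ ?_
  · rintro s t hst ⟨δ, hδ, M, h⟩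
    exact ⟨δ, hδ, M, fun x hx => h x (hst hx)⟩
  · rintro s t ⟨δ, hδ, M, h⟩ ⟨δ', hδ', M', h'⟩
    refine ⟨min δ δ', lt_min hδ hδ', max M M', ?_⟩
    rintro x (hx | hx)
    · exact (h x hx).mono (min_le_left _ _) (le_max_left _ _)
    · exact (h' x hx).mono (min_le_right _ _) (le_max_right _ _)
  · intro t ht
    obtain ⟨δ, hδ, M, h⟩ := (hf.regularity hl).1 t (hKT ht)
    exact ⟨_, mem_nhdsWithin_of_mem_nhds h, δ, hδ, M, fun x hx => hx⟩

lemma isOpen_time (T : ℝ) : IsOpen (Ioo 0 T ×ˢ (univ : Set ℝ)) := isOpen_Ioo.prod isOpen_univ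

lemma IsInterfaceCurve.continuousOn_pvInt (hl : 0 < l) (hf : IsInterfaceCurve l T f) :
    ContinuousOn (fun q : ℝ × ℝ => pvInt l 0 (f q.1) q.2) (Ioo 0 T ×ˢ univ) := by
  obtain ⟨h0, h1, h2⟩ := hf.regularity hl
  intro q hq
  refine ContinuousAt.continuousWithinAt ?_
  obtain ⟨δ, hδ, M, hb⟩ := h0 q.1 hq.1
  have hsh : ∀ η, Tendsto (fun q : ℝ × ℝ => (q.1, q.2 - η)) (𝓝 q) (𝓝 (q.1, q.2 - η)) := fun η =>
    Continuous.tendsto (by fun_prop) q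
  have hmem : ∀ η, Ioo 0 T ×ˢ (univ : Set ℝ) ∈ 𝓝 (q.1, q.2 - η) := fun η =>
    (isOpen_time T).mem_nhds ⟨hq.1, trivial⟩
  exact tendsto_pvInt (e := fun _ => 0) (G := fun q : ℝ × ℝ => f q.1) (X := fun q => q.2)
    (g := f q.1) hl hδ le_rfl tendsto_const_nhds (Eventually.of_forall fun _ => ⟨le_rfl, zero_le_one⟩)
    (continuousAt_fst.eventually hb)
    (fun η => ((h1.continuousAt (hmem η)).tendsto.comp (hsh η)))
    (fun η => ((h2.continuousAt (hmem η)).tendsto.comp (hsh η)))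

/-- A bound of the `L²` norm of the velocity depending only on the bounds of the profile. -/
lemma exists_velocity_bound (hl : 0 < l) (ρ₁ ρ₂ M : ℝ) : ∃ B, ∀ δ > 0, ∀ g, ProfileBound l δ M g →
    ∫ z in strip l, (velocity l ρ₁ ρ₂ g z).1 ^ 2 ≤ B ∧
    ∫ z in strip l, (velocity l ρ₁ ρ₂ g z).2 ^ 2 ≤ B := by
  set Q : ENNReal := ENNReal.ofReal (kerC l) ^ 2 * (singC l * ENNReal.ofReal M) with hQ
  have hQt : Q ≠ ⊤ := ENNReal.mul_ne_top (by simp)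
    (ENNReal.mul_ne_top (singC_lt_top hl).ne ENNReal.ofReal_ne_top)
  refine ⟨((ρ₁ - ρ₂) / (8 * l)) ^ 2 * Q.toReal, fun δ hδ g hg => ?_⟩
  have hgm := hg.continuous.measurable
  have hb : ∀ K : ℝ × ℝ → ℝ → ℝ,
      MemLp (fun z => ∫ x', K z x') 2 (volume.restrict (strip l)) →
      (∀ᵐ q ∂((volume.restrict (strip l)).prod (volume : Measure ℝ)),
        |K q.1 q.2| ≤ kerC l * singBound l (deriv g) g q.1 q.2) →
      ∫ z in strip l, (∫ x', K z x') ^ 2 ≤ Q.toReal := by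
    intro K hK hKb
    rw [integral_eq_lintegral_of_nonneg_ae (ae_of_all _ fun _ => sq_nonneg _)
      hK.integrable_sq.1]
    refine ENNReal.toReal_mono hQt ?_
    have h1 := lintegral_sq_integral_le (kerC_nonneg hl) (measurable_deriv g) hgm (hg.abs_le' hδ) hKb
    refine le_trans (le_of_eq (lintegral_congr fun z => ?_)) (h1.trans ?_)
    · rw [Real.enorm_eq_ofReal_abs, ← ENNReal.ofReal_pow (abs_nonneg _), sq_abs]
    · have h2 : ∫⁻ x, ENNReal.ofReal (deriv g x ^ 2) ≤ ENNReal.ofReal M := by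
        rw [← ofReal_integral_eq_lintegral_ofReal hg.deriv_sq_int (ae_of_all _ fun _ => sq_nonneg _)]
        exact ENNReal.ofReal_le_ofReal hg.deriv_sq_le
      exact mul_le_mul' le_rfl (mul_le_mul' le_rfl h2)
  have k1 := hb _ (memLp_integral_kernel hl (kerC_nonneg hl) (measurable_deriv g) hgm
    (hg.abs_le' hδ) hg.deriv_sq_int (measurable_intY (l := l) hgm 0).aestronglyMeasurable
    ((ae_abs_int_le hl hδ hg le_rfl).mono fun _ h => h.1))
    ((ae_abs_int_le hl hδ hg le_rfl).mono fun _ h => h.1)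
  have k2 := hb _ (memLp_integral_kernel hl (kerC_nonneg hl) (measurable_deriv g) hgm
    (hg.abs_le' hδ) hg.deriv_sq_int (measurable_intX (l := l) hgm 0).aestronglyMeasurable
    ((ae_abs_int_le hl hδ hg le_rfl).mono fun _ h => h.2))
    ((ae_abs_int_le hl hδ hg le_rfl).mono fun _ h => h.2)
  simp only [velocity, neg_sq, mul_pow, integral_const_mul]
  exact ⟨by gcongr, by gcongr⟩

end TimeUniform

/-! ### Time slices of test functions, space-time integrability -/

section Slices

variable {l T : ℝ} {φ ψ : ℝ × (ℝ × ℝ) → ℝ}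

lemma fderiv_time_slice (hφ : ContDiff ℝ 1 φ) (t : ℝ) (z u : ℝ × ℝ) :
    fderiv ℝ (fun z => φ (t, z)) z u = fderiv ℝ φ (t, z) (0, u) := by
  have h := ((hφ.differentiable (by norm_num) (t, z)).hasFDerivAt).comp z
    (hasFDerivAt_prodMk_right (𝕜 := ℝ) t z)
  have h' : HasFDerivAt (fun z => φ (t, z)) _ z := h
  rw [h'.fderiv]
  rfl

lemma contDiff_time_slice {n : WithTop ℕ∞} (hφ : ContDiff ℝ n φ) (t : ℝ) :
    ContDiff ℝ n fun z => φ (t, z) := hφ.comp (contDiff_const.prodMk contDiff_id)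

lemma hasCompactSupport_time_slice (hs : HasCompactSupport φ) (t : ℝ) :
    HasCompactSupport fun z => φ (t, z) :=
  HasCompactSupport.of_support_subset_isCompact (hs.isCompact.image continuous_snd)
    fun z hz => ⟨(t, z), subset_tsupport _ hz, rfl⟩

lemma tsupport_time_slice (hsupp : tsupport φ ⊆ Ioo 0 T ×ˢ strip l) (t : ℝ) :
    tsupport (fun z => φ (t, z)) ⊆ strip l := by
  have h : tsupport (fun z => φ (t, z)) ⊆ (fun z => (t, z)) ⁻¹' tsupport φ :=
    closure_minimal (fun z hz => subset_tsupport _ hz)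
      ((isClosed_tsupport φ).preimage (by fun_prop))
  exact fun z hz => (hsupp (h hz)).2

lemma eq_zero_of_notMem_time (hsupp : tsupport φ ⊆ Ioo 0 T ×ˢ strip l) {q : ℝ × (ℝ × ℝ)}
    (hq : q ∉ Ioo 0 T ×ˢ strip l) : φ q = 0 ∧ fderiv ℝ φ q = 0 :=
  ⟨image_eq_zero_of_notMem_tsupport fun h => hq (hsupp h),
    image_eq_zero_of_notMem_tsupport fun h => hq (hsupp (tsupport_fderiv_subset ℝ h))⟩

lemma restrict_time (l T : ℝ) : (volume : Measure (ℝ × (ℝ × ℝ))).restrict (Ioo 0 T ×ˢ strip l) =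
    ((volume : Measure ℝ).restrict (Ioo 0 T)).prod ((volume : Measure (ℝ × ℝ)).restrict (strip l)) := by
  rw [Measure.volume_eq_prod, Measure.prod_restrict]

/-- A Darcy flow is square integrable at each time, which says nothing about integrability in time.
A bound uniform over the times met by the support of `ψ` supplies it. -/
lemma integrable_mul_of_sq_bound {u : ℝ × (ℝ × ℝ) → ℝ} {B : ℝ}
    (hum : AEStronglyMeasurable u (((volume : Measure ℝ).restrict (Ioo 0 T)).prod
      ((volume : Measure (ℝ × ℝ)).restrict (strip l))))
    (hu : ∀ t ∈ Ioo 0 T, MemLp (fun z => u (t, z)) 2 (volume.restrict (strip l)))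
    (hψ : Continuous ψ) (hs : HasCompactSupport ψ)
    (hB : ∀ t ∈ Ioo 0 T, t ∈ Prod.fst '' tsupport ψ → ∫ z in strip l, u (t, z) ^ 2 ≤ B) :
    Integrable (fun q => u q * ψ q) (((volume : Measure ℝ).restrict (Ioo 0 T)).prod
      ((volume : Measure (ℝ × ℝ)).restrict (strip l))) := by
  have hψt : ∀ t, Continuous fun z => ψ (t, z) := fun t => hψ.comp (by fun_prop)
  have hψL : ∀ t, MemLp (fun z => ψ (t, z)) 2 (volume.restrict (strip l)) := fun t =>
    ((hψt t).memLp_of_hasCompactSupport (hasCompactSupport_time_slice hs t)).restrict _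
  have hm : AEStronglyMeasurable (fun q => u q * ψ q) (((volume : Measure ℝ).restrict (Ioo 0 T)).prod
      ((volume : Measure (ℝ × ℝ)).restrict (strip l))) := hum.mul hψ.aestronglyMeasurable
  have hψ2 : Integrable (fun q => ψ q ^ 2) (((volume : Measure ℝ).restrict (Ioo 0 T)).prod
      ((volume : Measure (ℝ × ℝ)).restrict (strip l))) := by
    rw [← restrict_time]
    refine (Continuous.integrable_of_hasCompactSupport (by fun_prop) ?_).restrict
    simp only [pow_two]; exact hs.mul_left
  refine (integrable_prod_iff hm).2 ⟨?_, ?_⟩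
  · filter_upwards [ae_restrict_mem measurableSet_Ioo] with t ht
    exact (hu t ht).integrable_mul (hψL t)
  · refine ((integrable_const |B|).add hψ2.integral_prod_left).mono' hm.norm.integral_prod_right' ?_
    filter_upwards [ae_restrict_mem measurableSet_Ioo] with t ht
    rw [Real.norm_of_nonneg (integral_nonneg fun _ => norm_nonneg _)]
    have h0 : 0 ≤ ∫ z in strip l, ψ (t, z) ^ 2 := integral_nonneg fun _ => sq_nonneg _
    by_cases htK : t ∈ Prod.fst '' tsupport ψ
    · calc ∫ z in strip l, ‖u (t, z) * ψ (t, z)‖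
          ≤ ∫ z in strip l, (u (t, z) ^ 2 + ψ (t, z) ^ 2) := by
            refine integral_mono ((hu t ht).integrable_mul (hψL t)).norm
              ((hu t ht).integrable_sq.add (hψL t).integrable_sq) fun z => ?_
            simp only [norm_mul, Real.norm_eq_abs]
            rw [← sq_abs (u (t, z)), ← sq_abs (ψ (t, z))]
            nlinarith [sq_nonneg (|u (t, z)| - |ψ (t, z)|), sq_nonneg (|u (t, z)| + |ψ (t, z)|)]
        _ = (∫ z in strip l, u (t, z) ^ 2) + ∫ z in strip l, ψ (t, z) ^ 2 :=
            integral_add (hu t ht).integrable_sq (hψL t).integrable_sq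
        _ ≤ |B| + ∫ z in strip l, ψ (t, z) ^ 2 := by
            gcongr; exact (hB t ht htK).trans (le_abs_self B)
    · have hz : ∀ z, ψ (t, z) = 0 := fun z => image_eq_zero_of_notMem_tsupport fun h =>
        htK ⟨(t, z), h, rfl⟩
      simp [hz]

end Slices

section Density

variable {l T : ℝ} {f : ℝ → ℝ → ℝ}

lemma IsInterfaceCurve.measurable_timeCut (hl : 0 < l) (hf : IsInterfaceCurve l T f) :
    Measurable ((Ioo 0 T ×ˢ (univ : Set ℝ)).indicator fun q : ℝ × ℝ => f q.1 q.2) :=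
  measurable_indicator_of_continuousOn (hf.regularity hl).2.1

lemma IsInterfaceCurve.aestronglyMeasurable_density (hl : 0 < l) (hf : IsInterfaceCurve l T f)
    (ρ₁ ρ₂ : ℝ) : AEStronglyMeasurable (fun q : ℝ × (ℝ × ℝ) => density l ρ₁ ρ₂ f q.1 q.2)
      (volume.restrict (Ioo 0 T ×ˢ strip l)) := by
  set F := (Ioo 0 T ×ˢ (univ : Set ℝ)).indicator fun q : ℝ × ℝ => f q.1 q.2 with hF
  have mF : Measurable F := hf.measurable_timeCut hl
  have mF' : Measurable fun q : ℝ × (ℝ × ℝ) => F (q.1, q.2.1) := mF.comp (by fun_prop)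
  have mS : MeasurableSet {q : ℝ × (ℝ × ℝ) | q.2 ∈ strip l} :=
    (measurableSet_strip l).preimage measurable_snd
  have m1 : MeasurableSet {q : ℝ × (ℝ × ℝ) | q.2 ∈ strip l ∧ F (q.1, q.2.1) < q.2.2} :=
    mS.inter (measurableSet_lt mF' (by fun_prop))
  have m2 : MeasurableSet {q : ℝ × (ℝ × ℝ) | q.2 ∈ strip l ∧ q.2.2 < F (q.1, q.2.1)} :=
    mS.inter (measurableSet_lt (by fun_prop) mF')
  refine AEStronglyMeasurable.congr (((measurable_const (a := ρ₁)).indicator m1).add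
    ((measurable_const (a := ρ₂)).indicator m2)).aestronglyMeasurable ?_
  filter_upwards [ae_restrict_mem (measurableSet_Ioo.prod (measurableSet_strip l))] with q hq
  have hm : (q.1, q.2.1) ∈ Ioo 0 T ×ˢ (univ : Set ℝ) := ⟨hq.1, trivial⟩
  have e1 : F (q.1, q.2.1) = f q.1 q.2.1 := indicator_of_mem hm _
  have i1 : q ∈ {q : ℝ × (ℝ × ℝ) | q.2 ∈ strip l ∧ F (q.1, q.2.1) < q.2.2} ↔
      q.2 ∈ upperDomain l (f q.1) := by rw [mem_ofPred_eq, e1]; rfl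
  have i2 : q ∈ {q : ℝ × (ℝ × ℝ) | q.2 ∈ strip l ∧ q.2.2 < F (q.1, q.2.1)} ↔
      q.2 ∈ lowerDomain l (f q.1) := by rw [mem_ofPred_eq, e1]; rfl
  rw [Pi.add_apply, density]
  congr 1
  · by_cases h : q.2 ∈ upperDomain l (f q.1)
    · rw [indicator_of_mem h, indicator_of_mem (i1.2 h)]
    · rw [indicator_of_notMem h, indicator_of_notMem fun h' => h (i1.1 h')]
  · by_cases h : q.2 ∈ lowerDomain l (f q.1)
    · rw [indicator_of_mem h, indicator_of_mem (i2.2 h)]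
    · rw [indicator_of_notMem h, indicator_of_notMem fun h' => h (i2.1 h')]

lemma abs_density_le (l ρ₁ ρ₂ : ℝ) (f : ℝ → ℝ → ℝ) (t : ℝ) (z : ℝ × ℝ) :
    |density l ρ₁ ρ₂ f t z| ≤ |ρ₁| + |ρ₂| := by
  unfold density
  refine (abs_add_le _ _).trans (add_le_add ?_ ?_)
  · rw [indicator]; split_ifs <;> simp
  · rw [indicator]; split_ifs <;> simp

end Density

/-! ### The weak mass equation reduced to the interface -/

section Mass

variable {l T ρ₁ ρ₂ : ℝ} {f : ℝ → ℝ → ℝ} {v : ℝ → ℝ × ℝ → ℝ × ℝ} {p : ℝ → ℝ × ℝ → ℝ}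
  {φ : ℝ × (ℝ × ℝ) → ℝ}

lemma continuous_fderiv_const (hφ : ContDiff ℝ 1 φ) (u : ℝ × (ℝ × ℝ)) :
    Continuous fun q => fderiv ℝ φ q u :=
  (hφ.continuous_fderiv (by norm_num)).clm_apply continuous_const

lemma hasCompactSupport_fderiv_const (hs : HasCompactSupport φ) (u : ℝ × (ℝ × ℝ)) :
    HasCompactSupport fun q => fderiv ℝ φ q u :=
  (hs.fderiv (𝕜 := ℝ)).comp_left (g := fun L : ℝ × (ℝ × ℝ) →L[ℝ] ℝ => L u) rfl

lemma fst_tsupport_fderiv_subset (φ : ℝ × (ℝ × ℝ) → ℝ) (u : ℝ × (ℝ × ℝ)) :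
    Prod.fst '' tsupport (fun q => fderiv ℝ φ q u) ⊆ Prod.fst '' tsupport φ := by
  refine image_mono (closure_minimal (fun q hq => ?_) (isClosed_tsupport _))
  by_contra h
  have h0 : fderiv ℝ φ q = 0 :=
    image_eq_zero_of_notMem_tsupport fun h' => h (tsupport_fderiv_subset ℝ h')
  exact hq (by simp [h0])

lemma integral_fderiv_time_eq_zero (hφ : ContDiff ℝ 1 φ) (hs : HasCompactSupport φ)
    (u : ℝ × (ℝ × ℝ)) : ∫ q, fderiv ℝ φ q u = 0 := by
  have : (volume : Measure (ℝ × ℝ)).IsAddHaarMeasure := by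
    rw [Measure.volume_eq_prod]; infer_instance
  have : (volume : Measure (ℝ × (ℝ × ℝ))).IsAddHaarMeasure := by
    rw [Measure.volume_eq_prod]; infer_instance
  have i1 : Integrable (fun q => fderiv ℝ φ q u) :=
    (continuous_fderiv_const hφ u).integrable_of_hasCompactSupport
      (hasCompactSupport_fderiv_const hs u)
  have i2 : Integrable φ := hφ.continuous.integrable_of_hasCompactSupport hs
  have h := integral_mul_fderiv_eq_neg_fderiv_mul_of_integrable
    (μ := (volume : Measure (ℝ × (ℝ × ℝ)))) (f := fun _ => (1 : ℝ)) (g := φ) (v := u)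
    (by simp) (by simpa using i1) (by simpa using i2)
    (fun _ _ => differentiableAt_const _) (fun x _ => hφ.differentiable (by norm_num) x)
  simpa using h

/-- The weak form of the mass equation, with the transport term moved to the interface. -/
lemma IsDarcyFlow.mass_integral (hl : 0 < l) (hf : IsInterfaceCurve l T f)
    (h : IsDarcyFlow l T (density l ρ₁ ρ₂ f) v p) (hφ : ContDiff ℝ ∞ φ)
    (hs : HasCompactSupport φ) (hsupp : tsupport φ ⊆ Ioo 0 T ×ˢ strip l) :
    IntegrableOn (fun q => density l ρ₁ ρ₂ f q.1 q.2 * fderiv ℝ φ q (1, 0) +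
      density l ρ₁ ρ₂ f q.1 q.2 * fderiv ℝ φ q (0, v q.1 q.2)) (Ioo 0 T ×ˢ strip l) ∧
    ∫ q in Ioo 0 T ×ˢ strip l, (density l ρ₁ ρ₂ f q.1 q.2 * fderiv ℝ φ q (1, 0) +
      density l ρ₁ ρ₂ f q.1 q.2 * fderiv ℝ φ q (0, v q.1 q.2)) =
    (∫ q in Ioo 0 T ×ˢ strip l, density l ρ₁ ρ₂ f q.1 q.2 * fderiv ℝ φ q (1, 0)) +
      (ρ₁ - ρ₂) * ((ρ₁ - ρ₂) / (8 * l)) *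
        ∫ t in Ioo 0 T, ∫ x, φ (t, (x, f t x)) * pvInt l 0 (f t) x := by
  have hφ1 : ContDiff ℝ 1 φ := hφ.of_le (by norm_num)
  have hK : IsCompact (Prod.fst '' tsupport φ) := hs.isCompact.image continuous_fst
  have hKT : Prod.fst '' tsupport φ ⊆ Ioo 0 T := by
    rintro _ ⟨q, hq, rfl⟩; exact (hsupp hq).1
  -- By uniqueness the arbitrary flow agrees at each time, almost everywhere, with the explicit
  -- velocity, which has bounds uniform in time and a computed flux.
  have hve : ∀ t ∈ Ioo 0 T, v t =ᵐ[volume.restrict (strip l)] velocity l ρ₁ ρ₂ (f t) :=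
    fun t ht => h.velocity_ae_eq hl (hf.isDarcyFlow hl ρ₁ ρ₂) ht
  obtain ⟨δ, hδ, M, hM⟩ := hf.exists_uniform_bound hl hK hKT
  obtain ⟨B, hB⟩ := exists_velocity_bound hl ρ₁ ρ₂ M
  have hvm : AEStronglyMeasurable (fun q : ℝ × (ℝ × ℝ) => v q.1 q.2)
      (((volume : Measure ℝ).restrict (Ioo 0 T)).prod
        ((volume : Measure (ℝ × ℝ)).restrict (strip l))) := by
    rw [← restrict_time]; exact h.measurable
  have hρm := hf.aestronglyMeasurable_density hl ρ₁ ρ₂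
  have hρb : ∀ᵐ q ∂((volume : Measure (ℝ × (ℝ × ℝ))).restrict (Ioo 0 T ×ˢ strip l)),
      ‖density l ρ₁ ρ₂ f q.1 q.2‖ ≤ |ρ₁| + |ρ₂| :=
    ae_of_all _ fun q => abs_density_le l ρ₁ ρ₂ f q.1 q.2
  have hi1 : IntegrableOn (fun q => (v q.1 q.2).1 * fderiv ℝ φ q (0, (1, 0)))
      (Ioo 0 T ×ˢ strip l) := by
    rw [IntegrableOn, restrict_time]
    refine integrable_mul_of_sq_bound (B := B) hvm.fst
      (fun t ht => (h.square_integrable t ht).fst) (continuous_fderiv_const hφ1 _)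
      (hasCompactSupport_fderiv_const hs _) fun t ht htK => ?_
    refine (integral_congr_ae ((hve t ht).mono fun z hz => ?_)).trans_le
      (hB δ hδ _ (hM t (fst_tsupport_fderiv_subset φ _ htK))).1
    simp only [hz]
  have hi2 : IntegrableOn (fun q => (v q.1 q.2).2 * fderiv ℝ φ q (0, (0, 1)))
      (Ioo 0 T ×ˢ strip l) := by
    rw [IntegrableOn, restrict_time]
    refine integrable_mul_of_sq_bound (B := B) hvm.snd
      (fun t ht => (h.square_integrable t ht).snd) (continuous_fderiv_const hφ1 _)
      (hasCompactSupport_fderiv_const hs _) fun t ht htK => ?_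
    refine (integral_congr_ae ((hve t ht).mono fun z hz => ?_)).trans_le
      (hB δ hδ _ (hM t (fst_tsupport_fderiv_subset φ _ htK))).2
    simp only [hz]
  have hv : IntegrableOn (fun q => fderiv ℝ φ q (0, v q.1 q.2)) (Ioo 0 T ×ˢ strip l) := by
    refine (hi1.add hi2).congr (ae_of_all _ fun q => ?_)
    simp only [Pi.add_apply]
    rw [← fderiv_time_slice hφ1 q.1 q.2 (v q.1 q.2), ← fderiv_time_slice hφ1 q.1 q.2 (1, 0),
      ← fderiv_time_slice hφ1 q.1 q.2 (0, 1)]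
    exact (fderiv_apply_eq _ _ _ _).symm
  have hρv : IntegrableOn (fun q => density l ρ₁ ρ₂ f q.1 q.2 * fderiv ℝ φ q (0, v q.1 q.2))
      (Ioo 0 T ×ˢ strip l) := hv.bdd_mul hρm hρb
  have hρt : IntegrableOn (fun q => density l ρ₁ ρ₂ f q.1 q.2 * fderiv ℝ φ q (1, 0))
      (Ioo 0 T ×ˢ strip l) :=
    (((continuous_fderiv_const hφ1 (1, 0)).integrable_of_hasCompactSupport
      (hasCompactSupport_fderiv_const hs _)).integrableOn).bdd_mul hρm hρb
  refine ⟨hρt.add hρv, ?_⟩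
  rw [integral_add hρt hρv]
  congr 1
  have hρv' := hρv
  have hv' := hv
  rw [IntegrableOn, restrict_time] at hρv' hv'
  rw [restrict_time, integral_prod _ hρv', ← integral_const_mul]
  refine integral_congr_ae ?_
  filter_upwards [ae_restrict_mem measurableSet_Ioo, hv'.prod_right_ae] with t ht hti
  obtain ⟨δ', hδ', M', hM'⟩ := hf.profileBound hl ht
  have hc := hf.continuous t ht
  have e : ∀ z u, fderiv ℝ φ (t, z) (0, u) = fderiv ℝ (fun z => φ (t, z)) z u := fun z u =>
    (fderiv_time_slice hφ1 t z u).symm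
  have e1 : (fun z => fderiv ℝ φ (t, z) (0, v t z)) =ᵐ[volume.restrict (strip l)]
      fun z => fderiv ℝ (fun z => φ (t, z)) z (velocity l ρ₁ ρ₂ (f t) z) := by
    filter_upwards [hve t ht] with z hz
    rw [e, hz]
  have e2 : volume.restrict (upperDomain l (f t)) ≤ volume.restrict (strip l) :=
    Measure.restrict_mono (fun z hz => hz.1) le_rfl
  -- The density is the constant `ρ₂` plus a jump on the upper domain. The constant part integrates
  -- to zero by incompressibility; the jump part is the flux through the interface.
  rw [setIntegral_density_mul l ρ₁ ρ₂ f t hc hti, integral_congr_ae e1,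
    integral_congr_ae (ae_mono e2 e1),
    setIntegral_fderiv_velocity hl hδ' hM' ρ₁ ρ₂ (contDiff_time_slice hφ1 t)
      (hasCompactSupport_time_slice hs t),
    setIntegral_upperDomain_velocity hl hδ' hM' ρ₁ ρ₂ (contDiff_time_slice hφ1 t)
      (hasCompactSupport_time_slice hs t) (tsupport_time_slice hsupp t)]
  ring

/-- The time derivative term of the weak mass equation, as an integral over the region above the
interface. -/
lemma IsInterfaceCurve.mass_time_integral (hl : 0 < l) (hf : IsInterfaceCurve l T f)
    (ρ₁ ρ₂ : ℝ) (hφ : ContDiff ℝ ∞ φ) (hs : HasCompactSupport φ)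
    (hsupp : tsupport φ ⊆ Ioo 0 T ×ˢ strip l) :
    Integrable (fun q : ℝ × ℝ => ∫ y in Ioi (f q.1 q.2), fderiv ℝ φ (q.1, (q.2, y)) (1, 0)) ∧
    ∫ q in Ioo 0 T ×ˢ strip l, density l ρ₁ ρ₂ f q.1 q.2 * fderiv ℝ φ q (1, 0) =
      (ρ₁ - ρ₂) * ∫ q : ℝ × ℝ, ∫ y in Ioi (f q.1 q.2), fderiv ℝ φ (q.1, (q.2, y)) (1, 0) := by
  have hφ1 : ContDiff ℝ 1 φ := hφ.of_le (by norm_num)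
  -- The profile is cut off in time only for measurability: the derivatives of `φ` vanish outside
  -- `(0, T)`, so the values of `f` there do not matter.
  set F := (Ioo 0 T ×ˢ (univ : Set ℝ)).indicator fun q : ℝ × ℝ => f q.1 q.2 with hF
  have mF : Measurable F := hf.measurable_timeCut hl
  set E : Set ((ℝ × ℝ) × ℝ) := {q | F q.1 < q.2} with hE
  have mE : MeasurableSet E := measurableSet_lt (mF.comp measurable_fst) measurable_snd
  have hA : MeasurePreserving (MeasurableEquiv.prodAssoc : (ℝ × ℝ) × ℝ ≃ᵐ ℝ × (ℝ × ℝ)) :=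
    measurePreserving_prodAssoc volume volume volume
  have hφt := (continuous_fderiv_const hφ1 (1, 0)).integrable_of_hasCompactSupport
    (μ := volume) (hasCompactSupport_fderiv_const hs _)
  have hi : Integrable (fun q : (ℝ × ℝ) × ℝ => fderiv ℝ φ (q.1.1, (q.1.2, q.2)) (1, 0)) :=
    (hA.integrable_comp_emb (MeasurableEquiv.measurableEmbedding _)).2 hφt
  have hiE := hi.indicator mE
  have hin : ∀ q : ℝ × ℝ, ∫ y in Ioi (f q.1 q.2), fderiv ℝ φ (q.1, (q.2, y)) (1, 0) =
      ∫ y, E.indicator (fun q : (ℝ × ℝ) × ℝ => fderiv ℝ φ (q.1.1, (q.1.2, q.2)) (1, 0)) (q, y) := by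
    intro q
    rw [← integral_indicator measurableSet_Ioi]
    by_cases hq : q.1 ∈ Ioo 0 T
    · have hFq : F q = f q.1 q.2 := 
      indicator_of_mem (show q ∈ Ioo 0 T ×ˢ (univ : Set ℝ) from ⟨hq, mem_univ _⟩) _
      refine integral_congr_ae (ae_of_all _ fun y => ?_)
      beta_reduce
      by_cases hy : f q.1 q.2 < y
      · rw [indicator_of_mem (by exact hy), indicator_of_mem (by rw [hE, mem_ofPred_eq, hFq]; exact hy)]
      · rw [indicator_of_notMem (by exact hy),
          indicator_of_notMem (by rw [hE, mem_ofPred_eq, hFq]; exact hy)]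
    · have h0 : ∀ y, fderiv ℝ φ (q.1, (q.2, y)) = 0 := fun y =>
        (eq_zero_of_notMem_time hsupp fun h => hq h.1).2
      simp [indicator, h0]
  simp only [hin]
  refine ⟨hiE.integral_prod_left, ?_⟩
  rw [← integral_prod _ hiE]
  have hae : ∀ᵐ q ∂((volume : Measure (ℝ × (ℝ × ℝ))).restrict (Ioo 0 T ×ˢ strip l)),
      density l ρ₁ ρ₂ f q.1 q.2 * fderiv ℝ φ q (1, 0) = ρ₂ * fderiv ℝ φ q (1, 0) +
      (ρ₁ - ρ₂) * E.indicator (fun q : (ℝ × ℝ) × ℝ => fderiv ℝ φ (q.1.1, (q.1.2, q.2)) (1, 0))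
        ((q.1, q.2.1), q.2.2) := by
    have hne : ∀ᵐ q : (ℝ × ℝ) × ℝ, q.2 ≠ F q.1 := by
      have hm : MeasurableSet {q : (ℝ × ℝ) × ℝ | q.2 ≠ F q.1} :=
        (measurableSet_eq_fun measurable_snd (mF.comp measurable_fst)).compl
      rw [Measure.volume_eq_prod, Measure.ae_prod_iff_ae_ae hm]
      exact ae_of_all _ fun x => by simp [ae_iff]
    have hne' : ∀ᵐ q : ℝ × (ℝ × ℝ), q.2.2 ≠ F (q.1, q.2.1) :=
      (hA.symm _).quasiMeasurePreserving.ae hne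
    filter_upwards [ae_restrict_of_ae hne',
      ae_restrict_mem (measurableSet_Ioo.prod (measurableSet_strip l))] with q hq hqs
    have hFq : F (q.1, q.2.1) = f q.1 q.2.1 := indicator_of_mem
      (show (q.1, q.2.1) ∈ Ioo 0 T ×ˢ (univ : Set ℝ) from ⟨hqs.1, mem_univ _⟩) _
    rw [hFq] at hq
    unfold density
    rcases lt_or_gt_of_ne hq with h | h
    · rw [indicator_of_notMem fun h' => lt_asymm h h'.2, indicator_of_mem (by exact ⟨hqs.2, h⟩),
        indicator_of_notMem (by rw [hE, mem_ofPred_eq, hFq]; exact h.le.not_gt)]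
      ring
    · rw [indicator_of_mem (by exact ⟨hqs.2, h⟩), indicator_of_notMem fun h' => lt_asymm h h'.2,
        indicator_of_mem (by rw [hE, mem_ofPred_eq, hFq]; exact h)]
      ring
  have hiE' : Integrable (fun q : ℝ × (ℝ × ℝ) => E.indicator
      (fun q : (ℝ × ℝ) × ℝ => fderiv ℝ φ (q.1.1, (q.1.2, q.2)) (1, 0)) ((q.1, q.2.1), q.2.2)) :=
    ((hA.symm _).integrable_comp_emb (MeasurableEquiv.measurableEmbedding _)).2 hiE
  -- The constant part `ρ₂` drops out because a derivative of a compactly supported function has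
  -- integral zero.
  rw [integral_congr_ae hae, integral_add (hφt.integrableOn.const_mul _)
    (hiE'.integrableOn.const_mul _), integral_const_mul, integral_const_mul,
    setIntegral_eq_integral_of_forall_compl_eq_zero, integral_fderiv_time_eq_zero hφ1 hs,
    setIntegral_eq_integral_of_forall_compl_eq_zero]
  · have := (hA.symm _).integral_comp (MeasurableEquiv.measurableEmbedding _)
      (E.indicator (fun q : (ℝ × ℝ) × ℝ => fderiv ℝ φ (q.1.1, (q.1.2, q.2)) (1, 0)))
    rw [mul_zero, zero_add, ← Measure.volume_eq_prod, ← this]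
    rfl
  · intro q hq
    refine indicator_apply_eq_zero.2 fun _ => ?_
    simp [(eq_zero_of_notMem_time hsupp hq).2]
  · intro q hq
    simp [(eq_zero_of_notMem_time hsupp hq).2]

end Mass

/-! ### The contour equation implies conservation of mass -/

section Equivalence

variable {l T ρ₁ ρ₂ : ℝ} {f : ℝ → ℝ → ℝ} {φ : ℝ × (ℝ × ℝ) → ℝ}

lemma continuous_of_continuousOn_of_eq_zero {X : Type*} [TopologicalSpace X] {U K : Set X}
    {H : X → ℝ} (hU : IsOpen U) (hK : IsClosed K) (hKU : K ⊆ U) (hH : ContinuousOn H U)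
    (h0 : ∀ x, x ∉ K → H x = 0) : Continuous H := by
  refine continuous_iff_continuousAt.2 fun x => ?_
  by_cases hx : x ∈ K
  · exact hH.continuousAt (hU.mem_nhds (hKU hx))
  · refine (continuousAt_const (y := (0 : ℝ))).congr ?_
    filter_upwards [hK.isOpen_compl.mem_nhds hx] with y hy
    exact (h0 y hy).symm

/-- For these interfaces the principal value always exists and equals `pvInt`, so only the time
derivative is at stake. -/
lemma solvesContourEquation_iff (hl : 0 < l) (hf : IsInterfaceCurve l T f) :
    SolvesContourEquation l T ρ₁ ρ₂ f ↔ ∀ t ∈ Ioo 0 T, ∀ x,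
      HasDerivAt (fun s => f s x) ((ρ₂ - ρ₁) / (8 * l) * pvInt l 0 (f t) x) t := by
  refine forall₂_congr fun t ht => forall_congr' fun x => ?_
  obtain ⟨δ, hδ, M, hM⟩ := hf.profileBound hl ht
  have h := hasPrincipalValue_pvInt hl hδ hM x
  exact ⟨fun ⟨a, ha, hd⟩ => by rwa [hasPrincipalValue_unique h ha], fun hd => ⟨_, h, hd⟩⟩

lemma exists_time_cutoff {K : Set ℝ} (hK : IsCompact K) (hKT : K ⊆ Ioo 0 T) :
    ∃ κ : ℝ → ℝ, ContDiff ℝ ∞ κ ∧ (∀ t ∈ K, κ =ᶠ[𝓝 t] fun _ => 1) ∧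
      ∃ K', IsCompact K' ∧ K' ⊆ Ioo 0 T ∧ ∀ t, t ∉ K' → κ t = 0 := by
  obtain ⟨K', hK', h1, h2⟩ := exists_compact_between hK isOpen_Ioo hKT
  obtain ⟨κ, k1, k2, -⟩ := exists_contMDiffMap_one_nhds_of_subset_interior (n := ⊤)
    (modelWithCornersSelf ℝ ℝ) hK.isClosed h1
  exact ⟨κ, κ.contMDiff.contDiff, fun t ht => eventually_nhdsSet_iff_forall.1 k1 t ht,
    K', hK', h2, k2⟩

lemma fderiv_space_slice (hφ : ContDiff ℝ 1 φ) (x t y : ℝ) :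
    fderiv ℝ (fun w : ℝ × ℝ => φ (w.1, (x, w.2))) (t, y) (1, 0) =
      fderiv ℝ φ (t, (x, y)) (1, 0) := by
  have h1 : HasFDerivAt (fun w : ℝ × ℝ => (w.1, (x, w.2)))
      ((ContinuousLinearMap.fst ℝ ℝ ℝ).prod
        ((0 : ℝ × ℝ →L[ℝ] ℝ).prod (ContinuousLinearMap.snd ℝ ℝ ℝ))) (t, y) :=
    hasFDerivAt_fst.prodMk ((hasFDerivAt_const x _).prodMk hasFDerivAt_snd)
  have h : HasFDerivAt (fun w : ℝ × ℝ => φ (w.1, (x, w.2))) _ (t, y) :=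
    ((hφ.differentiable (by norm_num) (t, (x, y))).hasFDerivAt).comp (t, y) h1
  rw [h.fderiv]
  rfl

/-- The trace on the interface of a test function times a function of `(t, x)`. -/
lemma IsInterfaceCurve.continuous_trace_mul (hl : 0 < l) (hf : IsInterfaceCurve l T f)
    (hφ : Continuous φ) (hs : HasCompactSupport φ) (hsupp : tsupport φ ⊆ Ioo 0 T ×ˢ strip l)
    {P : ℝ × ℝ → ℝ} (hP : ContinuousOn P (Ioo 0 T ×ˢ univ)) :
    Continuous (fun q : ℝ × ℝ => φ (q.1, (q.2, f q.1 q.2)) * P q) ∧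
    HasCompactSupport (fun q : ℝ × ℝ => φ (q.1, (q.2, f q.1 q.2)) * P q) := by
  set K : Set (ℝ × ℝ) := (fun q : ℝ × (ℝ × ℝ) => (q.1, q.2.1)) '' tsupport φ
  have hK : IsCompact K := hs.isCompact.image (by fun_prop)
  have h0 : ∀ q, q ∉ K → φ (q.1, (q.2, f q.1 q.2)) * P q = 0 := fun q hq => by
    rw [image_eq_zero_of_notMem_tsupport fun h => hq ⟨_, h, rfl⟩, zero_mul]
  refine ⟨continuous_of_continuousOn_of_eq_zero (isOpen_time T) hK.isClosed ?_
    (ContinuousOn.mul ?_ hP) h0, HasCompactSupport.intro hK h0⟩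
  · rintro _ ⟨q, hq, rfl⟩
    exact ⟨(hsupp hq).1, mem_univ _⟩
  · exact hφ.comp_continuousOn (continuousOn_fst.prodMk
      (continuousOn_snd.prodMk (hf.regularity hl).2.1))

/-- At fixed `x` the time term is a divergence in the `(t, y)` plane above the curve `y = f(t, x)`.
The divergence theorem turns it into an integral of `φ ∂ₜf` on the interface, which the contour
equation cancels against the flux. -/
lemma IsDarcyFlow.isWeakMassSolution (hl : 0 < l) (hf : IsInterfaceCurve l T f)
    {v : ℝ → ℝ × ℝ → ℝ × ℝ} {p : ℝ → ℝ × ℝ → ℝ}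
    (h : IsDarcyFlow l T (density l ρ₁ ρ₂ f) v p)
    (hc : SolvesContourEquation l T ρ₁ ρ₂ f) :
    IsWeakMassSolution l T (density l ρ₁ ρ₂ f) v := by
  rw [solvesContourEquation_iff hl hf] at hc
  intro φ hφ hs hsupp
  obtain ⟨hi, he⟩ := h.mass_integral hl hf hφ hs hsupp
  refine ⟨hi, he.trans ?_⟩
  obtain ⟨hG, hGe⟩ := hf.mass_time_integral hl ρ₁ ρ₂ hφ hs hsupp
  have hφ1 : ContDiff ℝ 1 φ := hφ.of_le (by norm_num)
  have hpv := hf.continuousOn_pvInt hl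
  obtain ⟨hPc, hPs⟩ := hf.continuous_trace_mul hl hφ.continuous hs hsupp hpv
  have hPi : Integrable (fun q : ℝ × ℝ => φ (q.1, (q.2, f q.1 q.2)) * pvInt l 0 (f q.1) q.2) :=
    hPc.integrable_of_hasCompactSupport hPs
  set K : Set ℝ := Prod.fst '' tsupport φ with hKdef
  have hK : IsCompact K := hs.isCompact.image continuous_fst
  have hKT : K ⊆ Ioo 0 T := by
    rintro _ ⟨q, hq, rfl⟩; exact (hsupp hq).1
  obtain ⟨κ, hκ, hκ1, K', hK', hKT', hκ0⟩ := exists_time_cutoff hK hKT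
  have h0 : ∀ t ∉ K, ∀ z, φ (t, z) = 0 ∧ fderiv ℝ φ (t, z) = 0 := fun t ht z =>
    ⟨image_eq_zero_of_notMem_tsupport fun h' => ht ⟨_, h', rfl⟩,
      image_eq_zero_of_notMem_tsupport fun h' => ht ⟨_, tsupport_fderiv_subset ℝ h', rfl⟩⟩
  have key : ∀ x, ∫ t, ∫ y in Ioi (f t x), fderiv ℝ φ (t, (x, y)) (1, 0) =
      (ρ₂ - ρ₁) / (8 * l) * ∫ t, φ (t, (x, f t x)) * pvInt l 0 (f t) x := by
    intro x
    -- The contour equation with the joint continuity of the principal value upgrades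
    -- differentiability in time to `C¹`.
    have hfx : ContDiffOn ℝ 1 (fun s => f s x) (Ioo 0 T) := by
      rw [show (1 : WithTop ℕ∞) = 0 + 1 by simp, contDiffOn_succ_iff_deriv_of_isOpen isOpen_Ioo]
      refine ⟨fun t ht => (hc t ht x).differentiableAt.differentiableWithinAt, by simp, ?_⟩
      rw [contDiffOn_zero]
      refine ContinuousOn.congr ?_ fun t ht => (hc t ht x).deriv
      exact continuousOn_const.mul (hpv.comp (f := fun t => (t, x)) (by fun_prop)
        fun t ht => ⟨ht, mem_univ _⟩)
    -- The divergence theorem requires a graph that is `C¹` on the whole line; the cutoff `κ` is one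
    -- near the times where `φ` lives.
    set g : ℝ → ℝ := fun t => κ t * f t x with hg
    have hgc : ContDiff ℝ 1 g := by
      refine contDiff_iff_contDiffAt.2 fun t => ?_
      by_cases ht : t ∈ K'
      · exact (hκ.of_le (by norm_num)).contDiffAt.mul
          (hfx.contDiffAt (isOpen_Ioo.mem_nhds (hKT' ht)))
      · refine (contDiffAt_const (c := (0 : ℝ))).congr_of_eventuallyEq ?_
        filter_upwards [hK'.isClosed.isOpen_compl.mem_nhds ht] with s hs
        simp [hg, hκ0 s hs]
    set W : ℝ × ℝ → ℝ := fun w => φ (w.1, (x, w.2)) with hW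
    have hWc : ContDiff ℝ 1 W := hφ1.comp (by fun_prop)
    have hWs : HasCompactSupport W :=
      HasCompactSupport.of_support_subset_isCompact
        (hs.isCompact.image (f := fun q : ℝ × (ℝ × ℝ) => (q.1, q.2.2)) (by fun_prop))
        fun w hw => ⟨_, subset_tsupport _ hw, rfl⟩
    -- Time plays the role of the horizontal variable here.
    have e := setIntegral_epi_fderiv_fst hgc hWc hWs
    rw [setIntegral_epi hgc.continuous (integrable_fderiv_apply hWc hWs _)] at e
    rw [← integral_const_mul]
    refine Eq.trans (integral_congr_ae (ae_of_all _ fun t => ?_))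
      (e.trans (integral_congr_ae (ae_of_all _ fun t => ?_)))
    · simp only [hW, fderiv_space_slice hφ1]
      by_cases ht : t ∈ K
      · have : g t = f t x := by simp [hg, (hκ1 t ht).self_of_nhds]
        rw [this]
      · simp [(h0 t ht _).2]
    · simp only [hW]
      by_cases ht : t ∈ K
      · have h1 : g t = f t x := by simp [hg, (hκ1 t ht).self_of_nhds]
        have h2 : g =ᶠ[𝓝 t] fun s => f s x := by
          filter_upwards [hκ1 t ht] with s hs
          simp [hg, hs]
        rw [h1, h2.deriv_eq, (hc t (hKT ht) x).deriv]
        ring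
      · simp [(h0 t ht _).1]
  have hset : ∫ t in Ioo 0 T, ∫ x, φ (t, (x, f t x)) * pvInt l 0 (f t) x =
      ∫ t, ∫ x, φ (t, (x, f t x)) * pvInt l 0 (f t) x :=
    setIntegral_eq_integral_of_forall_compl_eq_zero fun t ht => by
      simp [(h0 t (fun h' => ht (hKT h')) _).1]
  rw [hGe, hset, Measure.volume_eq_prod, integral_prod_symm _ hG]
  simp only [key]
  rw [integral_const_mul, ← integral_prod_symm _ hPi, integral_prod _ hPi]
  ring

end Equivalence

/-! ### Conservation of mass implies the contour equation -/

section Converse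

variable {l T ρ₁ ρ₂ : ℝ} {f : ℝ → ℝ → ℝ}

lemma exists_height_cutoff {a l : ℝ} (hal : a < l) (hl : 0 < l) : ∃ r, a ≤ r ∧ r < l ∧
    ∃ ζ : ℝ → ℝ, ContDiff ℝ ∞ ζ ∧ HasCompactSupport ζ ∧ tsupport ζ ⊆ Ioo (-l) l ∧
      ∀ y, |y| ≤ r → ζ y = 1 := by
  -- The maximum with `l / 2` keeps the inner radius of the bump positive.
  set r := max a (l / 2) with hr
  have h1 : a ≤ r := le_max_left _ _
  have h2 : l / 2 ≤ r := le_max_right _ _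
  have h3 : r < l := max_lt hal (by linarith)
  let B : ContDiffBump (0 : ℝ) := ⟨r, (r + l) / 2, by linarith, by linarith⟩
  refine ⟨r, h1, h3, B, B.contDiff, B.hasCompactSupport, ?_, fun y hy => ?_⟩
  · rw [B.tsupport_eq]
    intro y hy
    rw [mem_closedBall_zero_iff, Real.norm_eq_abs] at hy
    have hy' : |y| ≤ (r + l) / 2 := hy
    exact abs_lt.1 (by linarith)
  · refine B.one_of_mem_closedBall ?_
    rw [mem_closedBall_zero_iff, Real.norm_eq_abs]
    exact hy

/-- Where `ζ = 1` the integral above height `a` is affine in `a` with slope `-1`. This is how the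
height `f` itself is extracted from the density. -/
lemma integral_Ioi_of_eq_one {ζ : ℝ → ℝ} {r : ℝ} (hζ : Continuous ζ) (hs : HasCompactSupport ζ)
    (h1 : ∀ y, |y| ≤ r → ζ y = 1) {a : ℝ} (ha : |a| ≤ r) :
    ∫ y in Ioi a, ζ y = (r + ∫ y in Ioi r, ζ y) - a := by
  have hi : Integrable ζ := hζ.integrable_of_hasCompactSupport hs
  have h := abs_le.1 ha
  rw [← intervalIntegral.integral_interval_add_Ioi (a := a) (b := r) hi.integrableOn hi.integrableOn,
    intervalIntegral.integral_congr (g := fun _ => (1 : ℝ))]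
  · simp; ring
  · intro y hy
    rw [uIcc_of_le h.2] at hy
    exact h1 y (abs_le.2 ⟨by linarith [hy.1], hy.2⟩)

lemma fderiv_mul_time {θ : ℝ → ℝ} {ψ : ℝ × ℝ → ℝ} (hθ : ContDiff ℝ ∞ θ) (hψ : ContDiff ℝ ∞ ψ)
    (t : ℝ) (z : ℝ × ℝ) :
    fderiv ℝ (fun q : ℝ × (ℝ × ℝ) => θ q.1 * ψ q.2) (t, z) (1, 0) = deriv θ t * ψ z := by
  have h1 : HasFDerivAt (fun q : ℝ × (ℝ × ℝ) => θ q.1) _ (t, z) :=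
    ((hθ.differentiable (by norm_num) t).hasDerivAt.hasFDerivAt).comp (t, z) hasFDerivAt_fst
  have h2 : HasFDerivAt (fun q : ℝ × (ℝ × ℝ) => ψ q.2) _ (t, z) :=
    ((hψ.differentiable (by norm_num) z).hasFDerivAt).comp (t, z) hasFDerivAt_snd
  have h : HasFDerivAt (fun q : ℝ × (ℝ × ℝ) => θ q.1 * ψ q.2) _ (t, z) := h1.fun_mul h2
  rw [h.fderiv]
  simp [mul_comm]

/-- The contour equation integrated against a test function of time. -/
lemma IsDarcyFlow.integral_deriv_mul (hl : 0 < l) (hρ : ρ₁ ≠ ρ₂) (hf : IsInterfaceCurve l T f)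
    {v : ℝ → ℝ × ℝ → ℝ × ℝ} {p : ℝ → ℝ × ℝ → ℝ}
    (h : IsDarcyFlow l T (density l ρ₁ ρ₂ f) v p)
    (hm : IsWeakMassSolution l T (density l ρ₁ ρ₂ f) v) {θ : ℝ → ℝ} (hθ : ContDiff ℝ ∞ θ)
    (hθs : HasCompactSupport θ) (hθT : tsupport θ ⊆ Ioo 0 T) (x : ℝ) :
    ∫ t, f t x * deriv θ t = (ρ₁ - ρ₂) / (8 * l) * ∫ t, θ t * pvInt l 0 (f t) x := by
  obtain ⟨δ, hδ, M, hM⟩ := hf.exists_uniform_bound hl hθs.isCompact hθT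
  -- On the support of `θ` the interface keeps a uniform distance `δ` from the walls, so one `ζ`
  -- equals one at all heights it reaches.
  obtain ⟨r, hr1, hr2, ζ, hζ, hζs, hζl, hζ1⟩ := exists_height_cutoff (sub_lt_self l hδ) hl
  have hfr : ∀ t ∈ tsupport θ, ∀ x, |f t x| ≤ r := fun t ht x => ((hM t ht).abs_le x).trans hr1
  have hpv := hf.continuousOn_pvInt hl
  have hfc := (hf.regularity hl).2.1
  have hθ0 : ∀ t, t ∉ tsupport θ → θ t = 0 ∧ deriv θ t = 0 := fun t ht =>
    ⟨image_eq_zero_of_notMem_tsupport ht,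
      image_eq_zero_of_notMem_tsupport fun h' => ht (tsupport_deriv_subset h')⟩
  have hdθ : Continuous (deriv θ) := hθ.continuous_deriv (by norm_num)
  set C : ℝ := r + ∫ y in Ioi r, ζ y with hC
  set c : ℝ := (ρ₁ - ρ₂) / (8 * l) with hc
  set H₁ : ℝ × ℝ → ℝ := fun q => deriv θ q.1 * (C - f q.1 q.2) with hH₁
  set H₂ : ℝ × ℝ → ℝ := fun q => θ q.1 * pvInt l 0 (f q.1) q.2 with hH₂
  have hcl : IsClosed (tsupport θ ×ˢ (univ : Set ℝ)) := (isClosed_tsupport θ).prod isClosed_univ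
  have hsub : tsupport θ ×ˢ (univ : Set ℝ) ⊆ Ioo 0 T ×ˢ univ := prod_mono hθT Subset.rfl
  have hnm : ∀ q : ℝ × ℝ, q ∉ tsupport θ ×ˢ (univ : Set ℝ) → q.1 ∉ tsupport θ :=
    fun q hq h' => hq ⟨h', mem_univ _⟩
  have cH₁ : Continuous H₁ := continuous_of_continuousOn_of_eq_zero (isOpen_time T) hcl hsub
    ((hdθ.comp continuous_fst).continuousOn.mul (continuousOn_const.sub hfc))
    fun q hq => by simp [hH₁, (hθ0 _ (hnm q hq)).2]
  have cH₂ : Continuous H₂ := continuous_of_continuousOn_of_eq_zero (isOpen_time T) hcl hsub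
    ((hθ.continuous.comp continuous_fst).continuousOn.mul hpv)
    fun q hq => by simp [hH₂, (hθ0 _ (hnm q hq)).1]
  have sθ : ∀ {H : ℝ × ℝ → ℝ} (_ : ∀ q, q.1 ∉ tsupport θ → H q = 0) (x : ℝ),
      ∫ t, H (t, x) = ∫ t in tsupport θ, H (t, x) := fun h0 x =>
    (setIntegral_eq_integral_of_forall_compl_eq_zero fun t ht => h0 (t, x) ht).symm
  have z₁ : ∀ q : ℝ × ℝ, q.1 ∉ tsupport θ → H₁ q = 0 := fun q hq => by simp [hH₁, (hθ0 _ hq).2]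
  have z₂ : ∀ q : ℝ × ℝ, q.1 ∉ tsupport θ → H₂ q = 0 := fun q hq => by simp [hH₂, (hθ0 _ hq).1]
  set g : ℝ → ℝ := fun x => (∫ t, H₁ (t, x)) + c * ∫ t, H₂ (t, x) with hg
  have hgc : Continuous g := by
    simp only [hg, sθ z₁, sθ z₂]
    exact (continuous_parametric_integral_of_continuous (f := fun x t => H₁ (t, x))
      (cH₁.comp continuous_swap) hθs.isCompact).add
      (continuous_const.mul (continuous_parametric_integral_of_continuous (f := fun x t => H₂ (t, x))
      (cH₂.comp continuous_swap) hθs.isCompact))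
  have hgχ : ∀ χ : ℝ → ℝ, ContDiff ℝ ∞ χ → HasCompactSupport χ → ∫ x, χ x • g x = 0 := by
    intro χ hχ hχs
    set ψ : ℝ × ℝ → ℝ := fun z => χ z.1 * ζ z.2 with hψ
    have hψc : ContDiff ℝ ∞ ψ := (hχ.comp contDiff_fst).mul (hζ.comp contDiff_snd)
    set φ : ℝ × (ℝ × ℝ) → ℝ := fun q => θ q.1 * ψ q.2 with hφ
    have hφc : ContDiff ℝ ∞ φ := (hθ.comp contDiff_fst).mul (hψc.comp contDiff_snd)
    have hKc : IsCompact (tsupport θ ×ˢ (tsupport χ ×ˢ tsupport ζ)) :=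
      hθs.isCompact.prod (hχs.isCompact.prod hζs.isCompact)
    have hsub' : tsupport φ ⊆ tsupport θ ×ˢ (tsupport χ ×ˢ tsupport ζ) := by
      refine closure_minimal (fun q hq => ?_) hKc.isClosed
      have hq' : θ q.1 * (χ q.2.1 * ζ q.2.2) ≠ 0 := hq
      exact ⟨subset_tsupport _ (left_ne_zero_of_mul hq'),
        subset_tsupport _ (left_ne_zero_of_mul (right_ne_zero_of_mul hq')),
        subset_tsupport _ (right_ne_zero_of_mul (right_ne_zero_of_mul hq'))⟩
    have hφs : HasCompactSupport φ := hKc.of_isClosed_subset (isClosed_tsupport _) hsub'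
    have hφT : tsupport φ ⊆ Ioo 0 T ×ˢ strip l := fun q hq =>
      ⟨hθT (hsub' hq).1, (hζl (hsub' hq).2.2).1, (hζl (hsub' hq).2.2).2⟩
    obtain ⟨-, hG⟩ := hf.mass_time_integral hl ρ₁ ρ₂ hφc hφs hφT
    have hmass := (h.mass_integral hl hf hφc hφs hφT).2
    rw [(hm φ hφc hφs hφT).2, hG, mul_assoc, ← mul_add] at hmass
    -- Dividing by the density jump uses `ρ₁ ≠ ρ₂`; with equal densities the mass equation would
    -- carry no information.
    have hmass' := (mul_eq_zero.1 hmass.symm).resolve_left (sub_ne_zero.2 hρ)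
    have e1 : ∀ q : ℝ × ℝ, ∫ y in Ioi (f q.1 q.2), fderiv ℝ φ (q.1, (q.2, y)) (1, 0) =
        χ q.2 * H₁ q := by
      intro q
      simp only [hφ, fderiv_mul_time hθ hψc]
      rw [integral_const_mul]
      simp only [hψ]
      rw [integral_const_mul]
      by_cases hq : q.1 ∈ tsupport θ
      · rw [integral_Ioi_of_eq_one hζ.continuous hζs hζ1 (hfr _ hq _), hH₁]
        ring
      · rw [z₁ q hq, (hθ0 _ hq).2]; ring
    have e2 : ∀ t x, φ (t, (x, f t x)) * pvInt l 0 (f t) x = χ x * H₂ (t, x) := by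
      intro t x
      simp only [hφ, hψ, hH₂]
      by_cases ht : t ∈ tsupport θ
      · rw [hζ1 _ (hfr t ht x)]; ring
      · rw [(hθ0 _ ht).1]; ring
    have hcs : ∀ {H : ℝ × ℝ → ℝ} (_ : ∀ q, q.1 ∉ tsupport θ → H q = 0),
        HasCompactSupport fun q => χ q.2 * H q := fun h0 =>
      HasCompactSupport.intro (hθs.isCompact.prod hχs.isCompact) fun q hq => by
        by_cases hq1 : q.1 ∈ tsupport θ
        · rw [image_eq_zero_of_notMem_tsupport fun h' => hq ⟨hq1, h'⟩, zero_mul]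
        · rw [h0 q hq1, mul_zero]
    have hχ2 : Continuous fun q : ℝ × ℝ => χ q.2 := hχ.continuous.comp continuous_snd
    have i1 : Integrable (fun q => χ q.2 * H₁ q) ((volume : Measure ℝ).prod volume) :=
      (hχ2.mul cH₁).integrable_of_hasCompactSupport (hcs z₁)
    have i2 : Integrable (fun q => χ q.2 * H₂ q) ((volume : Measure ℝ).prod volume) :=
      (hχ2.mul cH₂).integrable_of_hasCompactSupport (hcs z₂)
    have hset : ∫ t in Ioo 0 T, ∫ x, χ x * H₂ (t, x) = ∫ t, ∫ x, χ x * H₂ (t, x) :=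
      setIntegral_eq_integral_of_forall_compl_eq_zero fun t ht => by
        simp [z₂ (t, _) fun h' => ht (hθT h')]
    simp only [e1, e2] at hmass'
    rw [hset, Measure.volume_eq_prod, integral_prod_symm _ i1, ← integral_prod _ i2,
      integral_prod_symm _ i2, ← integral_const_mul, ← integral_add i1.integral_prod_right
      (i2.integral_prod_right.const_mul _)] at hmass'
    rw [← hmass']
    refine integral_congr_ae (ae_of_all _ fun x => ?_)
    simp only [hg, smul_eq_mul, integral_const_mul]
    ring
  -- Orthogonality to every `χ` gives zero almost everywhere, and continuity of `g` makes it hold at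
  -- each `x`, as the contour equation demands.
  have hg0 : g = 0 := by
    refine (hgc.ae_eq_iff_eq volume continuous_const).1 ?_
    exact ae_eq_zero_of_integral_contDiff_smul_eq_zero hgc.locallyIntegrable hgχ
  have hgx : (∫ t, H₁ (t, x)) + c * ∫ t, H₂ (t, x) = 0 := congrFun hg0 x
  have hs' : HasCompactSupport (deriv θ) := hθs.deriv
  have iθ : Integrable (deriv θ) := hdθ.integrable_of_hasCompactSupport hs'
  have ifθ : Integrable fun t => f t x * deriv θ t := by
    have cc : Continuous fun t => f t x * deriv θ t :=
      continuous_of_continuousOn_of_eq_zero isOpen_Ioo (isClosed_tsupport θ) hθT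
        ((hfc.comp (f := fun t => (t, x)) (by fun_prop) fun t ht => ⟨ht, mem_univ _⟩).mul
          hdθ.continuousOn) fun t ht => by rw [(hθ0 t ht).2, mul_zero]
    exact cc.integrable_of_hasCompactSupport hs'.mul_left
  have e : ∫ t, H₁ (t, x) = -∫ t, f t x * deriv θ t := by
    -- The constant `C` depends on `ζ` but is paired with `θ'`, whose integral is zero.
    have h0 : ∫ t, deriv θ t = 0 := integral_eq_zero_of_hasDerivAt_of_integrable
      (fun t => (hθ.differentiable (by norm_num) t).hasDerivAt) iθ
      (hθ.continuous.integrable_of_hasCompactSupport hθs)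
    calc ∫ t, H₁ (t, x) = ∫ t, (deriv θ t * C - f t x * deriv θ t) :=
          integral_congr_ae (ae_of_all _ fun t => by simp only [hH₁]; ring)
      _ = _ := by rw [integral_sub (iθ.mul_const _) ifθ, integral_mul_const, h0]; ring
  rw [e] at hgx
  simp only [hH₂] at hgx
  linarith

/-- For fixed `x` the weak equation in time says that `f` plus a primitive of the principal value is
constant, by du Bois-Reymond. The integrand being continuous, the derivative exists at every time.
-/
lemma IsDarcyFlow.solvesContourEquation (hl : 0 < l) (hρ : ρ₁ ≠ ρ₂) (hf : IsInterfaceCurve l T f)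
    {v : ℝ → ℝ × ℝ → ℝ × ℝ} {p : ℝ → ℝ × ℝ → ℝ}
    (h : IsDarcyFlow l T (density l ρ₁ ρ₂ f) v p)
    (hm : IsWeakMassSolution l T (density l ρ₁ ρ₂ f) v) :
    SolvesContourEquation l T ρ₁ ρ₂ f := by
  rw [solvesContourEquation_iff hl hf]
  intro t₀ ht₀ x
  have hpv : ContinuousOn (fun t => pvInt l 0 (f t) x) (Ioo 0 T) :=
    (hf.continuousOn_pvInt hl).comp (f := fun t => (t, x)) (by fun_prop)
      fun t ht => ⟨ht, mem_univ _⟩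
  have hfc : ContinuousOn (fun t => f t x) (Ioo 0 T) :=
    (hf.regularity hl).2.1.comp (f := fun t => (t, x)) (by fun_prop) fun t ht => ⟨ht, mem_univ _⟩
  set α := t₀ / 2 with hα
  set β := (t₀ + T) / 2 with hβ
  have hsub : Icc α β ⊆ Ioo 0 T := fun t ht =>
    ⟨by linarith [ht.1, ht₀.1], by linarith [ht.2, ht₀.2]⟩
  have hmem : Ioo α β ∈ 𝓝 t₀ := Ioo_mem_nhds (by linarith [ht₀.1]) (by linarith [ht₀.2])
  -- Truncating to a compact interval around `t₀` gives a globally integrable function, so that its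
  -- primitive from `0` makes sense; test functions are then restricted to that interval.
  set k : ℝ → ℝ := (Icc α β).indicator fun t => pvInt l 0 (f t) x with hk
  have hki : Integrable k :=
    ((hpv.mono hsub).integrableOn_compact isCompact_Icc).integrable_indicator measurableSet_Icc
  set c := (ρ₁ - ρ₂) / (8 * l) with hc
  set u : ℝ → ℝ := fun t => f t x + c * ∫ s in (0 : ℝ)..t, k s with hu
  have hprim : Continuous fun t => ∫ s in (0 : ℝ)..t, k s :=
    intervalIntegral.continuous_primitive (fun _ _ => hki.intervalIntegrable) 0
  have huc : ContinuousOn u (Ioo α β) :=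
    (hfc.mono (Ioo_subset_Icc_self.trans hsub)).add (continuous_const.mul hprim).continuousOn
  obtain ⟨a, ha⟩ := ae_eq_const_of_integral_deriv_eq_zero isOpen_Ioo ordConnected_Ioo
    (huc.locallyIntegrableOn measurableSet_Ioo) (u := u) (fun θ hθ hθs hθT => by
      have hθT' : tsupport θ ⊆ Ioo 0 T := hθT.trans (Ioo_subset_Icc_self.trans hsub)
      have hd : Continuous (deriv θ) := hθ.continuous_deriv (by norm_num)
      have i1 : Integrable fun t => f t x * deriv θ t := by
        have cc : Continuous fun t => f t x * deriv θ t :=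
          continuous_of_continuousOn_of_eq_zero isOpen_Ioo (isClosed_tsupport θ) hθT'
            (hfc.mul hd.continuousOn) fun t ht => by
              rw [image_eq_zero_of_notMem_tsupport fun h' => ht (tsupport_deriv_subset h'), mul_zero]
        exact cc.integrable_of_hasCompactSupport hθs.deriv.mul_left
      have i2 : Integrable fun t => (∫ s in (0 : ℝ)..t, k s) * deriv θ t :=
        (hprim.mul hd).integrable_of_hasCompactSupport hθs.deriv.mul_left
      have e : ∫ t, θ t * pvInt l 0 (f t) x = ∫ t, k t * θ t := by
        refine integral_congr_ae (ae_of_all _ fun t => ?_)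
        by_cases ht : t ∈ Icc α β
        · simp only [hk, indicator_of_mem ht, mul_comm]
        · simp only [hk, indicator_of_notMem ht,
            image_eq_zero_of_notMem_tsupport fun h' => ht (Ioo_subset_Icc_self (hθT h')), zero_mul]
      calc ∫ t, u t * deriv θ t
          = ∫ t, (f t x * deriv θ t + c * ((∫ s in (0 : ℝ)..t, k s) * deriv θ t)) :=
            integral_congr_ae (ae_of_all _ fun t => by simp only [hu]; ring)
        _ = 0 := by
            rw [integral_add i1 (i2.const_mul _), integral_const_mul,
              h.integral_deriv_mul hl hρ hf hm hθ hθs hθT' x,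
              integral_primitive_mul_deriv hki.locallyIntegrable hθ hθs, e]
            ring)
  -- Both sides are continuous on an open interval, so equality almost everywhere is equality
  -- everywhere.
  have heq : EqOn u (fun _ => a) (Ioo α β) :=
    Measure.eqOn_open_of_ae_eq (μ := volume) ((ae_restrict_iff' measurableSet_Ioo).2 ha) isOpen_Ioo
      huc continuousOn_const
  have hkc : ContinuousAt k t₀ := by
    refine (hpv.continuousAt (isOpen_Ioo.mem_nhds ht₀)).congr ?_
    filter_upwards [hmem] with t ht
    rw [hk, indicator_of_mem (Ioo_subset_Icc_self ht)]
  have hder := intervalIntegral.integral_hasDerivAt_right (a := 0) (b := t₀)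
    hki.intervalIntegrable hki.aestronglyMeasurable.stronglyMeasurableAtFilter hkc
  have hk0 : k t₀ = pvInt l 0 (f t₀) x := by
    rw [hk, indicator_of_mem (Ioo_subset_Icc_self (mem_of_mem_nhds hmem))]
  rw [hk0] at hder
  have hfin := (hder.const_mul c).const_sub a
  refine (hfin.congr_of_eventuallyEq ?_).congr_deriv (by rw [hc]; ring)
  filter_upwards [hmem] with t ht
  have : f t x + c * ∫ s in (0 : ℝ)..t, k s = a := heq ht
  linarith

end Converse

end Muskat

end

theorem mainTheorem9 (l T ρ₁ ρ₂ : ℝ) (hl : 0 < l) (hT : 0 < T) (hρ : ρ₁ ≠ ρ₂)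
    (f : ℝ → ℝ → ℝ) (hf : Muskat.IsInterfaceCurve l T f) :
    (∃ (v : ℝ → ℝ × ℝ → ℝ × ℝ) (p : ℝ → ℝ × ℝ → ℝ),
      Muskat.IsDarcyFlow l T (Muskat.density l ρ₁ ρ₂ f) v p) ∧
    ∀ (v : ℝ → ℝ × ℝ → ℝ × ℝ) (p : ℝ → ℝ × ℝ → ℝ),
      Muskat.IsDarcyFlow l T (Muskat.density l ρ₁ ρ₂ f) v p →
      (Muskat.IsWeakMassSolution l T (Muskat.density l ρ₁ ρ₂ f) v ↔
        Muskat.SolvesContourEquation l T ρ₁ ρ₂ f) := by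
  exact ⟨⟨_, _, hf.isDarcyFlow hl ρ₁ ρ₂⟩, fun v p h =>
    ⟨fun hm => h.solvesContourEquation hl hρ hf hm, fun hc => h.isWeakMassSolution hl hf hc⟩⟩
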